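/- Let $F=\mathbb F_2$ be the field with two elements. Let $P_1,\dots,P_7$ be the $F$-rational points of $\mathbb P^2_F$ and let $L_1,\dots,L_7$ be the lines of $\mathbb P^2_F$ defined over $F$. Let $f_0\colon X_0\to\mathbb P^2_F$ be the blow-up along the reduced closed subscheme $\{P_1,\dots,P_7\}$, let $k$ be any field containing $F$, and let $X:=X_0\times_F k$. Let $E_i\subset X$ be the inverse image of the exceptional curve $f_0^{-1}(P_i)$, and let $L'_j\subset X$ be the inverse image of the proper transform of $L_j$ in $X_0$ (for $1\le i,j\le 7$). A curve on $X$ is an integral closed subscheme $C\subset X$ of dimension one, and $C^2$ denotes its self-intersection number over $k$, that is, the degree over $k$ of $\mathcal O_X(C)|_C$; equivalently, $C^2=C\cdot D_2-C\cdot D_1$ for any effective Cartier divisors $D_1,D_2$ on $X$ that do not contain $C$ and satisfy $C+D_1\sim D_2$, where $C\cdot D:=\dim_k H^0(C\cap D,\mathcal O_{C\cap D})$. If $C$ is a curve on $X$ with $C^2<0$, then $C$ is equal to one of the curves $E_1,\dots,E_7,L'_1,\dots,L'_7$. -/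

import Mathlib

open CategoryTheory CategoryTheory.Limits AlgebraicGeometry TopologicalSpace

universe u

noncomputable section

namespace LangerSurface

/-! ### Effective Cartier divisors, blow-ups, intersection numbers -/

/-- A closed subscheme, given by its quasi-coherent ideal sheaf `D`, is an effective Cartier
divisor: locally `D` is generated by one non-zero-divisor. -/
def IsEffectiveCartier {X : Scheme.{u}} (D : X.IdealSheafData) : Prop :=
  ∀ x : X, ∃ U : X.affineOpens, x ∈ U.1 ∧
    ∃ s ∈ nonZeroDivisors Γ(X, U), D.ideal U = Ideal.span {s}

/-- `f : X ⟶ Y` is the blow-up of `Y` along the closed subscheme with ideal sheaf `I`: the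
scheme-theoretic preimage of that subscheme in `X` is an effective Cartier divisor, and `f` is
terminal among the morphisms to `Y` with this property. (This determines `f` up to a unique
isomorphism over `Y`.) -/
def IsBlowup {X Y : Scheme.{u}} (f : X ⟶ Y) (I : Y.IdealSheafData) : Prop :=
  IsEffectiveCartier (I.comap f) ∧
    ∀ (T : Scheme.{u}) (g : T ⟶ Y), IsEffectiveCartier (I.comap g) → ∃! h : T ⟶ X, h ≫ f = g

/-- Linear equivalence of effective Cartier divisors `D`, `D'`: the ideal sheaves `𝒪(-D)` and
`𝒪(-D')` are isomorphic `𝒪_X`-modules. As they are quasi-coherent, such an isomorphism is a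
family of isomorphisms over the affine opens that is compatible with restriction. -/
def LinearlyEquivalent {X : Scheme.{u}} (D D' : X.IdealSheafData) : Prop :=
  ∃ e : ∀ U : X.affineOpens, D.ideal U ≃ₗ[Γ(X, U)] D'.ideal U,
    ∀ (U V : X.affineOpens) (h : U.1 ≤ V.1) (s : D.ideal V) (t : D.ideal U),
      (t : Γ(X, U)) = X.presheaf.map (homOfLE h).op (s : Γ(X, V)) →
      (e U t : Γ(X, U)) = X.presheaf.map (homOfLE h).op (e V s : Γ(X, V))

/-- A curve on `X`: an integral closed subscheme of dimension one, given by its ideal sheaf. -/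
def IsCurve {X : Scheme.{u}} (C : X.IdealSheafData) : Prop :=
  IsIntegral C.subscheme ∧ topologicalKrullDim C.subscheme = 1

/-- The intersection number `C · D` over the field `k` of a curve `C` and an effective Cartier
divisor `D` that does not contain `C`: the dimension over `k` of the ring of functions on the
zero-dimensional scheme `C ∩ D`. In other words, it is the sum over the closed points `P` of
`dim_k 𝒪_{X,P} / (I_C + I_D)_P`, which is the degree over `k` of `𝒪_X(D)|_C`. -/
def intersectionNumber (k : Type u) [Field k] {X : Scheme.{u}} (π : X ⟶ Spec (.of k))
    (C D : X.IdealSheafData) : ℕ :=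
  letI : Algebra k Γ((C ⊔ D).subscheme, ⊤) :=
    ((Scheme.ΓSpecIso (.of k)).inv ≫ ((C ⊔ D).subschemeι ≫ π).appTop).hom.toAlgebra
  Module.finrank k Γ((C ⊔ D).subscheme, ⊤)

/-- `n` is the self-intersection number `C²` of the effective Cartier divisor (a curve) `C` on the
`k`-scheme `X`: one writes `C ∼ D₂ - D₁` with effective Cartier divisors `D₁`, `D₂` that do not
contain `C`, and `n = C · D₂ - C · D₁`. The product of ideal sheaves is the sum of divisors, so
`C + D₁` has the ideal sheaf `C * D₁`. -/
def IsSelfIntersection (k : Type u) [Field k] {X : Scheme.{u}} (π : X ⟶ Spec (.of k))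
    (C : X.IdealSheafData) (n : ℤ) : Prop :=
  ∃ D₁ D₂ : X.IdealSheafData, IsEffectiveCartier D₁ ∧ IsEffectiveCartier D₂ ∧
    ¬ D₁ ≤ C ∧ ¬ D₂ ≤ C ∧ LinearlyEquivalent (C * D₁) D₂ ∧
    n = (intersectionNumber k π C D₂ : ℤ) - intersectionNumber k π C D₁

/-! ### The projective plane over `F` with its `F`-points and `F`-lines -/

attribute [local instance] MvPolynomial.gradedAlgebra

/-- The standard grading of `F[x₀, x₁, x₂]`. -/
abbrev grading (F : Type u) [Field F] : ℕ → Submodule F (MvPolynomial (Fin 3) F) :=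
  MvPolynomial.homogeneousSubmodule (Fin 3) F

/-- The projective plane over `F`. -/
abbrev P2 (F : Type u) [Field F] : Scheme.{u} := Proj (grading F)

/-- The structure morphism of the projective plane. -/
def P2.toSpec (F : Type u) [Field F] : P2 F ⟶ Spec (.of F) :=
  Proj.toSpecZero (grading F) ≫ Spec.map (CommRingCat.ofHom (algebraMap F (grading F 0)))

/-- The closed subset of the plane on which all the given polynomials vanish. -/
def zeros (F : Type u) [Field F] (s : Set (MvPolynomial (Fin 3) F)) : Closeds (P2 F) :=
  ⟨ProjectiveSpectrum.zeroLocus (grading F) s, ProjectiveSpectrum.isClosed_zeroLocus _ s⟩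

/-- The `F`-rational point `[v₀ : v₁ : v₂]`, for `v ≠ 0`, as a closed subset of the plane. -/
def ratPoint {F : Type u} [Field F] (v : Fin 3 → F) : Closeds (P2 F) :=
  zeros F (Set.range fun ij : Fin 3 × Fin 3 =>
    MvPolynomial.C (v ij.1) * MvPolynomial.X ij.2 - MvPolynomial.C (v ij.2) * MvPolynomial.X ij.1)

/-- The closed set of all `F`-rational points (for a finite field `F`). -/
def ratPoints (F : Type u) [Field F] : Closeds (P2 F) :=
  ⨆ v : {v : Fin 3 → F // v ≠ 0}, ratPoint v.1

/-- The `F`-line `a₀ x₀ + a₁ x₁ + a₂ x₂ = 0`, for `a ≠ 0`. -/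
def ratLine {F : Type u} [Field F] (a : Fin 3 → F) : Closeds (P2 F) :=
  zeros F {∑ i, MvPolynomial.C (a i) * MvPolynomial.X i}

/-- `f₀` is the blow-up of the plane over `F` along all its `F`-rational points (with the reduced
structure). -/
def IsBlowupAtRatPoints {F : Type u} [Field F] {X₀ : Scheme.{u}} (f₀ : X₀ ⟶ P2 F) : Prop :=
  IsBlowup f₀ (Scheme.IdealSheafData.vanishingIdeal (ratPoints F))

/-! ### The base change to a field `k` containing `F` and the distinguished curves -/

section Surface

variable {F : Type u} [Field F] (k : Type u) [Field k] [Algebra F k]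
  {X₀ : Scheme.{u}} (f₀ : X₀ ⟶ P2 F)

/-- The base change `X = X₀ ×_F k`. -/
abbrev surface : Scheme.{u} :=
  pullback (f₀ ≫ P2.toSpec F) (Spec.map (CommRingCat.ofHom (algebraMap F k)))

/-- The projection `X ⟶ X₀`. -/
abbrev surface.proj : surface k f₀ ⟶ X₀ := pullback.fst _ _

/-- The structure morphism `X ⟶ Spec k`. -/
abbrev surface.toSpec : surface k f₀ ⟶ Spec (.of k) := pullback.snd _ _

/-- The curve `E` over the `F`-rational point `[v₀ : v₁ : v₂]`: the inverse image in `X` of the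
exceptional curve of `f₀` over this point, as a reduced closed subscheme. -/
def exceptionalCurve (v : Fin 3 → F) : (surface k f₀).IdealSheafData :=
  Scheme.IdealSheafData.vanishingIdeal
    (((ratPoint v).preimage f₀.continuous).preimage (surface.proj k f₀).continuous)

/-- The proper transform in `X₀` of the line `a₀ x₀ + a₁ x₁ + a₂ x₂ = 0`: the closure of the
preimage of the line minus the blown up points. -/
def properTransform (a : Fin 3 → F) : Closeds X₀ :=
  Closeds.closure (f₀ ⁻¹' ((ratLine a : Set (P2 F)) \ (ratPoints F : Set (P2 F))))

/-- The curve `L'` of the line `a₀ x₀ + a₁ x₁ + a₂ x₂ = 0`: the inverse image in `X` of the proper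
transform of the line, as a reduced closed subscheme. -/
def lineCurve (a : Fin 3 → F) : (surface k f₀).IdealSheafData :=
  Scheme.IdealSheafData.vanishingIdeal
    ((properTransform f₀ a).preimage (surface.proj k f₀).continuous)

end Surface

end LangerSurface

end

/-! If the generic point of C lies over a rational point, then C is the exceptional curve there. If
it lies over a rational line but over no rational point, then C is the proper transform of that line
(`eq_exceptionalCurve`, `eq_lineCurve`). The reason is that the relation C + D₁ ∼ D₂ makes the prime
of C locally principal, so in a chart this prime is generated by any prime element it contains
(`eq_span_singleton_of_prime_mem`).

Every other C is the proper transform of a plane curve G = 0 of some degree d, with multiplicity m_v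
at the rational point v. Thus C ∼ dH − ∑ m_v E_v, where H is the total transform of a line. With h =
C·H and e_v = C·E_v this gives C² = dh − ∑ m_v e_v. Restricting G to a rational line, which it does
not contain, shows m_u + m_w + m_{u+w} ≤ d for the three points of the line (`exists_form`).
Intersecting C with the total transform of the line, L' + E_u + E_w + E_{u+w} ∼ H, shows e_u + e_w +
e_{u+w} ≤ h. On the Fano plane such bounds along lines imply ∑ m_v² ≤ d² and ∑ e_v² ≤ h²
(`sum_sq_le_of_line_sum_le`), and Cauchy–Schwarz yields ∑ m_v e_v ≤ dh
(`sum_mul_le_of_line_sum_le`). Hence C² ≥ 0 (`intersectionNumber_le`). The identities h = d and e_v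
= m_v are never needed.

Degrees on C are computed as dim_k S/I on one affine open Spec S of C that contains all supports in
question. Such an open exists because C is proper and quasi-finite, hence finite, over the plane
over k (`isAffineHom_curveToPlane`), and prime avoidance supplies a plane curve missing a given
finite set. Degrees are additive (`finrank_quotient_mul`). They are unchanged by multiplication with
a rational function ψ (`deg_eq_of_mul_equiv`): filter S by the pole order along the complement of
Spec S. The steps are finite-dimensional by properness, and ψ carries the sections of one ideal in
each step onto those of the other.

The blow-up is given only by its universal property. For a basis b₀, b₁, b₂ of F³ that property
yields a chart (s, t) ↦ b₀ + s b₁ + s t b₂. The charts are shown to be open immersions, to cover,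
and to glue by t t' = 1 (`isOpenImmersion_blowupChart`, `mem_range_blowupChart`, `chartMap_swap`).
This also gives properness, through the valuative criterion (`isProper_blowup`). -/

noncomputable section
namespace LangerSurface

/-! ### The inequality on the Fano plane. -/

section FanoInequality

variable {V : Type*} [AddCommGroup V] [Fintype V] [DecidableEq V]

/-- Let v₀ be a point with the largest value M. The other six points form three pairs u, u + v₀, one
on each line through v₀. The values x, y of a pair satisfy x, y ≤ M and x + y ≤ d − M, which bounds
x² + y². -/
lemma sum_sq_le_of_line_sum_le (hV : ∀ v : V, v + v = 0) (hcard : Fintype.card V = 8)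
    (m : V → ℤ) (d : ℤ) (hm : ∀ v, 0 ≤ m v)
    (hl : ∀ u w : V, u ≠ 0 → w ≠ 0 → u ≠ w → m u + m w + m (u + w) ≤ d) :
    ∑ v ∈ Finset.univ.erase 0, m v ^ 2 ≤ d ^ 2 := by
  have hne : (Finset.univ.erase (0 : V)).Nonempty := by
    rw [← Finset.card_pos, Finset.card_erase_of_mem (Finset.mem_univ _), Finset.card_univ, hcard]
    norm_num
  obtain ⟨v₀, hv₀, hmax⟩ := Finset.exists_max_image _ m hne
  have hv₀0 : v₀ ≠ 0 := (Finset.mem_erase.mp hv₀).1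
  set S := (Finset.univ.erase (0 : V)).erase v₀ with hS
  have hSmem : ∀ u, u ∈ S ↔ u ≠ v₀ ∧ u ≠ 0 := fun u ↦ by simp [hS]
  have hScard : S.card = 6 := by
    rw [hS, Finset.card_erase_of_mem hv₀, Finset.card_erase_of_mem (Finset.mem_univ _),
      Finset.card_univ, hcard]
  have hinv : ∀ u ∈ S, u + v₀ ∈ S := by
    intro u hu
    rw [hSmem] at hu ⊢
    refine ⟨fun h ↦ hu.2 (by simpa using h), fun h ↦ hu.1 ?_⟩
    have := congrArg (· + v₀) h
    simpa [add_assoc, hV] using this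
  have hpair : ∑ u ∈ S, m (u + v₀) ^ 2 = ∑ u ∈ S, m u ^ 2 := by
    refine Finset.sum_nbij' (· + v₀) (· + v₀) hinv hinv ?_ ?_ ?_ <;> simp [add_assoc, hV]
  -- Summing the bound over all six points counts every square twice.
  have key : ∀ B : ℤ, (∀ u ∈ S, m u ^ 2 + m (u + v₀) ^ 2 ≤ B) → ∑ u ∈ S, m u ^ 2 ≤ 3 * B := by
    intro B hB
    have h1 := Finset.sum_le_card_nsmul S _ B hB
    rw [Finset.sum_add_distrib, hpair, hScard] at h1
    simp only [nsmul_eq_mul, Nat.cast_ofNat] at h1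
    linarith
  have hsum : ∑ v ∈ Finset.univ.erase 0, m v ^ 2 = m v₀ ^ 2 + ∑ u ∈ S, m u ^ 2 :=
    (Finset.add_sum_erase _ (fun v ↦ m v ^ 2) hv₀).symm
  rw [hsum]
  have hle : ∀ u ∈ S, m u ≤ m v₀ ∧ m (u + v₀) ≤ m v₀ ∧ m u + m v₀ + m (u + v₀) ≤ d := by
    intro u hu
    have h1 := (hSmem _).mp hu
    have h2 := (hSmem _).mp (hinv u hu)
    exact ⟨hmax u (by simp [h1.2]), hmax _ (by simp [h2.2]), hl u v₀ h1.2 hv₀0 h1.1⟩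
  have hMd : m v₀ ≤ d := by
    obtain ⟨u, hu⟩ : S.Nonempty := by rw [← Finset.card_pos, hScard]; norm_num
    have := hle u hu
    linarith [hm u, hm (u + v₀)]
  have hM := hm v₀
  -- If 2M ≤ d, then x² + y² ≤ M(x + y) ≤ M(d − M), and d² − M² − 3M(d − M) = (d − M)(d − 2M) ≥ 0.
  -- If 2M ≥ d, then x² + y² ≤ (x + y)² ≤ (d − M)², and d² − M² − 3(d − M)² = 2(2M − d)(d − M) ≥ 0.
  rcases le_total (2 * m v₀) d with h | h
  · have := key (m v₀ * (d - m v₀)) (fun u hu ↦ by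
      obtain ⟨h1, h2, h3⟩ := hle u hu
      nlinarith [hm u, hm (u + v₀), mul_nonneg (hm u) (sub_nonneg.2 h1),
        mul_nonneg (hm (u + v₀)) (sub_nonneg.2 h2)])
    nlinarith
  · have := key ((d - m v₀) ^ 2) (fun u hu ↦ by
      obtain ⟨h1, h2, h3⟩ := hle u hu
      nlinarith [hm u, hm (u + v₀), mul_nonneg (hm u) (hm (u + v₀))])
    nlinarith

/-- Cauchy–Schwarz applied to the two square sums. Allowing two different functions is what makes it
unnecessary to identify the intersection numbers with the multiplicities. -/
lemma sum_mul_le_of_line_sum_le (hV : ∀ v : V, v + v = 0) (hcard : Fintype.card V = 8)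
    (m e : V → ℤ) (d h : ℤ) (hm : ∀ v, 0 ≤ m v) (he : ∀ v, 0 ≤ e v) (hd : 0 ≤ d) (hh : 0 ≤ h)
    (hmd : ∀ u w : V, u ≠ 0 → w ≠ 0 → u ≠ w → m u + m w + m (u + w) ≤ d)
    (heh : ∀ u w : V, u ≠ 0 → w ≠ 0 → u ≠ w → e u + e w + e (u + w) ≤ h) :
    ∑ v ∈ Finset.univ.erase 0, m v * e v ≤ d * h := by
  have h1 := sum_sq_le_of_line_sum_le hV hcard m d hm hmd
  have h2 := sum_sq_le_of_line_sum_le hV hcard e h he heh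
  have h3 := Finset.sum_mul_sq_le_sq_mul_sq (Finset.univ.erase (0 : V)) m e
  refine le_of_sq_le_sq ?_ (mul_nonneg hd hh)
  calc _ ≤ _ := h3
    _ ≤ d ^ 2 * h ^ 2 := mul_le_mul h1 h2 (Finset.sum_nonneg fun _ _ ↦ sq_nonneg _) (sq_nonneg _)
    _ = _ := by ring

end FanoInequality

/-! ### Comparing codimensions along a filtration. -/

section Codimension

open Module

variable {k K : Type*} [Field k] [Field K] [Algebra k K]

/-- Subspaces `a`, `b` of finite codimension in an increasing union of finite-dimensional spaces
`M n`, with `a ∩ M n ≃ b ∩ M n` for all `n`, have the same codimension. -/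
lemma finrank_quotient_eq_of_filtration {E : Type*} [AddCommGroup E] [Module k E]
    (a b : Submodule k E) (M : ℕ → Submodule k E) (hM : Monotone M) (hfin : ∀ n, Module.Finite k (M n))
    (htop : ∀ x, ∃ n, x ∈ M n) [Module.Finite k (E ⧸ a)] [Module.Finite k (E ⧸ b)]
    (e : ∀ n, Module.finrank k ↥(M n ⊓ a) = Module.finrank k ↥(M n ⊓ b)) :
    finrank k (E ⧸ a) = finrank k (E ⧸ b) := by
  -- The quotient by c is spanned by finitely many classes, and their representatives lie in a
  -- single `M n`. From then on `M n` surjects onto the quotient with kernel `M n ⊓ c`, so the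
  -- codimension is a difference of dimensions.
  have key : ∀ c : Submodule k E, Module.Finite k (E ⧸ c) → ∃ n₀, ∀ n, n₀ ≤ n →
      finrank k (E ⧸ c) + finrank k ↥(M n ⊓ c) = finrank k (M n) := by
    intro c _
    obtain ⟨s, hs⟩ := Module.Finite.fg_top (R := k) (M := E ⧸ c)
    have : ∃ n₀, (s : Set (E ⧸ c)) ⊆ (M n₀).map c.mkQ := by
      clear hs
      induction s using Finset.cons_induction with
      | empty => exact ⟨0, by simp⟩
      | cons x s hx ih =>
        obtain ⟨n, hn⟩ := ih
        obtain ⟨y, rfl⟩ := c.mkQ_surjective x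
        obtain ⟨n', hn'⟩ := htop y
        refine ⟨max n n', ?_⟩
        rw [Finset.coe_cons, Set.insert_subset_iff]
        exact ⟨⟨y, hM (le_max_right _ _) hn', rfl⟩,
          hn.trans (Submodule.map_mono (hM (le_max_left _ _)))⟩
    obtain ⟨n₀, hn₀⟩ := this
    refine ⟨n₀, fun n hn ↦ ?_⟩
    have hfinn := hfin n
    have hsurj : Function.Surjective (c.mkQ.domRestrict (M n)) := by
      rw [← LinearMap.range_eq_top, LinearMap.range_domRestrict, eq_top_iff, ← hs,
        Submodule.span_le]
      exact hn₀.trans (Submodule.map_mono (hM hn))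
    have h := (c.mkQ.domRestrict (M n)).finrank_range_add_finrank_ker
    rw [LinearMap.range_eq_top.mpr hsurj, finrank_top] at h
    rw [← h]
    congr 1
    rw [LinearMap.ker_domRestrict, Submodule.ker_mkQ]
    refine LinearEquiv.finrank_eq ?_
    exact ((Submodule.comapSubtypeEquivOfLe inf_le_left).symm.trans
      (LinearEquiv.ofEq _ _ (by simp)))
  obtain ⟨n₁, h₁⟩ := key a ‹_›
  obtain ⟨n₂, h₂⟩ := key b ‹_›
  have := h₁ (max n₁ n₂) (le_max_left _ _)
  have := h₂ (max n₁ n₂) (le_max_right _ _)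
  have := e (max n₁ n₂)
  omega

end Codimension

end LangerSurface
end

noncomputable section
namespace LangerSurface

/-! ### Filtration of a coordinate ring by pole order. -/

section PoleFiltration

open Module

variable {k K : Type*} [Field k] [Field K] [Algebra k K]

/-- The elements `x` of `R` for which every `s i ^ n * x` lies in `W i`. -/
def poleFiltration {ι : Type*} (R : Submodule k K) (W : ι → Subalgebra k K) (s : ι → K) (n : ℕ) :
    Submodule k R where
  carrier := {x | ∀ i, s i ^ n * (x : K) ∈ W i}
  add_mem' {x y} hx hy i := by
    simpa [mul_add] using add_mem (hx i) (hy i)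
  zero_mem' i := by simp
  smul_mem' c x hx i := by
    simpa [mul_smul_comm] using (W i).smul_mem (hx i) c

/-- Step 0 consists of elements without poles, which form a finite-dimensional space by `hglob`. An
element of step n + 1 whose classes s_i^(n+1) x modulo s_i all vanish lies in step n, so each
successive quotient embeds in the finite-dimensional product of the `W i` modulo `s i`. -/
lemma poleFiltration_finite {ι : Type*} [Finite ι] (R : Submodule k K) (W : ι → Subalgebra k K)
    (s : ι → K) (hsW : ∀ i, s i ∈ W i) (hs : ∀ i, s i ≠ 0)
    (hglob : Module.Finite k ↥(R ⊓ ⨅ i, Subalgebra.toSubmodule (W i)))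
    (hquot : ∀ i, Module.Finite k (W i ⧸ Ideal.span {(⟨s i, hsW i⟩ : W i)})) (n : ℕ) :
    Module.Finite k (poleFiltration R W s n) := by
  induction n with
  | zero =>
    let f : poleFiltration R W s 0 →ₗ[k] ↥(R ⊓ ⨅ i, Subalgebra.toSubmodule (W i)) :=
      LinearMap.codRestrict _ (R.subtype ∘ₗ Submodule.subtype _) (fun x ↦ by
        refine ⟨x.1.2, ?_⟩
        simp only [Submodule.mem_iInf, SetLike.mem_coe]
        intro i
        simpa using x.2 i)
    refine Module.Finite.of_injective f ?_
    intro x y hxy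
    exact Subtype.ext (Subtype.ext (congrArg (fun z : ↥(R ⊓ ⨅ i, Subalgebra.toSubmodule (W i)) ↦ (z : K)) hxy))
  | succ n ih =>
    let g : ∀ i, poleFiltration R W s (n + 1) →ₗ[k] W i := fun i ↦
      LinearMap.codRestrict (Subalgebra.toSubmodule (W i))
        ((LinearMap.mulLeft k (s i ^ (n + 1))) ∘ₗ R.subtype ∘ₗ Submodule.subtype _)
        (fun x ↦ x.2 i)
    let f : poleFiltration R W s (n + 1) →ₗ[k]
        (∀ i, W i ⧸ Ideal.span {(⟨s i, hsW i⟩ : W i)}) :=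
      LinearMap.pi fun i ↦ (Ideal.Quotient.mkₐ k _).toLinearMap ∘ₗ g i
    constructor
    refine Submodule.fg_of_fg_map_of_fg_inf_ker (R := k) (M := poleFiltration R W s (n + 1))
      (P := ∀ i, W i ⧸ Ideal.span {(⟨s i, hsW i⟩ : W i)}) f ?_ ?_
    · exact IsNoetherian.noetherian _
    · rw [top_inf_eq]
      have hk : (LinearMap.ker f).map (Submodule.subtype _) ≤ poleFiltration R W s n := by
        rintro _ ⟨x, hx, rfl⟩ i
        have h1 : Ideal.Quotient.mk (Ideal.span {(⟨s i, hsW i⟩ : W i)}) (g i x) = 0 :=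
          congrFun (LinearMap.mem_ker.mp hx) i
        rw [Ideal.Quotient.eq_zero_iff_mem, Ideal.mem_span_singleton] at h1
        obtain ⟨c, hc⟩ := h1
        have h2 : s i ^ (n + 1) * (x.1 : K) = s i * c := congrArg Subtype.val hc
        have h3 : s i ^ n * (x.1 : K) = c := by
          apply mul_left_cancel₀ (hs i)
          rw [← h2]; ring
        simp [h3]
      refine Submodule.fg_of_fg_map_injective _
        (Submodule.subtype_injective (poleFiltration R W s (n + 1))) ?_
      exact Submodule.FG.of_le (Module.Finite.iff_fg.mp ih) hk

/-- Here `R` is the ring of an affine open of a curve, the `W i` are rings of charts that cover the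
curve, and `s i` cuts out the complement of the open in the i-th chart. Multiplication by ψ maps `a`
onto `b` and preserves the pole order, so it identifies the parts of `a` and `b` in each step of the
filtration. -/
lemma finrank_quotient_eq_of_mul_equiv {ι : Type*} [Finite ι] (R : Submodule k K)
    (W : ι → Subalgebra k K)
    (s : ι → K) (hsW : ∀ i, s i ∈ W i) (hs : ∀ i, s i ≠ 0)
    (hRW : ∀ x ∈ R, ∀ i, ∃ N : ℕ, s i ^ N * x ∈ W i)
    (hglob : Module.Finite k ↥(R ⊓ ⨅ i, Subalgebra.toSubmodule (W i)))
    (hquot : ∀ i, Module.Finite k (W i ⧸ Ideal.span {(⟨s i, hsW i⟩ : W i)}))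
    (a b : Submodule k K) (ha : a ≤ R) (hb : b ≤ R) (a' b' : ι → Submodule k K)
    (ha' : ∀ i, ∀ x ∈ a' i, x ∈ W i) (hb' : ∀ i, ∀ x ∈ b' i, x ∈ W i)
    (haa' : ∀ x ∈ a, ∀ i n, s i ^ n * x ∈ W i → s i ^ n * x ∈ a' i)
    (hbb' : ∀ x ∈ b, ∀ i n, s i ^ n * x ∈ W i → s i ^ n * x ∈ b' i)
    (ψ : K) (hψ : ψ ≠ 0) (hab : ∀ x, x ∈ a ↔ ψ * x ∈ b) (hab' : ∀ i x, x ∈ a' i ↔ ψ * x ∈ b' i)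
    (hfa : Module.Finite k (R ⧸ a.comap R.subtype))
    (hfb : Module.Finite k (R ⧸ b.comap R.subtype)) :
    finrank k (R ⧸ a.comap R.subtype) = finrank k (R ⧸ b.comap R.subtype) := by
  refine finrank_quotient_eq_of_filtration _ _ (poleFiltration R W s) ?_
    (poleFiltration_finite R W s hsW hs hglob hquot) ?_ ?_
  · refine monotone_nat_of_le_succ fun n x hx i ↦ ?_
    rw [pow_succ', mul_assoc]
    exact mul_mem (hsW i) (hx i)
  · intro x
    cases nonempty_fintype ι
    choose N hN using hRW x x.2
    refine ⟨∑ i, N i, fun i ↦ ?_⟩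
    obtain ⟨c, hc⟩ := Nat.exists_eq_add_of_le (Finset.single_le_sum
      (fun _ _ ↦ Nat.zero_le _) (Finset.mem_univ i) : N i ≤ ∑ j, N j)
    rw [hc, pow_add, mul_comm (_ ^ _) (_ ^ _), mul_assoc]
    exact mul_mem (pow_mem (hsW i) _) (hN i)
  · intro n
    let e : K ≃ₗ[k] K := LinearEquiv.ofLinearMap (LinearMap.mulLeft k ψ) (LinearMap.mulLeft k ψ⁻¹)
      (by ext; simp [hψ]) (by ext; simp [hψ])
    have he : ∀ x, e x = ψ * x := fun x ↦ rfl
    have key : (((poleFiltration R W s n ⊓ a.comap R.subtype).map R.subtype).map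
        (e : K →ₗ[k] K)) = (poleFiltration R W s n ⊓ b.comap R.subtype).map R.subtype := by
      ext y
      simp only [Submodule.mem_map, Submodule.mem_inf, Submodule.mem_comap, Submodule.subtype_apply]
      constructor
      · rintro ⟨_, ⟨x, ⟨hx1, hx2⟩, rfl⟩, rfl⟩
        have h1 : ψ * (x : K) ∈ b := (hab _).mp hx2
        refine ⟨⟨ψ * x, hb h1⟩, ⟨fun i ↦ ?_, h1⟩, rfl⟩
        -- Once its poles are cleared, x is a section of the local ideal `a' i`. Multiplication by ψ
        -- carries this ideal into `b' i`, inside `W i`, so no new poles arise.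
        have h2 := (hab' i _).mp (haa' _ hx2 i n (hx1 i))
        rw [show ψ * (s i ^ n * (x : K)) = s i ^ n * (ψ * x) by ring] at h2
        exact hb' _ _ h2
      · rintro ⟨x, ⟨hx1, hx2⟩, rfl⟩
        have hcancel : ∀ z, ψ * (ψ⁻¹ * z) = z := fun z ↦ by rw [mul_inv_cancel_left₀ hψ]
        have h1 : ψ⁻¹ * (x : K) ∈ a := by rw [hab, hcancel]; exact hx2
        refine ⟨_, ⟨⟨ψ⁻¹ * x, ha h1⟩, ⟨fun i ↦ ?_, h1⟩, rfl⟩, by simp [he, hψ]⟩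
        have h2 := hbb' _ hx2 i n (hx1 i)
        rw [← hcancel (s i ^ n * (x : K)), ← hab'] at h2
        rw [show ψ⁻¹ * (s i ^ n * (x : K)) = s i ^ n * (ψ⁻¹ * x) by ring] at h2
        exact ha' _ _ h2
    have e1 := (Submodule.equivMapOfInjective R.subtype R.subtype_injective
      (poleFiltration R W s n ⊓ a.comap R.subtype)).finrank_eq
    have e2 := (Submodule.equivMapOfInjective R.subtype R.subtype_injective
      (poleFiltration R W s n ⊓ b.comap R.subtype)).finrank_eq
    have e3 := (e.submoduleMap ((poleFiltration R W s n ⊓ a.comap R.subtype).map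
      R.subtype)).finrank_eq
    rw [e1, e2, e3, ← key]

end PoleFiltration

/-! ### Additivity of the colength for locally principal ideals. -/

section Additivity

open Module

/-- If the ideal `a` of a domain is principal locally at each of the finitely many maximal ideals
containing `b`, then `a / ab ≃ R / b`. -/
lemma exists_local_generator {R : Type*} [CommRing R] [IsDomain R] (a : Ideal R)
    (S : Finset (Ideal R)) (hS : ∀ m ∈ S, m.IsMaximal)
    (ha : ∀ m ∈ S, ∃ α ∈ a, ∀ x ∈ a, ∃ u ∉ m, ∃ c, u * x = c * α) :
    ∃ φ ∈ a, ∀ m ∈ S, ∀ x ∈ a, ∃ u ∉ m, ∃ c, u * x = c * φ := by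
  classical
  choose! α hα hα' using ha
  -- Separating elements in the style of the Chinese remainder theorem: `e m` avoids `m` and lies in
  -- every other member of `S`.
  have hcrt : ∀ m ∈ S, ∃ e : R, e ∉ m ∧ ∀ m' ∈ S, m' ≠ m → e ∈ m' := by
    intro m hm
    have hmax := hS m hm
    have : ¬ (∏ m' ∈ S.erase m, m') ≤ m := by
      rw [hmax.isPrime.prod_le]
      rintro ⟨m', hm', hle⟩
      rw [Finset.mem_erase] at hm'
      exact hm'.1 ((hS m' hm'.2).eq_of_le hmax.ne_top hle)
    obtain ⟨e, he, hem⟩ := SetLike.not_le_iff_exists.mp this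
    refine ⟨e, hem, fun m' hm' hne ↦ ?_⟩
    exact (Ideal.prod_le_inf.trans (Finset.inf_le (Finset.mem_erase.mpr ⟨hne, hm'⟩))) he
  choose! e he he' using hcrt
  -- Up to denominators outside m, this sum is a multiple of the local generator α_m whose
  -- coefficient is nonzero modulo m: the m-th term contributes a unit at m, the other terms
  -- contribute elements of m.
  refine ⟨∑ m ∈ S, e m * α m, Ideal.sum_mem _ fun m hm ↦ a.mul_mem_left _ (hα m hm), ?_⟩
  intro m hm x hx
  have hmax := hS m hm
  have hpr := hmax.isPrime
  choose! u hu c hc using hα' m hm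
  set U := ∏ m' ∈ S, u (α m') with hU
  have hUm : U ∉ m := by
    rw [hU, hpr.prod_mem_iff]
    rintro ⟨m', hm', h⟩
    exact hu _ (hα m' hm') h
  have h1 : ∀ m' ∈ S, ∃ w, U * (e m' * α m') = w * α m ∧ (m' ≠ m → w ∈ m) ∧ (m' = m → w ∉ m) := by
    intro m' hm'
    by_cases h : m' = m
    · subst h
      refine ⟨U * e m', by ring, by simp, fun _ ↦ ?_⟩
      exact fun hmem ↦ (hpr.mem_or_mem hmem).elim hUm (he m' hm')
    · refine ⟨(∏ j ∈ S.erase m', u (α j)) * e m' * c (α m'), ?_, fun _ ↦ ?_, fun h' ↦ absurd h' h⟩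
      · rw [hU, ← Finset.mul_prod_erase _ _ hm']
        linear_combination (∏ j ∈ S.erase m', u (α j)) * e m' * hc (α m') (hα m' hm')
      · exact m.mul_mem_right _ (m.mul_mem_left _ (he' m' hm' m hm (Ne.symm h)))
  choose! w hw hw1 hw2 using h1
  have h2 : U * ∑ m ∈ S, e m * α m = (∑ m' ∈ S, w m') * α m := by
    rw [Finset.mul_sum, Finset.sum_mul]
    exact Finset.sum_congr rfl fun m' hm' ↦ hw m' hm'
  have h3 : ∑ m' ∈ S, w m' ∉ m := by
    rw [← Finset.add_sum_erase _ _ hm]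
    intro hmem
    refine hw2 m hm rfl ((Submodule.add_mem_iff_left _ (Ideal.sum_mem _ fun m' hm' ↦ ?_)).mp hmem)
    rw [Finset.mem_erase] at hm'
    exact hw1 m' hm'.2 hm'.1
  refine ⟨u x * ∑ m' ∈ S, w m', fun h ↦ (hpr.mem_or_mem h).elim (hu x hx) h3, c x * U, ?_⟩
  linear_combination (∑ m' ∈ S, w m') * hc x hx - c x * h2

/-- Dimensions are counted in 0 → a/ab → R/ab → R/a → 0. A single element φ generates `a` at each of
the finitely many maximal ideals above `b`, and multiplication by φ then gives R/b ≃ a/ab. -/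
lemma finrank_quotient_mul {k R : Type*} [Field k] [CommRing R] [IsDomain R] [Algebra k R]
    (a b : Ideal R) [Module.Finite k (R ⧸ a)] [Module.Finite k (R ⧸ b)] (ha0 : a ≠ ⊥)
    (ha : ∀ m : Ideal R, m.IsMaximal → ∃ α ∈ a, ∀ x ∈ a, ∃ u ∉ m, ∃ c, u * x = c * α) :
    finrank k (R ⧸ (a * b)) = finrank k (R ⧸ a) + finrank k (R ⧸ b) := by
  classical
  have hart : IsArtinianRing (R ⧸ b) := IsArtinianRing.of_finite k (R ⧸ b)
  have hfinS : {m : Ideal R | m.IsMaximal ∧ b ≤ m}.Finite := by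
    have h1 : {I : Ideal (R ⧸ b) | I.IsMaximal}.Finite := IsArtinianRing.setOfPred_isMaximal_finite _
    refine (h1.image (Ideal.comap (Ideal.Quotient.mk b))).subset ?_
    rintro m ⟨hm, hb⟩
    refine ⟨m.map (Ideal.Quotient.mk b), ?_, ?_⟩
    · rcases Ideal.map_eq_top_or_isMaximal_of_surjective (Ideal.Quotient.mk b)
          Ideal.Quotient.mk_surjective hm with h | h
      · exfalso
        have := congrArg (Ideal.comap (Ideal.Quotient.mk b)) h
        rw [Ideal.comap_map_of_surjective _ Ideal.Quotient.mk_surjective, ← RingHom.ker_eq_comap_bot,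
          Ideal.mk_ker, sup_eq_left.mpr hb, Ideal.comap_top] at this
        exact hm.ne_top this
      · exact h
    · rw [Ideal.comap_map_of_surjective _ Ideal.Quotient.mk_surjective, ← RingHom.ker_eq_comap_bot,
          Ideal.mk_ker, sup_eq_left.mpr hb]
  obtain ⟨φ, hφ, hφ'⟩ := exists_local_generator a hfinS.toFinset
    (fun m hm ↦ (hfinS.mem_toFinset.mp hm).1) (fun m hm ↦ ha m (hfinS.mem_toFinset.mp hm).1)
  simp only [Set.Finite.mem_toFinset, Set.mem_ofPred_eq] at hφ'
  have hφ0 : ∀ m : Ideal R, m.IsMaximal → b ≤ m → φ ≠ 0 := by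
    rintro m hm hb rfl
    obtain ⟨x, hx, hx0⟩ := Submodule.exists_mem_ne_zero_of_ne_bot ha0
    obtain ⟨u, hu, c, hc⟩ := hφ' m ⟨hm, hb⟩ x hx
    rw [mul_zero] at hc
    rcases mul_eq_zero.mp hc with h | h
    · exact hu (h ▸ m.zero_mem)
    · exact hx0 h
  -- multiplication by `φ` induces `R / b ≃ a / ab`
  have hker : ∀ r, φ * r ∈ a * b → r ∈ b := by
    intro r hr
    by_contra hrb
    let J : Ideal R := b.colon {r}
    have hJ : J ≠ ⊤ := fun h ↦ hrb (by
      have : (1 : R) ∈ J := h ▸ Submodule.mem_top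
      simpa [J, Submodule.mem_colon_singleton] using this)
    obtain ⟨m, hm, hJm⟩ := Ideal.exists_le_maximal J hJ
    have hbm : b ≤ m := le_trans (fun x hx ↦ by
      simpa [J, Submodule.mem_colon_singleton] using b.mul_mem_right r hx) hJm
    have key : ∀ y ∈ a * b, ∃ u ∉ m, ∃ c ∈ b, u * y = c * φ := by
      intro y hy
      refine Submodule.mul_induction_on hy (fun x hx z hz ↦ ?_) (fun x y hx hy ↦ ?_)
      · obtain ⟨u, hu, c, hc⟩ := hφ' m ⟨hm, hbm⟩ x hx
        exact ⟨u, hu, c * z, b.mul_mem_left _ hz, by linear_combination z * hc⟩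
      · obtain ⟨u, hu, c, hcb, hc⟩ := hx
        obtain ⟨u', hu', c', hcb', hc'⟩ := hy
        exact ⟨u * u', fun h ↦ (hm.isPrime.mem_or_mem h).elim hu hu', u' * c + u * c',
          b.add_mem (b.mul_mem_left _ hcb) (b.mul_mem_left _ hcb'),
          by linear_combination u' * hc + u * hc'⟩
    obtain ⟨u, hu, c, hcb, hc⟩ := key _ hr
    refine hu (hJm ?_)
    have : u * r = c := mul_right_cancel₀ (hφ0 m hm hbm) (by linear_combination hc)
    simpa [J, Submodule.mem_colon_singleton, this] using hcb
  -- Tested at each maximal ideal m: if m contains b, then φ generates `a` there; if not, then ab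
  -- and a agree there.
  have hsurj : ∀ x ∈ a, ∃ r, x - φ * r ∈ a * b := by
    intro x hx
    let J : Ideal R := (a * b ⊔ Ideal.span {φ}).colon {x}
    suffices h : J = ⊤ by
      have : (1 : R) ∈ J := h ▸ Submodule.mem_top
      rw [Submodule.mem_colon_singleton, one_smul, Submodule.mem_sup] at this
      obtain ⟨y, hy, z, hz, hyz⟩ := this
      obtain ⟨r, rfl⟩ := Ideal.mem_span_singleton'.mp hz
      exact ⟨r, by rw [← hyz]; convert hy using 1; ring⟩
    by_contra hJ
    obtain ⟨m, hm, hJm⟩ := Ideal.exists_le_maximal J hJ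
    by_cases hbm : b ≤ m
    · obtain ⟨u, hu, c, hc⟩ := hφ' m ⟨hm, hbm⟩ x hx
      refine hu (hJm ?_)
      rw [Submodule.mem_colon_singleton, smul_eq_mul, hc]
      exact Submodule.mem_sup_right (Ideal.mul_mem_left _ _ (Ideal.mem_span_singleton_self φ))
    · obtain ⟨z, hz, hzm⟩ := SetLike.not_le_iff_exists.mp hbm
      refine hzm (hJm ?_)
      rw [Submodule.mem_colon_singleton, smul_eq_mul, mul_comm z x]
      exact Submodule.mem_sup_left (Ideal.mul_mem_mul hx hz)
  let f : R →ₗ[k] R ⧸ (a * b) := (Ideal.Quotient.mkₐ k (a * b)).toLinearMap ∘ₗ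
    LinearMap.mulLeft k φ
  let g : R ⧸ (a * b) →ₗ[k] R ⧸ a := (Ideal.Quotient.factorₐ k (Ideal.mul_le_left : a * b ≤ a)).toLinearMap
  have hg : Function.Surjective g := Ideal.Quotient.factor_surjective (Ideal.mul_le_left : a * b ≤ a)
  have hfker : LinearMap.ker f = b.restrictScalars k := by
    ext r
    simp only [LinearMap.mem_ker, Submodule.restrictScalars_mem]
    change Ideal.Quotient.mk (a * b) (φ * r) = 0 ↔ _
    rw [Ideal.Quotient.eq_zero_iff_mem]
    exact ⟨hker r, fun h ↦ Ideal.mul_mem_mul hφ h⟩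
  have hrange : LinearMap.range f = LinearMap.ker g := by
    ext y
    obtain ⟨x, rfl⟩ := Ideal.Quotient.mk_surjective y
    have hgx : g (Ideal.Quotient.mk _ x) = Ideal.Quotient.mk a x := rfl
    rw [LinearMap.mem_ker, hgx, Ideal.Quotient.eq_zero_iff_mem]
    constructor
    · rintro ⟨r, hr⟩
      have hr' : Ideal.Quotient.mk (a * b) (φ * r) = Ideal.Quotient.mk _ x := hr
      have h1 : φ * r - x ∈ a := Ideal.mul_le_left ((Ideal.Quotient.eq).mp hr')
      simpa using a.sub_mem (a.mul_mem_right r hφ) h1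
    · intro hx
      obtain ⟨r, hr⟩ := hsurj x hx
      exact ⟨r, ((Ideal.Quotient.eq).mpr hr).symm⟩
  let e : (R ⧸ b) ≃ₗ[k] LinearMap.range f :=
    (Submodule.Quotient.restrictScalarsEquiv k b).symm.trans
      ((Submodule.quotEquivOfEq _ _ hfker.symm).trans f.quotKerEquivRange)
  have e1 := e.finrank_eq
  have hfinker : Module.Finite k (LinearMap.ker g) := by
    rw [← hrange]; exact Module.Finite.equiv e
  have : Module.Finite k (R ⧸ (a * b)) := by
    constructor
    refine Submodule.fg_of_fg_map_of_fg_inf_ker g (IsNoetherian.noetherian _) ?_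
    rw [top_inf_eq]
    exact Module.Finite.iff_fg.mp hfinker
  have h := g.finrank_range_add_finrank_ker
  rw [LinearMap.range_eq_top.mpr hg, finrank_top, ← hrange, ← e1] at h
  exact h.symm

end Additivity

end LangerSurface
end

noncomputable section
namespace LangerSurface

/-- Write u p = c π with u outside P. If p divided c, then u would be a multiple of π and lie in P;
so p divides π. For y in P the element p then divides some u y with u outside P, hence divides y.
This replaces any dimension theory: a locally principal prime that contains a prime element is
generated by it. -/
lemma eq_span_singleton_of_prime_mem {R : Type*} [CommRing R] [IsDomain R] {P : Ideal R}
    {p : R} (hp : Prime p) (hpP : p ∈ P)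
    (h : ∃ π ∈ P, ∀ y ∈ P, ∃ u ∉ P, ∃ c, u * y = c * π) : P = Ideal.span {p} := by
  obtain ⟨π, hπ, h⟩ := h
  obtain ⟨u, hu, c, hc⟩ := h p hpP
  have h1 : p ∣ π := by
    rcases hp.dvd_or_dvd (Dvd.intro_left u hc : p ∣ c * π) with ⟨c', rfl⟩ | h1
    · exfalso
      have : u = c' * π := mul_right_cancel₀ hp.ne_zero (by linear_combination hc)
      exact hu (this ▸ P.mul_mem_left _ hπ)
    · exact h1
  refine le_antisymm (fun y hy ↦ ?_) ((Ideal.span_singleton_le_iff_mem _).mpr hpP)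
  obtain ⟨u, hu, c, hc⟩ := h y hy
  rw [Ideal.mem_span_singleton]
  refine (hp.dvd_or_dvd (hc ▸ h1.mul_left c)).resolve_left fun hpu ↦ hu ?_
  exact P.mem_of_dvd hpu hpP

/-! ### Plane forms in a blow-up chart: order along s = 0, homogeneous equations, restriction to a
line. -/

namespace Poly

open MvPolynomial

variable {k : Type*} [Field k]

/-- The substitution `X₀ ↦ 1, X₁ ↦ s, X₂ ↦ s t`. -/
def std : MvPolynomial (Fin 3) k →ₐ[k] MvPolynomial (Fin 2) k :=
  aeval ![1, X 0, X 0 * X 1]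

@[simp] lemma std_X0 : std (X 0 : MvPolynomial (Fin 3) k) = 1 := by simp [std]
@[simp] lemma std_X1 : std (X 1 : MvPolynomial (Fin 3) k) = X 0 := by simp [std]
@[simp] lemma std_X2 : std (X 2 : MvPolynomial (Fin 3) k) = X 0 * X 1 := by simp [std]

/-- Since t is the quotient of the images of X₂ and X₁, every factor t costs one factor s. In a sum,
powers of X₀, which maps to 1, equalise the degrees. -/
lemma exists_std_eq (r : MvPolynomial (Fin 2) k) :
    ∃ (N d : ℕ) (R : MvPolynomial (Fin 3) k), R.IsHomogeneous d ∧ std R = X 0 ^ N * r := by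
  induction r using MvPolynomial.induction_on with
  | C a => exact ⟨0, 0, C a, isHomogeneous_C _ _, by simp [std, ← algebraMap_eq]⟩
  | add p q hp hq =>
    obtain ⟨N, d, R, hR, h⟩ := hp
    obtain ⟨N', d', R', hR', h'⟩ := hq
    refine ⟨N + N', d + d' + N + N', X 1 ^ N' * X 0 ^ (d' + N) * R + X 1 ^ N * X 0 ^ (d + N') * R',
      ?_, ?_⟩
    · refine IsHomogeneous.add ?_ ?_
      · convert (((isHomogeneous_X k (1 : Fin 3)).pow N').mul
          ((isHomogeneous_X k (0 : Fin 3)).pow (d' + N))).mul hR using 1; ring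
      · convert (((isHomogeneous_X k (1 : Fin 3)).pow N).mul
          ((isHomogeneous_X k (0 : Fin 3)).pow (d + N'))).mul hR' using 1; ring
    · simp only [map_add, map_mul, map_pow, std_X0, std_X1, h, h']; ring
  | mul_X p i hp =>
    obtain ⟨N, d, R, hR, h⟩ := hp
    match i with
    | 0 => exact ⟨N, d + 1, R * X 1, hR.mul (isHomogeneous_X _ _), by
        rw [map_mul, h, std_X1]; ring⟩
    | 1 => exact ⟨N + 1, d + 1, R * X 2, hR.mul (isHomogeneous_X _ _), by
        rw [map_mul, h, std_X2]; ring⟩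

/-- The exponent of the image of a monomial under `std`. -/
def stdExp (α : Fin 3 →₀ ℕ) : Fin 2 →₀ ℕ :=
  Finsupp.single 0 (α 1 + α 2) + Finsupp.single 1 (α 2)

lemma std_monomial (α : Fin 3 →₀ ℕ) (c : k) : std (monomial α c) = monomial (stdExp α) c := by
  rw [monomial_eq, map_mul, monomial_eq, Finsupp.prod_fintype _ _ (by simp),
    Finsupp.prod_fintype _ _ (by simp), map_prod]
  simp only [map_pow, Fin.prod_univ_three, std_X0, std_X1, std_X2, Fin.prod_univ_two, stdExp]
  have hC : std (C c : MvPolynomial (Fin 3) k) = C c := by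
    rw [← algebraMap_eq, AlgHom.commutes, algebraMap_eq]
  have h0 : ((Finsupp.single 0 (α 1 + α 2) + Finsupp.single 1 (α 2) : Fin 2 →₀ ℕ)) 0 =
      α 1 + α 2 := by simp
  have h1 : ((Finsupp.single 0 (α 1 + α 2) + Finsupp.single 1 (α 2) : Fin 2 →₀ ℕ)) 1 =
      α 2 := by simp
  rw [h0, h1, hC]
  ring

/-- The lost exponent of X₀ is recovered from the total degree. Hence `std` merges no monomials of a
form and is injective in each degree. -/
lemma stdExp_inj {α β : Fin 3 →₀ ℕ} (h : α.degree = β.degree) (he : stdExp α = stdExp β) :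
    α = β := by
  have h0 := DFunLike.congr_fun he 0
  have h1 := DFunLike.congr_fun he 1
  simp [stdExp] at h0 h1
  rw [Finsupp.degree_eq_sum, Finsupp.degree_eq_sum, Fin.sum_univ_three, Fin.sum_univ_three] at h
  ext i
  match i with
  | 0 => omega
  | 1 => omega
  | 2 => omega

lemma coeff_std {H : MvPolynomial (Fin 3) k} {d : ℕ} (hH : H.IsHomogeneous d) {α : Fin 3 →₀ ℕ}
    (hα : α.degree = d) : coeff (stdExp α) (std H) = coeff α H := by
  classical
  conv_lhs => rw [H.as_sum, map_sum, coeff_sum]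
  simp only [std_monomial, coeff_monomial]
  have : ∀ β ∈ H.support, (if stdExp β = stdExp α then coeff β H else 0) =
      if β = α then coeff β H else 0 := by
    intro β hβ
    have hβd : β.degree = d := by
      by_contra hne
      exact (mem_support_iff.mp hβ) (hH.coeff_eq_zero hne)
    by_cases h : stdExp β = stdExp α
    · have := stdExp_inj (hβd.trans hα.symm) h
      simp [this]
    · rw [if_neg h, if_neg (fun h' ↦ h (by rw [h']))]
  rw [Finset.sum_congr rfl this, Finset.sum_ite_eq']
  split_ifs with h
  · rfl
  · exact (notMem_support_iff.mp h).symm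

lemma eq_of_std_eq {H H' : MvPolynomial (Fin 3) k} {d : ℕ} (hH : H.IsHomogeneous d)
    (hH' : H'.IsHomogeneous d) (h : std H = std H') : H = H' := by
  ext α
  by_cases hα : α.degree = d
  · rw [← coeff_std hH hα, ← coeff_std hH' hα, h]
  · rw [hH.coeff_eq_zero hα, hH'.coeff_eq_zero hα]

/-- The monomial with exponent α acquires the power α₁ + α₂ of s. Since monomials are not merged,
divisibility by a power of s can be read off each monomial: the order along the exceptional curve is
the multiplicity at [1 : 0 : 0]. -/
lemma mem_span_pow_of_dvd_std {H : MvPolynomial (Fin 3) k} {d m : ℕ} (hH : H.IsHomogeneous d)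
    (h : X 0 ^ m ∣ std H) : H ∈ (Ideal.span {X 1, X 2} : Ideal (MvPolynomial (Fin 3) k)) ^ m := by
  obtain ⟨r, hr⟩ := h
  rw [H.as_sum]
  refine Ideal.sum_mem _ fun α hα ↦ ?_
  have hαd : α.degree = d := by
    by_contra hne
    exact (mem_support_iff.mp hα) (hH.coeff_eq_zero hne)
  have hc : coeff (stdExp α) (std H) ≠ 0 := by
    rw [coeff_std hH hαd]; exact mem_support_iff.mp hα
  have hm : m ≤ α 1 + α 2 := by
    by_contra hlt
    refine hc ?_
    rw [hr, X_pow_eq_monomial, coeff_monomial_mul', if_neg]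
    intro hle
    have := hle 0
    simp [stdExp] at this
    omega
  rw [monomial_eq, Finsupp.prod_fintype _ _ (by simp), Fin.prod_univ_three]
  refine Ideal.mul_mem_left _ _ ?_
  rw [mul_assoc]
  refine Ideal.mul_mem_left _ _ (Ideal.pow_le_pow_right hm ?_)
  rw [pow_add]
  exact Ideal.mul_mem_mul (Ideal.pow_mem_pow (Ideal.subset_span (by simp)) _)
    (Ideal.pow_mem_pow (Ideal.subset_span (by simp)) _)

lemma isHomogeneous_of_X_mul {σ : Type*} {i : σ} {G : MvPolynomial σ k} {d : ℕ}
    (h : (X i * G).IsHomogeneous (d + 1)) : G.IsHomogeneous d := by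
  classical
  intro α hα
  have h1 : coeff (Finsupp.single i 1 + α) (X i * G) ≠ 0 := by
    rwa [coeff_X_mul]
  have h2 := h h1
  rw [map_add, Finsupp.weight_single] at h2
  simp at h2
  omega

/-- Take G of least degree among the forms with image sᴺp. Minimality makes G prime to X₀ and X₁,
and this allows the powers of X₀ and X₁ used for homogenising to be cancelled from a divisibility by
G. -/
lemma exists_homogeneous_generator {p : MvPolynomial (Fin 2) k} (hp : Prime p)
    (hps : ¬ X 0 ∣ p) : ∃ (d N : ℕ) (G : MvPolynomial (Fin 3) k), G.IsHomogeneous d ∧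
      std G = X 0 ^ N * p ∧ ∀ (e : ℕ) (H : MvPolynomial (Fin 3) k), H.IsHomogeneous e →
        p ∣ std H → G ∣ H := by
  classical
  have hex : ∃ d, ∃ (N : ℕ) (G : MvPolynomial (Fin 3) k), G.IsHomogeneous d ∧
      std G = X 0 ^ N * p := by
    obtain ⟨N, d, G, h⟩ := exists_std_eq p
    exact ⟨d, N, G, h⟩
  obtain ⟨N, G, hG, hstd⟩ := Nat.find_spec hex
  set d := Nat.find hex with hd
  have hmin : ∀ (N : ℕ) (G : MvPolynomial (Fin 3) k) (e : ℕ), e < d → G.IsHomogeneous e →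
      std G ≠ X 0 ^ N * p := fun N G e he hG h ↦ Nat.find_min hex he ⟨N, G, hG, h⟩
  have hG0 : G ≠ 0 := by
    rintro rfl
    rw [map_zero] at hstd
    exact (mul_ne_zero (pow_ne_zero _ (X_ne_zero _)) hp.ne_zero) hstd.symm
  have hd1 : ∀ i, X i ∣ G → ∃ e, d = e + 1 := by
    rintro i ⟨G', rfl⟩
    refine Nat.exists_eq_succ_of_ne_zero fun h0 ↦ ?_
    have := hG.totalDegree hG0
    rw [totalDegree_mul_of_isDomain (X_ne_zero _) (right_ne_zero_of_mul hG0), totalDegree_X,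
      h0] at this
    omega
  have hX0 : ¬ X 0 ∣ G := by
    intro h
    obtain ⟨e, he⟩ := hd1 0 h
    obtain ⟨G', rfl⟩ := h
    rw [he] at hG
    refine hmin N G' e (by omega) (isHomogeneous_of_X_mul hG) ?_
    rw [← hstd, map_mul, std_X0, one_mul]
  have hX1 : ¬ X 1 ∣ G := by
    intro h
    obtain ⟨e, he⟩ := hd1 1 h
    obtain ⟨G', rfl⟩ := h
    rw [he] at hG
    rw [map_mul, std_X1] at hstd
    cases N with
    | zero => exact hps (by rw [pow_zero, one_mul] at hstd; exact ⟨_, hstd.symm⟩)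
    | succ N =>
      refine hmin N G' e (by omega) (isHomogeneous_of_X_mul hG) ?_
      apply mul_left_cancel₀ (X_ne_zero (R := k) (0 : Fin 2))
      rw [hstd]; ring
  refine ⟨d, N, G, hG, hstd, fun e H hH ⟨r, hr⟩ ↦ ?_⟩
  obtain ⟨N', d', R, hR, hstdR⟩ := exists_std_eq r
  -- Both sides have image s^(N+N') p r. The powers of X₀ only bring them to a common degree, where
  -- `std` is injective.
  have key : X 0 ^ (d + d') * (X 1 ^ (N + N') * H) = X 0 ^ (N + N' + e) * (G * R) := by
    refine eq_of_std_eq (d := d + d' + (N + N' + e)) ?_ ?_ ?_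
    · convert ((isHomogeneous_X k (0 : Fin 3)).pow (d + d')).mul
        (((isHomogeneous_X k (1 : Fin 3)).pow (N + N')).mul hH) using 1; ring
    · convert ((isHomogeneous_X k (0 : Fin 3)).pow (N + N' + e)).mul (hG.mul hR) using 1; ring
    · simp only [map_mul, map_pow, std_X0, std_X1, hr, hstd, hstdR]; ring
  have hpX : ∀ i : Fin 3, Prime (X i : MvPolynomial (Fin 3) k) := fun i ↦ X_prime
  have h1 : X 0 ^ (d + d') ∣ X 0 ^ (N + N' + e) * R :=
    (hpX 0).pow_dvd_of_dvd_mul_left _ hX0 ⟨_, by rw [← key.symm]; ring⟩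
  obtain ⟨R₁, hR₁⟩ := h1
  have key2 : X 1 ^ (N + N') * H = G * R₁ := by
    apply mul_left_cancel₀ (pow_ne_zero (d + d') (X_ne_zero (R := k) (0 : Fin 3)))
    rw [key]; linear_combination G * hR₁
  obtain ⟨R₂, hR₂⟩ := (hpX 1).pow_dvd_of_dvd_mul_left _ hX1 ⟨_, key2.symm⟩
  refine ⟨R₂, mul_left_cancel₀ (pow_ne_zero (N + N') (X_ne_zero (R := k) (1 : Fin 3))) ?_⟩
  rw [key2, hR₂]; ring

/-- The linear substitution `X i ↦ ∑ j, M i j X j`. -/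
def lin (M : Matrix (Fin 3) (Fin 3) k) : MvPolynomial (Fin 3) k →ₐ[k] MvPolynomial (Fin 3) k :=
  aeval fun i ↦ ∑ j, C (M i j) * X j

lemma lin_isHomogeneous (M : Matrix (Fin 3) (Fin 3) k) {H : MvPolynomial (Fin 3) k} {d : ℕ}
    (hH : H.IsHomogeneous d) : (lin M H).IsHomogeneous d := by
  rw [← one_mul d]
  refine hH.aeval _ fun i ↦ IsHomogeneous.sum _ _ _ fun j _ ↦ ?_
  exact (isHomogeneous_X k j).C_mul _

lemma lin_X (M : Matrix (Fin 3) (Fin 3) k) (i : Fin 3) :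
    lin M (X i) = ∑ j, C (M i j) * X j := by rw [lin, aeval_X]

lemma lin_form (M : Matrix (Fin 3) (Fin 3) k) (a : Fin 3 → k) :
    lin M (∑ i, C (a i) * X i) = ∑ j, C (Matrix.vecMul a M j) * X j := by
  simp only [lin, map_sum, map_mul, aeval_X, Matrix.vecMul, dotProduct, Finset.sum_mul,
    Finset.mul_sum]
  rw [Finset.sum_comm]
  refine Finset.sum_congr rfl fun i _ ↦ Finset.sum_congr rfl fun j _ ↦ ?_
  rw [← algebraMap_eq, AlgHom.commutes, algebraMap_eq]
  ring

lemma lin_lin (M N : Matrix (Fin 3) (Fin 3) k) (H : MvPolynomial (Fin 3) k) :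
    lin M (lin N H) = lin (N * M) H := by
  have : (lin M).comp (lin N) = lin (N * M) := by
    ext1 i
    rw [AlgHom.comp_apply, lin_X, lin_form, lin_X]
    rfl
  exact DFunLike.congr_fun this H

lemma lin_one (H : MvPolynomial (Fin 3) k) : lin 1 H = H := by
  have : lin (1 : Matrix (Fin 3) (Fin 3) k) = AlgHom.id k _ := by
    ext1 i
    simp [lin, Matrix.one_apply]
  rw [this]; rfl

/-- The substitution by the point `M (1, s, s t)`. -/
def chart (M : Matrix (Fin 3) (Fin 3) k) : MvPolynomial (Fin 3) k →ₐ[k] MvPolynomial (Fin 2) k :=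
  std.comp (lin M)

lemma chart_X (M : Matrix (Fin 3) (Fin 3) k) (i : Fin 3) :
    chart M (X i) = C (M i 0) + C (M i 1) * X 0 + C (M i 2) * (X 0 * X 1) := by
  simp only [chart, AlgHom.comp_apply, lin, aeval_X, Fin.sum_univ_three, map_add, map_mul, std_X0,
    std_X1, std_X2]
  simp [← algebraMap_eq]

lemma exists_homogeneous_generator_chart {M N : Matrix (Fin 3) (Fin 3) k} (hMN : M * N = 1)
    {p : MvPolynomial (Fin 2) k} (hp : Prime p)
    (hps : ¬ X 0 ∣ p) : ∃ (d n : ℕ) (G : MvPolynomial (Fin 3) k), G.IsHomogeneous d ∧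
      chart M G = X 0 ^ n * p ∧ ∀ (e : ℕ) (H : MvPolynomial (Fin 3) k), H.IsHomogeneous e →
        p ∣ chart M H → G ∣ H := by
  have hNM : N * M = 1 := mul_eq_one_comm.mp hMN
  obtain ⟨d, n, G, hG, h1, h2⟩ := exists_homogeneous_generator hp hps
  refine ⟨d, n, lin N G, lin_isHomogeneous _ hG, ?_, fun e H hH hpH ↦ ?_⟩
  · rw [chart, AlgHom.comp_apply, lin_lin, hNM, lin_one, h1]
  · have := map_dvd (lin N) (h2 e (lin M H) (lin_isHomogeneous _ hH) hpH)
    rwa [lin_lin, hMN, lin_one] at this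

/-- The ideal of the point `v`. -/
def pointIdeal (v : Fin 3 → k) : Ideal (MvPolynomial (Fin 3) k) :=
  Ideal.span (Set.range fun ij : Fin 3 × Fin 3 ↦ C (v ij.1) * X ij.2 - C (v ij.2) * X ij.1)

/-- With c·v = 1 and a·v = 0, the form a is the combination of the generators v_i X_j − v_j X_i with
coefficients c_i a_j. -/
lemma form_mem_pointIdeal {v a c : Fin 3 → k} (ha : ∑ i, a i * v i = 0) (hc : ∑ i, c i * v i = 1) :
    ∑ i, C (a i) * X i ∈ pointIdeal v := by
  have : ∑ j, C (a j) * X j = ∑ i, ∑ j, C (c i * a j) * (C (v i) * X j - C (v j) * X i) := by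
    have h1 : ∑ i, ∑ j, C (c i * a j) * (C (v i) * X j - C (v j) * X i) =
        C (∑ i, c i * v i) * ∑ j, C (a j) * X j - (∑ i, C (c i) * X i) * C (∑ i, a i * v i) := by
      simp only [map_sum, map_mul, Finset.sum_mul, Finset.mul_sum]
      rw [Finset.sum_comm, ← Finset.sum_sub_distrib]
      refine Finset.sum_congr rfl fun i _ ↦ ?_
      rw [← Finset.sum_sub_distrib]
      refine Finset.sum_congr rfl fun j _ ↦ ?_
      ring
    rw [h1, ha, hc]; simp
  rw [this]
  exact Ideal.sum_mem _ fun i _ ↦ Ideal.sum_mem _ fun j _ ↦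
    Ideal.mul_mem_left _ _ (Ideal.subset_span ⟨(i, j), rfl⟩)

lemma map_pow_dvd_of_mem_pow {R S : Type*} [CommRing R] [CommRing S] (f : R →+* S) {I : Ideal R}
    {s : S} (h : ∀ x ∈ I, s ∣ f x) {m : ℕ} {x : R} (hx : x ∈ I ^ m) : s ^ m ∣ f x := by
  rw [← Ideal.mem_span_singleton, ← Ideal.span_singleton_pow]
  have h1 : I.map f ≤ Ideal.span {s} := Ideal.map_le_iff_le_comap.mpr fun x hx ↦
    Ideal.mem_span_singleton.mpr (h x hx)
  have h2 := Ideal.mem_map_of_mem f hx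
  rw [Ideal.map_pow] at h2
  exact Ideal.pow_right_mono h1 m h2

lemma dvd_of_mem_pointIdeal {S : Type*} [CommRing S] (f : MvPolynomial (Fin 3) k →+* S)
    (v : Fin 3 → k) (s : S) (h : ∀ i j, s ∣ f (C (v i) * X j - C (v j) * X i)) :
    ∀ x ∈ pointIdeal v, s ∣ f x := by
  intro x hx
  rw [← Ideal.mem_span_singleton, ← Ideal.mem_comap]
  refine (Ideal.span_le.mpr ?_ : pointIdeal v ≤ _) hx
  rintro _ ⟨ij, rfl⟩
  exact Ideal.mem_span_singleton.mpr (h _ _)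

/-- The right-hand side depends only on the first column of `M`. So the order along s = 0 is the
multiplicity at the blown-up point, whichever frame defines the chart. -/
lemma pow_dvd_chart_iff {M N : Matrix (Fin 3) (Fin 3) k} (hMN : M * N = 1)
    {H : MvPolynomial (Fin 3) k} {d m : ℕ} (hH : H.IsHomogeneous d) :
    X 0 ^ m ∣ chart M H ↔ H ∈ pointIdeal (fun i ↦ M i 0) ^ m := by
  have hNM : N * M = 1 := mul_eq_one_comm.mp hMN
  have hN : ∀ l, ∑ i, N l i * M i 0 = if l = 0 then 1 else 0 := fun l ↦ by
    have := congrFun (congrFun hNM l) 0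
    rw [Matrix.mul_apply, Matrix.one_apply] at this
    exact this
  constructor
  · intro h
    have h1 := Ideal.mem_map_of_mem (lin N).toRingHom
      (mem_span_pow_of_dvd_std (lin_isHomogeneous M hH) h)
    have h2 : (lin N).toRingHom (lin M H) = H := by
      change lin N (lin M H) = H
      rw [lin_lin, hMN, lin_one]
    rw [h2, Ideal.map_pow] at h1
    refine Ideal.pow_right_mono ?_ m h1
    rw [Ideal.map_span, Ideal.span_le]
    rintro _ ⟨x, hx, rfl⟩
    rcases hx with rfl | rfl
    · change lin N (X 1) ∈ _
      rw [lin, aeval_X]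
      exact form_mem_pointIdeal (c := N 0) (by simp [hN]) (by simp [hN])
    · change lin N (X 2) ∈ _
      rw [lin, aeval_X]
      exact form_mem_pointIdeal (c := N 0) (by simp [hN]) (by simp [hN])
  · intro h
    refine map_pow_dvd_of_mem_pow (chart M).toRingHom
      (dvd_of_mem_pointIdeal (chart M).toRingHom _ _ fun i j ↦ ?_) h
    change _ ∣ chart M _
    rw [map_sub, map_mul, map_mul, chart_X, chart_X, ← algebraMap_eq, AlgHom.commutes,
      AlgHom.commutes, algebraMap_eq]
    exact ⟨C (M i 0) * (C (M j 1) + C (M j 2) * X 1) - C (M j 0) * (C (M i 1) + C (M i 2) * X 1),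
      by ring⟩

lemma prime_X_sub_X : Prime (X 1 - X 0 : MvPolynomial (Fin 2) k) := by
  let e : MvPolynomial (Fin 2) k ≃ₐ[k] MvPolynomial (Fin 2) k :=
    AlgEquiv.ofAlgHom (aeval ![X 0, X 1 - X 0]) (aeval ![X 0, X 1 + X 0])
      (by ext1 i; fin_cases i <;> simp) (by ext1 i; fin_cases i <;> simp)
  have h := (MulEquiv.prime_iff (p := (X 1 : MvPolynomial (Fin 2) k)) e.toMulEquiv).mpr X_prime
  have : e.toMulEquiv (X 1) = X 1 - X 0 := by
    change aeval ![X 0, X 1 - X 0] (X 1) = _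
    simp
  rwa [this] at h

/-- Bézout for a line: the restriction of g to the line through the first two columns is a nonzero
binary form of degree d, divisible by powers of three pairwise coprime linear forms. -/
lemma add_le_of_mem_pointIdeal_pow {M N : Matrix (Fin 3) (Fin 3) k} (hMN : M * N = 1)
    {g : MvPolynomial (Fin 3) k} {d m₁ m₂ m₃ : ℕ} (hg : g.IsHomogeneous d)
    (hline : ¬ (∑ j, C (N 2 j) * X j) ∣ g)
    (h₁ : g ∈ pointIdeal (fun i ↦ M i 0) ^ m₁) (h₂ : g ∈ pointIdeal (fun i ↦ M i 1) ^ m₂)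
    (h₃ : g ∈ pointIdeal (fun i ↦ M i 0 + M i 1) ^ m₃) : m₁ + m₂ + m₃ ≤ d := by
  let ρ : MvPolynomial (Fin 3) k →ₐ[k] MvPolynomial (Fin 2) k :=
    aeval fun i ↦ C (M i 0) * X 0 + C (M i 1) * X 1
  have hρX : ∀ i, ρ (X i) = C (M i 0) * X 0 + C (M i 1) * X 1 := fun i ↦ by simp [ρ]
  have hρC : ∀ c, ρ (C c) = C c := fun c ↦ by rw [← algebraMap_eq, AlgHom.commutes, algebraMap_eq]
  -- In the coordinates of the frame, restriction to the line sets the third coordinate to zero. A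
  -- form that restricts to zero is therefore divisible by that coordinate, whose coefficients are
  -- `N 2`.
  have hρ0 : ρ g ≠ 0 := by
    intro h0
    apply hline
    let z : MvPolynomial (Fin 3) k →ₐ[k] MvPolynomial (Fin 2) k := aeval ![X 0, X 1, 0]
    have hz : ρ = z.comp (lin M) := by
      ext1 i
      rw [hρX, AlgHom.comp_apply, lin, aeval_X, Fin.sum_univ_three]
      simp [z, ← algebraMap_eq]
    have h1 : ∀ f : MvPolynomial (Fin 3) k, z f = 0 → X 2 ∣ f := by
      intro f hf
      let z' : MvPolynomial (Fin 2) k →ₐ[k] MvPolynomial (Fin 3) k := aeval ![X 0, X 1]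
      have h2 : ∀ f, X 2 ∣ f - z' (z f) := by
        intro f
        induction f using MvPolynomial.induction_on with
        | C a => simp [← algebraMap_eq]
        | add p q hp hq => rw [map_add, map_add, add_sub_add_comm]; exact dvd_add hp hq
        | mul_X p i hp =>
          rw [map_mul, map_mul]
          have h3 : X 2 ∣ X i - z' (z (X i)) := by
            fin_cases i <;> simp [z, z']
          have h4 : p * X i - z' (z p) * z' (z (X i)) =
            (p - z' (z p)) * X i + z' (z p) * (X i - z' (z (X i))) := by ring
          rw [h4]
          exact dvd_add (hp.mul_right _) (h3.mul_left _)
      have := h2 f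
      rwa [hf, map_zero, sub_zero] at this
    rw [hz] at h0
    have h3 := map_dvd (lin N) (h1 (lin M g) h0)
    rw [lin_lin, hMN, lin_one, lin_X] at h3
    exact h3
  -- On the line, the first column is the point X₁ = 0, the second is X₀ = 0, and their sum is X₁ =
  -- X₀.
  have hdvd₁ : X 1 ^ m₁ ∣ ρ g :=
    map_pow_dvd_of_mem_pow ρ.toRingHom (dvd_of_mem_pointIdeal ρ.toRingHom _ _ fun i j ↦ by
      change _ ∣ ρ _
      rw [map_sub, map_mul, map_mul, hρX, hρX, hρC, hρC]
      exact ⟨C (M i 0) * C (M j 1) - C (M j 0) * C (M i 1), by ring⟩) h₁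
  have hdvd₂ : X 0 ^ m₂ ∣ ρ g :=
    map_pow_dvd_of_mem_pow ρ.toRingHom (dvd_of_mem_pointIdeal ρ.toRingHom _ _ fun i j ↦ by
      change _ ∣ ρ _
      rw [map_sub, map_mul, map_mul, hρX, hρX, hρC, hρC]
      exact ⟨C (M i 1) * C (M j 0) - C (M j 1) * C (M i 0), by ring⟩) h₂
  have hdvd₃ : (X 1 - X 0) ^ m₃ ∣ ρ g :=
    map_pow_dvd_of_mem_pow ρ.toRingHom (dvd_of_mem_pointIdeal ρ.toRingHom _ _ fun i j ↦ by
      change _ ∣ ρ _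
      rw [map_sub, map_mul, map_mul, hρX, hρX, hρC, hρC, C_add, C_add]
      exact ⟨C (M i 0) * C (M j 1) - C (M j 0) * C (M i 1), by ring⟩) h₃
  have hev : ∀ (q : MvPolynomial (Fin 2) k) (x y : k), eval ![x, y] q ≠ 0 →
      ∀ r : MvPolynomial (Fin 2) k, eval ![x, y] r = 0 → ¬ r ∣ q := by
    rintro q x y hq r hr ⟨c, rfl⟩
    simp [hr] at hq
  obtain ⟨f₁, hf₁⟩ := hdvd₁
  have h2 : X 0 ^ m₂ ∣ f₁ := by
    refine (X_prime (R := k) (i := (0 : Fin 2))).pow_dvd_of_dvd_mul_left m₂ (fun h ↦ ?_) (hf₁ ▸ hdvd₂)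
    exact hev _ 0 1 (by simp) _ (by simp) ((X_prime (R := k) (i := (0 : Fin 2))).dvd_of_dvd_pow h)
  obtain ⟨f₂, rfl⟩ := h2
  have h3 : (X 1 - X 0) ^ m₃ ∣ f₂ := by
    refine (prime_X_sub_X (k := k)).pow_dvd_of_dvd_mul_left m₃ (fun h ↦ ?_)
      (show _ ∣ X 1 ^ m₁ * X 0 ^ m₂ * f₂ from by rw [mul_assoc, ← hf₁]; exact hdvd₃)
    rcases (prime_X_sub_X (k := k)).dvd_or_dvd h with h | h
    · exact hev _ 1 1 (by simp) _ (by simp) ((prime_X_sub_X (k := k)).dvd_of_dvd_pow h)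
    · exact hev _ 1 1 (by simp) _ (by simp) ((prime_X_sub_X (k := k)).dvd_of_dvd_pow h)
  obtain ⟨f₃, rfl⟩ := h3
  have hρg : (ρ g).IsHomogeneous d := by
    rw [← one_mul d]
    exact hg.aeval _ fun i ↦ ((isHomogeneous_X k _).C_mul _).add ((isHomogeneous_X k _).C_mul _)
  have hdeg := hρg.totalDegree hρ0
  have hXX : (X 1 - X 0 : MvPolynomial (Fin 2) k) ≠ 0 := prime_X_sub_X.ne_zero
  have hXXd : (X 1 - X 0 : MvPolynomial (Fin 2) k).totalDegree = 1 :=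
    ((isHomogeneous_X k (1 : Fin 2)).sub (isHomogeneous_X k 0)).totalDegree hXX
  rw [hf₁] at hρ0
  have hn := right_ne_zero_of_mul hρ0
  have hn2 := right_ne_zero_of_mul hn
  have hn3 := right_ne_zero_of_mul hn2
  rw [hf₁, totalDegree_mul_of_isDomain (pow_ne_zero _ (X_ne_zero _)) hn,
    totalDegree_mul_of_isDomain (pow_ne_zero _ (X_ne_zero _)) hn2,
    totalDegree_mul_of_isDomain (pow_ne_zero _ hXX) hn3, totalDegree_X_pow, totalDegree_X_pow] at hdeg
  have h5 : ((X 1 - X 0 : MvPolynomial (Fin 2) k) ^ m₃).totalDegree = m₃ := by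
    have := (((isHomogeneous_X k (1 : Fin 2)).sub (isHomogeneous_X k 0)).pow m₃).totalDegree
      (pow_ne_zero _ hXX)
    simpa using this
  omega

end Poly

end LangerSurface
end

/-! ### Ideal sheaves pulled back to affine schemes. -/

noncomputable section
namespace LangerSurface

open Scheme Scheme.IdealSheafData

section IdealSheaf

variable {X Y : Scheme.{u}}

/-- Both ideals have the same upper bounds: on affine schemes ideal sheaves are ideals, and `comap`
is left adjoint to `map`. -/
lemma ideal_comap_top_of_isAffine [IsAffine X] [IsAffine Y] (I : Y.IdealSheafData) (f : X ⟶ Y) :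
    (I.comap f).ideal ⟨⊤, isAffineOpen_top _⟩ =
      (I.ideal ⟨⊤, isAffineOpen_top _⟩).map f.appTop.hom := by
  refine eq_of_forall_ge_iff fun K ↦ ?_
  obtain ⟨K, rfl⟩ : ∃ K' : X.IdealSheafData, K'.ideal ⟨⊤, isAffineOpen_top _⟩ = K :=
    ⟨equivOfIsAffine.symm K, equivOfIsAffine.apply_symm_apply K⟩
  have h1 : (I.comap f).ideal ⟨⊤, isAffineOpen_top _⟩ ≤ K.ideal ⟨⊤, isAffineOpen_top _⟩ ↔
      I.comap f ≤ K := ⟨fun h ↦ le_of_isAffine h, fun h ↦ h _⟩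
  have h2 : I ≤ K.map f ↔ I.ideal ⟨⊤, isAffineOpen_top _⟩ ≤
      (K.map f).ideal ⟨⊤, isAffineOpen_top _⟩ := ⟨fun h ↦ h _, fun h ↦ le_of_isAffine h⟩
  rw [h1, ← le_map_iff_comap_le, h2, Ideal.map_le_iff_le_comap, ideal_map_of_isAffineHom]
  rfl

/-- The ideal of `R` that an ideal sheaf on `X` generates along a morphism `Spec R ⟶ X`. -/
def pb (I : X.IdealSheafData) {R : CommRingCat.{u}} (f : Spec R ⟶ X) : Ideal R :=
  ((I.comap f).ideal ⟨⊤, isAffineOpen_top _⟩).map (ΓSpecIso R).hom.hom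

lemma map_map_ΓSpecIso {R S : CommRingCat.{u}} (φ : R ⟶ S) (J : Ideal Γ(Spec R, ⊤)) :
    (J.map (Spec.map φ).appTop.hom).map (ΓSpecIso S).hom.hom =
      (J.map (ΓSpecIso R).hom.hom).map φ.hom := by
  rw [Ideal.map_map, Ideal.map_map, ← CommRingCat.hom_comp, ← CommRingCat.hom_comp,
    ΓSpecIso_naturality]

lemma pb_comp (I : X.IdealSheafData) {R S : CommRingCat.{u}} (φ : R ⟶ S) (f : Spec R ⟶ X) :
    pb I (Spec.map φ ≫ f) = (pb I f).map φ.hom := by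
  rw [pb, comap_comp, ideal_comap_top_of_isAffine, map_map_ΓSpecIso]; rfl

lemma pb_comap (I : Y.IdealSheafData) (g : X ⟶ Y) {R : CommRingCat.{u}} (f : Spec R ⟶ X) :
    pb (I.comap g) f = pb I (f ≫ g) := by
  rw [pb, pb, comap_comp]

/-- The affine open of an open immersion from an affine scheme. -/
abbrev affineRange {R : CommRingCat.{u}} (f : Spec R ⟶ X) [IsOpenImmersion f] : X.affineOpens :=
  ⟨f ''ᵁ ⊤, (isAffineOpen_top _).image_of_isOpenImmersion f⟩

/-- The functions on the range of an open immersion from an affine scheme. -/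
def rangeIso {R : CommRingCat.{u}} (f : Spec R ⟶ X) [IsOpenImmersion f] :
    Γ(X, (affineRange f).1) ≅ R :=
  f.appIso ⊤ ≪≫ ΓSpecIso R

lemma mem_affineRange {R : CommRingCat.{u}} (f : Spec R ⟶ X) [IsOpenImmersion f] {x : X} :
    x ∈ (affineRange f).1 ↔ x ∈ Set.range f := by
  change x ∈ f ''ᵁ ⊤ ↔ _
  rw [Hom.image_top_eq_opensRange]; rfl

lemma pb_eq_map_rangeIso (I : X.IdealSheafData) {R : CommRingCat.{u}} (f : Spec R ⟶ X)
    [IsOpenImmersion f] : pb I f = (I.ideal (affineRange f)).map (rangeIso f).hom.hom := by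
  rw [pb, ideal_comap_of_isOpenImmersion, rangeIso, Iso.trans_hom, CommRingCat.hom_comp,
    ← Ideal.map_map]
  congr 1
  exact Ideal.comap_symm (f.appIso ⊤).commRingCatIsoToRingEquiv

lemma ideal_affineRange (I : X.IdealSheafData) {R : CommRingCat.{u}} (f : Spec R ⟶ X)
    [IsOpenImmersion f] : I.ideal (affineRange f) = (pb I f).map (rangeIso f).inv.hom := by
  rw [pb_eq_map_rangeIso, Ideal.map_map, ← CommRingCat.hom_comp, Iso.hom_inv_id]
  exact (Ideal.map_id _).symm

lemma rangeIso_fromSpec {U : X.Opens} (hU : IsAffineOpen U) :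
    (rangeIso hU.fromSpec).hom = X.presheaf.map (eqToHom (by simp)).op := by
  rw [rangeIso, Iso.trans_hom, Hom.appIso_hom', Hom.appLE,
    hU.fromSpec_app_of_le (hU.fromSpec ''ᵁ ⊤) (by simp)]
  simp only [Category.assoc, ← Functor.map_comp_assoc]
  rw [← op_comp, show (homOfLE _ ≫ homOfLE _ : (⊤ : (Spec Γ(X, U)).Opens) ⟶ ⊤) = 𝟙 _ from
    Subsingleton.elim _ _, op_id, CategoryTheory.Functor.map_id, Category.id_comp, Iso.inv_hom_id, Category.comp_id]
  rfl

lemma pb_fromSpec' (I : X.IdealSheafData) {U : X.Opens} (hU : IsAffineOpen U) :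
    pb I hU.fromSpec = I.ideal ⟨U, hU⟩ := by
  rw [pb_eq_map_rangeIso, rangeIso_fromSpec]
  exact I.map_ideal' (U := ⟨U, hU⟩) (V := affineRange hU.fromSpec) _

lemma pb_fromSpec (I : X.IdealSheafData) (U : X.affineOpens) : pb I U.2.fromSpec = I.ideal U :=
  pb_fromSpec' I U.2

lemma ideal_comap_eq_map (I : Y.IdealSheafData) (f : X ⟶ Y) (U : Y.affineOpens)
    (V : X.affineOpens) (h : V.1 ≤ f ⁻¹ᵁ U.1) :
    (I.comap f).ideal V = (I.ideal U).map (f.appLE U V h).hom := by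
  rw [← pb_fromSpec, pb_comap, ← IsAffineOpen.SpecMap_appLE_fromSpec f U.2 V.2 h, pb_comp,
    pb_fromSpec]

lemma exists_affine_le_preimage (f : X ⟶ Y) (x : X) :
    ∃ (U : Y.affineOpens) (V : X.affineOpens), x ∈ V.1 ∧ V.1 ≤ f ⁻¹ᵁ U.1 := by
  obtain ⟨U, hU, hxU, -⟩ := exists_isAffineOpen_mem_and_subset (x := f x) (U := ⊤) trivial
  obtain ⟨V, hV, hxV, hVU⟩ := exists_isAffineOpen_mem_and_subset (x := x) (U := f ⁻¹ᵁ U) hxU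
  exact ⟨⟨U, hU⟩, ⟨V, hV⟩, hxV, hVU⟩

lemma ext_of_forall_mem {I J : X.IdealSheafData}
    (h : ∀ x : X, ∃ U : X.affineOpens, x ∈ U.1 ∧ I.ideal U = J.ideal U) : I = J := by
  choose U hU hIJ using h
  refine ext_of_iSup_eq_top U ?_ hIJ
  exact top_le_iff.mp fun x _ ↦ Opens.mem_iSup.mpr ⟨x, hU x⟩

lemma comap_mul (I J : Y.IdealSheafData) (f : X ⟶ Y) :
    (I * J).comap f = I.comap f * J.comap f := by
  refine ext_of_forall_mem fun x ↦ ?_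
  obtain ⟨U, V, hx, h⟩ := exists_affine_le_preimage f x
  refine ⟨V, hx, ?_⟩
  rw [ideal_comap_eq_map _ f U V h]
  change ((I.ideal U) * (J.ideal U)).map _ = (I.comap f).ideal V * (J.comap f).ideal V
  rw [Ideal.map_mul, ideal_comap_eq_map _ f U V h, ideal_comap_eq_map _ f U V h]

lemma pb_mul (I J : X.IdealSheafData) {R : CommRingCat.{u}} (f : Spec R ⟶ X) :
    pb (I * J) f = pb I f * pb J f := by
  rw [pb, comap_mul, pb, pb, ← Ideal.map_mul]; rfl

lemma pb_top {R : CommRingCat.{u}} (f : Spec R ⟶ X) : pb (⊤ : X.IdealSheafData) f = ⊤ := by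
  rw [pb, comap_top, ideal_top]; exact Ideal.map_top _

lemma mem_support_iff_pb_le (I : X.IdealSheafData) {R : CommRingCat.{u}} (f : Spec R ⟶ X)
    (y : Spec R) : f y ∈ I.support ↔ pb I f ≤ y.asIdeal := by
  have h1 : f y ∈ I.support ↔ y ∈ (I.comap f).support := by rw [support_comap]; rfl
  rw [h1, mem_support_iff_of_mem (U := ⟨⊤, isAffineOpen_top _⟩) (Opens.mem_top y), pb,
    Ideal.map_le_iff_le_comap]
  simp only [Scheme.mem_zeroLocus_iff]
  refine forall₂_congr fun g _ ↦ ?_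
  rw [basicOpen_eq_of_affine']
  exact not_not

lemma IsEffectiveCartier.of_pb {D : X.IdealSheafData}
    (h : ∀ x : X, ∃ (R : CommRingCat.{u}) (f : Spec R ⟶ X), IsOpenImmersion f ∧ x ∈ Set.range f ∧
      ∃ s ∈ nonZeroDivisors R, pb D f = Ideal.span {s}) : IsEffectiveCartier D := by
  intro x
  obtain ⟨R, f, hf, hx, s, hs, h⟩ := h x
  refine ⟨affineRange f, (mem_affineRange f).mpr hx, (rangeIso f).inv.hom s, ?_, ?_⟩
  · rw [← MulEquivClass.map_nonZeroDivisors (rangeIso f).symm.commRingCatIsoToRingEquiv]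
    exact ⟨s, hs, rfl⟩
  · rw [ideal_affineRange, h, Ideal.map_span, Set.image_singleton]

lemma IsEffectiveCartier.exists_pb {D : X.IdealSheafData} (h : IsEffectiveCartier D) (x : X) :
    ∃ (R : CommRingCat.{u}) (f : Spec R ⟶ X) (y : Spec R), IsOpenImmersion f ∧ f y = x ∧
      ∃ s ∈ nonZeroDivisors R, pb D f = Ideal.span {s} := by
  obtain ⟨⟨U, hU⟩, hx, s, hs, h⟩ := h x
  have hU' : IsAffineOpen U := hU
  obtain ⟨y, hy⟩ : x ∈ Set.range hU'.fromSpec := by rw [hU'.range_fromSpec]; exact hx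
  exact ⟨_, hU'.fromSpec, y, inferInstance, hy, s, hs, by rw [pb_fromSpec' D hU']; exact h⟩

lemma hom_ext_of_isOpenImmersion {f g : X ⟶ Y}
    (h : ∀ (R : CommRingCat.{u}) (w : Spec R ⟶ X), IsOpenImmersion w → w ≫ f = w ≫ g) : f = g :=
  X.affineCover.hom_ext _ _ fun z ↦ h _ _ (X.affineCover.map_prop z)

/-- The inclusion of a basic open subset. -/
abbrev toAway {R : CommRingCat.{u}} (r : R) :
    R ⟶ CommRingCat.of (Localization.Away r) := CommRingCat.ofHom (algebraMap _ _)

instance isOpenImmersion_toAway {R : CommRingCat.{u}} (r : R) :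
    IsOpenImmersion (Spec.map (toAway r)) :=
  IsOpenImmersion.of_isLocalization (S := Localization.Away r) r

lemma mem_range_toAway {R : CommRingCat.{u}} (r : R) (y : Spec R) :
    y ∈ Set.range (Spec.map (toAway r)) ↔ r ∉ y.asIdeal := by
  have := PrimeSpectrum.localization_away_comap_range (Localization.Away r) r
  exact Set.ext_iff.mp this y

lemma exists_toAway {R : CommRingCat.{u}} (r : R) :
    ∃ (S : CommRingCat.{u}) (ψ : R ⟶ S), IsOpenImmersion (Spec.map ψ) ∧ IsUnit (ψ.hom r) ∧
      ∀ y : Spec R, y ∈ Set.range (Spec.map ψ) ↔ r ∉ y.asIdeal :=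
  ⟨_, toAway r, inferInstance, IsLocalization.Away.algebraMap_isUnit r, mem_range_toAway r⟩

lemma exists_notMem_of_mem_open {R : CommRingCat.{u}} (V : (Spec R).Opens) {y : Spec R}
    (hy : y ∈ V) : ∃ r, r ∉ y.asIdeal ∧ ∀ z : Spec R, r ∉ z.asIdeal → z ∈ V := by
  obtain ⟨_, ⟨_, ⟨r, rfl⟩, rfl⟩, hy₀, hr⟩ :=
    PrimeSpectrum.isBasis_basic_opens.exists_subset_of_mem_open
      (show y ∈ (V : Set (Spec R)) from hy) V.2
  exact ⟨r, hy₀, fun z hz ↦ hr hz⟩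

/-- The closed point of the spectrum of a local ring. -/
def closedPt (Q : CommRingCat.{u}) [IsLocalRing Q] : Spec Q := IsLocalRing.closedPoint Q

lemma specializes_closedPt {Q : CommRingCat.{u}} [IsLocalRing Q] (y : Spec Q) : y ⤳ closedPt Q :=
  IsLocalRing.specializes_closedPoint y

lemma exists_closedPoint_eq {R : CommRingCat.{u}} (y : Spec R) :
    ∃ (Q : CommRingCat.{u}) (_ : IsLocalRing Q) (π : R ⟶ Q),
      Spec.map π (closedPt Q) = y ∧ (∀ r, IsUnit (π.hom r) ↔ r ∉ y.asIdeal) ∧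
      (IsDomain R → IsDomain Q ∧ Function.Injective π.hom) := by
  have hy : y.asIdeal.IsPrime := y.2
  refine ⟨.of (Localization.AtPrime y.asIdeal), inferInstanceAs (IsLocalRing
    (Localization.AtPrime y.asIdeal)), CommRingCat.ofHom (algebraMap _ _), ?_, fun r ↦ ?_,
    fun hR ↦ ⟨?_, ?_⟩⟩
  · exact PrimeSpectrum.ext (Localization.AtPrime.under_maximalIdeal)
  · exact IsLocalization.AtPrime.isUnit_to_map_iff (Localization.AtPrime y.asIdeal) y.asIdeal r
  · exact IsLocalization.isDomain_localization y.asIdeal.primeCompl_le_nonZeroDivisors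
  · exact IsLocalization.injective (Localization.AtPrime y.asIdeal)
      y.asIdeal.primeCompl_le_nonZeroDivisors

lemma IsEffectiveCartier.comap_of_pb {R : CommRingCat.{u}} {D : X.IdealSheafData}
    {f : Spec R ⟶ X} {s : R} (hs : s ∈ nonZeroDivisors R) (h : pb D f = Ideal.span {s}) :
    IsEffectiveCartier (D.comap f) :=
  .of_pb fun x ↦ ⟨R, 𝟙 _, inferInstance, by simp, s, hs, by rw [pb_comap, Category.id_comp, h]⟩

/-- Both sides are radical ideals with the same zero locus. -/
lemma pb_vanishingIdeal (Z : Closeds X) {R : CommRingCat.{u}} (f : Spec R ⟶ X)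
    [IsOpenImmersion f] :
    pb (vanishingIdeal Z) f = PrimeSpectrum.vanishingIdeal (f ⁻¹' (Z : Set X)) := by
  have hrad : (pb (vanishingIdeal Z) f).IsRadical := by
    rw [pb_eq_map_rangeIso]
    have := Ideal.comap_symm (I := (vanishingIdeal Z).ideal (affineRange f))
      (rangeIso f).commRingCatIsoToRingEquiv
    change ((vanishingIdeal Z).ideal (affineRange f)).map
      (rangeIso f).commRingCatIsoToRingEquiv |>.IsRadical
    rw [← this, vanishingIdeal_ideal]
    exact (PrimeSpectrum.isRadical_vanishingIdeal _).comap _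
  rw [← hrad.radical, ← PrimeSpectrum.vanishingIdeal_zeroLocus_eq_radical]
  congr 1
  ext y
  rw [PrimeSpectrum.mem_zeroLocus, SetLike.coe_subset_coe]
  refine (mem_support_iff_pb_le _ f y).symm.trans ?_
  change f y ∈ ((vanishingIdeal Z).support : Set X) ↔ _
  rw [coe_support_vanishingIdeal]
  rfl

lemma vanishingIdeal_eq_of_isIntegral {I : X.IdealSheafData} [IsReduced I.subscheme] :
    vanishingIdeal I.support = I := by
  rw [vanishingIdeal_support]
  ext U : 2
  change (I.ideal U).radical = _
  refine Ideal.IsRadical.radical ?_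
  rw [← I.ker_subschemeι_app U]
  exact (RingHom.ker_isRadical_iff_reduced_of_surjective (I.subschemeι_app_surjective U)).mpr
    inferInstance

end IdealSheaf

end LangerSurface
end

/-! ### Points of the plane with values in a ring, by homogeneous coordinates. -/

noncomputable section
namespace LangerSurface

open MvPolynomial HomogeneousLocalization

attribute [local instance] MvPolynomial.gradedAlgebra

section HomogeneousEval

variable {σ K : Type*} [CommRing K] {R : Type*} [CommRing R]

lemma _root_.MvPolynomial.IsHomogeneous.eval₂_smul {φ φ' : MvPolynomial σ K →+* R} {l : R}
    (hC : ∀ c, φ' (C c) = φ (C c)) (hX : ∀ i, φ' (X i) = l * φ (X i)) {d : ℕ}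
    {a : MvPolynomial σ K} (ha : a.IsHomogeneous d) : φ' a = l ^ d * φ a := by
  rw [a.as_sum, map_sum, map_sum, Finset.mul_sum]
  refine Finset.sum_congr rfl fun α hα ↦ ?_
  have hαd : α.degree = d := by
    by_contra hne
    exact (mem_support_iff.mp hα) (ha.coeff_eq_zero hne)
  rw [monomial_eq, map_mul, map_mul, hC, Finsupp.prod, map_prod, map_prod]
  simp only [map_pow, hX, mul_pow, Finset.prod_mul_distrib, Finset.prod_pow_eq_pow_sum]
  rw [show ∑ i ∈ α.support, α i = d from hαd]
  ring

end HomogeneousEval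

section Points

variable {F : Type u} [Field F]

/-- Evaluation of degree zero fractions. -/
def evalAway {R : Type*} [CommRing R] (φ : MvPolynomial (Fin 3) F →+* R)
    {f : MvPolynomial (Fin 3) F} (hu : IsUnit (φ f)) : Away (grading F) f →+* R :=
  (IsLocalization.Away.lift (S := Localization.Away f) f hu).comp
    (algebraMap (Away (grading F) f) (Localization.Away f))

lemma evalAway_mk {R : Type*} [CommRing R] (φ : MvPolynomial (Fin 3) F →+* R)
    {f : MvPolynomial (Fin 3) F} (hu : IsUnit (φ f)) {d : ℕ} (hf : f ∈ grading F d) (n : ℕ)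
    (a : MvPolynomial (Fin 3) F) (ha : a ∈ grading F (n • d)) :
    φ f ^ n * evalAway φ hu (Away.mk _ hf n a ha) = φ a := by
  rw [evalAway, RingHom.comp_apply, HomogeneousLocalization.algebraMap_apply, Away.val_mk]
  have h1 : algebraMap (MvPolynomial (Fin 3) F) (Localization.Away f) f ^ n *
      Localization.mk a (⟨f ^ n, n, rfl⟩ : Submonoid.powers f) = algebraMap _ _ a := by
    rw [← map_pow, ← Localization.mk_one_eq_algebraMap, ← Localization.mk_one_eq_algebraMap,
      Localization.mk_mul, Localization.mk_eq_mk_iff, Localization.r_iff_exists]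
    exact ⟨1, by simp⟩
  have h2 := congrArg (IsLocalization.Away.lift (S := Localization.Away f) f hu) h1
  rwa [map_mul, map_pow, IsLocalization.Away.lift_eq, IsLocalization.Away.lift_eq] at h2

lemma evalAway_fromZeroRingHom {R : Type*} [CommRing R] (φ : MvPolynomial (Fin 3) F →+* R)
    {f : MvPolynomial (Fin 3) F} (hu : IsUnit (φ f)) (c : grading F 0) :
    evalAway φ hu (fromZeroRingHom _ _ c) = φ c.1 := by
  rw [evalAway, RingHom.comp_apply, HomogeneousLocalization.algebraMap_apply]
  change IsLocalization.Away.lift (S := Localization.Away f) f hu (Localization.mk c.1 1) = _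
  rw [Localization.mk_one_eq_algebraMap, IsLocalization.Away.lift_eq]

lemma evalAway_unique {R : Type*} [CommRing R] {φ : MvPolynomial (Fin 3) F →+* R}
    {f : MvPolynomial (Fin 3) F} (hu : IsUnit (φ f)) {d : ℕ} (hf : f ∈ grading F d)
    {g : Away (grading F) f →+* R}
    (hg : ∀ n a ha, φ f ^ n * g (Away.mk _ hf n a ha) = φ a) : g = evalAway φ hu := by
  ext x
  obtain ⟨n, a, ha, rfl⟩ := Away.mk_surjective _ hf x
  refine (hu.pow n).mul_left_cancel ?_
  rw [hg, evalAway_mk]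

lemma evalAway_comp {R S : Type*} [CommRing R] [CommRing S] (φ : MvPolynomial (Fin 3) F →+* R)
    (ψ : R →+* S) {f : MvPolynomial (Fin 3) F} (hu : IsUnit (φ f)) {d : ℕ} (hf : f ∈ grading F d) :
    ψ.comp (evalAway φ hu) = evalAway (ψ.comp φ) (f := f) (hu.map ψ) := by
  refine evalAway_unique _ hf fun n a ha ↦ ?_
  rw [RingHom.comp_apply, RingHom.comp_apply, RingHom.comp_apply, ← map_pow, ← map_mul,
    evalAway_mk]

lemma evalAway_smul {R : Type*} [CommRing R] {φ φ' : MvPolynomial (Fin 3) F →+* R} {l : R}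
    (hl : IsUnit l)
    (hC : ∀ c, φ' (C c) = φ (C c)) (hX : ∀ i, φ' (X i) = l * φ (X i))
    {f : MvPolynomial (Fin 3) F} (hu : IsUnit (φ f)) (hu' : IsUnit (φ' f)) {d : ℕ}
    (hf : f ∈ grading F d) : evalAway φ' hu' = evalAway φ hu := by
  refine evalAway_unique _ hf fun n a ha ↦ ?_
  have h1 := evalAway_mk φ' hu' hf n a ha
  rw [IsHomogeneous.eval₂_smul hC hX hf, IsHomogeneous.eval₂_smul hC hX ha] at h1
  refine (hl.pow (n • d)).mul_left_cancel ?_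
  rw [← h1, mul_pow, ← pow_mul, smul_eq_mul, mul_comm n d, mul_assoc]

lemma evalAway_awayMap {R : Type*} [CommRing R] (φ : MvPolynomial (Fin 3) F →+* R)
    {f g x : MvPolynomial (Fin 3) F} (hu : IsUnit (φ f)) (hux : IsUnit (φ x)) {d e : ℕ}
    (hf : f ∈ grading F d) (hg : g ∈ grading F e) (hx : x = f * g) :
    (evalAway φ hux).comp (awayMap _ hg hx) = evalAway φ hu := by
  refine evalAway_unique _ hf fun n a ha ↦ ?_
  rw [RingHom.comp_apply, awayMap_mk (hf := hf)]
  subst hx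
  have h1 := evalAway_mk φ hux (SetLike.mul_mem_graded hf hg) n (a * g ^ n) (by
    rw [smul_add]; exact SetLike.mul_mem_graded ha (SetLike.pow_mem_graded n hg))
  have hg' : IsUnit (φ g) := by rw [map_mul] at hux; exact isUnit_of_mul_isUnit_right hux
  refine (hg'.pow n).mul_left_cancel ?_
  rw [map_mul, map_mul, map_pow, mul_pow] at h1
  linear_combination h1

/-- The morphism to the plane with the given homogeneous coordinates. -/
def P2pt {R : CommRingCat.{u}} (φ : MvPolynomial (Fin 3) F →+* R) {f : MvPolynomial (Fin 3) F}
    {d : ℕ} (hf : f ∈ grading F d) (hd : 0 < d) (hu : IsUnit (φ f)) : Spec R ⟶ P2 F :=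
  Spec.map (CommRingCat.ofHom (evalAway φ hu)) ≫ Proj.awayι (grading F) f hf hd

lemma P2pt_eq_mul {R : CommRingCat.{u}} (φ : MvPolynomial (Fin 3) F →+* R)
    {f g : MvPolynomial (Fin 3) F} {d e : ℕ} (hf : f ∈ grading F d) (hd : 0 < d)
    (hu : IsUnit (φ f)) (hg : g ∈ grading F e) (hug : IsUnit (φ g)) :
    P2pt φ hf hd hu = P2pt φ (f := f * g) (SetLike.mul_mem_graded hf hg) (by omega)
      (by rw [map_mul]; exact hu.mul hug) := by
  rw [P2pt, P2pt, ← evalAway_awayMap φ hu (x := f * g) (by rw [map_mul]; exact hu.mul hug) hf hg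
    rfl, CommRingCat.ofHom_comp, Spec.map_comp, Category.assoc,
    Proj.SpecMap_awayMap_awayι]

/-- Both morphisms factor through D₊(fg) and are given there by the same fractions, so the
nonvanishing form used to define the point does not matter. -/
lemma P2pt_congr {R : CommRingCat.{u}} (φ : MvPolynomial (Fin 3) F →+* R)
    {f g : MvPolynomial (Fin 3) F} {d e : ℕ} (hf : f ∈ grading F d) (hd : 0 < d)
    (hu : IsUnit (φ f)) (hg : g ∈ grading F e) (he : 0 < e) (hug : IsUnit (φ g)) :
    P2pt φ hf hd hu = P2pt φ hg he hug := by
  rw [P2pt_eq_mul φ hf hd hu hg hug, P2pt_eq_mul φ hg he hug hf hu]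
  have h : ∀ (x y : MvPolynomial (Fin 3) F) (n m : ℕ) (hx : x ∈ grading F n)
      (hy : y ∈ grading F m) (hn hm hux huy), x = y → n = m →
      P2pt φ (f := x) (d := n) hx hn hux = P2pt φ (f := y) (d := m) hy hm huy := by
    rintro x y n m _ _ _ _ _ _ rfl rfl
    rfl
  exact h _ _ _ _ _ _ _ _ _ _ (mul_comm _ _) (add_comm _ _)

lemma P2pt_eq_of_eq {R : CommRingCat.{u}} {φ φ' : MvPolynomial (Fin 3) F →+* R} (h : φ = φ')
    {f : MvPolynomial (Fin 3) F} {d : ℕ} (hf : f ∈ grading F d) (hd : 0 < d)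
    (hu : IsUnit (φ f)) (hu' : IsUnit (φ' f)) :
    P2pt φ hf hd hu = P2pt φ' hf hd hu' := by
  subst h; rfl

lemma P2pt_smul {R : CommRingCat.{u}} {φ φ' : MvPolynomial (Fin 3) F →+* R} {l : R}
    (hl : IsUnit l) (hC : ∀ c, φ' (C c) = φ (C c)) (hX : ∀ i, φ' (X i) = l * φ (X i))
    {f f' : MvPolynomial (Fin 3) F} {d d' : ℕ} (hf : f ∈ grading F d) (hd : 0 < d)
    (hu : IsUnit (φ f)) (hf' : f' ∈ grading F d') (hd' : 0 < d') (hu' : IsUnit (φ' f')) :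
    P2pt φ' hf' hd' hu' = P2pt φ hf hd hu := by
  have hu2 : IsUnit (φ f') := by
    rw [IsHomogeneous.eval₂_smul hC hX hf'] at hu'
    exact isUnit_of_mul_isUnit_right hu'
  rw [P2pt_congr φ hf hd hu hf' hd' hu2, P2pt, P2pt, evalAway_smul hl hC hX hu2 hu' hf']

lemma SpecMap_P2pt {R S : CommRingCat.{u}} (ψ : R ⟶ S) (φ : MvPolynomial (Fin 3) F →+* R)
    {f : MvPolynomial (Fin 3) F} {d : ℕ} (hf : f ∈ grading F d) (hd : 0 < d) (hu : IsUnit (φ f)) :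
    Spec.map ψ ≫ P2pt φ hf hd hu = P2pt (ψ.hom.comp φ) hf hd (hu.map ψ.hom) := by
  rw [P2pt, P2pt, ← evalAway_comp φ ψ.hom hu hf, CommRingCat.ofHom_comp, Spec.map_comp,
    Category.assoc]
  rfl

lemma basicOpen_eq_top_iff_isUnit {R : Type*} [CommRing R] {a : R} :
    PrimeSpectrum.basicOpen a = ⊤ ↔ IsUnit a := by
  have := PrimeSpectrum.iSup_basicOpen_eq_top_iff (f := fun _ : Unit ↦ a)
  rwa [ciSup_const, Set.range_const, Ideal.span_singleton_eq_top] at this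

lemma P2pt_preimage_basicOpen {R : CommRingCat.{u}} (φ : MvPolynomial (Fin 3) F →+* R)
    {f : MvPolynomial (Fin 3) F} {d : ℕ} (hf : f ∈ grading F d) (hd : 0 < d) (hu : IsUnit (φ f))
    {g : MvPolynomial (Fin 3) F} {e : ℕ} (hg : g ∈ grading F e) (he : 0 < e) :
    P2pt φ hf hd hu ⁻¹ᵁ Proj.basicOpen (grading F) g = PrimeSpectrum.basicOpen (φ g) := by
  rw [P2pt, Scheme.Hom.comp_preimage, Proj.awayι_preimage_basicOpen _ hf hd hg he]
  change TopologicalSpace.Opens.comap _ _ = _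
  erw [PrimeSpectrum.comap_basicOpen]
  have h1 := evalAway_mk φ hu hf e (g ^ d) (by
    convert! SetLike.pow_mem_graded d hg using 2; exact mul_comm _ _)
  rw [map_pow] at h1
  have h2 : PrimeSpectrum.basicOpen (φ f ^ e) = ⊤ :=
    basicOpen_eq_top_iff_isUnit.mpr (hu.pow e)
  rw [← PrimeSpectrum.basicOpen_pow (φ g) d hd, ← h1, PrimeSpectrum.basicOpen_mul, h2, top_inf_eq]
  rfl

lemma P2pt_mem_basicOpen {R : CommRingCat.{u}} (φ : MvPolynomial (Fin 3) F →+* R)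
    {f : MvPolynomial (Fin 3) F} {d : ℕ} (hf : f ∈ grading F d) (hd : 0 < d) (hu : IsUnit (φ f))
    {g : MvPolynomial (Fin 3) F} {e : ℕ} (hg : g ∈ grading F e) (he : 0 < e) (y : Spec R) :
    P2pt φ hf hd hu y ∈ Proj.basicOpen (grading F) g ↔ φ g ∉ y.asIdeal := by
  change y ∈ P2pt φ hf hd hu ⁻¹ᵁ Proj.basicOpen (grading F) g ↔ _
  rw [P2pt_preimage_basicOpen φ hf hd hu hg he]
  rfl

/-- The universal coordinates on `D₊(f)` for a linear form `f`. -/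
def univEval {f : MvPolynomial (Fin 3) F} (hf : f ∈ grading F 1) :
    MvPolynomial (Fin 3) F →+* Away (grading F) f :=
  eval₂Hom ((fromZeroRingHom (grading F) _).comp (algebraMap F (grading F 0)))
    fun i ↦ Away.mk _ hf 1 (X i) (by simpa using isHomogeneous_X F i)

lemma univEval_eq_mk {f : MvPolynomial (Fin 3) F} (hf : f ∈ grading F 1) (n : ℕ)
    (a : MvPolynomial (Fin 3) F) (ha : a ∈ grading F (n • 1)) :
    univEval hf a = Away.mk _ hf n a ha := by
  apply HomogeneousLocalization.val_injective
  have h1 := IsHomogeneous.eval₂_smul (l := Localization.mk 1 ⟨f, 1, pow_one _⟩)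
    (φ := algebraMap (MvPolynomial (Fin 3) F) (Localization.Away f))
    (φ' := (algebraMap (Away (grading F) f) (Localization.Away f)).comp (univEval hf))
    (fun c ↦ ?_) (fun i ↦ ?_) ha
  · rw [RingHom.comp_apply, HomogeneousLocalization.algebraMap_apply] at h1
    rw [h1, Away.val_mk, ← Localization.mk_one_eq_algebraMap, Localization.mk_pow,
      Localization.mk_mul]
    congr 1
    · simp
    · ext; simp
  · rw [RingHom.comp_apply, univEval, coe_eval₂Hom, eval₂_C,
      HomogeneousLocalization.algebraMap_apply]
    change Localization.mk _ 1 = _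
    rw [Localization.mk_one_eq_algebraMap]
    rfl
  · rw [RingHom.comp_apply, univEval, coe_eval₂Hom, eval₂_X,
      HomogeneousLocalization.algebraMap_apply, Away.val_mk, ← Localization.mk_one_eq_algebraMap,
      Localization.mk_mul]
    congr 1
    · simp
    · ext; simp

lemma univEval_self {f : MvPolynomial (Fin 3) F} (hf : f ∈ grading F 1) : univEval hf f = 1 := by
  rw [univEval_eq_mk hf 1 f (by simpa using hf)]
  apply HomogeneousLocalization.val_injective
  rw [Away.val_mk, HomogeneousLocalization.val_one, ← Localization.mk_one, Localization.mk_eq_mk_iff,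
    Localization.r_iff_exists]
  exact ⟨1, by simp⟩

lemma univEval_surjective {f : MvPolynomial (Fin 3) F} (hf : f ∈ grading F 1) :
    Function.Surjective (univEval hf) := by
  intro x
  obtain ⟨n, a, ha, rfl⟩ := Away.mk_surjective _ hf x
  exact ⟨a, univEval_eq_mk hf n a ha⟩

lemma evalAway_univEval {f : MvPolynomial (Fin 3) F} (hf : f ∈ grading F 1)
    (hu : IsUnit (univEval hf f)) : evalAway (univEval hf) hu = RingHom.id _ := by
  refine (evalAway_unique hu hf fun n a ha ↦ ?_).symm
  rw [univEval_self, one_pow, one_mul, RingHom.id_apply, univEval_eq_mk hf n a ha]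

lemma awayι_eq_P2pt {f : MvPolynomial (Fin 3) F} (hf : f ∈ grading F 1) :
    Proj.awayι (grading F) f hf one_pos =
      P2pt (R := .of (Away (grading F) f)) (univEval hf) hf one_pos
        (by rw [univEval_self]; exact isUnit_one) := by
  rw [P2pt, evalAway_univEval]
  exact (Category.id_comp _).symm.trans (by rw [← Spec.map_id]; rfl)

/-- A morphism into D₊(f) is a ring homomorphism out of the degree-zero localisation. Composing it
with the universal coordinates gives coordinates normalised by f = 1. -/
lemma exists_eq_P2pt {R : CommRingCat.{u}} (g : Spec R ⟶ P2 F) {f : MvPolynomial (Fin 3) F}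
    (hf : f ∈ grading F 1) (hg : ∀ y, g y ∈ Proj.basicOpen (grading F) f) :
    ∃ (φ : MvPolynomial (Fin 3) F →+* R) (hu : IsUnit (φ f)), φ f = 1 ∧
      g = P2pt φ hf one_pos hu := by
  have hrange : Set.range g ⊆ Set.range (Proj.awayι (grading F) f hf one_pos) := by
    rintro _ ⟨y, rfl⟩
    have := hg y
    rwa [← Proj.opensRange_awayι _ f hf one_pos] at this
  obtain ⟨ψ, hψ⟩ := Spec.map_surjective (IsOpenImmersion.lift (Proj.awayι (grading F) f hf one_pos)
    g hrange)
  have h1 : g = Spec.map ψ ≫ Proj.awayι (grading F) f hf one_pos := by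
    rw [hψ, IsOpenImmersion.lift_fac]
  rw [awayι_eq_P2pt, SpecMap_P2pt] at h1
  exact ⟨_, _, by rw [RingHom.comp_apply, univEval_self, map_one], h1⟩

/-- Equal points pull D₊(f) back to the same open set, so f is a unit in both systems of
coordinates. Comparing the degree-zero fractions with denominator fⁿ then shows that the coordinates
are proportional. -/
lemma P2pt_inj {R : CommRingCat.{u}} {φ φ' : MvPolynomial (Fin 3) F →+* R}
    {f f' : MvPolynomial (Fin 3) F} {d d' : ℕ} {hf : f ∈ grading F d} {hd : 0 < d}
    {hu : IsUnit (φ f)} {hf' : f' ∈ grading F d'} {hd' : 0 < d'} {hu' : IsUnit (φ' f')}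
    (h : P2pt φ hf hd hu = P2pt φ' hf' hd' hu') :
    IsUnit (φ' f) ∧ ∀ n, ∀ a ∈ grading F (n • d), φ' f ^ n * φ a = φ f ^ n * φ' a := by
  have hu2 : IsUnit (φ' f) := by
    have h1 := P2pt_preimage_basicOpen φ hf hd hu hf hd
    rw [h, P2pt_preimage_basicOpen φ' hf' hd' hu' hf hd,
      basicOpen_eq_top_iff_isUnit.mpr hu] at h1
    exact basicOpen_eq_top_iff_isUnit.mp h1
  refine ⟨hu2, fun n a ha ↦ ?_⟩
  rw [P2pt_congr φ' hf' hd' hu' hf hd hu2, P2pt, P2pt, cancel_mono] at h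
  have h2 := congrArg CommRingCat.Hom.hom (Spec.map_injective h)
  have h3 : evalAway φ hu = evalAway φ' hu2 := h2
  rw [← evalAway_mk φ hu hf n a ha, ← evalAway_mk φ' hu2 hf n a ha, h3]
  ring

lemma P2pt_toSpec {R : CommRingCat.{u}} (φ : MvPolynomial (Fin 3) F →+* R)
    {f : MvPolynomial (Fin 3) F} {d : ℕ} (hf : f ∈ grading F d) (hd : 0 < d) (hu : IsUnit (φ f)) :
    P2pt φ hf hd hu ≫ P2.toSpec F = Spec.map (CommRingCat.ofHom (φ.comp C)) := by
  rw [P2pt, P2.toSpec, Category.assoc, Proj.awayι_toSpecZero_assoc, ← Spec.map_comp,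
    ← Spec.map_comp, ← CommRingCat.ofHom_comp, ← CommRingCat.ofHom_comp]
  congr 2
  ext c
  rw [RingHom.comp_apply, RingHom.comp_apply, evalAway_fromZeroRingHom]
  rfl

end Points

end LangerSurface
end

/-! ### Frames and the neighbourhoods of rational points. -/

noncomputable section
namespace LangerSurface

open MvPolynomial HomogeneousLocalization Scheme.IdealSheafData

attribute [local instance] MvPolynomial.gradedAlgebra

/-- A basis of `F³`, the columns of `M`, with its dual basis, the rows of `N`. -/
structure Frame (F : Type u) [Field F] where
  /-- The matrix of the basis. -/
  M : Matrix (Fin 3) (Fin 3) F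
  /-- The matrix of the dual basis. -/
  N : Matrix (Fin 3) (Fin 3) F
  mul_eq : M * N = 1

/-- The linear form with given coefficients. -/
def form {F : Type*} [CommSemiring F] (a : Fin 3 → F) : MvPolynomial (Fin 3) F :=
  ∑ i, C (a i) * X i

lemma form_mem_grading {F : Type u} [Field F] (a : Fin 3 → F) : form a ∈ grading F 1 :=
  IsHomogeneous.sum _ _ _ fun i _ ↦ (isHomogeneous_X _ i).C_mul _

lemma form_add {F : Type*} [CommSemiring F] (a b : Fin 3 → F) : form (a + b) = form a + form b := by
  simp [form, add_mul, Finset.sum_add_distrib]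

lemma form_smul {F : Type*} [CommSemiring F] (c : F) (a : Fin 3 → F) :
    form (c • a) = C c * form a := by
  simp [form, Finset.mul_sum, mul_assoc]

namespace Frame

variable {F : Type u} [Field F]

lemma mul_eq' (b : Frame F) : b.N * b.M = 1 := mul_eq_one_comm.mp b.mul_eq

/-- The first vector of the basis. -/
def pt (b : Frame F) : Fin 3 → F := fun i ↦ b.M i 0

/-- The linear forms of the dual basis. -/
def coord (b : Frame F) (j : Fin 3) : MvPolynomial (Fin 3) F := form (b.N j)

lemma coord_mem (b : Frame F) (j : Fin 3) : b.coord j ∈ grading F 1 := form_mem_grading _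

lemma sum_N_mul_M (b : Frame F) (i j : Fin 3) :
    ∑ l, b.N i l * b.M l j = if i = j then 1 else 0 := by
  have := congrFun (congrFun b.mul_eq' i) j
  rwa [Matrix.mul_apply, Matrix.one_apply] at this

lemma sum_M_mul_N (b : Frame F) (i j : Fin 3) :
    ∑ l, b.M i l * b.N l j = if i = j then 1 else 0 := by
  have := congrFun (congrFun b.mul_eq i) j
  rwa [Matrix.mul_apply, Matrix.one_apply] at this

lemma form_eq_sum (b : Frame F) (a : Fin 3 → F) :
    form a = ∑ j, C (∑ i, a i * b.M i j) * b.coord j := by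
  simp only [coord, form, map_sum, Finset.mul_sum, Finset.sum_mul, ← mul_assoc, ← map_mul]
  rw [Finset.sum_comm]
  refine Finset.sum_congr rfl fun l _ ↦ ?_
  rw [Finset.sum_comm]
  simp only [mul_assoc, ← Finset.sum_mul, ← map_sum, ← Finset.mul_sum, sum_M_mul_N]
  simp

lemma X_eq_sum (b : Frame F) (i : Fin 3) : X i = ∑ j, C (b.M i j) * b.coord j := by
  have := b.form_eq_sum (Pi.single i 1)
  simpa [form, Pi.single_apply] using this

lemma pt_ne_zero (b : Frame F) : b.pt ≠ 0 := by
  intro h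
  have := b.sum_N_mul_M 0 0
  simp [show ∀ l, b.M l 0 = 0 from fun l ↦ congrFun h l] at this

lemma exists_pt_eq {v : Fin 3 → F} (hv : v ≠ 0) : ∃ b : Frame F, b.pt = v := by
  have key : ∀ M : Matrix (Fin 3) (Fin 3) F, IsUnit M.det → (∀ i, M i 0 = v i) →
      ∃ b : Frame F, b.pt = v := fun M hM h ↦
    ⟨⟨M, M⁻¹, Matrix.mul_nonsing_inv _ hM⟩, funext h⟩
  obtain ⟨i, hi⟩ := Function.ne_iff.mp hv
  match i, hi with
  | 0, hi =>
    refine key !![v 0, 0, 0; v 1, 1, 0; v 2, 0, 1] ?_ (by intro i; fin_cases i <;> rfl)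
    simpa [Matrix.det_fin_three] using hi
  | 1, hi =>
    refine key !![v 0, 1, 0; v 1, 0, 0; v 2, 0, 1] ?_ (by intro i; fin_cases i <;> rfl)
    simpa [Matrix.det_fin_three] using hi
  | 2, hi =>
    refine key !![v 0, 1, 0; v 1, 0, 1; v 2, 0, 0] ?_ (by intro i; fin_cases i <;> rfl)
    simpa [Matrix.det_fin_three] using hi

/-- The frame with the last two vectors exchanged. -/
def swap (b : Frame F) : Frame F where
  M := b.M.submatrix id (Equiv.swap 1 2)
  N := b.N.submatrix (Equiv.swap 1 2) id
  mul_eq := by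
    rw [Matrix.submatrix_mul_equiv, b.mul_eq]; rfl

lemma swap_pt (b : Frame F) : b.swap.pt = b.pt := rfl
lemma swap_M_zero (b : Frame F) (i : Fin 3) : b.swap.M i 0 = b.M i 0 := rfl
lemma swap_M_one (b : Frame F) (i : Fin 3) : b.swap.M i 1 = b.M i 2 := rfl
lemma swap_M_two (b : Frame F) (i : Fin 3) : b.swap.M i 2 = b.M i 1 := rfl
lemma swap_swap (b : Frame F) : b.swap.swap = b := by
  cases b
  have h : (⇑(Equiv.swap (1 : Fin 3) 2) ∘ ⇑(Equiv.swap 1 2)) = id := by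
    funext i; simp
  simp [swap, Matrix.submatrix_submatrix, h]

/-- The evaluation at `b₀ + ξ b₁ + ζ b₂`. -/
def ev (b : Frame F) {R : Type*} [CommRing R] (i : F →+* R) (ξ ζ : R) :
    MvPolynomial (Fin 3) F →+* R :=
  eval₂Hom i fun l ↦ i (b.M l 0) + i (b.M l 1) * ξ + i (b.M l 2) * ζ

lemma ev_X (b : Frame F) {R : Type*} [CommRing R] (i : F →+* R) (ξ ζ : R) (l : Fin 3) :
    b.ev i ξ ζ (X l) = i (b.M l 0) + i (b.M l 1) * ξ + i (b.M l 2) * ζ := by simp [ev]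

lemma ev_C (b : Frame F) {R : Type*} [CommRing R] (i : F →+* R) (ξ ζ : R) (c : F) :
    b.ev i ξ ζ (C c) = i c := by simp [ev]

lemma ev_form (b : Frame F) {R : Type*} [CommRing R] (i : F →+* R) (ξ ζ : R) (a : Fin 3 → F) :
    b.ev i ξ ζ (form a) =
      i (∑ l, a l * b.M l 0) + i (∑ l, a l * b.M l 1) * ξ + i (∑ l, a l * b.M l 2) * ζ := by
  simp only [form, map_sum, map_mul, ev_X, ev_C, Finset.sum_mul, ← Finset.sum_add_distrib]
  exact Finset.sum_congr rfl fun l _ ↦ by ring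

lemma ev_coord_zero (b : Frame F) {R : Type*} [CommRing R] (i : F →+* R) (ξ ζ : R) :
    b.ev i ξ ζ (b.coord 0) = 1 := by
  rw [coord, ev_form, sum_N_mul_M, sum_N_mul_M, sum_N_mul_M]; simp

lemma ev_coord_one (b : Frame F) {R : Type*} [CommRing R] (i : F →+* R) (ξ ζ : R) :
    b.ev i ξ ζ (b.coord 1) = ξ := by
  rw [coord, ev_form, sum_N_mul_M, sum_N_mul_M, sum_N_mul_M]; simp

lemma ev_coord_two (b : Frame F) {R : Type*} [CommRing R] (i : F →+* R) (ξ ζ : R) :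
    b.ev i ξ ζ (b.coord 2) = ζ := by
  rw [coord, ev_form, sum_N_mul_M, sum_N_mul_M, sum_N_mul_M]; simp

lemma hom_ext (b : Frame F) {R : Type*} [CommRing R] {φ φ' : MvPolynomial (Fin 3) F →+* R}
    (hC : ∀ c, φ (C c) = φ' (C c)) (h : ∀ j, φ (b.coord j) = φ' (b.coord j)) : φ = φ' := by
  ext1
  · ext c; exact hC c
  · rename_i l
    rw [b.X_eq_sum]
    simp only [map_sum, map_mul, hC, h]

lemma eq_ev (b : Frame F) {R : Type*} [CommRing R] (φ : MvPolynomial (Fin 3) F →+* R)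
    (h : φ (b.coord 0) = 1) : φ = b.ev (φ.comp C) (φ (b.coord 1)) (φ (b.coord 2)) := by
  refine b.hom_ext (fun c ↦ by rw [ev_C]; rfl) fun j ↦ ?_
  match j with
  | 0 => rw [h, ev_coord_zero]
  | 1 => rw [ev_coord_one]
  | 2 => rw [ev_coord_two]

lemma comp_ev (b : Frame F) {R S : Type*} [CommRing R] [CommRing S] (i : F →+* R) (ξ ζ : R)
    (ψ : R →+* S) : ψ.comp (b.ev i ξ ζ) = b.ev (ψ.comp i) (ψ ξ) (ψ ζ) := by
  refine b.hom_ext (fun c ↦ by simp [ev_C]) fun j ↦ ?_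
  match j with
  | 0 => rw [RingHom.comp_apply, ev_coord_zero, ev_coord_zero, map_one]
  | 1 => rw [RingHom.comp_apply, ev_coord_one, ev_coord_one]
  | 2 => rw [RingHom.comp_apply, ev_coord_two, ev_coord_two]

/-- D₊ of the first coordinate is the affine plane with the other two coordinates divided by the
first. The inverse substitutes those two fractions. -/
lemma evalAway_coord_zero_bijective (b : Frame F)
    (h : IsUnit (b.ev (C : F →+* MvPolynomial (Fin 2) F) (X 0) (X 1) (b.coord 0))) :
    Function.Bijective (evalAway (b.ev (C : F →+* MvPolynomial (Fin 2) F) (X 0) (X 1)) h) := by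
  have hc := b.coord_mem 0
  let ρ := univEval hc
  let g : MvPolynomial (Fin 2) F →+* Away (grading F) (b.coord 0) :=
    eval₂Hom (ρ.comp C) ![ρ (b.coord 1), ρ (b.coord 2)]
  have he : ∀ a, evalAway (b.ev (C : F →+* MvPolynomial (Fin 2) F) (X 0) (X 1)) h (ρ a) =
      b.ev C (X 0) (X 1) a := by
    have : (evalAway (b.ev (C : F →+* MvPolynomial (Fin 2) F) (X 0) (X 1)) h).comp ρ =
        b.ev C (X 0) (X 1) := by
      refine ringHom_ext (fun c ↦ ?_) fun l ↦ ?_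
      · rw [RingHom.comp_apply]
        simp only [ρ, univEval, coe_eval₂Hom, eval₂_C]
        exact evalAway_fromZeroRingHom _ _ _
      · have h2 := evalAway_mk (b.ev (C : F →+* MvPolynomial (Fin 2) F) (X 0) (X 1)) h hc 1 (X l)
          (by simpa using isHomogeneous_X F l)
        rw [ev_coord_zero, one_pow, one_mul] at h2
        rw [RingHom.comp_apply, ← h2]
        simp [ρ, univEval]
    exact fun a ↦ DFunLike.congr_fun this a
  have hgρ : g.comp (b.ev (C : F →+* MvPolynomial (Fin 2) F) (X 0) (X 1)) = ρ := by
    rw [comp_ev, b.eq_ev ρ (univEval_self hc)]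
    have h3 : g.comp C = ρ.comp C := RingHom.ext fun c ↦ by simp only [g, RingHom.comp_apply, coe_eval₂Hom, eval₂_C]
    rw [h3]
    congr 1 <;> simp only [g, coe_eval₂Hom, eval₂_X] <;> rfl
  constructor
  · intro x y hxy
    obtain ⟨a, rfl⟩ := univEval_surjective hc x
    obtain ⟨a', rfl⟩ := univEval_surjective hc y
    change evalAway _ h (ρ a) = evalAway _ h (ρ a') at hxy
    rw [he, he] at hxy
    have h4 := DFunLike.congr_fun hgρ
    exact (h4 a).symm.trans ((congrArg g hxy).trans (h4 a'))
  · intro x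
    induction x using MvPolynomial.induction_on with
    | C a => exact ⟨ρ (C a), by rw [he, ev_C]⟩
    | add p q hp hq =>
      obtain ⟨x, rfl⟩ := hp
      obtain ⟨y, rfl⟩ := hq
      exact ⟨x + y, map_add _ _ _⟩
    | mul_X p i hp =>
      obtain ⟨x, rfl⟩ := hp
      match i with
      | 0 => exact ⟨x * ρ (b.coord 1), by rw [map_mul, he, ev_coord_one]⟩
      | 1 => exact ⟨x * ρ (b.coord 2), by rw [map_mul, he, ev_coord_two]⟩

section Denom

variable [Fintype F]

/-- The product of the linear forms that have the value one at the first basis vector. -/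
def denom (b : Frame F) : MvPolynomial (Fin 3) F :=
  ∏ p : F × F, form (b.N 0 + p.1 • b.N 1 + p.2 • b.N 2)

lemma denom_mem (b : Frame F) : b.denom ∈ grading F (Fintype.card (F × F)) := by
  have := IsHomogeneous.prod Finset.univ
    (fun p : F × F ↦ form (b.N 0 + p.1 • b.N 1 + p.2 • b.N 2)) (fun _ ↦ 1)
    fun p _ ↦ form_mem_grading _
  simpa [denom] using this

lemma card_pos : 0 < Fintype.card (F × F) := Fintype.card_pos

lemma ev_denom (b : Frame F) {R : Type*} [CommRing R] (i : F →+* R) (ξ ζ : R) :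
    b.ev i ξ ζ b.denom = ∏ p : F × F, (1 + i p.1 * ξ + i p.2 * ζ) := by
  rw [denom, map_prod]
  refine Finset.prod_congr rfl fun p _ ↦ ?_
  rw [form_add, form_add, form_smul, form_smul, map_add, map_add, map_mul, map_mul, ev_C, ev_C]
  change b.ev i ξ ζ (b.coord 0) + _ * b.ev i ξ ζ (b.coord 1) + _ * b.ev i ξ ζ (b.coord 2) = _
  rw [ev_coord_zero, ev_coord_one, ev_coord_two]

/-- The forms with value one at b₀ are exactly N₀ + p₁N₁ + p₂N₂. The condition thus depends on b₀
alone, not on the rest of the frame. -/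
lemma isUnit_denom_iff (b : Frame F) {R : Type*} [CommRing R] (φ : MvPolynomial (Fin 3) F →+* R) :
    IsUnit (φ b.denom) ↔ ∀ a : Fin 3 → F, ∑ l, a l * b.pt l = 1 → IsUnit (φ (form a)) := by
  rw [denom, map_prod, IsUnit.prod_univ_iff]
  constructor
  · intro h a ha
    have h1 := b.form_eq_sum a
    rw [Fin.sum_univ_three, show ∑ i, a i * b.M i 0 = 1 from ha] at h1
    have := h (∑ i, a i * b.M i 1, ∑ i, a i * b.M i 2)
    rw [form_add, form_add, form_smul, form_smul] at this
    rw [h1]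
    simpa [coord] using this
  · intro h p
    refine h _ ?_
    have h0 := b.sum_N_mul_M 0 0
    have h1 := b.sum_N_mul_M 1 0
    have h2 := b.sum_N_mul_M 2 0
    simp only [Pi.add_apply, Pi.smul_apply, smul_eq_mul, add_mul, Finset.sum_add_distrib,
      mul_assoc, ← Finset.mul_sum, pt]
    rw [h0, h1, h2]
    simp

lemma swap_isUnit_denom_iff (b : Frame F) {R : Type*} [CommRing R]
    (φ : MvPolynomial (Fin 3) F →+* R) : IsUnit (φ b.swap.denom) ↔ IsUnit (φ b.denom) := by
  rw [isUnit_denom_iff, isUnit_denom_iff, swap_pt]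

/-- The point `b₀ + ξ b₁ + ζ b₂` of the plane. -/
def map (b : Frame F) {R : CommRingCat.{u}} (i : F →+* R) (ξ ζ : R)
    (h : IsUnit (b.ev i ξ ζ b.denom)) : Spec R ⟶ P2 F :=
  P2pt (b.ev i ξ ζ) b.denom_mem card_pos h

lemma SpecMap_map (b : Frame F) {R S : CommRingCat.{u}} (i : F →+* R) (ξ ζ : R)
    (h : IsUnit (b.ev i ξ ζ b.denom)) (ψ : R ⟶ S) :
    Spec.map ψ ≫ b.map i ξ ζ h = b.map (ψ.hom.comp i) (ψ.hom ξ) (ψ.hom ζ)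
      (by rw [← comp_ev]; exact h.map ψ.hom) := by
  rw [map, SpecMap_P2pt]
  exact P2pt_eq_of_eq (comp_ev _ _ _ _ _) _ _ _ _

/-- The coordinate ring of the neighbourhood of the first basis vector. -/
abbrev NbhdRing (F : Type u) [Field F] [Fintype F] : Type u :=
  Localization.Away (∏ p : F × F, (1 + C p.1 * X 0 + C p.2 * X 1) : MvPolynomial (Fin 2) F)

lemma isUnit_ev_nbhd (b : Frame F) : IsUnit (b.ev (algebraMap F (NbhdRing F))
    (algebraMap (MvPolynomial (Fin 2) F) _ (X 0)) (algebraMap (MvPolynomial (Fin 2) F) _ (X 1))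
      b.denom) := by
  rw [ev_denom]
  have h := IsLocalization.Away.algebraMap_isUnit (S := NbhdRing F)
    (∏ p : F × F, (1 + C p.1 * X 0 + C p.2 * X 1) : MvPolynomial (Fin 2) F)
  rw [map_prod] at h
  refine (congrArg IsUnit (Finset.prod_congr rfl fun p _ ↦ ?_)).mp h
  simp only [IsScalarTower.algebraMap_apply F (MvPolynomial (Fin 2) F) (NbhdRing F),
    MvPolynomial.algebraMap_eq, map_add, map_one, map_mul]

/-- The neighbourhood of the first basis vector on which it is the only rational point. -/
def nbhd (b : Frame F) : Spec (.of (NbhdRing F)) ⟶ P2 F :=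
  b.map (R := .of (NbhdRing F)) (algebraMap F (NbhdRing F))
    (algebraMap (MvPolynomial (Fin 2) F) _ (X 0)) (algebraMap (MvPolynomial (Fin 2) F) _ (X 1))
    b.isUnit_ev_nbhd

/-- A principal localisation of the affine plane, followed by the identification of that plane with
D₊ of the first coordinate. -/
instance isOpenImmersion_nbhd (b : Frame F) : IsOpenImmersion b.nbhd := by
  have h0 : IsUnit (b.ev (C : F →+* MvPolynomial (Fin 2) F) (X 0) (X 1) (b.coord 0)) := by
    rw [ev_coord_zero]; exact isUnit_one
  let loc : CommRingCat.of (MvPolynomial (Fin 2) F) ⟶ CommRingCat.of (NbhdRing F) :=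
    CommRingCat.ofHom (algebraMap _ _)
  have h1 : b.nbhd = Spec.map loc ≫ P2pt (R := .of (MvPolynomial (Fin 2) F))
      (b.ev C (X 0) (X 1)) (b.coord_mem 0) one_pos h0 := by
    rw [SpecMap_P2pt, nbhd, map]
    have h2 : loc.hom.comp (b.ev (C : F →+* MvPolynomial (Fin 2) F) (X 0) (X 1)) =
        b.ev (algebraMap F (NbhdRing F)) (algebraMap (MvPolynomial (Fin 2) F) _ (X 0))
          (algebraMap (MvPolynomial (Fin 2) F) _ (X 1)) := comp_ev _ _ _ _ _
    have h5 : IsUnit ((loc.hom.comp (b.ev (C : F →+* MvPolynomial (Fin 2) F) (X 0) (X 1)))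
        b.denom) := by rw [h2]; exact b.isUnit_ev_nbhd
    rw [P2pt_congr _ (b.coord_mem 0) one_pos (h0.map loc.hom) b.denom_mem card_pos h5]
    exact P2pt_eq_of_eq h2.symm _ _ _ _
  have h3 : IsOpenImmersion (Spec.map loc) :=
    IsOpenImmersion.of_isLocalization (S := NbhdRing F)
      (∏ p : F × F, (1 + C p.1 * X 0 + C p.2 * X 1) : MvPolynomial (Fin 2) F)
  have h4 : IsIso (CommRingCat.ofHom (evalAway
      (b.ev (C : F →+* MvPolynomial (Fin 2) F) (X 0) (X 1)) h0)) :=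
    (ConcreteCategory.isIso_iff_bijective _).mpr (b.evalAway_coord_zero_bijective h0)
  rw [h1, P2pt]
  infer_instance

/-- The map out of the coordinate ring of the neighbourhood. -/
def nbhdLift (b : Frame F) {R : Type*} [CommRing R] (i : F →+* R) (ξ ζ : R)
    (h : IsUnit (b.ev i ξ ζ b.denom)) : NbhdRing F →+* R :=
  IsLocalization.Away.lift
    (∏ p : F × F, (1 + C p.1 * X 0 + C p.2 * X 1) : MvPolynomial (Fin 2) F)
    (g := eval₂Hom i ![ξ, ζ]) (by
      rw [map_prod]; rw [ev_denom] at h; simpa using h)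

lemma nbhdLift_X_zero (b : Frame F) {R : Type*} [CommRing R] (i : F →+* R) (ξ ζ : R)
    (h : IsUnit (b.ev i ξ ζ b.denom)) :
    b.nbhdLift i ξ ζ h (algebraMap (MvPolynomial (Fin 2) F) _ (X 0)) = ξ := by
  rw [nbhdLift, IsLocalization.Away.lift_eq]; simp

lemma nbhdLift_X_one (b : Frame F) {R : Type*} [CommRing R] (i : F →+* R) (ξ ζ : R)
    (h : IsUnit (b.ev i ξ ζ b.denom)) :
    b.nbhdLift i ξ ζ h (algebraMap (MvPolynomial (Fin 2) F) _ (X 1)) = ζ := by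
  rw [nbhdLift, IsLocalization.Away.lift_eq]; simp

lemma nbhdLift_comp_algebraMap (b : Frame F) {R : Type*} [CommRing R] (i : F →+* R) (ξ ζ : R)
    (h : IsUnit (b.ev i ξ ζ b.denom)) :
    (b.nbhdLift i ξ ζ h).comp (algebraMap F (NbhdRing F)) = i := by
  ext c
  rw [RingHom.comp_apply, IsScalarTower.algebraMap_apply F (MvPolynomial (Fin 2) F) (NbhdRing F),
    nbhdLift, IsLocalization.Away.lift_eq]
  simp [MvPolynomial.algebraMap_eq]

lemma map_eq_nbhd (b : Frame F) {R : CommRingCat.{u}} (i : F →+* R) (ξ ζ : R)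
    (h : IsUnit (b.ev i ξ ζ b.denom)) :
    b.map i ξ ζ h = Spec.map (CommRingCat.ofHom (b.nbhdLift i ξ ζ h)) ≫ b.nbhd := by
  rw [nbhd, SpecMap_map]
  simp only [CommRingCat.hom_ofHom, nbhdLift_comp_algebraMap, nbhdLift_X_zero, nbhdLift_X_one]

/-- The ideal of the first basis vector in its neighbourhood is prime. -/
lemma isPrime_span_nbhd :
    (Ideal.span {algebraMap (MvPolynomial (Fin 2) F) (NbhdRing F) (X 0),
      algebraMap (MvPolynomial (Fin 2) F) (NbhdRing F) (X 1)}).IsPrime := by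
  let g : NbhdRing F →+* F := IsLocalization.Away.lift
    (∏ p : F × F, (1 + C p.1 * X 0 + C p.2 * X 1) : MvPolynomial (Fin 2) F)
    (g := eval₂Hom (RingHom.id F) 0) (by rw [map_prod]; simp)
  have hg : ∀ p, g (algebraMap _ _ p) = eval₂Hom (RingHom.id F) 0 p := fun p ↦
    IsLocalization.Away.lift_eq _ _ _
  suffices h : Ideal.span {algebraMap (MvPolynomial (Fin 2) F) (NbhdRing F) (X 0),
      algebraMap (MvPolynomial (Fin 2) F) (NbhdRing F) (X 1)} = RingHom.ker g by
    rw [h]; exact RingHom.ker_isPrime g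
  refine le_antisymm ?_ fun x hx ↦ ?_
  · rw [Ideal.span_le]
    rintro _ (rfl | rfl) <;> simp [RingHom.mem_ker, hg]
  · obtain ⟨n, p, hp⟩ := IsLocalization.Away.surj
      (∏ p : F × F, (1 + C p.1 * X 0 + C p.2 * X 1) : MvPolynomial (Fin 2) F) x
    have hu := (IsLocalization.Away.algebraMap_isUnit (S := NbhdRing F)
      (∏ p : F × F, (1 + C p.1 * X 0 + C p.2 * X 1) : MvPolynomial (Fin 2) F)).pow n
    rw [← Ideal.mul_unit_mem_iff_mem _ hu, hp]
    have h0 : eval₂Hom (RingHom.id F) 0 p = 0 := by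
      rw [← hg, ← hp, map_mul, RingHom.mem_ker.mp hx, zero_mul]
    have h1 : ∀ p : MvPolynomial (Fin 2) F,
        p - C (eval₂Hom (RingHom.id F) 0 p) ∈ Ideal.span {X 0, X 1} := by
      intro p
      induction p using MvPolynomial.induction_on with
      | C a => simp
      | add p q hp hq => rw [map_add, map_add, add_sub_add_comm]; exact Ideal.add_mem _ hp hq
      | mul_X p i hp =>
        simp only [map_mul, coe_eval₂Hom, eval₂_X, Pi.zero_apply, map_zero, mul_zero, sub_zero]
        refine Ideal.mul_mem_left _ _ (Ideal.subset_span ?_)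
        match i with
        | 0 => simp
        | 1 => simp
    have h2 := h1 p
    rw [h0, map_zero, sub_zero] at h2
    have h3 := Ideal.mem_map_of_mem (algebraMap _ (NbhdRing F)) h2
    rwa [Ideal.map_span, Set.image_pair] at h3

end Denom

end Frame

section RatPoints

variable {F : Type u} [Field F]

lemma P2pt_mem_zeros {R : CommRingCat.{u}} (φ : MvPolynomial (Fin 3) F →+* R)
    {f : MvPolynomial (Fin 3) F} {d : ℕ} (hf : f ∈ grading F d) (hd : 0 < d) (hu : IsUnit (φ f))
    {s : Set (MvPolynomial (Fin 3) F)} (hs : ∀ g ∈ s, g ∈ grading F 1) (y : Spec R) :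
    P2pt φ hf hd hu y ∈ (zeros F s : Set (P2 F)) ↔ ∀ g ∈ s, φ g ∈ y.asIdeal := by
  refine (ProjectiveSpectrum.mem_zeroLocus (𝒜 := grading F) _ _).trans ?_
  refine forall₂_congr fun g hg ↦ ?_
  have := P2pt_mem_basicOpen φ hf hd hu (hs g hg) one_pos y
  rw [Proj.mem_basicOpen] at this
  exact not_iff_not.mp this

lemma P2pt_mem_ratPoint {R : CommRingCat.{u}} (φ : MvPolynomial (Fin 3) F →+* R)
    {f : MvPolynomial (Fin 3) F} {d : ℕ} (hf : f ∈ grading F d) (hd : 0 < d) (hu : IsUnit (φ f))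
    (v : Fin 3 → F) (y : Spec R) :
    P2pt φ hf hd hu y ∈ (ratPoint v : Set (P2 F)) ↔
      ∀ i j, φ (C (v i)) * φ (X j) - φ (C (v j)) * φ (X i) ∈ y.asIdeal := by
  rw [ratPoint, P2pt_mem_zeros φ hf hd hu]
  · simp only [Set.forall_mem_range, map_sub, map_mul, Prod.forall]
  · rintro _ ⟨ij, rfl⟩
    exact Submodule.sub_mem _ ((isHomogeneous_X _ _).C_mul _) ((isHomogeneous_X _ _).C_mul _)

lemma P2pt_mem_ratLine {R : CommRingCat.{u}} (φ : MvPolynomial (Fin 3) F →+* R)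
    {f : MvPolynomial (Fin 3) F} {d : ℕ} (hf : f ∈ grading F d) (hd : 0 < d) (hu : IsUnit (φ f))
    (a : Fin 3 → F) (y : Spec R) :
    P2pt φ hf hd hu y ∈ (ratLine a : Set (P2 F)) ↔ φ (form a) ∈ y.asIdeal := by
  rw [ratLine, P2pt_mem_zeros φ hf hd hu]
  · simp [form]
  · rintro _ rfl
    exact form_mem_grading a

lemma coe_ratPoints [Finite F] :
    (ratPoints F : Set (P2 F)) = ⋃ v : {v : Fin 3 → F // v ≠ 0}, (ratPoint v.1 : Set (P2 F)) := by
  cases nonempty_fintype {v : Fin 3 → F // v ≠ 0}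
  rw [ratPoints, ← Finset.sup_univ_eq_iSup, Closeds.coe_finset_sup, Finset.sup_univ_eq_iSup]
  rfl

end RatPoints

end LangerSurface
end

/-! ### Rational points over the field with two elements. -/

noncomputable section
namespace LangerSurface

open MvPolynomial HomogeneousLocalization Scheme.IdealSheafData

attribute [local instance] MvPolynomial.gradedAlgebra

lemma eq_zero_or_one_of_card {F : Type*} [Field F] (hF : Nat.card F = 2) (c : F) :
    c = 0 ∨ c = 1 := by
  by_contra! h
  have hfin : Finite F := Nat.finite_of_card_ne_zero (by omega)
  cases nonempty_fintype F
  classical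
  have h1 : ({0, 1, c} : Finset F).card = 3 := by
    rw [Finset.card_insert_of_notMem, Finset.card_insert_of_notMem, Finset.card_singleton]
    · simpa using h.2.symm
    · simpa using h.1.symm
  have h2 := Finset.card_le_univ ({0, 1, c} : Finset F)
  rw [h1, ← Nat.card_eq_fintype_card, hF] at h2
  omega

/-- A ring carries at most one F-algebra structure, so compatibility of morphisms with the structure
over F is automatic. -/
lemma ringHom_eq_of_card {F : Type*} [Field F] (hF : Nat.card F = 2) {R : Type*} [CommRing R]
    (i i' : F →+* R) : i = i' := by
  ext c
  rcases eq_zero_or_one_of_card hF c with rfl | rfl <;> simp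

section

variable {F : Type u} [Field F]

lemma mem_pointIdeal_of_P2pt_mem {R : CommRingCat.{u}} {φ : MvPolynomial (Fin 3) F →+* R}
    {f : MvPolynomial (Fin 3) F} {d : ℕ} {hf : f ∈ grading F d} {hd : 0 < d} {hu : IsUnit (φ f)}
    {v : Fin 3 → F} {y : Spec R} (h : P2pt φ hf hd hu y ∈ (ratPoint v : Set (P2 F)))
    {g : MvPolynomial (Fin 3) F} (hg : g ∈ Poly.pointIdeal v) : φ g ∈ y.asIdeal := by
  rw [P2pt_mem_ratPoint] at h
  refine (Ideal.span_le (I := y.asIdeal.comap φ)).mpr ?_ hg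
  rintro _ ⟨⟨i, j⟩, rfl⟩
  simpa using h i j

lemma exists_sum_mul_eq_one {v : Fin 3 → F} (hv : v ≠ 0) : ∃ c : Fin 3 → F, ∑ i, c i * v i = 1 := by
  obtain ⟨i, hi⟩ := Function.ne_iff.mp hv
  refine ⟨Pi.single i (v i)⁻¹, ?_⟩
  rw [Finset.sum_eq_single i]
  · simpa using inv_mul_cancel₀ hi
  · intro j _ hj; simp [hj]
  · simp

lemma iSup_basicOpen_X : ⨆ i, Proj.basicOpen (grading F) (X i) = ⊤ := by
  refine Proj.iSup_basicOpen_eq_top' (grading F) _ (fun i ↦ ⟨1, isHomogeneous_X F i⟩) ?_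
  rw [eq_top_iff]
  intro p _
  induction p using MvPolynomial.induction_on with
  | C a => exact Subalgebra.algebraMap_mem _ (⟨C a, isHomogeneous_C _ a⟩ : grading F 0)
  | add p q hp hq => exact add_mem (hp trivial) (hq trivial)
  | mul_X p i hp => exact mul_mem (hp trivial) (Algebra.subset_adjoin ⟨i, rfl⟩)

lemma Frame.swap_ev (b : Frame F) {R : Type*} [CommRing R] (i : F →+* R) (ξ ζ : R) :
    b.swap.ev i ζ ξ = b.ev i ξ ζ := by
  refine ringHom_ext (fun c ↦ by rw [ev_C, ev_C]) fun l ↦ ?_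
  rw [ev_X, ev_X, swap_M_zero, swap_M_one, swap_M_two]
  ring

variable [Fintype F]

/-- On the neighbourhood, every form with value one at b₀ is a unit, so it cannot vanish at another
rational point v that is met there. Hence the forms N₁ and N₂ vanish at v, and v is a multiple of
b₀; over F the only nonzero multiple is b₀ itself. -/
lemma Frame.map_mem_ratPoint (hF : Nat.card F = 2) (b : Frame F) {R : CommRingCat.{u}}
    (i : F →+* R) (ξ ζ : R) (h : IsUnit (b.ev i ξ ζ b.denom)) {v : Fin 3 → F} (hv : v ≠ 0)
    (y : Spec R) : b.map i ξ ζ h y ∈ (ratPoint v : Set (P2 F)) ↔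
      v = b.pt ∧ ξ ∈ y.asIdeal ∧ ζ ∈ y.asIdeal := by
  constructor
  · intro hy
    obtain ⟨c, hc⟩ := exists_sum_mul_eq_one hv
    have h1 : ∀ a : Fin 3 → F, ∑ l, a l * v l = 0 → b.ev i ξ ζ (form a) ∈ y.asIdeal := fun a ha ↦
      mem_pointIdeal_of_P2pt_mem hy (Poly.form_mem_pointIdeal ha hc)
    have h2 : ∀ a : Fin 3 → F, ∑ l, a l * v l = 0 → ∑ l, a l * b.pt l ≠ 1 := fun a ha ha1 ↦
      y.2.ne_top (Ideal.eq_top_of_isUnit_mem _ (h1 a ha) ((b.isUnit_denom_iff _).mp h a ha1))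
    have hNv : ∀ j, j ≠ 0 → ∑ l, b.N j l * v l = 0 := by
      intro j hj
      by_contra hne
      have hne1 : ∑ l, b.N j l * v l = 1 := (eq_zero_or_one_of_card hF _).resolve_left hne
      -- This form vanishes at v because N_j has value 1 there, and it still has value 1 at b₀
      -- because N_j vanishes at b₀.
      refine h2 (b.N 0 - (∑ l, b.N 0 l * v l) • b.N j) ?_ ?_
      · simp only [Pi.sub_apply, Pi.smul_apply, smul_eq_mul, sub_mul, Finset.sum_sub_distrib,
          mul_assoc, ← Finset.mul_sum, hne1]
        ring
      · have h3 : ∑ l, b.N 0 l * b.pt l = 1 := b.sum_N_mul_M 0 0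
        have h4 : ∑ l, b.N j l * b.pt l = 0 := by
          have := b.sum_N_mul_M j 0; rwa [if_neg hj] at this
        simp only [Pi.sub_apply, Pi.smul_apply, smul_eq_mul, sub_mul, Finset.sum_sub_distrib,
          mul_assoc, ← Finset.mul_sum, h3, h4]
        ring
    have hvb : v = b.pt := by
      have h5 : ∀ i, v i = ∑ j, b.M i j * ∑ l, b.N j l * v l := by
        intro i
        have h6 : (b.M * b.N).mulVec v i = v i := by rw [b.mul_eq, Matrix.one_mulVec]
        rw [← h6, ← Matrix.mulVec_mulVec]
        rfl
      have h7 : ∀ i, v i = b.M i 0 * ∑ l, b.N 0 l * v l := by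
        intro i
        conv_lhs => rw [h5 i]
        rw [Fin.sum_univ_three, hNv 1 (by decide), hNv 2 (by decide)]; ring
      rcases eq_zero_or_one_of_card hF (∑ l, b.N 0 l * v l) with h8 | h8
      · exact absurd (_root_.funext fun i ↦ by rw [h7 i, h8]; simp) hv
      · exact _root_.funext fun i ↦ by rw [h7 i, h8, mul_one]; rfl
    refine ⟨hvb, ?_, ?_⟩
    · have := h1 (b.N 1) (hNv 1 (by decide))
      rwa [← b.ev_coord_one i ξ ζ]
    · have := h1 (b.N 2) (hNv 2 (by decide))
      rwa [← b.ev_coord_two i ξ ζ]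
  · rintro ⟨rfl, h1, h2⟩
    rw [Frame.map, P2pt_mem_ratPoint]
    intro l m
    rw [b.ev_C, b.ev_C, b.ev_X, b.ev_X]
    have : i (b.pt l) * (i (b.M m 0) + i (b.M m 1) * ξ + i (b.M m 2) * ζ) -
        i (b.pt m) * (i (b.M l 0) + i (b.M l 1) * ξ + i (b.M l 2) * ζ) =
        (i (b.pt l) * i (b.M m 1) - i (b.pt m) * i (b.M l 1)) * ξ +
        (i (b.pt l) * i (b.M m 2) - i (b.pt m) * i (b.M l 2)) * ζ := by
      simp only [Frame.pt]; ring
    rw [this]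
    exact Ideal.add_mem _ (Ideal.mul_mem_left _ _ h1) (Ideal.mul_mem_left _ _ h2)

lemma Frame.map_mem_ratPoints (hF : Nat.card F = 2) (b : Frame F) {R : CommRingCat.{u}}
    (i : F →+* R) (ξ ζ : R) (h : IsUnit (b.ev i ξ ζ b.denom)) (y : Spec R) :
    b.map i ξ ζ h y ∈ (ratPoints F : Set (P2 F)) ↔ ξ ∈ y.asIdeal ∧ ζ ∈ y.asIdeal := by
  rw [coe_ratPoints, Set.mem_iUnion]
  constructor
  · rintro ⟨v, hv⟩
    exact ((b.map_mem_ratPoint hF i ξ ζ h v.2 y).mp hv).2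
  · intro hy
    exact ⟨⟨b.pt, b.pt_ne_zero⟩, (b.map_mem_ratPoint hF i ξ ζ h b.pt_ne_zero y).mpr ⟨rfl, hy⟩⟩

/-- On the universal neighbourhood the ideal of the rational points is radical with zero locus ξ = ζ
= 0, and (ξ, ζ) is prime there. Every other point with such coordinates factors through this
neighbourhood. -/
lemma Frame.pb_map (hF : Nat.card F = 2) (b : Frame F) {R : CommRingCat.{u}} (i : F →+* R)
    (ξ ζ : R) (h : IsUnit (b.ev i ξ ζ b.denom)) :
    pb (vanishingIdeal (ratPoints F)) (b.map i ξ ζ h) = Ideal.span {ξ, ζ} := by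
  have h1 : pb (vanishingIdeal (ratPoints F)) b.nbhd =
      Ideal.span {algebraMap (MvPolynomial (Fin 2) F) (Frame.NbhdRing F) (X 0),
        algebraMap (MvPolynomial (Fin 2) F) (Frame.NbhdRing F) (X 1)} := by
    rw [pb_vanishingIdeal]
    have hp := Frame.isPrime_span_nbhd (F := F)
    rw [← hp.radical, ← PrimeSpectrum.vanishingIdeal_zeroLocus_eq_radical,
      PrimeSpectrum.zeroLocus_span]
    congr 1
    ext y
    refine (b.map_mem_ratPoints hF _ _ _ _ y).trans ?_
    rw [PrimeSpectrum.mem_zeroLocus, Set.pair_subset_iff]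
    rfl
  rw [b.map_eq_nbhd, pb_comp, h1, Ideal.map_span, Set.image_pair, CommRingCat.hom_ofHom,
    b.nbhdLift_X_zero, b.nbhdLift_X_one]

/-- The F-linear forms vanishing at x form a proper subspace W, so some nonzero functional kills W.
That functional is evaluation at a rational vector v, and every form vanishing at x vanishes at v. A
frame that starts with v therefore has x in its neighbourhood. -/
lemma Frame.exists_mem_basicOpen (x : P2 F) :
    ∃ b : Frame F, x ∈ Proj.basicOpen (grading F) b.denom := by
  let W : Submodule F (Fin 3 → F) :=
    { carrier := {a | form a ∈ x.asHomogeneousIdeal}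
      add_mem' := fun {a c} ha hc ↦ by
        change form (a + c) ∈ x.asHomogeneousIdeal.toIdeal
        rw [form_add]; exact x.asHomogeneousIdeal.toIdeal.add_mem ha hc
      zero_mem' := by
        change form 0 ∈ x.asHomogeneousIdeal
        simp [form]
      smul_mem' := fun c a ha ↦ by
        change form (c • a) ∈ x.asHomogeneousIdeal.toIdeal
        rw [form_smul]; exact Ideal.mul_mem_left _ _ ha }
  have hW : W < ⊤ := by
    rw [lt_top_iff_ne_top]
    intro h
    have hx : x ∈ ⨆ i, Proj.basicOpen (grading F) (X i) := by rw [iSup_basicOpen_X]; trivial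
    obtain ⟨i, hi⟩ := Opens.mem_iSup.mp hx
    rw [Proj.mem_basicOpen] at hi
    apply hi
    have : Pi.single i 1 ∈ W := by rw [h]; trivial
    have h2 : form (Pi.single i (1 : F)) ∈ x.asHomogeneousIdeal := this
    simpa [form, Pi.single_apply] using h2
  obtain ⟨f, hf, hWf⟩ := Submodule.exists_le_ker_of_lt_top W hW
  have hfa : ∀ a, f a = ∑ i, a i * f (Pi.single i 1) := by
    intro a
    conv_lhs => rw [← Finset.univ_sum_single a, map_sum]
    refine Finset.sum_congr rfl fun i _ ↦ ?_
    rw [← smul_eq_mul, ← map_smul]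
    congr 1
    ext j
    simp [Pi.single_apply]
  have hv : (fun i ↦ f (Pi.single i 1)) ≠ 0 := by
    intro h
    apply hf
    ext a
    rw [LinearMap.comp_apply, hfa]
    simp [fun i ↦ congrFun h i]
  obtain ⟨b, hb⟩ := Frame.exists_pt_eq hv
  refine ⟨b, ?_⟩
  rw [Proj.mem_basicOpen]
  intro hmem
  have hmem' : b.denom ∈ x.asHomogeneousIdeal.toIdeal := hmem
  rw [Frame.denom, Ideal.IsPrime.prod_mem_iff (hp := x.isPrime)] at hmem'
  obtain ⟨p, -, hp⟩ := hmem'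
  have h1 : f (b.N 0 + p.1 • b.N 1 + p.2 • b.N 2) = 0 := hWf hp
  rw [hfa] at h1
  have h2 : ∀ i, f (Pi.single i 1) = b.M i 0 := fun i ↦ (congrFun hb i).symm
  have h3 := b.sum_N_mul_M 0 0
  have h4 := b.sum_N_mul_M 1 0
  have h5 := b.sum_N_mul_M 2 0
  simp only [h2, Pi.add_apply, Pi.smul_apply, smul_eq_mul, add_mul, Finset.sum_add_distrib,
      mul_assoc, ← Finset.mul_sum] at h1
  rw [h3, h4, h5] at h1
  simp at h1

lemma Frame.exists_eq_map (b : Frame F) {R : CommRingCat.{u}} (g : Spec R ⟶ P2 F)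
    (hg : ∀ y, g y ∈ Proj.basicOpen (grading F) b.denom) :
    ∃ (i : F →+* R) (ξ ζ : R) (h : IsUnit (b.ev i ξ ζ b.denom)), g = b.map i ξ ζ h := by
  have hdvd : b.coord 0 ∣ b.denom := by
    have := Finset.dvd_prod_of_mem (fun p : F × F ↦ form (b.N 0 + p.1 • b.N 1 + p.2 • b.N 2))
      (Finset.mem_univ ((0, 0) : F × F))
    simp only [zero_smul, add_zero] at this
    exact this
  obtain ⟨φ, hu, h1, rfl⟩ := exists_eq_P2pt g (b.coord_mem 0)
    fun y ↦ Proj.basicOpen_mono _ _ _ hdvd (hg y)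
  have hφ := b.eq_ev φ h1
  have hd : IsUnit (φ b.denom) := by
    rw [← basicOpen_eq_top_iff_isUnit, ← P2pt_preimage_basicOpen φ (b.coord_mem 0) one_pos hu
      b.denom_mem card_pos]
    exact top_le_iff.mp fun y _ ↦ hg y
  have hd' := hd
  rw [hφ] at hd'
  refine ⟨_, _, _, hd', ?_⟩
  rw [P2pt_congr φ (b.coord_mem 0) one_pos hu b.denom_mem card_pos hd]
  exact P2pt_eq_of_eq hφ _ _ _ _

lemma Frame.map_mem_basicOpen (b : Frame F) {R : CommRingCat.{u}} (i : F →+* R) (ξ ζ : R)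
    (h : IsUnit (b.ev i ξ ζ b.denom)) (y : Spec R) :
    b.map i ξ ζ h y ∈ Proj.basicOpen (grading F) b.denom := by
  rw [Frame.map, P2pt_mem_basicOpen _ _ _ _ b.denom_mem card_pos]
  exact fun hy ↦ y.2.ne_top (Ideal.eq_top_of_isUnit_mem _ hy h)

/-- The coordinates of `b` are normalised by `coord 0` = 1, so the factor of proportionality is the
value of this form in the other coordinates. -/
lemma Frame.eval_of_map_eq (b b' : Frame F) {R : CommRingCat.{u}} {i i' : F →+* R} {ξ ζ ξ' ζ' : R}
    {h : IsUnit (b.ev i ξ ζ b.denom)} {h' : IsUnit (b'.ev i' ξ' ζ' b'.denom)}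
    (heq : b.map i ξ ζ h = b'.map i' ξ' ζ' h') :
    IsUnit (b'.ev i' ξ' ζ' (b.coord 0)) ∧ ∀ a ∈ grading F 1,
      b'.ev i' ξ' ζ' a = b'.ev i' ξ' ζ' (b.coord 0) * b.ev i ξ ζ a := by
  have hu : IsUnit (b.ev i ξ ζ (b.coord 0)) := by rw [ev_coord_zero]; exact isUnit_one
  rw [Frame.map, P2pt_congr _ b.denom_mem card_pos h (b.coord_mem 0) one_pos hu] at heq
  obtain ⟨h1, h2⟩ := P2pt_inj heq
  refine ⟨h1, fun a ha ↦ ?_⟩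
  have := h2 1 a (by simpa using ha)
  rw [ev_coord_zero] at this
  simpa using this.symm

lemma Frame.map_inj (b : Frame F) {R : CommRingCat.{u}} {i i' : F →+* R} {ξ ζ ξ' ζ' : R}
    {h : IsUnit (b.ev i ξ ζ b.denom)} {h' : IsUnit (b.ev i' ξ' ζ' b.denom)}
    (heq : b.map i ξ ζ h = b.map i' ξ' ζ' h') : ξ = ξ' ∧ ζ = ζ' := by
  obtain ⟨-, h2⟩ := b.eval_of_map_eq b heq
  have h3 := h2 _ (b.coord_mem 1)
  have h4 := h2 _ (b.coord_mem 2)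
  rw [ev_coord_zero, ev_coord_one, ev_coord_one, one_mul] at h3
  rw [ev_coord_zero, ev_coord_two, ev_coord_two, one_mul] at h4
  exact ⟨h3.symm, h4.symm⟩

lemma Frame.map_eq_of_smul (b b' : Frame F) {R : CommRingCat.{u}} {i : F →+* R} {ξ ζ ξ' ζ' : R}
    (h : IsUnit (b.ev i ξ ζ b.denom)) (h' : IsUnit (b'.ev i ξ' ζ' b'.denom)) {l : R}
    (hl : IsUnit l) (hX : ∀ m, b'.ev i ξ' ζ' (X m) = l * b.ev i ξ ζ (X m)) :
    b'.map i ξ' ζ' h' = b.map i ξ ζ h :=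
  P2pt_smul hl (fun c ↦ by rw [ev_C, ev_C]) hX _ _ _ _ _ _

lemma Frame.swap_map (b : Frame F) {R : CommRingCat.{u}} (i : F →+* R) (ξ ζ : R)
    (h : IsUnit (b.ev i ξ ζ b.denom)) (h' : IsUnit (b.swap.ev i ζ ξ b.swap.denom)) :
    b.swap.map i ζ ξ h' = b.map i ξ ζ h :=
  b.map_eq_of_smul _ h h' isUnit_one fun m ↦ by rw [swap_ev, one_mul]

end

end LangerSurface
end

/-! ### Charts of the blow-up from its universal property. -/

noncomputable section
namespace LangerSurface

open MvPolynomial Scheme.IdealSheafData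

attribute [local instance] MvPolynomial.gradedAlgebra

section ChartRing

/-- The polynomial that is inverted on the charts of the blow-up. -/
def chartDenom (F k : Type*) [Field F] [Fintype F] [Field k] [Algebra F k] :
    MvPolynomial (Fin 2) k :=
  ∏ p : F × F, (1 + C (algebraMap F k p.1) * X 0 + C (algebraMap F k p.2) * (X 0 * X 1))

/-- The coordinate ring of the charts of the blow-up. -/
abbrev ChartRing (F k : Type*) [Field F] [Fintype F] [Field k] [Algebra F k] : Type _ :=
  Localization.Away (chartDenom F k)

/-- The condition for `(s, t)` to be a point of a chart. -/
def IsChartPoint {F : Type*} [Field F] [Fintype F] {R : Type*} [CommRing R] (i : F →+* R)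
    (s t : R) : Prop :=
  IsUnit (∏ p : F × F, (1 + i p.1 * s + i p.2 * (s * t)))

lemma Frame.isUnit_ev_denom_iff {F : Type u} [Field F] [Fintype F] (b : Frame F) {R : Type*}
    [CommRing R] {i : F →+* R} {s t : R} :
    IsUnit (b.ev i s (s * t) b.denom) ↔ IsChartPoint i s t := by
  rw [IsChartPoint, b.ev_denom]

lemma IsChartPoint.map {F : Type*} [Field F] [Fintype F] {R S : Type*} [CommRing R] [CommRing S]
    {i : F →+* R} {s t : R} (h : IsChartPoint i s t) (ψ : R →+* S) :
    IsChartPoint (ψ.comp i) (ψ s) (ψ t) := by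
  have := IsUnit.map ψ h
  rw [map_prod] at this
  simpa [IsChartPoint] using this

lemma isChartPoint_zero {F : Type*} [Field F] [Fintype F] {R : Type*} [CommRing R] (i : F →+* R)
    (t : R) : IsChartPoint i 0 t := by
  simp [IsChartPoint]

namespace ChartRing

variable {F k : Type*} [Field F] [Fintype F] [Field k] [Algebra F k]

variable (F k) in
/-- The first coordinate, the equation of the exceptional curve. -/
def s : ChartRing F k := algebraMap (MvPolynomial (Fin 2) k) _ (X 0)

variable (F k) in
/-- The second coordinate. -/
def t : ChartRing F k := algebraMap (MvPolynomial (Fin 2) k) _ (X 1)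

lemma eval_chartDenom (x : k) :
    eval ![0, x] (chartDenom F k) = 1 := by
  simp [chartDenom, map_prod]

lemma chartDenom_ne_zero : chartDenom F k ≠ 0 := by
  intro h
  have := eval_chartDenom (F := F) (0 : k)
  simp [h] at this

instance : IsDomain (ChartRing F k) :=
  IsLocalization.isDomain_localization
    (powers_le_nonZeroDivisors_of_noZeroDivisors (chartDenom_ne_zero (F := F) (k := k)))

lemma algebraMap_injective :
    Function.Injective (algebraMap (MvPolynomial (Fin 2) k) (ChartRing F k)) :=
  IsLocalization.injective _ (powers_le_nonZeroDivisors_of_noZeroDivisors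
    (chartDenom_ne_zero (F := F) (k := k)))

lemma s_ne_zero : s F k ≠ 0 := by
  rw [s, Ne, map_eq_zero_iff _ algebraMap_injective]
  exact X_ne_zero _

lemma t_ne_zero : t F k ≠ 0 := by
  rw [t, Ne, map_eq_zero_iff _ algebraMap_injective]
  exact X_ne_zero _

lemma isChartPoint_st : IsChartPoint (algebraMap F (ChartRing F k)) (s F k) (t F k) := by
  have h := IsLocalization.Away.algebraMap_isUnit (S := ChartRing F k) (chartDenom F k)
  have hd : algebraMap _ (ChartRing F k) (chartDenom F k) = _ := map_prod _ _ _
  rw [hd] at h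
  refine (congrArg IsUnit (Finset.prod_congr rfl fun p _ ↦ ?_)).mp h
  simp only [IsScalarTower.algebraMap_apply F k (ChartRing F k),
    IsScalarTower.algebraMap_apply k (MvPolynomial (Fin 2) k) (ChartRing F k),
    MvPolynomial.algebraMap_eq, map_add, map_one, map_mul, s, t]

variable {R : Type*} [CommRing R]

/-- The homomorphism from the chart ring with given values of the coordinates. -/
def lift (i : k →+* R) (s t : R) (h : IsChartPoint (i.comp (algebraMap F k)) s t) :
    ChartRing F k →+* R :=
  IsLocalization.Away.lift (chartDenom F k) (g := eval₂Hom i ![s, t]) (by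
    have h1 : eval₂Hom i ![s, t] (chartDenom F k) = ∏ p : F × F, (1 + (i.comp (algebraMap F k)) p.1 * s +
        (i.comp (algebraMap F k)) p.2 * (s * t)) := by
      unfold chartDenom
      rw [map_prod]
      simp
    rw [h1]
    exact h)

section

variable (i : k →+* R) (s' t' : R) (h : IsChartPoint (i.comp (algebraMap F k)) s' t')

lemma lift_algebraMap_poly (p : MvPolynomial (Fin 2) k) :
    lift i s' t' h (algebraMap _ _ p) = eval₂Hom i ![s', t'] p := IsLocalization.Away.lift_eq _ _ _

lemma lift_s : lift i s' t' h (s F k) = s' := by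
  rw [s, lift_algebraMap_poly]; simp

lemma lift_t : lift i s' t' h (t F k) = t' := by
  rw [t, lift_algebraMap_poly]; simp

lemma lift_algebraMap (c : k) : lift i s' t' h (algebraMap k _ c) = i c := by
  rw [IsScalarTower.algebraMap_apply k (MvPolynomial (Fin 2) k), lift_algebraMap_poly,
    MvPolynomial.algebraMap_eq]
  simp

lemma lift_comp_algebraMap : (lift i s' t' h).comp (algebraMap k (ChartRing F k)) = i :=
  RingHom.ext fun c ↦ lift_algebraMap i s' t' h c

end

lemma hom_ext {φ ψ : ChartRing F k →+* R} (hk : ∀ c, φ (algebraMap k _ c) = ψ (algebraMap k _ c))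
    (hs : φ (s F k) = ψ (s F k)) (ht : φ (t F k) = ψ (t F k)) : φ = ψ := by
  refine IsLocalization.ringHom_ext (Submonoid.powers (chartDenom F k)) ?_
  refine MvPolynomial.ringHom_ext (fun c ↦ ?_) fun l ↦ ?_
  · have := hk c
    rwa [IsScalarTower.algebraMap_apply k (MvPolynomial (Fin 2) k), MvPolynomial.algebraMap_eq]
      at this
  · match l with
    | 0 => exact hs
    | 1 => exact ht

lemma eq_lift (φ : ChartRing F k →+* R)
    (h : IsChartPoint ((φ.comp (algebraMap k _)).comp (algebraMap F k)) (φ (s F k)) (φ (t F k))) :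
    φ = lift (φ.comp (algebraMap k _)) (φ (s F k)) (φ (t F k)) h :=
  hom_ext (fun c ↦ by rw [lift_algebraMap]; rfl) (by rw [lift_s]) (by rw [lift_t])

lemma isChartPoint_map (φ : ChartRing F k →+* R) :
    IsChartPoint ((φ.comp (algebraMap k _)).comp (algebraMap F k)) (φ (s F k)) (φ (t F k)) := by
  have := (isChartPoint_st (F := F) (k := k)).map φ
  rwa [IsScalarTower.algebraMap_eq F k (ChartRing F k), ← RingHom.comp_assoc] at this

end ChartRing

end ChartRing

/-- Every point of a local scheme specialises to the closed point, so an open set containing the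
image of the closed point contains the whole image. -/
lemma exists_eq_SpecMap_comp_of_isLocalRing {X : Scheme.{u}} {R Q : CommRingCat.{u}}
    [IsLocalRing R] (g : Spec R ⟶ X) (w : Spec Q ⟶ X) [IsOpenImmersion w]
    (h : g (closedPt R) ∈ Set.range w) : ∃ ν : Q ⟶ R, g = Spec.map ν ≫ w := by
  have hr : Set.range g ⊆ Set.range w := by
    rintro _ ⟨y, rfl⟩
    have h1 : y ⤳ closedPt R := specializes_closedPt y
    exact (h1.map g.continuous).mem_open w.opensRange.2 h
  obtain ⟨ν, hν⟩ := Spec.map_surjective (IsOpenImmersion.lift w g hr)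
  exact ⟨ν, by rw [hν, IsOpenImmersion.lift_fac]⟩

lemma map_mem_nonZeroDivisors_of_isOpenImmersion {R S : CommRingCat.{u}} (φ : R ⟶ S)
    [IsOpenImmersion (Spec.map φ)] {s : R} (hs : s ∈ nonZeroDivisors R) :
    φ.hom s ∈ nonZeroDivisors S := by
  have hflat : φ.hom.Flat := (HasRingHomProperty.Spec_iff (P := @Flat)).mp inferInstance
  let := φ.hom.toAlgebra
  have : Module.Flat R S := hflat
  have h1 := Module.Flat.isSMulRegular_of_nonZeroDivisors (M := S) hs
  rw [mem_nonZeroDivisors_iff_right]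
  intro x hx
  refine h1 (?_ : s • x = s • 0)
  rw [smul_zero, Algebra.smul_def, mul_comm]
  exact hx

section Blowup

lemma eq_of_pb_eq_span {F : Type u} [Field F] {X₀ : Scheme.{u}} {f₀ : X₀ ⟶ P2 F}
    (hf₀ : IsBlowupAtRatPoints f₀) {R : CommRingCat.{u}} {g g' : Spec R ⟶ X₀}
    (h : g ≫ f₀ = g' ≫ f₀) {s : R} (hs : s ∈ nonZeroDivisors R)
    (hI : pb (vanishingIdeal (ratPoints F)) (g ≫ f₀) = Ideal.span {s}) : g = g' :=
  (hf₀.2 _ (g ≫ f₀) (IsEffectiveCartier.comap_of_pb hs hI)).unique rfl h.symm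

variable {F : Type u} [Field F] [Fintype F] {X₀ : Scheme.{u}} {f₀ : X₀ ⟶ P2 F}

/-- The morphism of a chart to the plane. -/
abbrev Frame.chartToPlane (b : Frame F) {R : CommRingCat.{u}} (i : F →+* R) (s t : R)
    (h : IsChartPoint i s t) : Spec R ⟶ P2 F :=
  b.map i s (s * t) (b.isUnit_ev_denom_iff.mpr h)

lemma Frame.pb_chartToPlane (hF : Nat.card F = 2) (b : Frame F) {R : CommRingCat.{u}}
    (i : F →+* R) (s t : R) (h : IsChartPoint i s t) :
    pb (vanishingIdeal (ratPoints F)) (b.chartToPlane i s t h) = Ideal.span {s} := by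
  rw [b.pb_map hF]
  refine le_antisymm (Ideal.span_le.mpr ?_) (Ideal.span_mono (by simp))
  rintro _ (rfl | rfl)
  · exact Ideal.mem_span_singleton_self _
  · exact Ideal.mul_mem_right _ _ (Ideal.mem_span_singleton_self _)

/-- Along (s, t) ↦ b₀ + s b₁ + s t b₂ the ideal of the rational points becomes (s, st) = (s), which
is Cartier; the universal property lifts this map to the blow-up. -/
lemma exists_blowupChart (hF : Nat.card F = 2) (hf₀ : IsBlowupAtRatPoints f₀) (b : Frame F) :
    ∃ j : Spec (.of (ChartRing F F)) ⟶ X₀, j ≫ f₀ = b.chartToPlane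
      (R := .of (ChartRing F F)) (algebraMap F _) (ChartRing.s F F) (ChartRing.t F F)
      ChartRing.isChartPoint_st :=
  (hf₀.2 _ _ (IsEffectiveCartier.comap_of_pb
    (mem_nonZeroDivisors_of_ne_zero ChartRing.s_ne_zero) (b.pb_chartToPlane hF _ _ _ _))).exists

/-- The chart of the blow-up. -/
def blowupChart (hF : Nat.card F = 2) (hf₀ : IsBlowupAtRatPoints f₀) (b : Frame F) :
    Spec (.of (ChartRing F F)) ⟶ X₀ :=
  (exists_blowupChart hF hf₀ b).choose

lemma blowupChart_comp (hF : Nat.card F = 2) (hf₀ : IsBlowupAtRatPoints f₀) (b : Frame F) :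
    blowupChart hF hf₀ b ≫ f₀ = b.chartToPlane
      (R := .of (ChartRing F F)) (algebraMap F _) (ChartRing.s F F) (ChartRing.t F F)
      ChartRing.isChartPoint_st :=
  (exists_blowupChart hF hf₀ b).choose_spec

/-- The point of the blow-up with given coordinates in a chart. -/
def chartMap (hF : Nat.card F = 2) (hf₀ : IsBlowupAtRatPoints f₀) (b : Frame F)
    {R : CommRingCat.{u}} (i : F →+* R) (s t : R) (h : IsChartPoint i s t) : Spec R ⟶ X₀ :=
  Spec.map (CommRingCat.ofHom (ChartRing.lift (k := F) i s t h)) ≫ blowupChart hF hf₀ b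

lemma chartMap_comp (hF : Nat.card F = 2) (hf₀ : IsBlowupAtRatPoints f₀) (b : Frame F)
    {R : CommRingCat.{u}} (i : F →+* R) (s t : R) (h : IsChartPoint i s t) :
    chartMap hF hf₀ b i s t h ≫ f₀ = b.chartToPlane i s t h := by
  rw [chartMap, Category.assoc, blowupChart_comp, Frame.chartToPlane, Frame.SpecMap_map]
  simp only [CommRingCat.hom_ofHom, map_mul, ChartRing.lift_s, ChartRing.lift_t,
    ChartRing.lift_comp_algebraMap]

lemma SpecMap_chartMap (hF : Nat.card F = 2) (hf₀ : IsBlowupAtRatPoints f₀) (b : Frame F)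
    {R S : CommRingCat.{u}} (i : F →+* R) (s t : R) (h : IsChartPoint i s t) (ψ : R ⟶ S) :
    Spec.map ψ ≫ chartMap hF hf₀ b i s t h =
      chartMap hF hf₀ b (ψ.hom.comp i) (ψ.hom s) (ψ.hom t) (h.map ψ.hom) := by
  rw [chartMap, chartMap, ← Spec.map_comp_assoc]
  congr 2
  ext1
  refine ChartRing.hom_ext (fun c ↦ ?_) ?_ ?_
  · simp [ChartRing.lift_algebraMap]
  · simp [ChartRing.lift_s]
  · simp [ChartRing.lift_t]

lemma SpecMap_blowupChart (hF : Nat.card F = 2) (hf₀ : IsBlowupAtRatPoints f₀) (b : Frame F)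
    {R : CommRingCat.{u}} (μ : CommRingCat.of (ChartRing F F) ⟶ R) (i : F →+* R) :
    ∃ h, Spec.map μ ≫ blowupChart hF hf₀ b =
      chartMap hF hf₀ b i (μ.hom (ChartRing.s F F)) (μ.hom (ChartRing.t F F)) h := by
  have h1 := ChartRing.isChartPoint_map μ.hom
  obtain rfl : (μ.hom.comp (algebraMap F (ChartRing F F))) = i := ringHom_eq_of_card hF _ _
  refine ⟨h1, ?_⟩
  rw [chartMap]
  congr 2
  ext1
  exact ChartRing.eq_lift μ.hom h1

lemma eq_chartMap (hF : Nat.card F = 2) (hf₀ : IsBlowupAtRatPoints f₀) (b : Frame F)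
    {R : CommRingCat.{u}} {i : F →+* R} {s t : R} (hs : s ∈ nonZeroDivisors R)
    (h : IsChartPoint i s t) {g : Spec R ⟶ X₀} (hg : g ≫ f₀ = b.chartToPlane i s t h) :
    g = chartMap hF hf₀ b i s t h :=
  eq_of_pb_eq_span hf₀ (by rw [hg, chartMap_comp]) hs (by rw [hg, b.pb_chartToPlane hF])

/-- Around each point over the neighbourhood of a frame, the ideal of the rational points is
generated by one of its two generators. -/
lemma exists_local_chart (hF : Nat.card F = 2) (hf₀ : IsBlowupAtRatPoints f₀) (b : Frame F)
    {x : X₀} (hx : f₀ x ∈ Proj.basicOpen (grading F) b.denom) :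
    ∃ (R : CommRingCat.{u}) (w : Spec R ⟶ X₀) (y : Spec R) (i : F →+* R) (σ α β γ δ : R) (h : _),
      IsOpenImmersion w ∧ w y = x ∧ σ ∈ nonZeroDivisors R ∧ γ * α + δ * β = 1 ∧
      w ≫ f₀ = b.map i (σ * α) (σ * β) h := by
  obtain ⟨R₀, f, y₀, hf, rfl, s, hs, hI⟩ := hf₀.1.exists_pb x
  rw [pb_comap] at hI
  obtain ⟨r, hry, hr⟩ := exists_notMem_of_mem_open
    ((f ≫ f₀) ⁻¹ᵁ Proj.basicOpen (grading F) b.denom) (y := y₀) hx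
  obtain ⟨S, ψ, hψ, -, hψr⟩ := exists_toAway r
  obtain ⟨y, hy⟩ := (hψr y₀).mpr hry
  obtain ⟨i, ξ, ζ, h, hmap⟩ := b.exists_eq_map ((Spec.map ψ ≫ f) ≫ f₀)
    (fun z ↦ hr _ ((hψr _).mp ⟨z, rfl⟩))
  have hs' := map_mem_nonZeroDivisors_of_isOpenImmersion ψ hs
  have hspan : Ideal.span {ξ, ζ} = Ideal.span {ψ.hom s} := by
    rw [← b.pb_map hF i ξ ζ h, ← hmap, Category.assoc, pb_comp, hI, Ideal.map_span,
      Set.image_singleton]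
  obtain ⟨α, hα⟩ := Ideal.mem_span_singleton.mp (hspan ▸ Ideal.subset_span (by simp) :
    ξ ∈ Ideal.span {ψ.hom s})
  obtain ⟨β, hβ⟩ := Ideal.mem_span_singleton.mp (hspan ▸ Ideal.subset_span (by simp) :
    ζ ∈ Ideal.span {ψ.hom s})
  obtain ⟨γ, δ, hγδ⟩ := Ideal.mem_span_pair.mp (hspan.symm ▸ Ideal.mem_span_singleton_self _ :
    ψ.hom s ∈ Ideal.span {ξ, ζ})
  subst hα hβ
  refine ⟨_, Spec.map ψ ≫ f, y, i, ψ.hom s, α, β, γ, δ, h, ?_, ?_, hs', ?_, hmap⟩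
  · infer_instance
  · rw [Scheme.Hom.comp_apply, hy]
  -- The generator is a combination of the two coordinates, and both are multiples of it. Cancelling
  -- it leaves a unimodular pair α, β.
  · have h2 : (γ * α + δ * β - 1) * ψ.hom s = 0 := by linear_combination hγδ
    have h3 := (mem_nonZeroDivisors_iff_right.mp hs') _ h2
    linear_combination h3

/-- Where α is invertible, σα generates the ideal and t = β/α is the missing chart coordinate;
uniqueness in the universal property identifies the inclusion with the resulting point of the chart.
-/
lemma exists_chartMap_of_notMem (hF : Nat.card F = 2) (hf₀ : IsBlowupAtRatPoints f₀) (b : Frame F)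
    {R : CommRingCat.{u}} (w : Spec R ⟶ X₀) [IsOpenImmersion w] {i : F →+* R} {σ α β : R} {h}
    (hσ : σ ∈ nonZeroDivisors R) (hw : w ≫ f₀ = b.map i (σ * α) (σ * β) h) {y : Spec R}
    (hy : α ∉ y.asIdeal) : ∃ (S : CommRingCat.{u}) (w' : Spec S ⟶ X₀)
      (μ : CommRingCat.of (ChartRing F F) ⟶ S), IsOpenImmersion w' ∧ w y ∈ Set.range w' ∧
        w' = Spec.map μ ≫ blowupChart hF hf₀ b := by
  obtain ⟨S, ψ, hψ, ⟨u, hu⟩, hψr⟩ := exists_toAway α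
  obtain ⟨z, hz⟩ := (hψr y).mpr hy
  have hσ' := map_mem_nonZeroDivisors_of_isOpenImmersion ψ hσ
  have hmap : (Spec.map ψ ≫ w) ≫ f₀ = b.map (ψ.hom.comp i) (ψ.hom (σ * α)) (ψ.hom (σ * β))
    (by rw [← Frame.comp_ev]; exact h.map ψ.hom) := by
    rw [Category.assoc, hw, b.SpecMap_map]
  have hst : ψ.hom (σ * α) * (↑u⁻¹ * ψ.hom β) = ψ.hom (σ * β) := by
    rw [map_mul, map_mul, ← hu]
    calc ψ.hom σ * ↑u * (↑u⁻¹ * ψ.hom β) = ψ.hom σ * (u * ↑u⁻¹) * ψ.hom β := by ring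
      _ = _ := by rw [Units.mul_inv, mul_one]
  have hcp : IsChartPoint (ψ.hom.comp i) (ψ.hom (σ * α)) (↑u⁻¹ * ψ.hom β) := by
    rw [← b.isUnit_ev_denom_iff, hst, ← Frame.comp_ev]
    exact h.map ψ.hom
  refine ⟨_, Spec.map ψ ≫ w, _, inferInstance, ⟨z, by rw [Scheme.Hom.comp_apply, hz]⟩,
    eq_chartMap hF hf₀ b (s := ψ.hom (σ * α)) (t := ↑u⁻¹ * ψ.hom β) ?_ hcp ?_⟩
  · rw [map_mul]
    exact mul_mem hσ' (hu ▸ u.isUnit.mem_nonZeroDivisors)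
  · rw [hmap]
    simp only [Frame.chartToPlane, hst]

/-- The image in the plane determines s and s t, and s is a non-zero-divisor on open subsets of the
chart, so t is determined as well. -/
lemma eq_opens_ι_of_comp_blowupChart (hF : Nat.card F = 2) (hf₀ : IsBlowupAtRatPoints f₀)
    (b : Frame F) {V : (Spec (.of (ChartRing F F))).Opens} {g : V.toScheme ⟶ Spec (.of (ChartRing F F))}
    (h : g ≫ blowupChart hF hf₀ b = V.ι ≫ blowupChart hF hf₀ b) : g = V.ι := by
  refine hom_ext_of_isOpenImmersion fun R w hw ↦ ?_
  obtain ⟨φ, hφ⟩ := Spec.map_surjective (w ≫ g)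
  obtain ⟨ψ, hψ⟩ := Spec.map_surjective (w ≫ V.ι)
  have hψo : IsOpenImmersion (Spec.map ψ) := by rw [hψ]; infer_instance
  rw [← hφ, ← hψ]
  have h1 : Spec.map φ ≫ blowupChart hF hf₀ b = Spec.map ψ ≫ blowupChart hF hf₀ b := by
    rw [hφ, hψ, Category.assoc, Category.assoc, h]
  have h2 := congrArg (· ≫ f₀) h1
  simp only [Category.assoc, blowupChart_comp, Frame.chartToPlane, Frame.SpecMap_map] at h2
  obtain ⟨h3, h4⟩ := b.map_inj h2
  rw [map_mul, map_mul, h3] at h4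
  have h5 := map_mem_nonZeroDivisors_of_isOpenImmersion ψ
    (mem_nonZeroDivisors_of_ne_zero (ChartRing.s_ne_zero (F := F) (k := F)))
  congr 1
  ext1
  refine ChartRing.hom_ext (fun c ↦ ?_) h3 ?_
  · exact DFunLike.congr_fun (ringHom_eq_of_card hF (φ.hom.comp (algebraMap F (ChartRing F F)))
      (ψ.hom.comp (algebraMap F (ChartRing F F)))) c
  · exact (mem_nonZeroDivisors_iff_left.mp h5 _ (by rw [mul_sub, h4, sub_self]) |> sub_eq_zero.mp)

/-- Near the image of any point there is an open affine w' of the blow-up that factors through the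
chart as `Spec.map μ`. Over the range of w' this factorisation inverts the chart morphism. -/
instance isOpenImmersion_blowupChart (hF : Nat.card F = 2) (hf₀ : IsBlowupAtRatPoints f₀)
    (b : Frame F) : IsOpenImmersion (blowupChart hF hf₀ b) := by
  set j := blowupChart hF hf₀ b with hj
  refine IsZariskiLocalAtTarget.of_forall_source_exists_preimage _ fun y ↦ ?_
  have hx : f₀ (j y) ∈ Proj.basicOpen (grading F) b.denom := by
    rw [← Scheme.Hom.comp_apply, hj, blowupChart_comp]
    exact b.map_mem_basicOpen _ _ _ _ _
  obtain ⟨R, w, z, i, σ, α, β, γ, δ, h, hw, hwz, hσ, hγδ, hmap⟩ := exists_local_chart hF hf₀ b hx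
  -- In the local ring at y one has s = σα and s t = σβ. As σ is a combination of these, s divides
  -- σ, so cancelling s shows that α is a unit.
  have hα : α ∉ z.asIdeal := by
    obtain ⟨Q, hQ, π, hcl, -, hdom⟩ := exists_closedPoint_eq y
    obtain ⟨hQd, hπ⟩ := hdom (inferInstanceAs (IsDomain (ChartRing F F)))
    obtain ⟨ν, hν⟩ := exists_eq_SpecMap_comp_of_isLocalRing (Spec.map π ≫ j) w
      ⟨z, by rw [Scheme.Hom.comp_apply, hcl]; exact hwz⟩
    have h1 : w (Spec.map ν (closedPt Q)) = w z := by
      rw [← Scheme.Hom.comp_apply, ← hν, Scheme.Hom.comp_apply, hcl, hwz]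
    have h2 : Spec.map ν (closedPt Q) = z := w.isOpenEmbedding.injective h1
    have h3 := congrArg (· ≫ f₀) hν
    simp only [Category.assoc, hj, blowupChart_comp, hmap, Frame.chartToPlane,
      Frame.SpecMap_map] at h3
    obtain ⟨h4, h5⟩ := b.map_inj h3
    have hπs : π.hom (ChartRing.s F F) ≠ 0 := by
      rw [Ne, map_eq_zero_iff _ hπ]; exact ChartRing.s_ne_zero
    have hα' : IsUnit (ν.hom α) := by
      rw [map_mul ν.hom] at h4 h5
      obtain ⟨c, hc⟩ : π.hom (ChartRing.s F F) ∣ ν.hom σ := by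
        have h6 : ν.hom σ = ν.hom γ * (ν.hom σ * ν.hom α) + ν.hom δ * (ν.hom σ * ν.hom β) := by
          have := congrArg ν.hom hγδ
          rw [map_add, map_mul, map_mul, map_one] at this
          linear_combination (-(ν.hom σ)) * this
        have h7 : π.hom (ChartRing.s F F * ChartRing.t F F) =
          π.hom (ChartRing.s F F) * π.hom (ChartRing.t F F) := map_mul π.hom _ _
        rw [h6, ← h4, ← h5, h7]
        exact dvd_add (dvd_mul_left _ _) (Dvd.intro (ν.hom δ * π.hom (ChartRing.t F F)) (by ring))
      refine IsUnit.of_mul_eq_one c (mul_left_cancel₀ hπs ?_)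
      rw [mul_one]
      conv_rhs => rw [h4, hc]
      ring
    rw [← h2]
    intro hmem
    exact (IsLocalRing.mem_maximalIdeal _).mp hmem hα'
  obtain ⟨S, w', μ, hw', hmem, hfac⟩ := exists_chartMap_of_notMem hF hf₀ b w hσ hmap hα
  rw [hwz] at hmem
  refine ⟨w'.opensRange, hmem, ?_⟩
  have hr : Set.range ((j ⁻¹ᵁ w'.opensRange).ι ≫ j) ⊆ Set.range w' := by
    rintro _ ⟨a, rfl⟩
    exact a.2
  have hr' : Set.range (Spec.map μ) ⊆ Set.range (j ⁻¹ᵁ w'.opensRange).ι := by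
    rintro _ ⟨a, rfl⟩
    rw [Scheme.Opens.range_ι]
    change j (Spec.map μ a) ∈ Set.range w'
    rw [← Scheme.Hom.comp_apply, hj, ← hfac]
    exact ⟨a, rfl⟩
  let e := IsOpenImmersion.lift w' ((j ⁻¹ᵁ w'.opensRange).ι ≫ j) hr
  let e' := IsOpenImmersion.lift (j ⁻¹ᵁ w'.opensRange).ι (Spec.map μ) hr'
  have he : e ≫ w' = (j ⁻¹ᵁ w'.opensRange).ι ≫ j := IsOpenImmersion.lift_fac _ _ _
  have he' : e' ≫ (j ⁻¹ᵁ w'.opensRange).ι = Spec.map μ := IsOpenImmersion.lift_fac _ _ _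
  have : IsIso e := by
    refine ⟨e', ?_, ?_⟩
    · rw [← cancel_mono (j ⁻¹ᵁ w'.opensRange).ι, Category.assoc, he', Category.id_comp]
      refine eq_opens_ι_of_comp_blowupChart hF hf₀ b ?_
      rw [Category.assoc, ← hfac, he]
    · rw [← cancel_mono w', Category.assoc, he, reassoc_of% he', Category.id_comp, hfac]
  rw [← he]
  infer_instance

/-- Since γα + δβ = 1, one of α and β is invertible at the point; α leads to the chart of `b`, β to
that of `b.swap`. -/
lemma mem_range_blowupChart (hF : Nat.card F = 2) (hf₀ : IsBlowupAtRatPoints f₀) (b : Frame F)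
    {x : X₀} (hx : f₀ x ∈ Proj.basicOpen (grading F) b.denom) :
    x ∈ Set.range (blowupChart hF hf₀ b) ∨ x ∈ Set.range (blowupChart hF hf₀ b.swap) := by
  obtain ⟨R, w, z, i, σ, α, β, γ, δ, h, hw, rfl, hσ, hγδ, hmap⟩ := exists_local_chart hF hf₀ b hx
  have key : ∀ (b : Frame F), (∃ (S : CommRingCat.{u}) (w' : Spec S ⟶ X₀)
      (μ : CommRingCat.of (ChartRing F F) ⟶ S), IsOpenImmersion w' ∧ w z ∈ Set.range w' ∧
        w' = Spec.map μ ≫ blowupChart hF hf₀ b) → w z ∈ Set.range (blowupChart hF hf₀ b) := by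
    rintro b ⟨S, w', μ, -, ⟨a, ha⟩, rfl⟩
    exact ⟨Spec.map μ a, ha⟩
  by_cases hα : α ∈ z.asIdeal
  · right
    have hβ : β ∉ z.asIdeal := fun hβ ↦ z.2.ne_top ((Ideal.eq_top_iff_one _).mpr
      (hγδ ▸ Ideal.add_mem _ (Ideal.mul_mem_left _ _ hα) (Ideal.mul_mem_left _ _ hβ)))
    have h' : IsUnit (b.swap.ev i (σ * β) (σ * α) b.swap.denom) := by
      rw [b.swap_isUnit_denom_iff, b.swap_ev]; exact h
    exact key _ (exists_chartMap_of_notMem hF hf₀ b.swap w hσ (h := h')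
      (by rw [b.swap_map _ _ _ h, hmap]) hβ)
  · exact Or.inl (key _ (exists_chartMap_of_notMem hF hf₀ b w hσ hmap hα))

lemma exists_mem_range_blowupChart (hF : Nat.card F = 2) (hf₀ : IsBlowupAtRatPoints f₀) (x : X₀) :
    ∃ b : Frame F, x ∈ Set.range (blowupChart hF hf₀ b) := by
  obtain ⟨b, hb⟩ := Frame.exists_mem_basicOpen (f₀ x)
  rcases mem_range_blowupChart hF hf₀ b hb with h | h
  exacts [⟨_, h⟩, ⟨_, h⟩]

end Blowup

end LangerSurface
end

/-! ### Gluing the two charts over a rational point. -/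

noncomputable section
namespace LangerSurface

open MvPolynomial Scheme.IdealSheafData

attribute [local instance] MvPolynomial.gradedAlgebra

lemma exists_affine_overlap {X : Scheme.{u}} {R R' : CommRingCat.{u}} (w : Spec R ⟶ X)
    (w' : Spec R' ⟶ X) [IsOpenImmersion w] [IsOpenImmersion w'] {x : X} (hx : x ∈ Set.range w)
    (hx' : x ∈ Set.range w') :
    ∃ (T : CommRingCat.{u}) (φ : R ⟶ T) (φ' : R' ⟶ T) (z : Spec T), IsOpenImmersion (Spec.map φ) ∧
      IsOpenImmersion (Spec.map φ') ∧ Spec.map φ ≫ w = Spec.map φ' ≫ w' ∧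
      (Spec.map φ ≫ w) z = x := by
  obtain ⟨y, rfl⟩ := hx
  obtain ⟨r, hry, hr⟩ := exists_notMem_of_mem_open (w ⁻¹ᵁ w'.opensRange) (y := y) hx'
  obtain ⟨T, φ, hφ, -, hφr⟩ := exists_toAway r
  obtain ⟨z, hz⟩ := (hφr y).mpr hry
  have hrange : Set.range (Spec.map φ ≫ w) ⊆ Set.range w' := by
    rintro _ ⟨a, rfl⟩
    exact hr _ ((hφr _).mp ⟨a, rfl⟩)
  obtain ⟨φ', hφ'⟩ := Spec.map_surjective (IsOpenImmersion.lift w' (Spec.map φ ≫ w) hrange)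
  have h1 : Spec.map φ' ≫ w' = Spec.map φ ≫ w := by rw [hφ', IsOpenImmersion.lift_fac]
  refine ⟨T, φ, φ', z, hφ, ?_, h1.symm, by rw [Scheme.Hom.comp_apply, hz]⟩
  have : IsOpenImmersion (Spec.map φ' ≫ w') := by rw [h1]; infer_instance
  exact IsOpenImmersion.of_comp _ w'

section

variable {F : Type u} [Field F] [Fintype F] {X₀ : Scheme.{u}} {f₀ : X₀ ⟶ P2 F}

lemma chartMap_eq_of_eq (hF : Nat.card F = 2) (hf₀ : IsBlowupAtRatPoints f₀) (b : Frame F)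
    {R : CommRingCat.{u}} {i i' : F →+* R} {s t s' t' : R} (h : IsChartPoint i s t)
    (h' : IsChartPoint i' s' t') (hs : s = s') (ht : t = t') :
    chartMap hF hf₀ b i s t h = chartMap hF hf₀ b i' s' t' h' := by
  obtain rfl := ringHom_eq_of_card hF i i'
  subst hs ht
  rfl

lemma IsChartPoint.swap {R : Type*} [CommRing R] {i : F →+* R} {s t t' : R}
    (h : IsChartPoint i s t) (htt' : t * t' = 1) : IsChartPoint i (s * t) t' := by
  obtain ⟨b, -⟩ := Frame.exists_pt_eq (F := F) (v := 1) one_ne_zero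
  rw [← b.isUnit_ev_denom_iff] at h
  rw [← b.swap.isUnit_ev_denom_iff, show s * t * t' = s by rw [mul_assoc, htt', mul_one],
    b.swap_isUnit_denom_iff, b.swap_ev]
  exact h

/-- In the universal case, the chart ring with t inverted, the coordinate s is a non-zero-divisor
and uniqueness in the universal property applies. The general case, in which s may well be zero, is
a specialisation of it. -/
lemma chartMap_swap (hF : Nat.card F = 2) (hf₀ : IsBlowupAtRatPoints f₀) (b : Frame F)
    {R : CommRingCat.{u}} {i : F →+* R} {s t t' : R} (htt' : t * t' = 1) (h : IsChartPoint i s t) :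
    chartMap hF hf₀ b i s t h = chartMap hF hf₀ b.swap i (s * t) t' (h.swap htt') := by
  let A := ChartRing F F
  let L := Localization.Away (ChartRing.t F F)
  have : IsDomain L := IsLocalization.isDomain_localization
    (powers_le_nonZeroDivisors_of_noZeroDivisors ChartRing.t_ne_zero)
  have hinj : Function.Injective (algebraMap A L) := IsLocalization.injective _
    (powers_le_nonZeroDivisors_of_noZeroDivisors ChartRing.t_ne_zero)
  let σ : L := algebraMap A L (ChartRing.s F F)
  let θ : L := algebraMap A L (ChartRing.t F F)
  let τ : L := IsLocalization.Away.invSelf (ChartRing.t F F)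
  have hθτ : θ * τ = 1 := IsLocalization.Away.mul_invSelf _
  have hcp : IsChartPoint ((algebraMap A L).comp (algebraMap F A)) σ θ :=
    ChartRing.isChartPoint_st.map (algebraMap A L)
  have huniv : chartMap (R := .of L) hF hf₀ b _ σ θ hcp =
      chartMap (R := .of L) hF hf₀ b.swap _ (σ * θ) τ (hcp.swap hθτ) := by
    refine eq_chartMap hF hf₀ b.swap (mem_nonZeroDivisors_of_ne_zero ?_) _ ?_
    · refine mul_ne_zero ?_ (left_ne_zero_of_mul_eq_one hθτ)
      exact (map_ne_zero_iff _ hinj).mpr ChartRing.s_ne_zero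
    · rw [chartMap_comp]
      have h1 : σ * θ * τ = σ := by rw [mul_assoc, hθτ, mul_one]
      simp only [Frame.chartToPlane, h1]
      exact (b.swap_map _ _ _ _ _).symm
  let φ : L →+* R := IsLocalization.Away.lift (ChartRing.t F F) (g := ChartRing.lift (k := F) i s t h)
    (by rw [ChartRing.lift_t]; exact .of_mul_eq_one _ htt')
  have hφ : ∀ x, φ (algebraMap A L x) = ChartRing.lift (k := F) i s t h x :=
    fun x ↦ IsLocalization.Away.lift_eq _ _ _
  have hφσ : φ σ = s := by rw [hφ, ChartRing.lift_s]
  have hφθ : φ θ = t := by rw [hφ, ChartRing.lift_t]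
  have hφτ : φ τ = t' := by
    have h2 := congrArg φ hθτ
    rw [map_mul, hφθ, map_one] at h2
    calc φ τ = (t * t') * φ τ := by rw [htt', one_mul]
      _ = t' * (t * φ τ) := by ring
      _ = t' := by rw [h2, mul_one]
  have h3 := congrArg (fun g ↦ Spec.map (CommRingCat.ofHom φ) ≫ g) huniv
  simp only [SpecMap_chartMap] at h3
  refine ((chartMap_eq_of_eq hF hf₀ b _ _ ?_ ?_).symm.trans h3).trans
    (chartMap_eq_of_eq hF hf₀ b.swap _ _ ?_ ?_)
  · exact hφσ
  · exact hφθ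
  · change φ (σ * θ) = _
    rw [map_mul, hφσ, hφθ]
  · exact hφτ

/-- Near a common point of two charts, the blow-up has coordinates of both charts. -/
lemma exists_chart_overlap (hF : Nat.card F = 2) (hf₀ : IsBlowupAtRatPoints f₀) (b b' : Frame F)
    {x : X₀} (hx : x ∈ Set.range (blowupChart hF hf₀ b))
    (hx' : x ∈ Set.range (blowupChart hF hf₀ b')) :
    ∃ (T : CommRingCat.{u}) (φ φ' : CommRingCat.of (ChartRing F F) ⟶ T) (z : Spec T),
      Spec.map φ ≫ blowupChart hF hf₀ b = Spec.map φ' ≫ blowupChart hF hf₀ b' ∧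
      IsOpenImmersion (Spec.map φ) ∧ IsOpenImmersion (Spec.map φ') ∧
      (Spec.map φ ≫ blowupChart hF hf₀ b) z = x := by
  obtain ⟨T, φ, φ', z, h1, h2, h3, h4⟩ := exists_affine_overlap _ _ hx hx'
  exact ⟨T, φ, φ', z, h3, h1, h2, h4⟩

/-- On an affine overlap of the charts s is a non-zero-divisor, and comparing the images in the
plane gives t t' = 1 there. The given point factors through such an overlap because its source is
local. -/
lemma mul_eq_one_of_chartMap_eq (hF : Nat.card F = 2) (hf₀ : IsBlowupAtRatPoints f₀) (b : Frame F)
    {R : CommRingCat.{u}} [IsLocalRing R] {i i' : F →+* R} {s t s' t' : R} {h : IsChartPoint i s t}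
    {h' : IsChartPoint i' s' t'}
    (heq : chartMap hF hf₀ b i s t h = chartMap hF hf₀ b.swap i' s' t' h') : t * t' = 1 := by
  let x := chartMap hF hf₀ b i s t h (closedPt R)
  obtain ⟨T, φ, φ', z, h1, h2, h3, h4⟩ := exists_chart_overlap hF hf₀ b b.swap (x := x)
    ⟨_, (Scheme.Hom.comp_apply _ _ _).symm⟩ (by
      have : x = chartMap hF hf₀ b.swap i' s' t' h' (closedPt R) := by rw [← heq]
      rw [this]
      exact ⟨_, (Scheme.Hom.comp_apply _ _ _).symm⟩)
  have hφ : φ.hom (ChartRing.t F F) * φ'.hom (ChartRing.t F F) = 1 := by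
    have h5 := congrArg (· ≫ f₀) h1
    simp only [Category.assoc, blowupChart_comp, Frame.chartToPlane, Frame.SpecMap_map] at h5
    have h7 : ∀ (i₁ : F →+* T) (ξ ζ : T) (hi : IsUnit (b.swap.ev i₁ ξ ζ b.swap.denom)),
        b.swap.map i₁ ξ ζ hi = b.map i₁ ζ ξ (by
          rwa [b.swap_isUnit_denom_iff, b.swap_ev] at hi) := fun i₁ ξ ζ hi ↦
      b.swap_map i₁ ζ ξ _ hi
    rw [h7] at h5
    obtain ⟨h8, h9⟩ := b.map_inj h5
    rw [map_mul] at h8 h9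
    have hs := map_mem_nonZeroDivisors_of_isOpenImmersion φ
      (mem_nonZeroDivisors_of_ne_zero (ChartRing.s_ne_zero (F := F) (k := F)))
    have h10 : (φ.hom (ChartRing.t F F) * φ'.hom (ChartRing.t F F) - 1) *
        φ.hom (ChartRing.s F F) = 0 := by
      linear_combination φ'.hom (ChartRing.t F F) * h9 - h8
    exact sub_eq_zero.mp (mem_nonZeroDivisors_iff_right.mp hs _ h10)
  obtain ⟨ν, hν⟩ := exists_eq_SpecMap_comp_of_isLocalRing (chartMap hF hf₀ b i s t h)
    (Spec.map φ ≫ blowupChart hF hf₀ b) ⟨z, h4⟩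
  have hν' := hν
  rw [heq, h1] at hν'
  have h11 : ∀ (b : Frame F) {i : F →+* R} {s t : R} {h : IsChartPoint i s t}
      {φ : CommRingCat.of (ChartRing F F) ⟶ T},
      chartMap hF hf₀ b i s t h = Spec.map ν ≫ Spec.map φ ≫ blowupChart hF hf₀ b →
      t = ν.hom (φ.hom (ChartRing.t F F)) := by
    intro b i s t h φ h12
    rw [chartMap, ← Category.assoc, cancel_mono, ← Spec.map_comp] at h12
    have h13 := congrArg (fun f : CommRingCat.of (ChartRing F F) ⟶ R ↦ f.hom (ChartRing.t F F))
      (Spec.map_injective h12)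
    simpa [ChartRing.lift_t] using h13
  rw [h11 b hν, h11 b.swap hν', ← map_mul, hφ, map_one]

end

end LangerSurface
end

/-! ### Properness of the blow-up. -/

noncomputable section
namespace LangerSurface

open MvPolynomial Scheme.IdealSheafData

attribute [local instance] MvPolynomial.gradedAlgebra

instance isProper_toSpec (F : Type u) [Field F] : IsProper (P2.toSpec F) := by
  have h1 : Function.Bijective (algebraMap F (grading F 0)) := by
    refine ⟨fun c c' h ↦ C_injective (Fin 3) F (congrArg Subtype.val h), fun x ↦ ?_⟩
    have hx : (x : MvPolynomial (Fin 3) F).IsHomogeneous 0 := x.2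
    rw [← totalDegree_zero_iff_isHomogeneous, totalDegree_eq_zero_iff_eq_C] at hx
    exact ⟨_, Subtype.ext hx.symm⟩
  have : IsIso (CommRingCat.ofHom (algebraMap F (grading F 0))) :=
    (ConcreteCategory.isIso_iff_bijective _).mpr h1
  have : Algebra.FiniteType (grading F 0) (MvPolynomial (Fin 3) F) :=
    RingHom.finiteType_algebraMap.mp (RingHom.FiniteType.of_comp_finiteType
      (f := algebraMap F (grading F 0))
      (RingHom.finiteType_algebraMap.mpr
        (inferInstance : Algebra.FiniteType F (MvPolynomial (Fin 3) F))))
  exact inferInstanceAs (IsProper (Proj.toSpecZero (grading F) ≫ _))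

section

variable {F : Type u} [Field F] [Fintype F] {X₀ : Scheme.{u}} {f₀ : X₀ ⟶ P2 F}

instance finite_frame : Finite (Frame F) :=
  Finite.of_injective (fun b : Frame F ↦ (b.M, b.N)) fun b b' h ↦ by
    cases b; cases b'; simpa using h

/-- The cover of the blow-up by its charts. -/
def blowupCover (hF : Nat.card F = 2) (hf₀ : IsBlowupAtRatPoints f₀) : X₀.OpenCover :=
  Scheme.Cover.mkOfCovers (Frame F) (fun _ ↦ Spec (.of (ChartRing F F)))
    (fun b ↦ blowupChart hF hf₀ b) (fun x ↦ exists_mem_range_blowupChart hF hf₀ x)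

lemma blowupChart_comp_toSpec (hF : Nat.card F = 2) (hf₀ : IsBlowupAtRatPoints f₀) (b : Frame F) :
    blowupChart hF hf₀ b ≫ f₀ ≫ P2.toSpec F =
      Spec.map (CommRingCat.ofHom (algebraMap F (ChartRing F F))) := by
  rw [← Category.assoc, blowupChart_comp, Frame.chartToPlane, Frame.map, P2pt_toSpec]
  congr 2
  ext c
  exact b.ev_C _ _ _ c

lemma isNoetherian_blowup (hF : Nat.card F = 2) (hf₀ : IsBlowupAtRatPoints f₀) :
    IsNoetherian X₀ := by
  have h1 : IsNoetherianRing (ChartRing F F) :=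
    IsLocalization.isNoetherianRing (Submonoid.powers (chartDenom F F)) _ inferInstance
  have h2 : ∀ i, IsAffine ((blowupCover hF hf₀).X i) := fun i ↦
    inferInstanceAs (IsAffine (Spec (.of (ChartRing F F))))
  have h3 : IsLocallyNoetherian X₀ :=
    (isLocallyNoetherian_iff_of_affine_openCover (blowupCover hF hf₀)).mpr fun i ↦
      isNoetherianRing_of_ringEquiv (ChartRing F F)
        (Scheme.ΓSpecIso (.of (ChartRing F F))).symm.commRingCatIsoToRingEquiv
  have h4 : CompactSpace X₀ := by
    refine isCompact_univ_iff.mp ?_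
    have : (Set.univ : Set X₀) = ⋃ b : Frame F, Set.range (blowupChart hF hf₀ b) := by
      symm
      rw [Set.eq_univ_iff_forall]
      exact fun x ↦ Set.mem_iUnion.mpr (exists_mem_range_blowupChart hF hf₀ x)
    rw [this]
    exact isCompact_iUnion fun b ↦ isCompact_range (blowupChart hF hf₀ b).continuous
  exact { }

lemma locallyOfFiniteType_blowup (hF : Nat.card F = 2) (hf₀ : IsBlowupAtRatPoints f₀) :
    LocallyOfFiniteType f₀ := by
  have : LocallyOfFiniteType (f₀ ≫ P2.toSpec F) := by
    have : IsZariskiLocalAtSource @LocallyOfFiniteType.{u} :=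
      HasRingHomProperty.instIsZariskiLocalAtSource
    refine IsZariskiLocalAtSource.of_openCover (P := @LocallyOfFiniteType) (blowupCover hF hf₀) fun (b : Frame F) ↦ ?_
    change LocallyOfFiniteType (blowupChart hF hf₀ b ≫ f₀ ≫ P2.toSpec F)
    rw [blowupChart_comp_toSpec, HasRingHomProperty.Spec_iff (P := @LocallyOfFiniteType)]
    have h1 : Algebra.FiniteType F (MvPolynomial (Fin 2) F) := inferInstance
    have : Algebra.FiniteType F (ChartRing F F) :=
      h1.trans (IsLocalization.finiteType_of_monoid_fg (Submonoid.powers (chartDenom F F)) _)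
    exact (RingHom.finiteType_algebraMap).mpr this
  exact locallyOfFiniteType_of_comp f₀ (P2.toSpec F)

lemma chartMap_inj (hF : Nat.card F = 2) (hf₀ : IsBlowupAtRatPoints f₀) (b : Frame F)
    {R : CommRingCat.{u}} {i i' : F →+* R} {s t s' t' : R} {h : IsChartPoint i s t}
    {h' : IsChartPoint i' s' t'}
    (heq : chartMap hF hf₀ b i s t h = chartMap hF hf₀ b i' s' t' h') : s = s' ∧ t = t' := by
  rw [chartMap, chartMap, cancel_mono] at heq
  have h1 := Spec.map_injective heq
  have hs := congrArg (fun f : CommRingCat.of (ChartRing F F) ⟶ R ↦ f.hom (ChartRing.s F F)) h1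
  have ht := congrArg (fun f : CommRingCat.of (ChartRing F F) ⟶ R ↦ f.hom (ChartRing.t F F)) h1
  simp only [CommRingCat.hom_ofHom, ChartRing.lift_s, ChartRing.lift_t] at hs ht
  exact ⟨hs, ht⟩

lemma exists_eq_chartMap (hF : Nat.card F = 2) (hf₀ : IsBlowupAtRatPoints f₀) (b : Frame F)
    {R : CommRingCat.{u}} [IsLocalRing R] (i : F →+* R) (g : Spec R ⟶ X₀)
    (hg : g (closedPt R) ∈ Set.range (blowupChart hF hf₀ b)) :
    ∃ s t h, g = chartMap hF hf₀ b i s t h := by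
  obtain ⟨ν, hν⟩ := exists_eq_SpecMap_comp_of_isLocalRing g _ hg
  obtain ⟨h, h1⟩ := SpecMap_blowupChart hF hf₀ b ν i
  exact ⟨_, _, h, hν.trans h1⟩

lemma exists_eq_chartMap_or (hF : Nat.card F = 2) (hf₀ : IsBlowupAtRatPoints f₀) (b : Frame F)
    {R : CommRingCat.{u}} [IsLocalRing R] (g : Spec R ⟶ X₀) {i : F →+* R} {ξ ζ : R} {h}
    (hg : g ≫ f₀ = b.map i ξ ζ h) :
    (∃ t h, g = chartMap hF hf₀ b i ξ t h ∧ ζ = ξ * t) ∨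
      ∃ t h, g = chartMap hF hf₀ b.swap i ζ t h ∧ ξ = ζ * t := by
  have hx : f₀ (g (closedPt R)) ∈ Proj.basicOpen (grading F) b.denom := by
    rw [← Scheme.Hom.comp_apply, hg]
    exact b.map_mem_basicOpen _ _ _ _ _
  refine (mem_range_blowupChart hF hf₀ b hx).imp (fun hx ↦ ?_) fun hx ↦ ?_
  · obtain ⟨s, t, h', rfl⟩ := exists_eq_chartMap hF hf₀ b i g hx
    rw [chartMap_comp] at hg
    obtain ⟨rfl, h2⟩ := b.map_inj hg
    exact ⟨t, h', rfl, h2.symm⟩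
  · obtain ⟨s, t, h', rfl⟩ := exists_eq_chartMap hF hf₀ b.swap i g hx
    rw [chartMap_comp] at hg
    rw [← b.swap_map i ξ ζ h (by rwa [b.swap_isUnit_denom_iff, b.swap_ev])] at hg
    obtain ⟨rfl, h2⟩ := b.swap.map_inj hg
    exact ⟨t, h', rfl, h2.symm⟩

lemma exists_span_singleton {V : Type*} [CommRing V] [IsDomain V] [ValuationRing V] (ξ ζ : V) :
    ∃ σ, Ideal.span {ξ, ζ} = Ideal.span {σ} ∧ (σ = ξ ∨ σ = ζ) := by
  have key : ∀ ξ ζ : V, ξ ∣ ζ → Ideal.span {ξ, ζ} = Ideal.span {ξ} := fun ξ ζ h ↦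
    le_antisymm (Ideal.span_le.mpr (by
      rintro _ (rfl | rfl)
      · exact Ideal.mem_span_singleton_self _
      · exact Ideal.mem_span_singleton.mpr h)) (Ideal.span_mono (by simp))
  rcases ValuationRing.dvd_total ξ ζ with h | h
  · exact ⟨ξ, key ξ ζ h, .inl rfl⟩
  · exact ⟨ζ, by rw [Set.pair_comm]; exact key ζ ξ h, .inr rfl⟩

/-- Lifts over a valuation ring, when the image lies in the blown up points. -/
lemma existsUnique_lift_zero (hF : Nat.card F = 2) (hf₀ : IsBlowupAtRatPoints f₀) (b : Frame F)
    {V K : CommRingCat.{u}} [IsDomain V] [ValuationRing V] [IsLocalRing K]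
    {κ : V ⟶ K} (hκ : Function.Injective κ.hom) {i : F →+* V} {h} {v : V} {h'} {g : Spec K ⟶ X₀}
    (hg : g = chartMap hF hf₀ b (κ.hom.comp i) 0 (κ.hom v) h') :
    ∃! l : Spec V ⟶ X₀, Spec.map κ ≫ l = g ∧ l ≫ f₀ = b.map i 0 0 h := by
  refine ⟨chartMap hF hf₀ b i 0 v (isChartPoint_zero _ _), ⟨?_, ?_⟩, ?_⟩
  · rw [SpecMap_chartMap, hg]
    exact chartMap_eq_of_eq hF hf₀ b _ _ (map_zero _) rfl
  · rw [chartMap_comp]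
    simp only [Frame.chartToPlane, zero_mul]
  · rintro l ⟨hl, hl'⟩
    rcases exists_eq_chartMap_or hF hf₀ b l hl' with ⟨t, h1, rfl, -⟩ | ⟨t, h1, rfl, -⟩
    · rw [SpecMap_chartMap, hg] at hl
      exact chartMap_eq_of_eq hF hf₀ b _ _ rfl (hκ (chartMap_inj hF hf₀ b hl).2)
    · rw [SpecMap_chartMap, hg] at hl
      have h2 := mul_eq_one_of_chartMap_eq hF hf₀ b hl.symm
      rw [← map_mul, ← map_one κ.hom] at h2
      rw [chartMap_swap hF hf₀ b (hκ h2) (isChartPoint_zero i v)]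
      exact chartMap_eq_of_eq hF hf₀ b.swap _ _ (zero_mul _).symm rfl

/-- The valuative criterion. Over a valuation ring the ideal (ξ, ζ) of the rational points is
generated by one element σ, and the two cases depend on whether σ vanishes. -/
lemma existsUnique_lift (hF : Nat.card F = 2) (hf₀ : IsBlowupAtRatPoints f₀)
    {V K : CommRingCat.{u}} [IsDomain V] [ValuationRing V] (hK : IsField K) [Algebra V K]
    [IsFractionRing V K] {κ : V ⟶ K} (hκ' : κ.hom = algebraMap V K) (g : Spec K ⟶ X₀)
    (g₂ : Spec V ⟶ P2 F)
    (hg : g ≫ f₀ = Spec.map κ ≫ g₂) :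
    ∃! l : Spec V ⟶ X₀, Spec.map κ ≫ l = g ∧ l ≫ f₀ = g₂ := by
  have hκ : Function.Injective κ.hom := by rw [hκ']; exact IsFractionRing.injective V K
  let _ : Field K := hK.toField
  obtain ⟨b, hb⟩ := Frame.exists_mem_basicOpen (g₂ (closedPt V))
  obtain ⟨i, ξ, ζ, h, rfl⟩ := b.exists_eq_map g₂ fun y ↦
    ((specializes_closedPt y).map g₂.continuous).mem_open (Proj.basicOpen (grading F) b.denom).2 hb
  obtain ⟨σ, hσ, hσ'⟩ := exists_span_singleton ξ ζ
  -- If σ = 0, the whole valuation ring maps to a rational point and the given K-point lies on the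
  -- exceptional curve. Its coordinate or the inverse of that coordinate is integral, and this
  -- selects one of the two charts for the lift.
  by_cases h0 : σ = 0
  · have h00 : ξ = 0 ∧ ζ = 0 := by
      rw [h0, Ideal.span_singleton_zero, Ideal.span_eq_bot] at hσ
      exact ⟨hσ _ (by simp), hσ _ (by simp)⟩
    obtain ⟨rfl, rfl⟩ := h00
    have key : ∀ (b : Frame F) {h} {τ : K} {h'},
        g = chartMap hF hf₀ b (κ.hom.comp i) 0 τ h' →
        ∃! l : Spec V ⟶ X₀, Spec.map κ ≫ l = g ∧ l ≫ f₀ = b.map i 0 0 h := by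
      intro b h τ h' hτ
      rcases ValuationRing.isInteger_or_isInteger V τ with ⟨v, hv⟩ | ⟨v, hv⟩
      · rw [← hκ'] at hv
        subst hv
        exact existsUnique_lift_zero hF hf₀ b hκ hτ
      · rw [← hκ'] at hv
        by_cases hτ0 : τ = 0
        · subst hτ0
          exact existsUnique_lift_zero hF hf₀ b hκ (v := 0)
            (hτ.trans (chartMap_eq_of_eq hF hf₀ b h' (isChartPoint_zero _ _) rfl (map_zero _).symm))
        · have h2 : b.map i 0 0 h = b.swap.map i 0 0 (by
              rwa [b.swap_isUnit_denom_iff, b.swap_ev]) := (b.swap_map i 0 0 _ _).symm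
          rw [h2]
          refine existsUnique_lift_zero hF hf₀ b.swap hκ (v := v)
            (h' := isChartPoint_zero _ _) (hτ.trans ?_)
          rw [chartMap_swap hF hf₀ b (mul_inv_cancel₀ hτ0)]
          exact chartMap_eq_of_eq hF hf₀ b.swap _ _ (zero_mul _) hv.symm
    rw [b.SpecMap_map] at hg
    rcases exists_eq_chartMap_or hF hf₀ b g hg with ⟨t, h1, h2, -⟩ | ⟨t, h1, h2, -⟩
    · exact key b (h' := isChartPoint_zero _ t)
        (h2.trans (chartMap_eq_of_eq hF hf₀ b _ _ (map_zero _) rfl))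
    · rw [← b.swap_map i 0 0 h (by rwa [b.swap_isUnit_denom_iff, b.swap_ev])]
      exact key b.swap (h' := isChartPoint_zero _ t)
        (h2.trans (chartMap_eq_of_eq hF hf₀ b.swap _ _ (map_zero _) rfl))
  -- If σ ≠ 0, the pulled-back ideal is Cartier, so existence and uniqueness come from the universal
  -- property, on V for the lift and on K for its restriction.
  · have hpb : pb (vanishingIdeal (ratPoints F)) (b.map i ξ ζ h) = Ideal.span {σ} := by
      rw [b.pb_map hF, hσ]
    obtain ⟨l, hl, hu⟩ := hf₀.2 _ (b.map i ξ ζ h)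
      (IsEffectiveCartier.comap_of_pb (mem_nonZeroDivisors_of_ne_zero h0) hpb)
    refine ⟨l, ⟨?_, hl⟩, fun l' hl' ↦ hu _ hl'.2⟩
    refine eq_of_pb_eq_span hf₀ (s := κ.hom σ) ?_ ?_ ?_
    · rw [Category.assoc, hl, hg]
    · exact mem_nonZeroDivisors_of_ne_zero ((map_ne_zero_iff _ hκ).mpr h0)
    · rw [Category.assoc, hl, pb_comp, hpb, Ideal.map_span, Set.image_singleton]

lemma isProper_blowup (hF : Nat.card F = 2) (hf₀ : IsBlowupAtRatPoints f₀) : IsProper f₀ := by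
  have := isNoetherian_blowup hF hf₀
  have := locallyOfFiniteType_blowup hF hf₀
  have : QuasiSeparated (f₀ ≫ P2.toSpec F) := inferInstance
  have : QuasiSeparated f₀ := .of_comp f₀ (P2.toSpec F)
  have : QuasiCompact (f₀ ≫ P2.toSpec F) := inferInstance
  have : QuasiCompact f₀ := .of_comp f₀ (P2.toSpec F)
  refine IsProper.of_valuativeCriterion f₀ fun S ↦ ?_
  have h1 : IsDomain (CommRingCat.of S.R) := inferInstanceAs (IsDomain S.R)
  have h2 : ValuationRing (CommRingCat.of S.R) := inferInstanceAs (ValuationRing S.R)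
  have h3 : IsField (CommRingCat.of S.K) := Field.toIsField S.K
  let _ : Algebra (CommRingCat.of S.R) (CommRingCat.of S.K) := inferInstanceAs (Algebra S.R S.K)
  have h4 : IsFractionRing (CommRingCat.of S.R) (CommRingCat.of S.K) :=
    inferInstanceAs (IsFractionRing S.R S.K)
  obtain ⟨l, ⟨hl, hl'⟩, hu⟩ := existsUnique_lift hF hf₀ h3
    (κ := CommRingCat.ofHom (algebraMap S.R S.K)) rfl S.i₁ S.i₂ S.commSq.w
  exact ⟨⟨⟨l, hl, hl'⟩⟩, fun L ↦ CommSq.LiftStruct.ext (hu _ ⟨L.fac_left, L.fac_right⟩)⟩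

end

end LangerSurface
end

/-! ### Linear equivalence in local equations, and integral closed subschemes. -/

noncomputable section
namespace LangerSurface

open Scheme Scheme.IdealSheafData

section Transfer

variable {X : Scheme.{u}}

lemma map_rangeIso_hom {R S : CommRingCat.{u}} (w : Spec R ⟶ X) [IsOpenImmersion w] (φ : R ⟶ S)
    [IsOpenImmersion (Spec.map φ ≫ w)]
    (h : (affineRange (Spec.map φ ≫ w)).1 ≤ (affineRange w).1) :
    X.presheaf.map (homOfLE h).op ≫ (rangeIso (Spec.map φ ≫ w)).hom = (rangeIso w).hom ≫ φ := by
  simp only [rangeIso, Iso.trans_hom, Hom.appIso_hom', Category.assoc]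
  rw [Scheme.Hom.map_appLE_assoc, ← Scheme.Hom.appLE_comp_appLE _ _ _ ⊤ _ (by simp) (by simp),
    Category.assoc, ← ΓSpecIso_naturality]
  congr 2

lemma affineRange_comp_le {R S : CommRingCat.{u}} (w : Spec R ⟶ X) [IsOpenImmersion w] (φ : R ⟶ S)
    [IsOpenImmersion (Spec.map φ ≫ w)] :
    (affineRange (Spec.map φ ≫ w)).1 ≤ (affineRange w).1 := by
  intro x hx
  rw [mem_affineRange] at hx ⊢
  obtain ⟨y, rfl⟩ := hx
  exact ⟨_, (Scheme.Hom.comp_apply _ _ _).symm⟩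

lemma rangeIso_inv_mem {D : X.IdealSheafData} {R : CommRingCat.{u}} (w : Spec R ⟶ X)
    [IsOpenImmersion w] {r : R} (hr : r ∈ pb D w) :
    (rangeIso w).inv.hom r ∈ D.ideal (affineRange w) := by
  rw [ideal_affineRange]; exact Ideal.mem_map_of_mem _ hr

lemma rangeIso_hom_inv {R : CommRingCat.{u}} (w : Spec R ⟶ X) [IsOpenImmersion w] (r : R) :
    (rangeIso w).hom.hom ((rangeIso w).inv.hom r) = r := by
  rw [← CommRingCat.comp_apply, Iso.inv_hom_id]; rfl

lemma rangeIso_inv_hom {R : CommRingCat.{u}} (w : Spec R ⟶ X) [IsOpenImmersion w]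
    (r : Γ(X, (affineRange w).1)) :
    (rangeIso w).inv.hom ((rangeIso w).hom.hom r) = r := by
  rw [← CommRingCat.comp_apply, Iso.hom_inv_id]; rfl

/-- On each affine chart, generators of linearly equivalent ideal sheaves correspond, and the
ratio of corresponding generators does not depend on the chart. -/
lemma LinearlyEquivalent.exists_transfer {D D' : X.IdealSheafData} (h : LinearlyEquivalent D D') :
    ∃ θ : ∀ (R : CommRingCat.{u}) (_ : Spec R ⟶ X), R → R,
      (∀ (R : CommRingCat.{u}) (w : Spec R ⟶ X) (β : R), IsOpenImmersion w →
        pb D' w = Ideal.span {β} → pb D w = Ideal.span {θ R w β}) ∧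
      ∀ (R R' T : CommRingCat.{u}) (w : Spec R ⟶ X) (w' : Spec R' ⟶ X) (φ : R ⟶ T) (φ' : R' ⟶ T)
        (β : R) (β' : R'), IsOpenImmersion w → IsOpenImmersion w' →
        IsOpenImmersion (Spec.map φ ≫ w) → Spec.map φ ≫ w = Spec.map φ' ≫ w' →
        pb D' w = Ideal.span {β} → pb D' w' = Ideal.span {β'} →
        φ.hom (θ R w β) * φ'.hom β' = φ'.hom (θ R' w' β') * φ.hom β := by
  classical
  obtain ⟨e, he⟩ := h
  -- Only local generators on open affines matter; elsewhere the value 0 is arbitrary.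
  let θ : ∀ (R : CommRingCat.{u}) (_ : Spec R ⟶ X), R → R := fun R w β ↦
    if hw : IsOpenImmersion w then if hβ : β ∈ pb D' w then
      (rangeIso w).hom.hom ((e (affineRange w)).symm ⟨(rangeIso w).inv.hom β,
        rangeIso_inv_mem w hβ⟩ : Γ(X, (affineRange w).1)) else 0 else 0
  have hθ : ∀ (R : CommRingCat.{u}) (w : Spec R ⟶ X) (β : R) (hw : IsOpenImmersion w)
      (hβ : β ∈ pb D' w), (rangeIso w).inv.hom (θ R w β) = ((e (affineRange w)).symm
        ⟨(rangeIso w).inv.hom β, rangeIso_inv_mem w hβ⟩ : Γ(X, (affineRange w).1)) := by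
    intro R w β hw hβ
    simp only [θ, dif_pos hw, dif_pos hβ]
    exact rangeIso_inv_hom w _
  have key : ∀ (R T : CommRingCat.{u}) (w : Spec R ⟶ X) (φ : R ⟶ T) (v : Spec T ⟶ X)
      (β : R) (hw : IsOpenImmersion w) (hv : IsOpenImmersion v) (hvw : v = Spec.map φ ≫ w)
      (hβ : β ∈ pb D' w), ∃ a : D.ideal (affineRange v),
        (a : Γ(X, (affineRange v).1)) = (rangeIso v).inv.hom (φ.hom (θ R w β)) ∧
        (e _ a : Γ(X, (affineRange v).1)) = (rangeIso v).inv.hom (φ.hom β) := by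
    intro R T w φ v β hw hv hvw hβ
    subst hvw
    have hres : ∀ r, X.presheaf.map (homOfLE (affineRange_comp_le w φ)).op
        ((rangeIso w).inv.hom r) = (rangeIso (Spec.map φ ≫ w)).inv.hom (φ.hom r) := by
      intro r
      have h1 := congrArg (fun f ↦ f.hom ((rangeIso w).inv.hom r))
        (map_rangeIso_hom w φ (affineRange_comp_le w φ))
      simp only [CommRingCat.hom_comp, RingHom.comp_apply] at h1
      exact (rangeIso_inv_hom _ _).symm.trans (congrArg (rangeIso (Spec.map φ ≫ w)).inv.hom
        (h1.trans (congrArg φ.hom (rangeIso_hom_inv w r))))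
    have hmem : θ R w β ∈ pb D w := by
      rw [pb_eq_map_rangeIso, ← rangeIso_hom_inv w (θ R w β), hθ R w β hw hβ]
      exact Ideal.mem_map_of_mem _ (Subtype.prop _)
    let a : D.ideal (affineRange (Spec.map φ ≫ w)) :=
      ⟨(rangeIso (Spec.map φ ≫ w)).inv.hom (φ.hom (θ R w β)), rangeIso_inv_mem _ (by
        rw [pb_comp]; exact Ideal.mem_map_of_mem _ hmem)⟩
    refine ⟨a, rfl, ?_⟩
    rw [he (affineRange (Spec.map φ ≫ w)) (affineRange w) (affineRange_comp_le w φ)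
      ((e (affineRange w)).symm ⟨(rangeIso w).inv.hom β, rangeIso_inv_mem w hβ⟩) a]
    · rw [LinearEquiv.apply_symm_apply]
      exact hres β
    · rw [← hθ R w β hw hβ]
      exact (hres _).symm
  refine ⟨θ, fun R w β hw hβ ↦ ?_, fun R R' T w w' φ φ' β β' hw hw' hT hww' hβ hβ' ↦ ?_⟩
  · have hβm : β ∈ pb D' w := hβ ▸ Ideal.mem_span_singleton_self β
    refine le_antisymm (fun x hx ↦ ?_) ?_
    · rw [Ideal.mem_span_singleton']
      have h1 : (rangeIso w).hom.hom (e _ ⟨(rangeIso w).inv.hom x, rangeIso_inv_mem w hx⟩ :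
          Γ(X, (affineRange w).1)) ∈ pb D' w := by
        rw [pb_eq_map_rangeIso]
        exact Ideal.mem_map_of_mem _ (Subtype.prop _)
      rw [hβ, Ideal.mem_span_singleton'] at h1
      obtain ⟨c, hc⟩ := h1
      refine ⟨c, ?_⟩
      have h2 : e _ ⟨(rangeIso w).inv.hom x, rangeIso_inv_mem w hx⟩ =
          (rangeIso w).inv.hom c • (⟨(rangeIso w).inv.hom β, rangeIso_inv_mem w hβm⟩ :
            D'.ideal (affineRange w)) := by
        apply Subtype.ext
        have h3 := congrArg (rangeIso w).inv.hom hc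
        rw [map_mul, rangeIso_inv_hom] at h3
        exact h3.symm
      have h4 := congrArg (e _).symm h2
      rw [LinearEquiv.symm_apply_apply, map_smul] at h4
      have h5 := congrArg (fun z : D.ideal (affineRange w) ↦
        (rangeIso w).hom.hom (z : Γ(X, (affineRange w).1))) h4
      simp only [Submodule.coe_smul, smul_eq_mul, map_mul] at h5
      have h6 := congrArg (rangeIso w).hom.hom (hθ R w β hw hβm)
      exact ((rangeIso_hom_inv w x).symm.trans h5 |>.trans (congrArg₂ (· * ·) (rangeIso_hom_inv w c)
        (h6.symm.trans (rangeIso_hom_inv w _)))).symm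
    · rw [Ideal.span_le, Set.singleton_subset_iff, SetLike.mem_coe, pb_eq_map_rangeIso,
        ← rangeIso_hom_inv w (θ R w β), hθ R w β hw hβm]
      exact Ideal.mem_map_of_mem _ (Subtype.prop _)
  · have hβm : β ∈ pb D' w := hβ ▸ Ideal.mem_span_singleton_self β
    have hβm' : β' ∈ pb D' w' := hβ' ▸ Ideal.mem_span_singleton_self β'
    obtain ⟨a, ha, hea⟩ := key R T w φ (Spec.map φ ≫ w) β hw hT rfl hβm
    obtain ⟨a', ha', hea'⟩ := key R' T w' φ' (Spec.map φ ≫ w) β' hw' hT hww' hβm'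
    -- Commutativity of the product, pushed through the linear map `e`, gives a·e(a') = a'·e(a),
    -- which is the independence of the ratio.
    have h1 : (a : Γ(X, (affineRange (Spec.map φ ≫ w)).1)) • a' =
        (a' : Γ(X, (affineRange (Spec.map φ ≫ w)).1)) • a := Subtype.ext (mul_comm _ _)
    have h2 := congrArg (fun z ↦ (e _ z : Γ(X, (affineRange (Spec.map φ ≫ w)).1))) h1
    simp only [map_smul, Submodule.coe_smul, smul_eq_mul, hea, hea', ha, ha', ← map_mul] at h2
    have h3 := congrArg (rangeIso (Spec.map φ ≫ w)).hom.hom h2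
    rwa [rangeIso_hom_inv, rangeIso_hom_inv] at h3

/-- A factor of a principal ideal whose other factor is generated by a non-zero-divisor is
principal. This is how C + D₁ ∼ D₂ makes C locally principal. -/
lemma exists_generator_of_span_mul {R : Type*} [CommRing R] {J : Ideal R} {δ γ : R}
    (hδ : δ ∈ nonZeroDivisors R) (h : J * Ideal.span {δ} = Ideal.span {γ}) :
    ∃ p, J = Ideal.span {p} ∧ p * δ = γ := by
  obtain ⟨p, hp, hpγ⟩ := Ideal.mem_mul_span_singleton.mp
    (h ▸ Ideal.mem_span_singleton_self γ : γ ∈ J * Ideal.span {δ})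
  refine ⟨p, le_antisymm (fun x hx ↦ ?_) (Ideal.span_le.mpr (by simpa using hp)), hpγ⟩
  have h1 : x * δ ∈ Ideal.span {γ} := h ▸ Ideal.mul_mem_mul hx (Ideal.mem_span_singleton_self δ)
  obtain ⟨c, hc⟩ := Ideal.mem_span_singleton'.mp h1
  refine Ideal.mem_span_singleton'.mpr ⟨c, ?_⟩
  have h2 : (c * p - x) * δ = 0 := by rw [← hpγ] at hc; linear_combination hc
  exact sub_eq_zero.mp (mem_nonZeroDivisors_iff_right.mp hδ _ h2)

/-- Inside a chart, two Cartier divisors have simultaneous local equations. -/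
lemma exists_pb_pair {D D' : X.IdealSheafData} (hD : IsEffectiveCartier D)
    (hD' : IsEffectiveCartier D') {A : CommRingCat.{u}} (J : Spec A ⟶ X) [IsOpenImmersion J]
    {x : X} (hx : x ∈ Set.range J) :
    ∃ (R : CommRingCat.{u}) (ν : A ⟶ R) (z : Spec R), IsOpenImmersion (Spec.map ν) ∧
      (Spec.map ν ≫ J) z = x ∧
      (∃ δ ∈ nonZeroDivisors R, pb D (Spec.map ν ≫ J) = Ideal.span {δ}) ∧
      ∃ δ ∈ nonZeroDivisors R, pb D' (Spec.map ν ≫ J) = Ideal.span {δ} := by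
  obtain ⟨R, w, y, hw, hy, s, hs, h⟩ := hD.exists_pb x
  obtain ⟨R', w', y', hw', hy', s', hs', h'⟩ := hD'.exists_pb x
  obtain ⟨T, φ, φ', z, h1, h2, h3, h4⟩ := exists_affine_overlap J w hx ⟨y, hy⟩
  obtain ⟨T', φ₂, φ₂', z', h1', h2', h3', h4'⟩ := exists_affine_overlap (Spec.map φ ≫ J) w'
    ⟨z, h4⟩ ⟨y', hy'⟩
  refine ⟨T', φ ≫ φ₂, z', ?_, ?_, ⟨(φ' ≫ φ₂).hom s, ?_, ?_⟩, ⟨φ₂'.hom s', ?_, ?_⟩⟩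
  · rw [Spec.map_comp]; infer_instance
  · rw [Spec.map_comp, Category.assoc]; exact h4'
  · have : IsOpenImmersion (Spec.map (φ' ≫ φ₂)) := by rw [Spec.map_comp]; infer_instance
    exact map_mem_nonZeroDivisors_of_isOpenImmersion _ hs
  · rw [Spec.map_comp, Category.assoc, h3, ← Category.assoc, ← Spec.map_comp, pb_comp, h,
      Ideal.map_span, Set.image_singleton]
  · exact map_mem_nonZeroDivisors_of_isOpenImmersion _ hs'
  · rw [Spec.map_comp, Category.assoc, h3', pb_comp, h', Ideal.map_span, Set.image_singleton]

end Transfer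

section IntegralSubscheme

variable {X : Scheme.{u}}

/-- The generic point of an integral closed subscheme. -/
def gen (C : X.IdealSheafData) [IsIntegral C.subscheme] : X :=
  C.subschemeι (genericPoint C.subscheme)

lemma support_eq_closure (C : X.IdealSheafData) [IsIntegral C.subscheme] :
    (C.support : Set X) = closure {gen C} := by
  have h1 := C.subschemeι.isClosedEmbedding.isClosedMap.closure_image_eq_of_continuous
    C.subschemeι.continuous {genericPoint C.subscheme}
  rw [Set.image_singleton, genericPoint_closure, Set.image_univ, C.range_subschemeι] at h1
  exact h1.symm

lemma eq_vanishingIdeal_of_support (C : X.IdealSheafData) [IsIntegral C.subscheme] (Z : Closeds X)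
    (h1 : gen C ∈ Z) (h2 : ∀ x ∈ Z, gen C ⤳ x) : C = vanishingIdeal Z := by
  rw [← vanishingIdeal_eq_of_isIntegral (I := C)]
  congr 1
  refine Closeds.ext ?_
  rw [support_eq_closure]
  refine subset_antisymm (closure_minimal (by simpa using h1) Z.isClosed) fun x hx ↦ ?_
  exact (h2 x hx).mem_closed isClosed_closure (subset_closure rfl)

lemma pb_eq_asIdeal (C : X.IdealSheafData) [IsIntegral C.subscheme] {R : CommRingCat.{u}}
    (w : Spec R ⟶ X) [IsOpenImmersion w] {y : Spec R} (hy : w y = gen C) : pb C w = y.asIdeal := by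
  rw [← vanishingIdeal_eq_of_isIntegral (I := C), pb_vanishingIdeal, support_eq_closure, ← hy]
  have h1 : w ⁻¹' closure {w y} = closure {y} := by
    rw [← Set.image_singleton, w.isOpenEmbedding.isInducing.closure_eq_preimage_closure_image]
  refine (congrArg PrimeSpectrum.vanishingIdeal h1).trans ?_
  exact (PrimeSpectrum.vanishingIdeal_closure _).trans (PrimeSpectrum.vanishingIdeal_singleton y)

/-- If `C + D₁` is linearly equivalent to an effective Cartier divisor, the prime ideal of `C` in
an affine chart is locally principal. -/
lemma exists_generator_asIdeal {C D₁ D₂ : X.IdealSheafData} [IsIntegral C.subscheme]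
    (h₁ : IsEffectiveCartier D₁) (h₂ : IsEffectiveCartier D₂) (h : LinearlyEquivalent (C * D₁) D₂)
    {A : CommRingCat.{u}} [IsDomain A] (J : Spec A ⟶ X) [IsOpenImmersion J] {y : Spec A}
    (hy : J y = gen C) :
    ∃ π ∈ y.asIdeal, ∀ x ∈ y.asIdeal, ∃ u ∉ y.asIdeal, ∃ c, u * x = c * π := by
  obtain ⟨θ, hθ, -⟩ := h.exists_transfer
  obtain ⟨R, ν, z, hν, hz, ⟨δ, hδ, hδ'⟩, ⟨γ, -, hγ⟩⟩ := exists_pb_pair h₁ h₂ J ⟨y, hy⟩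
  have h3 := hθ R (Spec.map ν ≫ J) γ inferInstance hγ
  rw [pb_mul, hδ'] at h3
  obtain ⟨p, hp, -⟩ := exists_generator_of_span_mul hδ h3
  have hzy : Spec.map ν z = y := J.isOpenEmbedding.injective (by
    rw [← Scheme.Hom.comp_apply, hz, hy])
  have hyp : y.asIdeal.IsPrime := y.2
  let Q := Localization.AtPrime y.asIdeal
  let π : A ⟶ .of Q := CommRingCat.ofHom (algebraMap A Q)
  have : IsLocalRing (CommRingCat.of Q) := inferInstanceAs (IsLocalRing Q)
  have hcl : Spec.map π (closedPt (.of Q)) = y :=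
    PrimeSpectrum.ext (Localization.AtPrime.under_maximalIdeal)
  obtain ⟨μ, hμ⟩ := exists_eq_SpecMap_comp_of_isLocalRing (Spec.map π) (Spec.map ν)
    ⟨z, by rw [hzy, hcl]⟩
  have h4 : y.asIdeal.map (algebraMap A Q) = Ideal.span {μ.hom p} := by
    have h5 := pb_comp C π J
    rw [hμ, Category.assoc, pb_comp, hp, pb_eq_asIdeal C J hy, Ideal.map_span,
      Set.image_singleton] at h5
    exact h5.symm
  generalize μ.hom p = g at h4
  obtain ⟨⟨a, u⟩, hau⟩ := IsLocalization.surj y.asIdeal.primeCompl g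
  have hmem : ∀ x, algebraMap A Q x ∈ y.asIdeal.map (algebraMap A Q) ↔ x ∈ y.asIdeal := by
    intro x
    rw [Localization.AtPrime.map_eq_maximalIdeal]
    exact IsLocalization.AtPrime.to_map_mem_maximal_iff Q y.asIdeal x
  have hinj : Function.Injective (algebraMap A Q) := IsLocalization.injective Q
    y.asIdeal.primeCompl_le_nonZeroDivisors
  refine ⟨a, ?_, fun x hx ↦ ?_⟩
  · rw [← hmem, ← hau, h4]
    exact Ideal.mul_mem_right _ _ (Ideal.mem_span_singleton_self g)
  · rw [← hmem, h4, Ideal.mem_span_singleton'] at hx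
    obtain ⟨c, hc⟩ := hx
    obtain ⟨⟨c', v⟩, hcv⟩ := IsLocalization.surj y.asIdeal.primeCompl c
    refine ⟨v * u, fun hmem ↦ ?_, c', hinj ?_⟩
    · exact (hyp.mem_or_mem hmem).elim v.2 u.2
    · simp only [map_mul]
      rw [← hau, ← hcv, ← hc]
      ring

end IntegralSubscheme

end LangerSurface
end

/-! ### Charts of the surface over k and equations of the lines in them. -/

noncomputable section
namespace LangerSurface

open MvPolynomial Scheme.IdealSheafData

attribute [local instance] MvPolynomial.gradedAlgebra

section ChartRing

variable {F k : Type*} [Field F] [Fintype F] [Field k] [Algebra F k]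

lemma prime_add_mul_X {c₁ c₂ : k} (h : c₂ ≠ 0) :
    Prime (C c₁ + C c₂ * X 1 : MvPolynomial (Fin 2) k) := by
  let e : MvPolynomial (Fin 2) k ≃ₐ[k] MvPolynomial (Fin 2) k :=
    AlgEquiv.ofAlgHom (aeval ![X 0, C c₁ + C c₂ * X 1]) (aeval ![X 0, C c₂⁻¹ * (X 1 - C c₁)])
      (by
        ext1 i
        fin_cases i
        · simp
        · simp only [AlgHom.comp_apply, AlgHom.id_apply, aeval_X, Fin.mk_one, Matrix.cons_val_one,
            Matrix.cons_val_fin_one, map_mul, map_sub, ← MvPolynomial.algebraMap_eq,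
            AlgHom.commutes]
          rw [add_sub_cancel_left, ← mul_assoc, ← map_mul, inv_mul_cancel₀ h, map_one, one_mul])
      (by
        ext1 i
        fin_cases i
        · simp
        · simp only [AlgHom.comp_apply, AlgHom.id_apply, aeval_X, Fin.mk_one, Matrix.cons_val_one,
            Matrix.cons_val_fin_one, map_mul, map_add, ← MvPolynomial.algebraMap_eq,
            AlgHom.commutes]
          rw [← mul_assoc, ← map_mul, mul_inv_cancel₀ h, map_one, one_mul, add_sub_cancel])
  have h1 := (MulEquiv.prime_iff (p := (X 1 : MvPolynomial (Fin 2) k)) e.toMulEquiv).mpr X_prime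
  have h2 : e.toMulEquiv (X 1) = C c₁ + C c₂ * X 1 := by
    change aeval ![X 0, C c₁ + C c₂ * X 1] (X 1) = _
    simp
  rwa [h2] at h1

namespace ChartRing

lemma prime_algebraMap {p : MvPolynomial (Fin 2) k} (hp : Prime p)
    (hu : ¬ IsUnit (algebraMap _ (ChartRing F k) p)) :
    Prime (algebraMap _ (ChartRing F k) p) := by
  have hp0 : algebraMap _ (ChartRing F k) p ≠ 0 :=
    (map_ne_zero_iff _ algebraMap_injective).mpr hp.ne_zero
  rw [← Ideal.span_singleton_prime hp0, ← Set.image_singleton, ← Ideal.map_span]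
  refine IsLocalization.isPrime_of_isPrime_disjoint (Submonoid.powers (chartDenom F k)) _ _
    ((Ideal.span_singleton_prime hp.ne_zero).mpr hp) ?_
  rw [Set.disjoint_left]
  rintro _ ⟨n, rfl⟩ hn
  rw [SetLike.mem_coe, Ideal.mem_span_singleton] at hn
  exact hu (isUnit_of_dvd_unit (map_dvd _ hn) (by
    rw [map_pow]
    exact (IsLocalization.Away.algebraMap_isUnit (S := ChartRing F k) (chartDenom F k)).pow n))

lemma not_isUnit_algebraMap {p : MvPolynomial (Fin 2) k} {x : k} (hx : eval ![0, x] p = 0) :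
    ¬ IsUnit (algebraMap _ (ChartRing F k) p) := fun h ↦ by
  have h1 := h.map (lift (F := F) (RingHom.id k) 0 x (isChartPoint_zero _ _))
  rw [lift_algebraMap_poly] at h1
  exact h1.ne_zero hx

lemma prime_s : Prime (s F k) :=
  prime_algebraMap X_prime (not_isUnit_algebraMap (x := 0) (by simp))

lemma not_s_dvd {p : MvPolynomial (Fin 2) k} {x : k} (hx : eval ![0, x] p ≠ 0) :
    ¬ s F k ∣ algebraMap _ (ChartRing F k) p := fun h ↦ by
  have h1 := map_dvd (lift (F := F) (RingHom.id k) 0 x (isChartPoint_zero _ _)) h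
  rw [lift_algebraMap_poly, lift_s, zero_dvd_iff] at h1
  exact hx h1

lemma not_s_dvd_t : ¬ s F k ∣ t F k := not_s_dvd (x := 1) (by simp)

/-- The base change of the chart ring. -/
def baseChange : ChartRing F F →+* ChartRing F k :=
  lift (algebraMap F (ChartRing F k)) (s F k) (t F k) isChartPoint_st

instance : IsDomain (CommRingCat.of (ChartRing F k)) := inferInstanceAs (IsDomain (ChartRing F k))

end ChartRing

/-- The chart ring over k has the universal property of the base change: a homomorphism out of it
amounts to scalars together with the values of s and t. -/
lemma isPushout_chartRing {F k : Type u} [Field F] [Fintype F] [Field k] [Algebra F k] :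
    IsPushout (CommRingCat.ofHom (algebraMap F (ChartRing F F)))
      (CommRingCat.ofHom (algebraMap F k)) (CommRingCat.ofHom (ChartRing.baseChange (F := F) (k := k)))
      (CommRingCat.ofHom (algebraMap k (ChartRing F k))) := by
  refine ⟨⟨?_⟩, ⟨PushoutCocone.IsColimit.mk _ (fun c ↦ ?_) (fun c ↦ ?_) (fun c ↦ ?_)
    (fun c m h₁ h₂ ↦ ?_)⟩⟩
  · ext x
    exact (ChartRing.lift_algebraMap (F := F) (k := F) (algebraMap F (ChartRing F k)) (ChartRing.s F k)
      (ChartRing.t F k) ChartRing.isChartPoint_st x).trans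
      (IsScalarTower.algebraMap_apply F k (ChartRing F k) x)
  · refine CommRingCat.ofHom (ChartRing.lift (F := F) c.inr.hom (c.inl.hom (ChartRing.s F F))
      (c.inl.hom (ChartRing.t F F)) ?_)
    have h1 : c.inr.hom.comp (algebraMap F k) = c.inl.hom.comp (algebraMap F (ChartRing F F)) :=
      congrArg CommRingCat.Hom.hom c.condition.symm
    rw [h1]
    exact ChartRing.isChartPoint_st.map c.inl.hom
  · ext1
    refine ChartRing.hom_ext (fun x ↦ ?_) ?_ ?_
    · have h1 := congrArg (fun f ↦ f.hom x) c.condition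
      simp only [CommRingCat.hom_comp, RingHom.comp_apply, CommRingCat.hom_ofHom] at h1
      simp only [CommRingCat.hom_comp, RingHom.comp_apply, CommRingCat.hom_ofHom,
        ChartRing.baseChange, ChartRing.lift_algebraMap]
      rw [IsScalarTower.algebraMap_apply F k (ChartRing F k), ChartRing.lift_algebraMap]
      exact h1.symm
    · simp [ChartRing.baseChange, ChartRing.lift_s]
    · simp [ChartRing.baseChange, ChartRing.lift_t]
  · ext x
    simp only [CommRingCat.hom_comp, RingHom.comp_apply, CommRingCat.hom_ofHom,
      ChartRing.lift_algebraMap]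
  · ext1
    refine ChartRing.hom_ext (fun x ↦ ?_) ?_ ?_
    · simp only [CommRingCat.hom_ofHom, ChartRing.lift_algebraMap]
      exact congrArg (fun f ↦ f.hom x) h₂
    · simp only [CommRingCat.hom_ofHom, ChartRing.lift_s]
      rw [← h₁]
      simp [ChartRing.baseChange, ChartRing.lift_s]
    · simp only [CommRingCat.hom_ofHom, ChartRing.lift_t]
      rw [← h₁]
      simp [ChartRing.baseChange, ChartRing.lift_t]

end ChartRing

/-- A nonzero form has a nonzero value at some vector of the basis, and the first value is excluded.
-/
lemma exists_coeff_ne_zero {F : Type u} [Field F] {b : Frame F} {a : Fin 3 → F} (ha : a ≠ 0)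
    (h : ∑ i, a i * b.pt i = 0) : ∑ i, a i * b.M i 1 ≠ 0 ∨ ∑ i, a i * b.M i 2 ≠ 0 := by
  by_contra! hcon
  apply ha
  change ∑ i, a i * b.M i 0 = 0 at h
  have h1 : a = Matrix.vecMul (Matrix.vecMul a b.M) b.N := by
    rw [Matrix.vecMul_vecMul, b.mul_eq, Matrix.vecMul_one]
  have h2 : Matrix.vecMul a b.M = 0 := by
    ext j
    match j with
    | 0 => exact h
    | 1 => exact hcon.1
    | 2 => exact hcon.2
  rw [h1, h2, Matrix.zero_vecMul]

section

variable {F : Type u} [Field F] [Fintype F] {X₀ : Scheme.{u}} {f₀ : X₀ ⟶ P2 F}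
  (k : Type u) [Field k] [Algebra F k]

/-- The chart of the surface. -/
def surfaceChart (hF : Nat.card F = 2) (hf₀ : IsBlowupAtRatPoints f₀) (b : Frame F) :
    Spec (.of (ChartRing F k)) ⟶ surface k f₀ :=
  pullback.lift (chartMap hF hf₀ b (R := .of (ChartRing F k)) (algebraMap F (ChartRing F k))
    (ChartRing.s F k) (ChartRing.t F k) ChartRing.isChartPoint_st)
    (Spec.map (CommRingCat.ofHom (algebraMap k (ChartRing F k)))) (by
      rw [chartMap, Category.assoc, blowupChart_comp_toSpec, ← Spec.map_comp, ← Spec.map_comp]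
      exact congrArg _ isPushout_chartRing.w)

lemma surfaceChart_proj (hF : Nat.card F = 2) (hf₀ : IsBlowupAtRatPoints f₀) (b : Frame F) :
    surfaceChart k hF hf₀ b ≫ surface.proj k f₀ =
      chartMap hF hf₀ b (R := .of (ChartRing F k)) (algebraMap F (ChartRing F k))
        (ChartRing.s F k) (ChartRing.t F k) ChartRing.isChartPoint_st :=
  pullback.lift_fst _ _ _

lemma surfaceChart_toSpec (hF : Nat.card F = 2) (hf₀ : IsBlowupAtRatPoints f₀) (b : Frame F) :
    surfaceChart k hF hf₀ b ≫ surface.toSpec k f₀ =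
      Spec.map (CommRingCat.ofHom (algebraMap k (ChartRing F k))) :=
  pullback.lift_snd _ _ _

lemma surfaceChart_plane (hF : Nat.card F = 2) (hf₀ : IsBlowupAtRatPoints f₀) (b : Frame F) :
    surfaceChart k hF hf₀ b ≫ surface.proj k f₀ ≫ f₀ =
      b.chartToPlane (R := .of (ChartRing F k)) (algebraMap F (ChartRing F k))
        (ChartRing.s F k) (ChartRing.t F k) ChartRing.isChartPoint_st := by
  rw [← Category.assoc, surfaceChart_proj, chartMap_comp]

lemma isPullback_surfaceChart (hF : Nat.card F = 2) (hf₀ : IsBlowupAtRatPoints f₀) (b : Frame F) :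
    IsPullback (Spec.map (CommRingCat.ofHom (ChartRing.baseChange (F := F) (k := k))))
      (surfaceChart k hF hf₀ b) (blowupChart hF hf₀ b) (surface.proj k f₀) := by
  refine IsPullback.of_bot (v₂₁ := surface.toSpec k f₀) (v₂₂ := f₀ ≫ P2.toSpec F)
    (h₃₁ := Spec.map (CommRingCat.ofHom (algebraMap F k))) ?_ ?_ (IsPullback.of_hasPullback _ _)
  · rw [surfaceChart_toSpec, blowupChart_comp_toSpec]
    exact isPullback_SpecMap_of_isPushout _ _ _ _ isPushout_chartRing
  · rw [surfaceChart_proj]; rfl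

instance isOpenImmersion_surfaceChart (hF : Nat.card F = 2) (hf₀ : IsBlowupAtRatPoints f₀)
    (b : Frame F) : IsOpenImmersion (surfaceChart k hF hf₀ b) :=
  MorphismProperty.of_isPullback (P := @IsOpenImmersion) (isPullback_surfaceChart k hF hf₀ b)
    inferInstance

lemma mem_range_surfaceChart (hF : Nat.card F = 2) (hf₀ : IsBlowupAtRatPoints f₀) (b : Frame F)
    {x : surface k f₀} (hx : surface.proj k f₀ x ∈ Set.range (blowupChart hF hf₀ b)) :
    x ∈ Set.range (surfaceChart k hF hf₀ b) := by
  have h1 : x ∈ Set.range (pullback.snd (blowupChart hF hf₀ b) (surface.proj k f₀)) := by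
    rw [Scheme.Pullback.range_snd]; exact hx
  obtain ⟨z, hz⟩ := h1
  refine ⟨(isPullback_surfaceChart k hF hf₀ b).isoPullback.inv z, ?_⟩
  rw [← hz, ← Scheme.Hom.comp_apply, IsPullback.isoPullback_inv_snd]

lemma exists_mem_range_surfaceChart (hF : Nat.card F = 2) (hf₀ : IsBlowupAtRatPoints f₀)
    (x : surface k f₀) : ∃ b : Frame F, x ∈ Set.range (surfaceChart k hF hf₀ b) := by
  obtain ⟨b, hb⟩ := exists_mem_range_blowupChart hF hf₀ (surface.proj k f₀ x)
  exact ⟨b, mem_range_surfaceChart k hF hf₀ b hb⟩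

lemma mem_range_surfaceChart_or (hF : Nat.card F = 2) (hf₀ : IsBlowupAtRatPoints f₀) (b : Frame F)
    {x : surface k f₀} (hx : f₀ (surface.proj k f₀ x) ∈ Proj.basicOpen (grading F) b.denom) :
    x ∈ Set.range (surfaceChart k hF hf₀ b) ∨ x ∈ Set.range (surfaceChart k hF hf₀ b.swap) :=
  (mem_range_blowupChart hF hf₀ b hx).imp (mem_range_surfaceChart k hF hf₀ b)
    (mem_range_surfaceChart k hF hf₀ b.swap)

/-- Where t is invertible, (s t, t⁻¹) are coordinates in the other chart. -/
lemma surfaceChart_mem_range_swap (hF : Nat.card F = 2) (hf₀ : IsBlowupAtRatPoints f₀) (b : Frame F)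
    {y : Spec (.of (ChartRing F k))} (hy : ChartRing.t F k ∉ y.asIdeal) :
    surfaceChart k hF hf₀ b y ∈ Set.range (surfaceChart k hF hf₀ b.swap) := by
  refine mem_range_surfaceChart k hF hf₀ _ ?_
  rw [← Scheme.Hom.comp_apply, surfaceChart_proj]
  obtain ⟨T, ψ, -, ⟨u, hu⟩, hψ⟩ := exists_toAway (R := .of (ChartRing F k)) (ChartRing.t F k)
  obtain ⟨z, rfl⟩ := (hψ y).mpr hy
  rw [← Scheme.Hom.comp_apply, SpecMap_chartMap,
    chartMap_swap hF hf₀ b (t' := ↑u⁻¹) (by rw [← hu, Units.mul_inv])]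
  exact ⟨_, (Scheme.Hom.comp_apply _ _ _).symm⟩

lemma plane_surfaceChart (hF : Nat.card F = 2) (hf₀ : IsBlowupAtRatPoints f₀) (b : Frame F)
    (y : Spec (.of (ChartRing F k))) : f₀ (surface.proj k f₀ (surfaceChart k hF hf₀ b y)) =
      b.chartToPlane (R := .of (ChartRing F k)) (algebraMap F (ChartRing F k))
        (ChartRing.s F k) (ChartRing.t F k) ChartRing.isChartPoint_st y := by
  rw [← surfaceChart_plane, Scheme.Hom.comp_apply, Scheme.Hom.comp_apply]

lemma surfaceChart_mem_ratPoint (hF : Nat.card F = 2) (hf₀ : IsBlowupAtRatPoints f₀) (b : Frame F)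
    (y : Spec (.of (ChartRing F k))) {v : Fin 3 → F} (hv : v ≠ 0) :
    f₀ (surface.proj k f₀ (surfaceChart k hF hf₀ b y)) ∈ (ratPoint v : Set (P2 F)) ↔
      v = b.pt ∧ ChartRing.s F k ∈ y.asIdeal := by
  rw [plane_surfaceChart, Frame.chartToPlane, b.map_mem_ratPoint hF _ _ _ _ hv]
  exact and_congr_right fun _ ↦ and_iff_left_of_imp fun h ↦ Ideal.mul_mem_right _ _ h

/-- The equation of the proper transform of a line in a chart. -/
def lineEq (b : Frame F) (a : Fin 3 → F) : ChartRing F k :=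
  open Classical in
  if ∑ i, a i * b.pt i = 0 then algebraMap F _ (∑ i, a i * b.M i 1) +
    algebraMap F _ (∑ i, a i * b.M i 2) * ChartRing.t F k else 1

lemma lineEq_of_eq_zero {b : Frame F} {a : Fin 3 → F} (h : ∑ i, a i * b.pt i = 0) :
    lineEq k b a = algebraMap F _ (∑ i, a i * b.M i 1) +
      algebraMap F _ (∑ i, a i * b.M i 2) * ChartRing.t F k := if_pos h

lemma lineEq_of_ne_zero {b : Frame F} {a : Fin 3 → F} (h : ∑ i, a i * b.pt i ≠ 0) :
    lineEq k b a = 1 := if_neg h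

lemma ev_form_of_eq_zero {b : Frame F} {a : Fin 3 → F} (h : ∑ i, a i * b.pt i = 0) :
    b.ev (algebraMap F (ChartRing F k)) (ChartRing.s F k) (ChartRing.s F k * ChartRing.t F k)
      (form a) = ChartRing.s F k * lineEq k b a := by
  rw [lineEq_of_eq_zero k h, b.ev_form]
  change ∑ l, a l * b.M l 0 = 0 at h
  rw [h, map_zero]
  ring

lemma isUnit_ev_form {b : Frame F} {a : Fin 3 → F} (hF : Nat.card F = 2)
    (h : ∑ i, a i * b.pt i ≠ 0) {R : Type*} [CommRing R] {φ : MvPolynomial (Fin 3) F →+* R}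
    (hφ : IsUnit (φ b.denom)) : IsUnit (φ (form a)) :=
  (b.isUnit_denom_iff φ).mp hφ a ((eq_zero_or_one_of_card hF _).resolve_left h)

lemma isUnit_chart_denom (b : Frame F) :
    IsUnit (b.ev (algebraMap F (ChartRing F k)) (ChartRing.s F k)
      (ChartRing.s F k * ChartRing.t F k) b.denom) :=
  b.isUnit_ev_denom_iff.mpr ChartRing.isChartPoint_st

lemma lineEq_eq_algebraMap {b : Frame F} {a : Fin 3 → F} (h : ∑ i, a i * b.pt i = 0) :
    lineEq k b a = algebraMap (MvPolynomial (Fin 2) k) (ChartRing F k) (C (algebraMap F k (∑ i, a i * b.M i 1)) +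
      C (algebraMap F k (∑ i, a i * b.M i 2)) * X 1) := by
  rw [lineEq_of_eq_zero k h, map_add, map_mul, IsScalarTower.algebraMap_apply F k (ChartRing F k),
    IsScalarTower.algebraMap_apply F k (ChartRing F k),
    IsScalarTower.algebraMap_apply k (MvPolynomial (Fin 2) k) (ChartRing F k),
    IsScalarTower.algebraMap_apply k (MvPolynomial (Fin 2) k) (ChartRing F k),
    MvPolynomial.algebraMap_eq]
  rfl

lemma prime_lineEq {b : Frame F} {a : Fin 3 → F} (h : ∑ i, a i * b.pt i = 0)
    (h2 : ∑ i, a i * b.M i 2 ≠ 0) : Prime (lineEq k b a) := by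
  have h2' : algebraMap F k (∑ i, a i * b.M i 2) ≠ 0 :=
    (map_ne_zero_iff _ (algebraMap F k).injective).mpr h2
  rw [lineEq_eq_algebraMap k h]
  refine ChartRing.prime_algebraMap (prime_add_mul_X h2') (ChartRing.not_isUnit_algebraMap
    (F := F) (x := -(algebraMap F k (∑ i, a i * b.M i 2))⁻¹ * algebraMap F k (∑ i, a i * b.M i 1)) ?_)
  simp only [map_add, map_mul, eval_C, eval_X, Matrix.cons_val_one, Matrix.cons_val_fin_one]
  field_simp
  ring

/-- Either the line misses b₀ and the equation is 1, or the coefficient of t vanishes and the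
equation is a nonzero constant. The remaining lines have a prime equation. -/
lemma isUnit_lineEq {b : Frame F} {a : Fin 3 → F} (ha : a ≠ 0)
    (h2 : ∑ i, a i * b.pt i = 0 → ∑ i, a i * b.M i 2 = 0) : IsUnit (lineEq k b a) := by
  by_cases h : ∑ i, a i * b.pt i = 0
  · have h1 := (exists_coeff_ne_zero ha h).resolve_right (not_not.mpr (h2 h))
    rw [lineEq_of_eq_zero k h, h2 h, map_zero, zero_mul, add_zero]
    exact (IsUnit.mk0 _ h1).map _
  · rw [lineEq_of_ne_zero k h]
    exact isUnit_one

lemma not_lineEq_dvd_s {b : Frame F} {a : Fin 3 → F} (h : ∑ i, a i * b.pt i = 0)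
    (h2 : ∑ i, a i * b.M i 2 ≠ 0) : ¬ lineEq k b a ∣ ChartRing.s F k := by
  intro hd
  have h3 : Associated (lineEq k b a) (ChartRing.s F k) :=
    (prime_lineEq k h h2).irreducible.associated_of_dvd ChartRing.prime_s.irreducible hd
  have h4 := h3.symm.dvd
  rw [lineEq_eq_algebraMap k h] at h4
  have h2' : algebraMap F k (∑ i, a i * b.M i 2) ≠ 0 :=
    (map_ne_zero_iff _ (algebraMap F k).injective).mpr h2
  refine ChartRing.not_s_dvd (F := F) (x := (algebraMap F k (∑ i, a i * b.M i 2))⁻¹ *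
    (1 - algebraMap F k (∑ i, a i * b.M i 1))) ?_ h4
  simp only [map_add, map_mul, eval_C, eval_X, Matrix.cons_val_one, Matrix.cons_val_fin_one]
  rw [mul_inv_cancel_left₀ h2']
  simp

end

end LangerSurface
end

/-! ### Exceptional curves and proper transforms in the charts, and how to recognise them. -/

noncomputable section
namespace LangerSurface

open MvPolynomial Scheme.IdealSheafData

attribute [local instance] MvPolynomial.gradedAlgebra

section

variable {F : Type u} [Field F]

/-- The coordinate vector of a common point is proportional to the cross product of a and c; each
required relation is an explicit combination of the two forms. -/
lemma ratLine_inf_ratLine {a c : Fin 3 → F} {x : P2 F} (ha : x ∈ (ratLine a : Set (P2 F)))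
    (hc : x ∈ (ratLine c : Set (P2 F))) :
    x ∈ (ratPoint ![a 1 * c 2 - a 2 * c 1, a 2 * c 0 - a 0 * c 2, a 0 * c 1 - a 1 * c 0] :
      Set (P2 F)) := by
  have ha' : form a ∈ x.asHomogeneousIdeal.toIdeal := ha rfl
  have hc' : form c ∈ x.asHomogeneousIdeal.toIdeal := hc rfl
  rintro _ ⟨⟨i, j⟩, rfl⟩
  change _ ∈ x.asHomogeneousIdeal.toIdeal
  have key : ∀ p q : MvPolynomial (Fin 3) F, p * form a + q * form c ∈
      x.asHomogeneousIdeal.toIdeal := fun p q ↦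
    Ideal.add_mem _ (Ideal.mul_mem_left _ _ ha') (Ideal.mul_mem_left _ _ hc')
  have h0 : ∀ p : MvPolynomial (Fin 3) F, p = 0 → p ∈ x.asHomogeneousIdeal.toIdeal :=
    fun p hp ↦ hp ▸ Ideal.zero_mem _
  simp only [form, Fin.sum_univ_three] at key
  fin_cases i <;> fin_cases j
  · exact h0 _ (by simp)
  · convert key (C (c 2)) (-C (a 2)) using 1
    simp; ring
  · convert key (-C (c 1)) (C (a 1)) using 1
    simp; ring
  · convert key (-C (c 2)) (C (a 2)) using 1
    simp; ring
  · exact h0 _ (by simp)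
  · convert key (C (c 0)) (-C (a 0)) using 1
    simp; ring
  · convert key (C (c 1)) (-C (a 1)) using 1
    simp; ring
  · convert key (-C (c 0)) (C (a 0)) using 1
    simp; ring
  · exact h0 _ (by simp)

lemma cross_ne_zero {a c v : Fin 3 → F} (ha : a ≠ 0) (hav : ∑ i, a i * v i = 0)
    (hcv : ∑ i, c i * v i = 1) :
    ![a 1 * c 2 - a 2 * c 1, a 2 * c 0 - a 0 * c 2, a 0 * c 1 - a 1 * c 0] ≠ 0 := by
  intro h
  have h0 : a 1 * c 2 - a 2 * c 1 = 0 := congrFun h 0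
  have h1 : a 2 * c 0 - a 0 * c 2 = 0 := congrFun h 1
  have h2 : a 0 * c 1 - a 1 * c 0 = 0 := congrFun h 2
  rw [Fin.sum_univ_three] at hav hcv
  apply ha
  ext i
  match i with
  | 0 => change a 0 = 0; linear_combination (-a 0) * hcv + c 0 * hav + v 1 * h2 - v 2 * h1
  | 1 => change a 1 = 0; linear_combination (-a 1) * hcv + c 1 * hav + v 2 * h0 - v 0 * h2
  | 2 => change a 2 = 0; linear_combination (-a 2) * hcv + c 2 * hav + v 0 * h1 - v 1 * h0

variable [Fintype F]

lemma Frame.mem_basicOpen_denom (b : Frame F) (x : P2 F) :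
    x ∈ Proj.basicOpen (grading F) b.denom ↔
      ∀ a : Fin 3 → F, ∑ l, a l * b.pt l = 1 → x ∉ (ratLine a : Set (P2 F)) := by
  have hp : x.asHomogeneousIdeal.toIdeal.IsPrime := x.isPrime
  have h1 : ∀ f, IsUnit (algebraMap (MvPolynomial (Fin 3) F)
      (Localization.AtPrime x.asHomogeneousIdeal.toIdeal) f) ↔
        f ∉ x.asHomogeneousIdeal.toIdeal := fun f ↦
    IsLocalization.AtPrime.isUnit_to_map_iff _ x.asHomogeneousIdeal.toIdeal f
  refine (h1 b.denom).symm.trans ((b.isUnit_denom_iff _).trans ?_)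
  refine forall₂_congr fun a _ ↦ (h1 _).trans (not_congr ?_)
  change _ ↔ {form a} ⊆ (x.asHomogeneousIdeal.toIdeal : Set _)
  rw [Set.singleton_subset_iff]; rfl

variable {X₀ : Scheme.{u}} {f₀ : X₀ ⟶ P2 F} (k : Type u) [Field k] [Algebra F k]

lemma surfaceChart_mem_ratLine (hF : Nat.card F = 2) (hf₀ : IsBlowupAtRatPoints f₀) (b : Frame F)
    (y : Spec (.of (ChartRing F k))) (a : Fin 3 → F) :
    f₀ (surface.proj k f₀ (surfaceChart k hF hf₀ b y)) ∈ (ratLine a : Set (P2 F)) ↔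
      ∑ i, a i * b.pt i = 0 ∧ ChartRing.s F k * lineEq k b a ∈ y.asIdeal := by
  rw [plane_surfaceChart, Frame.chartToPlane, Frame.map, P2pt_mem_ratLine]
  constructor
  · intro h
    have h0 : ∑ i, a i * b.pt i = 0 := by
      by_contra hne
      exact y.2.ne_top (Ideal.eq_top_of_isUnit_mem _ h
        (isUnit_ev_form hF hne (isUnit_chart_denom k b)))
    rw [ev_form_of_eq_zero k h0] at h
    exact ⟨h0, h⟩
  · rintro ⟨h0, h⟩
    rw [ev_form_of_eq_zero k h0]
    exact h

/-- The witness is the generic point of the zero locus of the line equation. It lies off the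
exceptional curve because the line equation does not divide s. -/
lemma mem_closure_lineEq {b : Frame F} {a : Fin 3 → F} (ha : a ≠ 0)
    (y : Spec (.of (ChartRing F k))) (hy : lineEq k b a ∈ y.asIdeal) :
    ∃ z : Spec (.of (ChartRing F k)), z ⤳ y ∧ ∑ i, a i * b.pt i = 0 ∧
      z.asIdeal = Ideal.span {lineEq k b a} ∧ ChartRing.s F k ∉ z.asIdeal := by
  have hnu : ¬ IsUnit (lineEq k b a) := fun hu ↦ y.2.ne_top (Ideal.eq_top_of_isUnit_mem _ hy hu)
  have h0 : ∑ i, a i * b.pt i = 0 := by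
    by_contra h
    exact hnu (by rw [lineEq_of_ne_zero k h]; exact isUnit_one)
  have h2 : ∑ i, a i * b.M i 2 ≠ 0 := fun h ↦ hnu (isUnit_lineEq k ha fun _ ↦ h)
  have hp := prime_lineEq k h0 h2
  refine ⟨⟨Ideal.span {lineEq k b a}, (Ideal.span_singleton_prime hp.ne_zero).mpr hp⟩, ?_, h0, rfl,
    fun h ↦ not_lineEq_dvd_s k h0 h2 (Ideal.mem_span_singleton.mp h)⟩
  exact (PrimeSpectrum.le_iff_specializes _ y).mp ((Ideal.span_singleton_le_iff_mem _).mpr hy)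

/-- The pulled-back line has equation s times `lineEq`, so off s = 0 it is the zero locus of
`lineEq`. Taking the closure adds nothing, since that locus is closed and its generic point is off s
= 0. Closures may be computed in the chart because the chart is open. -/
lemma blowupChart_mem_properTransform (hF : Nat.card F = 2) (hf₀ : IsBlowupAtRatPoints f₀)
    (b : Frame F) (y : Spec (.of (ChartRing F F))) {a : Fin 3 → F} (ha : a ≠ 0) :
    blowupChart hF hf₀ b y ∈ (properTransform f₀ a : Set X₀) ↔ lineEq F b a ∈ y.asIdeal := by
  have hpre : ∀ z, blowupChart hF hf₀ b z ∈
      f₀ ⁻¹' ((ratLine a : Set (P2 F)) \ (ratPoints F : Set (P2 F))) ↔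
      ∑ i, a i * b.pt i = 0 ∧ lineEq F b a ∈ z.asIdeal ∧ ChartRing.s F F ∉ z.asIdeal := by
    intro z
    have h1 : f₀ (blowupChart hF hf₀ b z) = _ := (Scheme.Hom.comp_apply _ _ _).symm.trans
      (congrArg (fun f : Spec (.of (ChartRing F F)) ⟶ P2 F ↦ f z) (blowupChart_comp hF hf₀ b))
    rw [Set.mem_preimage, h1, Set.mem_sdiff, Frame.chartToPlane, b.map_mem_ratPoints hF, Frame.map,
      P2pt_mem_ratLine]
    constructor
    · rintro ⟨h2, h3⟩
      have h0 : ∑ i, a i * b.pt i = 0 := by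
        by_contra hne
        exact z.2.ne_top (Ideal.eq_top_of_isUnit_mem _ h2
          (isUnit_ev_form hF hne (isUnit_chart_denom F b)))
      have hs : ChartRing.s F F ∉ z.asIdeal := fun hs ↦ h3 ⟨hs, Ideal.mul_mem_right _ _ hs⟩
      rw [ev_form_of_eq_zero F h0] at h2
      exact ⟨h0, (z.2.mem_or_mem h2).resolve_left hs, hs⟩
    · rintro ⟨h0, h2, h3⟩
      rw [ev_form_of_eq_zero F h0]
      exact ⟨Ideal.mul_mem_left _ _ h2, fun h ↦ h3 h.1⟩
  have hcl : blowupChart hF hf₀ b ⁻¹' (properTransform f₀ a : Set X₀) =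
      closure (blowupChart hF hf₀ b ⁻¹'
        (f₀ ⁻¹' ((ratLine a : Set (P2 F)) \ (ratPoints F : Set (P2 F))))) :=
    (blowupChart hF hf₀ b).isOpenEmbedding.isOpenMap.preimage_closure_eq_closure_preimage
      (blowupChart hF hf₀ b).continuous _
  change y ∈ blowupChart hF hf₀ b ⁻¹' (properTransform f₀ a : Set X₀) ↔ _
  rw [hcl]
  constructor
  · intro hy
    have hclosed : IsClosed (PrimeSpectrum.zeroLocus {lineEq F b a}) :=
      PrimeSpectrum.isClosed_zeroLocus _
    have h1 : y ∈ PrimeSpectrum.zeroLocus {lineEq F b a} := by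
      refine closure_minimal ?_ hclosed hy
      intro z hz
      exact Set.singleton_subset_iff.mpr ((hpre z).mp hz).2.1
    exact Set.singleton_subset_iff.mp h1
  · intro hy
    obtain ⟨z, hz, h0, h1, h2⟩ := mem_closure_lineEq F ha y hy
    refine hz.mem_closed isClosed_closure (subset_closure ((hpre z).mpr ⟨h0, ?_, h2⟩))
    rw [h1]
    exact Ideal.mem_span_singleton_self _

lemma surfaceChart_mem_properTransform (hF : Nat.card F = 2) (hf₀ : IsBlowupAtRatPoints f₀)
    (b : Frame F) (y : Spec (.of (ChartRing F k))) {a : Fin 3 → F} (ha : a ≠ 0) :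
    surface.proj k f₀ (surfaceChart k hF hf₀ b y) ∈ (properTransform f₀ a : Set X₀) ↔
      lineEq k b a ∈ y.asIdeal := by
  rw [← Scheme.Hom.comp_apply, surfaceChart_proj, chartMap, Scheme.Hom.comp_apply,
    blowupChart_mem_properTransform hF hf₀ b _ ha]
  have h1 : ChartRing.baseChange (lineEq F b a) = lineEq k b a := by
    by_cases h : ∑ i, a i * b.pt i = 0
    · rw [lineEq_of_eq_zero k h, lineEq_of_eq_zero F h, map_add, map_mul, ChartRing.baseChange,
        ChartRing.lift_t, ChartRing.lift_algebraMap, ChartRing.lift_algebraMap]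
    · rw [lineEq_of_ne_zero k h, lineEq_of_ne_zero F h, map_one]
  rw [← h1]
  rfl

lemma pb_exceptionalCurve (hF : Nat.card F = 2) (hf₀ : IsBlowupAtRatPoints f₀) (b : Frame F) :
    pb (exceptionalCurve k f₀ b.pt) (surfaceChart k hF hf₀ b) =
      Ideal.span {ChartRing.s F k} := by
  rw [exceptionalCurve, pb_vanishingIdeal]
  have hp : (Ideal.span {ChartRing.s F k}).IsPrime :=
    (Ideal.span_singleton_prime ChartRing.prime_s.ne_zero).mpr ChartRing.prime_s
  refine Eq.trans ?_ hp.radical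
  rw [← PrimeSpectrum.vanishingIdeal_zeroLocus_eq_radical, PrimeSpectrum.zeroLocus_span]
  refine congrArg PrimeSpectrum.vanishingIdeal (Set.ext fun y ↦ ?_)
  exact (surfaceChart_mem_ratPoint k hF hf₀ b y b.pt_ne_zero).trans
    ((and_iff_right rfl).trans Set.singleton_subset_iff.symm)

lemma pb_exceptionalCurve_of_ne (hF : Nat.card F = 2) (hf₀ : IsBlowupAtRatPoints f₀) (b : Frame F)
    {v : Fin 3 → F} (hv : v ≠ 0) (h : v ≠ b.pt) :
    pb (exceptionalCurve k f₀ v) (surfaceChart k hF hf₀ b) = ⊤ := by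
  rw [exceptionalCurve, pb_vanishingIdeal, ← PrimeSpectrum.vanishingIdeal_empty]
  refine congrArg PrimeSpectrum.vanishingIdeal (Set.eq_empty_iff_forall_notMem.mpr fun y hy ↦ ?_)
  exact h ((surfaceChart_mem_ratPoint k hF hf₀ b y hv).mp hy).1

lemma pb_lineCurve (hF : Nat.card F = 2) (hf₀ : IsBlowupAtRatPoints f₀) (b : Frame F)
    {a : Fin 3 → F} (ha : a ≠ 0) :
    pb (lineCurve k f₀ a) (surfaceChart k hF hf₀ b) = Ideal.span {lineEq k b a} := by
  rw [lineCurve, pb_vanishingIdeal]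
  have hrad : (Ideal.span {lineEq k b a}).radical = Ideal.span {lineEq k b a} := by
    by_cases h : ∑ i, a i * b.pt i = 0 ∧ ∑ i, a i * b.M i 2 ≠ 0
    · have hp := prime_lineEq k h.1 h.2
      exact ((Ideal.span_singleton_prime hp.ne_zero).mpr hp).radical
    · rw [Ideal.span_singleton_eq_top.mpr (isUnit_lineEq k ha fun h0 ↦ by
        by_contra h2; exact h ⟨h0, h2⟩), Ideal.radical_top]
  refine Eq.trans ?_ hrad
  rw [← PrimeSpectrum.vanishingIdeal_zeroLocus_eq_radical, PrimeSpectrum.zeroLocus_span]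
  refine congrArg PrimeSpectrum.vanishingIdeal (Set.ext fun y ↦ ?_)
  exact (surfaceChart_mem_properTransform k hF hf₀ b y ha).trans Set.singleton_subset_iff.symm

variable {k}

lemma specializes_surfaceChart (hF : Nat.card F = 2) (hf₀ : IsBlowupAtRatPoints f₀) (b : Frame F)
    {y y' : Spec (.of (ChartRing F k))} (h : y.asIdeal ≤ y'.asIdeal) :
    surfaceChart k hF hf₀ b y ⤳ surfaceChart k hF hf₀ b y' :=
  ((PrimeSpectrum.le_iff_specializes y y').mp h).map (surfaceChart k hF hf₀ b).continuous

/-- In each chart that contains the generic point of C, its prime contains s and is locally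
principal, hence equals (s). Every point of the exceptional curve lies in such a chart and so is a
specialisation of that generic point. -/
lemma eq_exceptionalCurve (hF : Nat.card F = 2) (hf₀ : IsBlowupAtRatPoints f₀)
    {C D₁ D₂ : (surface k f₀).IdealSheafData} [IsIntegral C.subscheme]
    (h₁ : IsEffectiveCartier D₁) (h₂ : IsEffectiveCartier D₂) (h : LinearlyEquivalent (C * D₁) D₂)
    {v : Fin 3 → F} (hv : v ≠ 0)
    (hC : f₀ (surface.proj k f₀ (gen C)) ∈ (ratPoint v : Set (P2 F))) :
    C = exceptionalCurve k f₀ v := by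
  have key : ∀ (b : Frame F) (y : Spec (.of (ChartRing F k))),
      surfaceChart k hF hf₀ b y = gen C →
      b.pt = v ∧ y.asIdeal = Ideal.span {ChartRing.s F k} := by
    intro b y hy
    rw [← hy, surfaceChart_mem_ratPoint k hF hf₀ b y hv] at hC
    exact ⟨hC.1.symm, eq_span_singleton_of_prime_mem ChartRing.prime_s hC.2
      (exists_generator_asIdeal h₁ h₂ h _ hy)⟩
  obtain ⟨b, y, hy⟩ := exists_mem_range_surfaceChart k hF hf₀ (gen C)
  obtain ⟨rfl, hys⟩ := key b y hy
  -- The exceptional curve needs both charts over b₀; as s does not divide t, its generic point lies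
  -- in the second chart too.
  have ht : ChartRing.t F k ∉ y.asIdeal := by
    rw [hys, Ideal.mem_span_singleton]; exact ChartRing.not_s_dvd_t
  obtain ⟨y₂, hy₂⟩ := surfaceChart_mem_range_swap k hF hf₀ b ht
  rw [hy] at hy₂
  refine eq_vanishingIdeal_of_support C _ hC fun x hx ↦ ?_
  have hb : f₀ (surface.proj k f₀ x) ∈ Proj.basicOpen (grading F) b.denom := by
    obtain ⟨b', y', rfl⟩ := exists_mem_range_surfaceChart k hF hf₀ x
    have h3 := ((surfaceChart_mem_ratPoint k hF hf₀ b' y' hv).mp hx).1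
    rw [Frame.mem_basicOpen_denom, h3, ← Frame.mem_basicOpen_denom, plane_surfaceChart]
    exact b'.map_mem_basicOpen _ _ _ _ _
  have hfin : ∀ (b₁ : Frame F) (y y' : Spec (.of (ChartRing F k))), b₁.pt = b.pt →
      surfaceChart k hF hf₀ b₁ y = gen C → surfaceChart k hF hf₀ b₁ y' = x → gen C ⤳ x := by
    rintro b₁ y y' hb₁ h4 rfl
    rw [← h4]
    refine specializes_surfaceChart hF hf₀ b₁ ?_
    rw [(key b₁ y h4).2, Ideal.span_singleton_le_iff_mem]
    exact ((surfaceChart_mem_ratPoint k hF hf₀ b₁ y' hv).mp hx).2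
  rcases mem_range_surfaceChart_or k hF hf₀ b hb with ⟨y', hy'⟩ | ⟨y', hy'⟩
  · exact hfin b y y' rfl hy hy'
  · exact hfin b.swap y₂ y' rfl hy₂ hy'

/-- The generic point of C lies over the line but off s = 0, so the line equation is in its prime
and, being prime itself, generates it. It remains to see that each chart meeting the proper
transform contains this generic point. -/
lemma eq_lineCurve (hF : Nat.card F = 2) (hf₀ : IsBlowupAtRatPoints f₀)
    {C D₁ D₂ : (surface k f₀).IdealSheafData} [IsIntegral C.subscheme]
    (h₁ : IsEffectiveCartier D₁) (h₂ : IsEffectiveCartier D₂) (h : LinearlyEquivalent (C * D₁) D₂)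
    (hC : ∀ v : Fin 3 → F, v ≠ 0 →
      f₀ (surface.proj k f₀ (gen C)) ∉ (ratPoint v : Set (P2 F)))
    {a : Fin 3 → F} (ha : a ≠ 0)
    (hCa : f₀ (surface.proj k f₀ (gen C)) ∈ (ratLine a : Set (P2 F))) :
    C = lineCurve k f₀ a := by
  have key : ∀ (b : Frame F) (y : Spec (.of (ChartRing F k))),
      surfaceChart k hF hf₀ b y = gen C → lineEq k b a ∈ y.asIdeal := by
    intro b y hy
    rw [← hy] at hC hCa
    refine (y.2.mem_or_mem ((surfaceChart_mem_ratLine k hF hf₀ b y a).mp hCa).2).resolve_left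
      fun hs ↦ hC b.pt b.pt_ne_zero ?_
    rw [surfaceChart_mem_ratPoint k hF hf₀ b y b.pt_ne_zero]
    exact ⟨rfl, hs⟩
  refine eq_vanishingIdeal_of_support C _ ?_ fun x hx ↦ ?_
  · obtain ⟨b, y, hy⟩ := exists_mem_range_surfaceChart k hF hf₀ (gen C)
    rw [← hy]
    exact (surfaceChart_mem_properTransform k hF hf₀ b y ha).mpr (key b y hy)
  · obtain ⟨b, y, rfl⟩ := exists_mem_range_surfaceChart k hF hf₀ x
    have hy : lineEq k b a ∈ y.asIdeal :=
      (surfaceChart_mem_properTransform k hF hf₀ b y ha).mp hx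
    have hnu : ¬ IsUnit (lineEq k b a) := fun hu ↦ y.2.ne_top (Ideal.eq_top_of_isUnit_mem _ hy hu)
    have h0 : ∑ i, a i * b.pt i = 0 := by
      by_contra hne
      exact hnu (by rw [lineEq_of_ne_zero k hne]; exact isUnit_one)
    have h2 : ∑ i, a i * b.M i 2 ≠ 0 := fun h2 ↦ hnu (isUnit_lineEq k ha fun _ ↦ h2)
    -- Otherwise the generic point would lie over a second rational line, hence over the rational
    -- intersection point of the two lines, which is excluded.
    have hb : f₀ (surface.proj k f₀ (gen C)) ∈ Proj.basicOpen (grading F) b.denom := by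
      rw [Frame.mem_basicOpen_denom]
      intro c hc hmem
      exact hC _ (cross_ne_zero ha h0 hc) (ratLine_inf_ratLine hCa hmem)
    have hmem : gen C ∈ Set.range (surfaceChart k hF hf₀ b) := by
      refine (mem_range_surfaceChart_or k hF hf₀ b hb).elim id ?_
      rintro ⟨y₂, hy₂⟩
      rw [← hy₂]
      -- In the swapped chart the constant term of the line equation is the nonzero coefficient of t
      -- from the original chart, so t = 0 is impossible on the line.
      have ht : ChartRing.t F k ∉ y₂.asIdeal := by
        intro ht
        have h3 := key b.swap y₂ hy₂
        rw [lineEq_of_eq_zero k (show ∑ i, a i * b.swap.pt i = 0 from h0)] at h3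
        have h4 := (Ideal.add_mem_iff_left _ (Ideal.mul_mem_left _ _ ht)).mp h3
        refine y₂.2.ne_top (Ideal.eq_top_of_isUnit_mem _ h4 ((IsUnit.mk0 _ ?_).map _))
        exact h2
      have h5 := surfaceChart_mem_range_swap k hF hf₀ b.swap ht
      rwa [Frame.swap_swap] at h5
    obtain ⟨y₃, hy₃⟩ := hmem
    rw [← hy₃]
    refine specializes_surfaceChart hF hf₀ b ?_
    rw [eq_span_singleton_of_prime_mem (prime_lineEq k h0 h2) (key b y₃ hy₃)
      (exists_generator_asIdeal h₁ h₂ h _ hy₃), Ideal.span_singleton_le_iff_mem]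
    exact hy

end

end LangerSurface
end

/-! ### Rational functions that are local sections of an ideal sheaf. -/

noncomputable section
namespace LangerSurface

open Scheme.IdealSheafData Module

section Lattice

variable {Y : Scheme.{u}} [IsIntegral Y] {K : Type u} [Field K] {ε : Spec (.of K) ⟶ Y}
  (hε : ε (closedPt (.of K)) = genericPoint Y)

include hε in
lemma genericPoint_mem_range {S : CommRingCat.{u}} (w : Spec S ⟶ Y) [IsOpenImmersion w]
    (z : Spec S) : ε (closedPt (.of K)) ∈ Set.range w := by
  rw [hε]
  exact (genericPoint_specializes (w z)).mem_open w.opensRange.2 ⟨z, rfl⟩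

include hε in
lemma exists_toField {S : CommRingCat.{u}} (w : Spec S ⟶ Y) [IsOpenImmersion w] (z : Spec S) :
    ∃ κ : S ⟶ .of K, Spec.map κ ≫ w = ε := by
  have : IsLocalRing (CommRingCat.of K) := inferInstanceAs (IsLocalRing K)
  obtain ⟨κ, hκ⟩ := exists_eq_SpecMap_comp_of_isLocalRing ε w (genericPoint_mem_range hε w z)
  exact ⟨κ, hκ.symm⟩

lemma isDomain_of_isOpenImmersion {S : CommRingCat.{u}} (w : Spec S ⟶ Y) [IsOpenImmersion w]
    (z : Spec S) : IsDomain S := by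
  have : Nonempty (Spec S) := ⟨z⟩
  have : IsIntegral (Spec S) := isIntegral_of_isOpenImmersion w
  exact (affine_isIntegral_iff S).mp this

include hε in
lemma toField_injective {S : CommRingCat.{u}} (w : Spec S ⟶ Y) [IsOpenImmersion w]
    {κ : S ⟶ .of K} (hκ : Spec.map κ ≫ w = ε) : Function.Injective κ.hom := by
  have : IsLocalRing (CommRingCat.of K) := inferInstanceAs (IsLocalRing K)
  let z := Spec.map κ (closedPt (.of K))
  have hz : w z = genericPoint Y := by rw [← hε, ← hκ, Scheme.Hom.comp_apply]
  have hdom : IsDomain S := isDomain_of_isOpenImmersion w z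
  let o : Spec S := ⟨⊥, Ideal.isPrime_bot⟩
  have h1 : w z ⤳ w o := hz ▸ genericPoint_specializes (w o)
  have h2 : z.asIdeal ≤ ⊥ :=
    (PrimeSpectrum.le_iff_specializes z o).mpr (w.isOpenEmbedding.isInducing.specializes_iff.mp h1)
  rw [injective_iff_map_eq_zero]
  intro a ha
  have h3 : a ∈ z.asIdeal := by
    change κ.hom a ∈ IsLocalRing.maximalIdeal K
    rw [ha]
    exact Ideal.zero_mem _
  exact h2 h3

variable (ε) in
/-- The rational functions which, at the point `y`, are sections of the ideal sheaf `A`. -/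
def lat (A : Y.IdealSheafData) (y : Y) : Set K :=
  {x | ∃ (S : CommRingCat.{u}) (w : Spec S ⟶ Y) (κ : S ⟶ .of K), IsOpenImmersion w ∧
    y ∈ Set.range w ∧ Spec.map κ ≫ w = ε ∧ ∃ α ∈ pb A w, κ.hom α = x}

include hε in
lemma mem_lat_iff (A : Y.IdealSheafData) {S : CommRingCat.{u}} (w : Spec S ⟶ Y)
    [IsOpenImmersion w] {κ : S ⟶ .of K} (hκ : Spec.map κ ≫ w = ε) (z : Spec S) (x : K) :
    x ∈ lat ε A (w z) ↔ ∃ u ∉ z.asIdeal, ∃ α ∈ pb A w, κ.hom u * x = κ.hom α := by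
  have : IsLocalRing (CommRingCat.of K) := inferInstanceAs (IsLocalRing K)
  have hinj := toField_injective hε w hκ
  constructor
  · rintro ⟨S', w', κ', hw', hz, hκ', α', hα', rfl⟩
    have hzp : z.asIdeal.IsPrime := z.2
    let Q := Localization.AtPrime z.asIdeal
    let π : S ⟶ .of Q := CommRingCat.ofHom (algebraMap S Q)
    have : IsLocalRing (CommRingCat.of Q) := inferInstanceAs (IsLocalRing Q)
    have hcl : Spec.map π (closedPt (.of Q)) = z :=
      PrimeSpectrum.ext (Localization.AtPrime.under_maximalIdeal)
    obtain ⟨ν, hν⟩ := exists_eq_SpecMap_comp_of_isLocalRing (Spec.map π ≫ w) w' (by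
      rw [Scheme.Hom.comp_apply, hcl]; exact hz)
    let q : CommRingCat.of Q ⟶ .of K := CommRingCat.ofHom (IsLocalization.lift (M := z.asIdeal.primeCompl)
      (g := κ.hom) fun u ↦ (IsUnit.mk0 (G₀ := K) _ ((map_ne_zero_iff _ hinj).mpr fun h ↦ u.2
        (h ▸ Ideal.zero_mem z.asIdeal))))
    have hq : π ≫ q = κ := by
      ext x; exact IsLocalization.lift_eq _ _
    have hq' : ν ≫ q = κ' := by
      refine Spec.map_injective ?_
      rw [← cancel_mono w', hκ', Spec.map_comp, Category.assoc, ← hν, ← Category.assoc,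
        ← Spec.map_comp, hq, hκ]
    have h1 : ν.hom α' ∈ (pb A w).map (algebraMap S Q) := by
      have h2 := pb_comp A π w
      rw [hν, pb_comp] at h2
      rw [show (pb A w).map (algebraMap S Q) = _ from h2.symm]
      exact Ideal.mem_map_of_mem _ hα'
    rw [IsLocalization.mem_map_algebraMap_iff z.asIdeal.primeCompl] at h1
    obtain ⟨⟨⟨α, hα⟩, u⟩, hu⟩ := h1
    refine ⟨u, u.2, α, hα, ?_⟩
    have h3 := congrArg q.hom hu
    rw [map_mul] at h3
    have h4 : ∀ r, q.hom (algebraMap S Q r) = κ.hom r := fun r ↦ congrArg (fun f ↦ f.hom r) hq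
    have h5 : q.hom (ν.hom α') = κ'.hom α' := congrArg (fun f ↦ f.hom α') hq'
    rw [h4, h5] at h3
    rw [mul_comm]
    exact h3.trans (h4 α)
  · rintro ⟨u, hu, α, hα, hx⟩
    obtain ⟨T, ψ, hψ, ⟨v, hv⟩, hrange⟩ := exists_toAway u
    obtain ⟨z', hz'⟩ := (hrange z).mpr hu
    obtain ⟨κ', hκ'⟩ := exists_toField hε (Spec.map ψ ≫ w) z'
    have hκκ' : ψ ≫ κ' = κ := by
      refine Spec.map_injective ?_
      rw [← cancel_mono w, hκ, Spec.map_comp, Category.assoc, hκ']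
    have h1 : ∀ r, κ'.hom (ψ.hom r) = κ.hom r := fun r ↦ congrArg (fun f ↦ f.hom r) hκκ'
    refine ⟨T, Spec.map ψ ≫ w, κ', inferInstance, ⟨z', by rw [Scheme.Hom.comp_apply, hz']⟩, hκ',
      ↑v⁻¹ * ψ.hom α, ?_, ?_⟩
    · rw [pb_comp]
      exact Ideal.mul_mem_left _ _ (Ideal.mem_map_of_mem _ hα)
    · have h2 : κ'.hom ↑v⁻¹ * κ.hom u = 1 := by
        rw [← h1, ← hv, ← map_mul, Units.inv_mul, map_one]
      rw [map_mul, h1, ← hx]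
      calc κ'.hom ↑v⁻¹ * (κ.hom u * x) = (κ'.hom ↑v⁻¹ * κ.hom u) * x := by ring
        _ = x := by rw [h2, one_mul]

include hε in
-- The denominators u with u x in `A` form an ideal J. A prime without σ never contains J, so σ lies
-- in the radical of J.
lemma exists_pow_mul_eq (A : Y.IdealSheafData) {S : CommRingCat.{u}} (w : Spec S ⟶ Y)
    [IsOpenImmersion w] {κ : S ⟶ .of K} (hκ : Spec.map κ ≫ w = ε) (σ : S) {x : K}
    (h : ∀ z : Spec S, σ ∉ z.asIdeal → x ∈ lat ε A (w z)) :
    ∃ n : ℕ, ∃ α ∈ pb A w, κ.hom σ ^ n * x = κ.hom α := by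
  let J : Ideal S :=
    { carrier := {u | ∃ α ∈ pb A w, κ.hom u * x = κ.hom α}
      add_mem' := by
        rintro u u' ⟨α, hα, h⟩ ⟨α', hα', h'⟩
        exact ⟨α + α', Ideal.add_mem _ hα hα', by rw [map_add, map_add, add_mul, h, h']⟩
      zero_mem' := ⟨0, Ideal.zero_mem _, by simp⟩
      smul_mem' := by
        rintro c u ⟨α, hα, h⟩
        exact ⟨c * α, Ideal.mul_mem_left _ _ hα, by
          rw [smul_eq_mul, map_mul, map_mul, mul_assoc, h]⟩ }
  have hJ : σ ∈ J.radical := by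
    rw [Ideal.radical_eq_sInf, Ideal.mem_sInf]
    rintro m ⟨hJm, hm⟩
    by_contra hσ
    obtain ⟨u, hu, α, hα, hx⟩ := (mem_lat_iff hε A w hκ ⟨m, hm⟩ x).mp (h ⟨m, hm⟩ hσ)
    exact hu (hJm ⟨α, hα, hx⟩)
  obtain ⟨n, α, hα, hx⟩ := hJ
  exact ⟨n, α, hα, by rw [← hx, map_pow]⟩

include hε in
lemma forall_mem_lat_iff (A : Y.IdealSheafData) {S : CommRingCat.{u}} (w : Spec S ⟶ Y)
    [IsOpenImmersion w] {κ : S ⟶ .of K} (hκ : Spec.map κ ≫ w = ε) (x : K) :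
    (∀ z, x ∈ lat ε A (w z)) ↔ ∃ α ∈ pb A w, κ.hom α = x := by
  constructor
  · intro h
    obtain ⟨n, α, hα, hx⟩ := exists_pow_mul_eq hε A w hκ 1 fun z _ ↦ h z
    exact ⟨α, hα, by rw [← hx, map_one, one_pow, one_mul]⟩
  · rintro ⟨α, hα, rfl⟩ z
    exact ⟨S, w, κ, inferInstance, ⟨z, rfl⟩, hκ, α, hα, rfl⟩

include hε in
lemma mem_lat_iff_of_generators {A B : Y.IdealSheafData} {S : CommRingCat.{u}} (w : Spec S ⟶ Y)
    [IsOpenImmersion w] {κ : S ⟶ .of K} (hκ : Spec.map κ ≫ w = ε) (z : Spec S) {α β : S}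
    (hA : pb A w = Ideal.span {α}) (hB : pb B w = Ideal.span {β}) {ψ : K} (hψ : ψ ≠ 0)
    (h : ψ * κ.hom α = κ.hom β) (x : K) : x ∈ lat ε A (w z) ↔ ψ * x ∈ lat ε B (w z) := by
  rw [mem_lat_iff hε A w hκ, mem_lat_iff hε B w hκ, hA, hB]
  refine exists_congr fun u ↦ and_congr_right fun _ ↦ ?_
  simp only [Ideal.mem_span_singleton']
  constructor
  · rintro ⟨_, ⟨c, rfl⟩, hc⟩
    refine ⟨_, ⟨c, rfl⟩, ?_⟩
    rw [map_mul] at hc ⊢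
    linear_combination ψ * hc + κ.hom c * h
  · rintro ⟨_, ⟨c, rfl⟩, hc⟩
    refine ⟨_, ⟨c, rfl⟩, mul_left_cancel₀ hψ ?_⟩
    rw [map_mul] at hc ⊢
    linear_combination hc - κ.hom c * h

include hε in
-- Some section f of `A` does not vanish at y; multiplying numerator and denominator by f moves any
-- function regular at y into `A`.
lemma lat_of_notMem_support {A : Y.IdealSheafData} {y : Y} (hy : y ∉ A.support) :
    lat ε A y = lat ε ⊤ y := by
  obtain ⟨U, hU, hyU, -⟩ := exists_isAffineOpen_mem_and_subset (x := y) (U := ⊤) trivial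
  obtain ⟨z, rfl⟩ : y ∈ Set.range hU.fromSpec := by rw [hU.range_fromSpec]; exact hyU
  obtain ⟨κ, hκ⟩ := exists_toField hε hU.fromSpec z
  ext x
  rw [mem_lat_iff hε A _ hκ, mem_lat_iff hε ⊤ _ hκ]
  rw [mem_support_iff_pb_le, SetLike.not_le_iff_exists] at hy
  obtain ⟨f, hf, hfz⟩ := hy
  constructor
  · rintro ⟨u, hu, α, hα, h⟩
    exact ⟨u, hu, α, by rw [pb_top]; trivial, h⟩
  · rintro ⟨u, hu, α, -, h⟩
    refine ⟨f * u, fun hmem ↦ (z.2.mem_or_mem hmem).elim hfz hu, f * α,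
      Ideal.mul_mem_right _ _ hf, ?_⟩
    rw [map_mul, map_mul, mul_assoc, h]

include hε in
/-- A rational function that is regular everywhere comes from a global section. -/
lemma exists_appTop_of_forall_mem_lat {x : K} (h : ∀ y, x ∈ lat ε ⊤ y) :
    ∃ g : Γ(Y, ⊤), (ε.appTop ≫ (Scheme.ΓSpecIso (.of K)).hom).hom g = x := by
  classical
  let ι := {U : Y.affineOpens // Nonempty U.1}
  have hgerm : ∀ U : Y.Opens, (hU : Nonempty U) → ε ⁻¹ᵁ U = ⊤ := by
    rintro U ⟨⟨y, hy⟩⟩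
    refine top_le_iff.mp fun p _ ↦ ?_
    have hp : p = closedPt (.of K) := Subsingleton.elim (α := PrimeSpectrum K) _ _
    rw [hp]
    change ε (closedPt (.of K)) ∈ U
    rw [hε]
    exact (genericPoint_specializes y).mem_open U.2 hy
  let ev : ∀ U : Y.Opens, Nonempty U → (Γ(Y, U) ⟶ .of K) := fun U hU ↦
    ε.appLE U ⊤ (hgerm U hU).ge ≫ (Scheme.ΓSpecIso (.of K)).hom
  have hev : ∀ (U V : Y.Opens) (hU : Nonempty U) (hV : Nonempty V) (i : U ⟶ V) (s : Γ(Y, V)),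
      (ev U hU).hom (Y.presheaf.map i.op s) = (ev V hV).hom s := by
    intro U V hU hV i s
    have h1 : Y.presheaf.map i.op ≫ ev U hU = ev V hV := by
      simp only [ev]
      rw [Scheme.Hom.map_appLE_assoc]
    exact congrArg (fun f ↦ f.hom s) h1
  -- On an integral scheme a nonzero section is invertible on a nonempty open set, so its value at
  -- the generic point is nonzero. This makes the local sections agree on overlaps, and they glue.
  have hinj : ∀ (U : Y.Opens) (hU : Nonempty U), Function.Injective (ev U hU).hom := by
    intro U hU
    rw [injective_iff_map_eq_zero]
    intro s hs
    by_contra hne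
    have h1 : Y.basicOpen s ≠ ⊥ := fun h ↦ hne ((basicOpen_eq_bot_iff s).mp h)
    obtain ⟨y, hy⟩ := (Opens.ne_bot_iff_nonempty _).mp h1
    have hD : Nonempty (Y.basicOpen s) := ⟨⟨y, hy⟩⟩
    have h2 := RingedSpace.isUnit_res_basicOpen Y.toRingedSpace s
    have h3 := (h2.map (ev _ hD).hom)
    have h4 : (ev _ hD).hom (Y.presheaf.map (homOfLE (Y.basicOpen_le s)).op s) = 0 :=
      (hev _ _ hD hU _ s).trans hs
    have h5 : IsUnit (0 : K) := h4 ▸ h3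
    exact not_isUnit_zero h5
  have hsec : ∀ i : ι, ∃ s : Γ(Y, i.1.1), (ev _ i.2).hom s = x := by
    rintro ⟨⟨U, hU⟩, hne⟩
    have hU' : IsAffineOpen U := hU
    have hz : Nonempty (Spec Γ(Y, U)) := by
      obtain ⟨⟨y, hy⟩⟩ := hne
      obtain ⟨z, -⟩ : y ∈ Set.range hU'.fromSpec := by rw [hU'.range_fromSpec]; exact hy
      exact ⟨z⟩
    have hκ : Spec.map (ev U hne) ≫ hU'.fromSpec = ε := by
      have h1 := IsAffineOpen.SpecMap_appLE_fromSpec ε hU' (isAffineOpen_top (Spec (.of K)))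
        (hgerm U hne).ge
      rw [Spec.map_comp, Category.assoc, h1, IsAffineOpen.fromSpec_top]
      have h2 : Spec.map (Scheme.ΓSpecIso (.of K)).hom ≫ (Spec (.of K)).isoSpec.inv = 𝟙 _ := by
        rw [SpecMap_ΓSpecIso_hom, Scheme.toSpecΓ_isoSpec_inv]
      exact (Category.assoc _ _ _).symm.trans ((congrArg (· ≫ ε) h2).trans (Category.id_comp _))
    obtain ⟨α, -, hα⟩ := (forall_mem_lat_iff hε ⊤ hU'.fromSpec hκ x).mp fun z ↦ h _
    exact ⟨α, hα⟩
  choose sec hs using hsec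
  obtain ⟨g, hg, -⟩ := Y.sheaf.existsUnique_gluing' (fun i : ι ↦ i.1.1) ⊤ (fun i ↦ homOfLE le_top)
    (fun y _ ↦ by
      obtain ⟨U, hU, hyU, -⟩ := exists_isAffineOpen_mem_and_subset (x := y) (U := ⊤) trivial
      exact Opens.mem_iSup.mpr ⟨⟨⟨U, hU⟩, ⟨⟨y, hyU⟩⟩⟩, hyU⟩) sec (by
    intro i j
    have hne : Nonempty ↥(i.1.1 ⊓ j.1.1) := by
      obtain ⟨y, hy⟩ := i.2
      obtain ⟨y', hy'⟩ := j.2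
      exact ⟨⟨genericPoint Y, (genericPoint_specializes y).mem_open i.1.1.2 hy,
        (genericPoint_specializes y').mem_open j.1.1.2 hy'⟩⟩
    refine hinj _ hne ?_
    exact ((hev _ _ hne i.2 _ (sec i)).trans (hs i)).trans
      ((hev _ _ hne j.2 _ (sec j)).trans (hs j)).symm)
  refine ⟨g, ?_⟩
  obtain ⟨U, hU, hyU, -⟩ := exists_isAffineOpen_mem_and_subset (x := genericPoint Y) (U := ⊤) trivial
  let i : ι := ⟨⟨U, hU⟩, ⟨⟨_, hyU⟩⟩⟩
  have hne : Nonempty (⊤ : Y.Opens) := ⟨⟨genericPoint Y, trivial⟩⟩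
  have h1 := hev _ _ i.2 hne (homOfLE le_top) g
  have h2 : (ev _ i.2).hom (Y.presheaf.map (homOfLE le_top).op g) = x :=
    (congrArg (ev _ i.2).hom (hg i)).trans (hs i)
  rw [← h2]
  refine Eq.trans ?_ h1.symm
  have h3 : ε.appLE ⊤ ⊤ (hgerm ⊤ hne).ge = ε.appTop := Scheme.Hom.appLE_eq_app _
  exact congrArg (fun f ↦ (f ≫ (Scheme.ΓSpecIso (.of K)).hom).hom g) h3.symm

end Lattice

end LangerSurface
end

/-! ### Degrees on an affine open of a curve: invariance and additivity. -/

noncomputable section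
namespace LangerSurface

open Scheme.IdealSheafData Module

section Algebra

variable {k K S : Type*} [Field k] [Field K] [Algebra k K] [CommRing S] [Algebra k S]

/-- The quotient by an ideal, computed inside a field. -/
def quotientEquivOfInjective (f : S →ₐ[k] K) (hf : Function.Injective f) (a : Ideal S) :
    (S ⧸ a) ≃ₗ[k] (LinearMap.range f.toLinearMap ⧸
      ((a.restrictScalars k).map f.toLinearMap).comap (LinearMap.range f.toLinearMap).subtype) :=
  Submodule.Quotient.equiv (a.restrictScalars k) _ (LinearEquiv.ofInjective f.toLinearMap hf) (by
    ext ⟨x, hx⟩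
    simp only [Submodule.mem_map, Submodule.mem_comap]
    exact ⟨fun ⟨α, hα, h⟩ ↦ ⟨α, hα, congrArg Subtype.val h⟩,
      fun ⟨α, hα, h⟩ ↦ ⟨α, hα, Subtype.ext h⟩⟩)

/-- The codimension comparison transported from subspaces of a field to abstract rings that embed in
it. -/
lemma finrank_quotient_eq_of_algHom {ι : Type*} [Finite ι] {W : ι → Type*} [∀ i, CommRing (W i)]
    [∀ i, Algebra k (W i)] (f : S →ₐ[k] K) (hf : Function.Injective f)
    (f' : ∀ i, W i →ₐ[k] K) (hf' : ∀ i, Function.Injective (f' i)) (σ : ∀ i, W i)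
    (hσ : ∀ i, f' i (σ i) ≠ 0) (hpow : ∀ r i, ∃ (n : ℕ) (α : W i), f' i (σ i) ^ n * f r = f' i α)
    (hglob : Module.Finite k
      ↥(LinearMap.range f.toLinearMap ⊓ ⨅ i, Subalgebra.toSubmodule (f' i).range))
    (hquot : ∀ i, Module.Finite k (W i ⧸ Ideal.span {σ i}))
    (a b : Ideal S) (a' b' : ∀ i, Ideal (W i))
    (ha : ∀ α ∈ a, ∀ i (n : ℕ) β, f' i β = f' i (σ i) ^ n * f α → β ∈ a' i)
    (hb : ∀ α ∈ b, ∀ i (n : ℕ) β, f' i β = f' i (σ i) ^ n * f α → β ∈ b' i)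
    {ψ : K} (hψ : ψ ≠ 0)
    (hab : ∀ x, (∃ α ∈ a, f α = x) ↔ ∃ β ∈ b, f β = ψ * x)
    (hab' : ∀ i x, (∃ α ∈ a' i, f' i α = x) ↔ ∃ β ∈ b' i, f' i β = ψ * x)
    (hfa : Module.Finite k (S ⧸ a)) (hfb : Module.Finite k (S ⧸ b)) :
    finrank k (S ⧸ a) = finrank k (S ⧸ b) := by
  rw [(quotientEquivOfInjective f hf a).finrank_eq, (quotientEquivOfInjective f hf b).finrank_eq]
  refine finrank_quotient_eq_of_mul_equiv (LinearMap.range f.toLinearMap) (fun i ↦ (f' i).range)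
    (fun i ↦ f' i (σ i)) (fun i ↦ ⟨_, rfl⟩) hσ ?_ hglob ?_ _ _ ?_ ?_
    (fun i ↦ ((a' i).restrictScalars k).map (f' i).toLinearMap)
    (fun i ↦ ((b' i).restrictScalars k).map (f' i).toLinearMap) ?_ ?_ ?_ ?_
    ψ hψ hab hab' ?_ ?_
  · rintro _ ⟨r, rfl⟩ i
    obtain ⟨n, α, h⟩ := hpow r i
    exact ⟨n, α, h.symm⟩
  · intro i
    have := hquot i
    refine Module.Finite.equiv (Ideal.quotientEquivAlg (Ideal.span {σ i}) _
      (AlgEquiv.ofInjective (f' i) (hf' i)) ?_).toLinearEquiv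
    rw [Ideal.map_span, Set.image_singleton]
    rfl
  · exact LinearMap.map_le_range
  · exact LinearMap.map_le_range
  · exact fun i x hx ↦ LinearMap.map_le_range hx
  · exact fun i x hx ↦ LinearMap.map_le_range hx
  · rintro _ ⟨α, hα, rfl⟩ i n ⟨β, hβ⟩
    exact ⟨β, ha α hα i n β hβ, hβ⟩
  · rintro _ ⟨α, hα, rfl⟩ i n ⟨β, hβ⟩
    exact ⟨β, hb α hα i n β hβ, hβ⟩
  · exact Module.Finite.equiv (quotientEquivOfInjective f hf a)
  · exact Module.Finite.equiv (quotientEquivOfInjective f hf b)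

end Algebra

section Degree

variable {k : Type u} [Field k] {Y : Scheme.{u}} (π : Y ⟶ Spec (.of k))

/-- The scalars in the coordinate ring of an affine scheme over the `k`-scheme `Y`. -/
def scalars {S : CommRingCat.{u}} (w : Spec S ⟶ Y) : CommRingCat.of k ⟶ S :=
  Spec.preimage (w ≫ π)

lemma scalars_comp {S T : CommRingCat.{u}} (w : Spec S ⟶ Y) (φ : S ⟶ T) (w' : Spec T ⟶ Y)
    (h : Spec.map φ ≫ w = w') : scalars π w ≫ φ = scalars π w' := by
  refine Spec.map_injective ?_
  rw [Spec.map_comp, scalars, scalars, Spec.map_preimage, Spec.map_preimage, ← h, Category.assoc]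

/-- The `k`-algebra structure on the coordinate ring of an affine scheme over `Y`. -/
abbrev coordAlgebra {S : CommRingCat.{u}} (w : Spec S ⟶ Y) : Algebra k S :=
  (scalars π w).hom.toAlgebra

/-- The degree over `k` of the part of a closed subscheme over an affine scheme. -/
def deg {S : CommRingCat.{u}} (w : Spec S ⟶ Y) (A : Y.IdealSheafData) : ℕ :=
  letI := coordAlgebra π w
  finrank k (S ⧸ pb A w)

/-- All proper closed subschemes of affine opens of `Y` are finite over `k`. -/
def FiniteQuotients : Prop :=
  ∀ (S : CommRingCat.{u}) (w : Spec S ⟶ Y), IsOpenImmersion w → ∀ I : Ideal S, I ≠ ⊥ →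
    letI := coordAlgebra π w
    Module.Finite k (S ⧸ I)

variable {π} [IsIntegral Y] {K : Type u} [Field K] {ε : Spec (.of K) ⟶ Y}

set_option maxHeartbeats 400000 in
-- Principal divisors have degree zero. Outside Spec S both ideals are trivial, so ψ is a unit there
-- and preserves pole orders along the complement; the filtration of S by pole order then compares
-- the two codimensions.
lemma deg_eq_of_mul_equiv (hε : ε (closedPt (.of K)) = genericPoint Y)
    (hfin : FiniteQuotients π) (hΓ : π.appTop.hom.Finite)
    {ι : Type*} [Finite ι] (W : ι → CommRingCat.{u}) (w' : ∀ i, Spec (W i) ⟶ Y)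
    [∀ i, IsOpenImmersion (w' i)] (hcov : ∀ y, ∃ i, y ∈ Set.range (w' i))
    (z' : ∀ i, Spec (W i)) {S : CommRingCat.{u}} (w : Spec S ⟶ Y) [IsOpenImmersion w] (z : Spec S)
    (σ : ∀ i, W i) (hσ : ∀ i z, w' i z ∈ Set.range w ↔ σ i ∉ z.asIdeal)
    {A B : Y.IdealSheafData} (hA : ∀ y ∈ A.support, y ∈ Set.range w)
    (hB : ∀ y ∈ B.support, y ∈ Set.range w) (hA0 : pb A w ≠ ⊥) (hB0 : pb B w ≠ ⊥)
    {ψ : K} (hψ : ψ ≠ 0) (h : ∀ y x, x ∈ lat ε A y ↔ ψ * x ∈ lat ε B y) :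
    deg π w A = deg π w B := by
  obtain ⟨κ, hκ⟩ := exists_toField hε w z
  choose κ' hκ' using fun i ↦ exists_toField hε (w' i) (z' i)
  let _ : Algebra k K := coordAlgebra π ε
  let _ : Algebra k S := coordAlgebra π w
  let _ : ∀ i, Algebra k (W i) := fun i ↦ coordAlgebra π (w' i)
  let f : S →ₐ[k] K := { κ.hom with
    commutes' := fun c ↦ congrArg (fun g ↦ g.hom c) (scalars_comp π w κ ε hκ) }
  let f' : ∀ i, W i →ₐ[k] K := fun i ↦ { (κ' i).hom with
    commutes' := fun c ↦ congrArg (fun g ↦ g.hom c) (scalars_comp π (w' i) (κ' i) ε (hκ' i)) }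
  have hf : Function.Injective f := toField_injective hε w hκ
  have hf' : ∀ i, Function.Injective (f' i) := fun i ↦ toField_injective hε (w' i) (hκ' i)
  have hs : ∀ i, f' i (σ i) ≠ 0 := by
    intro i h0
    have h1 := (hσ i (Spec.map (κ' i) (closedPt (.of K)))).mp (by
      rw [← Scheme.Hom.comp_apply, hκ']; exact genericPoint_mem_range hε w z)
    refine h1 ?_
    change (κ' i).hom (σ i) ∈ IsLocalRing.maximalIdeal K
    exact (show (κ' i).hom (σ i) = 0 from h0) ▸ Ideal.zero_mem _
  -- At points inside Spec S this is the hypothesis on α, multiplied by a power of σ. At points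
  -- outside, D is the unit ideal and only regularity of β is required.
  have hloc : ∀ D : Y.IdealSheafData, (∀ y ∈ D.support, y ∈ Set.range w) → ∀ α ∈ pb D w,
      ∀ i (n : ℕ) β, f' i β = f' i (σ i) ^ n * f α → β ∈ pb D (w' i) := by
    intro D hD α hα i n β hβ
    obtain ⟨β', hβ', hββ'⟩ := (forall_mem_lat_iff hε D (w' i) (hκ' i) (f' i β)).mp (by
      intro y
      by_cases hy : w' i y ∈ Set.range w
      · obtain ⟨y', hy'⟩ := hy
        have h1 := (forall_mem_lat_iff hε D w hκ (f α)).mpr ⟨α, hα, rfl⟩ y'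
        rw [hy', mem_lat_iff hε D (w' i) (hκ' i)] at h1
        rw [mem_lat_iff hε D (w' i) (hκ' i)]
        obtain ⟨u, hu, γ, hγ, h⟩ := h1
        refine ⟨u, hu, σ i ^ n * γ, Ideal.mul_mem_left _ _ hγ, ?_⟩
        rw [map_mul, map_pow, ← h, hβ]
        change _ * ((κ' i).hom (σ i) ^ n * _) = _
        ring
      · rw [lat_of_notMem_support hε fun h ↦ hy (hD _ h)]
        exact (forall_mem_lat_iff hε ⊤ (w' i) (hκ' i) _).mpr ⟨β, by rw [pb_top]; trivial, rfl⟩ y)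
    rwa [← hf' i hββ']
  refine finrank_quotient_eq_of_algHom f hf f' hf' σ hs ?_ ?_ ?_ (pb A w) (pb B w)
    (fun i ↦ pb A (w' i)) (fun i ↦ pb B (w' i)) (hloc A hA) (hloc B hB) hψ ?_ ?_
    (hfin S w inferInstance _ hA0) (hfin S w inferInstance _ hB0)
  · intro r i
    obtain ⟨n, α, -, h⟩ := exists_pow_mul_eq hε ⊤ (w' i) (hκ' i) (σ i) (x := f r) (by
      intro y hy
      obtain ⟨y', hy'⟩ := (hσ i y).mpr hy
      rw [← hy']
      exact (forall_mem_lat_iff hε ⊤ w hκ _).mpr ⟨r, by rw [pb_top]; trivial, rfl⟩ y')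
    exact ⟨n, α, h⟩
  · let g : CommRingCat.of k ⟶ Γ(Y, ⊤) := (Scheme.ΓSpecIso (.of k)).inv ≫ π.appTop
    let _ : Algebra k Γ(Y, ⊤) := g.hom.toAlgebra
    have hg : Module.Finite k Γ(Y, ⊤) := by
      have : g.hom.Finite := hΓ.comp (RingHom.Finite.of_surjective _
        (ConcreteCategory.bijective_of_isIso (Scheme.ΓSpecIso (.of k)).inv).2)
      exact this
    have hgε : g ≫ ε.appTop ≫ (Scheme.ΓSpecIso (.of K)).hom = scalars π ε := by
      refine Spec.map_injective ?_
      rw [scalars, Spec.map_preimage, Spec.map_comp, Spec.map_comp, SpecMap_ΓSpecIso_hom,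
        Category.assoc, ← Scheme.toSpecΓ_naturality_assoc, Spec.map_comp,
        ← Scheme.toSpecΓ_naturality_assoc, ← SpecMap_ΓSpecIso_hom, ← Spec.map_comp,
        Iso.inv_hom_id, Spec.map_id, Category.comp_id]
    let e : Γ(Y, ⊤) →ₐ[k] K := { (ε.appTop ≫ (Scheme.ΓSpecIso (.of K)).hom).hom with
      commutes' := fun c ↦ congrArg (fun g ↦ g.hom c) hgε }
    -- The charts cover Y, so an element regular on all of them is a global section, and the global
    -- sections are finite over k.
    have hle : LinearMap.range f.toLinearMap ⊓ ⨅ i, Subalgebra.toSubmodule (f' i).range ≤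
        LinearMap.range e.toLinearMap := by
      rintro x ⟨-, hx⟩
      simp only [Submodule.mem_iInf, SetLike.mem_coe] at hx
      refine exists_appTop_of_forall_mem_lat hε fun y ↦ ?_
      obtain ⟨i, y', rfl⟩ := hcov y
      obtain ⟨α, hα⟩ := hx i
      exact (forall_mem_lat_iff hε ⊤ (w' i) (hκ' i) x).mpr ⟨α, by rw [pb_top]; trivial, hα⟩ y'
    exact Submodule.finiteDimensional_of_le hle
  · intro i
    refine hfin (W i) (w' i) inferInstance (Ideal.span {σ i}) ?_
    rw [Ne, Ideal.span_singleton_eq_bot]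
    exact fun h ↦ hs i (by rw [h, map_zero])
  · intro x
    refine (forall_mem_lat_iff hε A w hκ x).symm.trans
      (Iff.trans ?_ (forall_mem_lat_iff hε B w hκ (ψ * x)))
    exact forall_congr' fun z ↦ h _ x
  · intro i x
    refine (forall_mem_lat_iff hε A (w' i) (hκ' i) x).symm.trans
      (Iff.trans ?_ (forall_mem_lat_iff hε B (w' i) (hκ' i) (ψ * x)))
    exact forall_congr' fun z ↦ h _ x

omit [IsIntegral Y] in
-- The local equation generates the ideal in the local ring at m; clearing its denominator gives the
-- element α in S. The open affine w need not be one on which the ideal is globally principal.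
lemma exists_local_generator_pb {A : Y.IdealSheafData} (hA : IsEffectiveCartier A)
    {S : CommRingCat.{u}} [IsDomain S] (w : Spec S ⟶ Y) (m : Spec S) :
    ∃ α ∈ pb A w, ∀ x ∈ pb A w, ∃ u ∉ m.asIdeal, ∃ c, u * x = c * α := by
  have hmp : m.asIdeal.IsPrime := m.2
  let Q := Localization.AtPrime m.asIdeal
  let q : S ⟶ .of Q := CommRingCat.ofHom (algebraMap S Q)
  have : IsLocalRing (CommRingCat.of Q) := inferInstanceAs (IsLocalRing Q)
  have hcl : Spec.map q (closedPt (.of Q)) = m :=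
    PrimeSpectrum.ext (Localization.AtPrime.under_maximalIdeal)
  obtain ⟨R, w', y, hw', hy, δ, -, hδ⟩ := hA.exists_pb (w m)
  obtain ⟨ν, hν⟩ := exists_eq_SpecMap_comp_of_isLocalRing (Spec.map q ≫ w) w' (by
    rw [Scheme.Hom.comp_apply, hcl]; exact ⟨y, hy⟩)
  have h2 : (pb A w).map (algebraMap S Q) = Ideal.span {ν.hom δ} := by
    have h3 := pb_comp A q w
    rw [hν, pb_comp, hδ, Ideal.map_span, Set.image_singleton] at h3
    exact h3.symm
  have h4 : ν.hom δ ∈ (pb A w).map (algebraMap S Q) := h2 ▸ Ideal.mem_span_singleton_self _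
  rw [IsLocalization.mem_map_algebraMap_iff m.asIdeal.primeCompl] at h4
  obtain ⟨⟨⟨α, hα⟩, u⟩, hu⟩ := h4
  refine ⟨α, hα, fun x hx ↦ ?_⟩
  have h5 : algebraMap S Q x ∈ Ideal.span {ν.hom δ} := h2 ▸ Ideal.mem_map_of_mem _ hx
  obtain ⟨c, hc⟩ := Ideal.mem_span_singleton'.mp h5
  obtain ⟨⟨c', u'⟩, hc'⟩ := IsLocalization.surj m.asIdeal.primeCompl c
  have hinj : Function.Injective (algebraMap S Q) :=
    IsLocalization.injective _ m.asIdeal.primeCompl_le_nonZeroDivisors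
  refine ⟨u' * u, fun h ↦ (hmp.mem_or_mem h).elim u'.2 u.2, c', hinj ?_⟩
  rw [map_mul, map_mul, map_mul, ← hc]
  linear_combination algebraMap S Q u * ν.hom δ * hc' + algebraMap S Q c' * hu

lemma deg_mul (hfin : FiniteQuotients π) {S : CommRingCat.{u}} (w : Spec S ⟶ Y)
    [IsOpenImmersion w] (z : Spec S) {A B : Y.IdealSheafData} (hA : IsEffectiveCartier A)
    (hA0 : pb A w ≠ ⊥) (hB0 : pb B w ≠ ⊥) : deg π w (A * B) = deg π w A + deg π w B := by
  have hdom : IsDomain S := isDomain_of_isOpenImmersion w z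
  let _ : Algebra k S := coordAlgebra π w
  have := hfin S w inferInstance _ hA0
  have := hfin S w inferInstance _ hB0
  rw [deg, pb_mul]
  exact finrank_quotient_mul _ _ hA0 fun m hm ↦ exists_local_generator_pb hA w ⟨m, hm.isPrime⟩

end Degree

end LangerSurface
end

/-! ### Intersection numbers as degrees on the curve. -/

noncomputable section
namespace LangerSurface

open Scheme.IdealSheafData Module

section IntersectionNumber

lemma comap_map_of_isClosedImmersion {X Y : Scheme.{u}} (ι : Y ⟶ X) [IsClosedImmersion ι]
    (J : Y.IdealSheafData) : (J.map ι).comap ι = J := by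
  refine ext_of_forall_mem fun y ↦ ?_
  obtain ⟨U, hU, hyU, -⟩ := exists_isAffineOpen_mem_and_subset (x := ι y) (U := ⊤) trivial
  refine ⟨⟨ι ⁻¹ᵁ U, hU.preimage ι⟩, hyU, ?_⟩
  rw [ideal_comap_eq_map (J.map ι) ι ⟨U, hU⟩ ⟨ι ⁻¹ᵁ U, hU.preimage ι⟩ le_rfl,
    ideal_map_of_isAffineHom, Scheme.Hom.appLE_eq_app]
  exact Ideal.map_comap_of_surjective _ (ι.app_surjective U hU) _

lemma comap_subschemeι_self {X : Scheme.{u}} (C : X.IdealSheafData) :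
    C.comap C.subschemeι = ⊥ := by
  rw [← le_bot_iff, ← le_map_iff_comap_le, map_bot, ker_subschemeι]

/-- As a closed subscheme of C, the intersection with D is cut out by the restriction of D, since C
restricts to the zero ideal on itself. -/
lemma ker_inclusion {X : Scheme.{u}} (C D : X.IdealSheafData) :
    (inclusion (le_sup_left : C ≤ C ⊔ D)).ker = D.comap C.subschemeι := by
  rw [← comap_map_of_isClosedImmersion C.subschemeι (inclusion _).ker, map_ker,
    inclusion_subschemeι, ker_subschemeι, comap_sup, comap_subschemeι_self, bot_sup_eq]

variable {k : Type u} [Field k]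

/-- The intersection lies inside the affine open, where it is the closed subscheme Spec S/I with I
the pulled-back ideal of D. Its ring of functions is therefore S/I as a k-algebra. -/
lemma intersectionNumber_eq_deg {X : Scheme.{u}} (π : X ⟶ Spec (.of k)) (C D : X.IdealSheafData)
    {S : CommRingCat.{u}} (w : Spec S ⟶ C.subscheme) [IsOpenImmersion w]
    (hw : ∀ y ∈ (D.comap C.subschemeι).support, y ∈ Set.range w) :
    intersectionNumber k π C D = deg (C.subschemeι ≫ π) w (D.comap C.subschemeι) := by
  let i : (C ⊔ D).subscheme ⟶ C.subscheme := inclusion le_sup_left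
  have hi : i ≫ C.subschemeι = (C ⊔ D).subschemeι := inclusion_subschemeι _
  have : IsClosedImmersion (i ≫ C.subschemeι) := by rw [hi]; infer_instance
  have : IsClosedImmersion i := .of_comp_isClosedImmersion i C.subschemeι
  have hker : i.ker = D.comap C.subschemeι := ker_inclusion C D
  have hrange : Set.range i ⊆ Set.range w := by
    rintro _ ⟨x, rfl⟩
    refine hw _ ?_
    rw [← hker]
    exact i.range_subset_ker_support ⟨x, rfl⟩
  let j : (C ⊔ D).subscheme ⟶ Spec S := IsOpenImmersion.lift w i hrange
  have hj : j ≫ w = i := IsOpenImmersion.lift_fac w i hrange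
  let e : (C ⊔ D).subscheme ≅ pullback w i :=
    { hom := pullback.lift j (𝟙 _) (by rw [hj, Category.id_comp])
      inv := pullback.snd w i
      hom_inv_id := pullback.lift_snd _ _ _
      inv_hom_id := by
        apply pullback.hom_ext
        · rw [Category.assoc, pullback.lift_fst, Category.id_comp, ← cancel_mono w, Category.assoc,
            hj, pullback.condition]
        · rw [Category.assoc, pullback.lift_snd, Category.id_comp, Category.comp_id] }
  have hej : e.hom ≫ pullback.fst w i = j := pullback.lift_fst _ _ _
  have hkerj : j.ker = (D.comap C.subschemeι).comap w := by
    have := e.isIso_hom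
    rw [← hej, Scheme.Hom.ker_comp_of_isIso, ker_fst_of_isClosedImmersion, hker]
  have : IsClosedImmersion j := by
    have := e.isIso_hom
    rw [← hej]; infer_instance
  let f : S ⟶ Γ((C ⊔ D).subscheme, ⊤) := (Scheme.ΓSpecIso S).inv ≫ j.appTop
  have hsurj : Function.Surjective f.hom :=
    (IsClosedImmersion.isAffine_surjective_of_isAffine j).2.comp
      (ConcreteCategory.bijective_of_isIso (Scheme.ΓSpecIso S).inv).2
  have hkerf : RingHom.ker f.hom = pb (D.comap C.subschemeι) w := by
    have h1 : Function.Surjective (Scheme.ΓSpecIso S).hom.hom :=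
      (ConcreteCategory.bijective_of_isIso (Scheme.ΓSpecIso S).hom).2
    have h2 : (Scheme.ΓSpecIso S).hom ≫ f = j.appTop := Iso.hom_inv_id_assoc _ _
    have h3 : ∀ y, f.hom ((Scheme.ΓSpecIso S).hom.hom y) = j.appTop.hom y :=
      fun y ↦ congrArg (fun g ↦ g.hom y) h2
    ext x
    rw [pb, ← hkerj, Scheme.Hom.ker_apply, Ideal.mem_map_iff_of_surjective _ h1, RingHom.mem_ker]
    obtain ⟨y, rfl⟩ := h1 x
    constructor
    · exact fun h ↦ ⟨y, (h3 y).symm.trans h, rfl⟩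
    · rintro ⟨y', hy', h⟩
      rw [← h]
      exact (h3 y').trans hy'
  have hscal : scalars (C.subschemeι ≫ π) w ≫ f =
      (Scheme.ΓSpecIso (.of k)).inv ≫ ((C ⊔ D).subschemeι ≫ π).appTop := by
    have h1 := Scheme.ΓSpecIso_inv_naturality (scalars (C.subschemeι ≫ π) w)
    rw [reassoc_of% h1, scalars, Spec.map_preimage, ← Scheme.Hom.comp_appTop, reassoc_of% hj,
      reassoc_of% hi]
  let _ : Algebra k S := coordAlgebra (C.subschemeι ≫ π) w
  let _ : Algebra k Γ((C ⊔ D).subscheme, ⊤) :=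
    ((Scheme.ΓSpecIso (.of k)).inv ≫ ((C ⊔ D).subschemeι ≫ π).appTop).hom.toAlgebra
  let g : S →ₐ[k] Γ((C ⊔ D).subscheme, ⊤) := { f.hom with
    commutes' := fun c ↦ congrArg (fun g ↦ g.hom c) hscal }
  have hkerg : RingHom.ker g = pb (D.comap C.subschemeι) w := hkerf
  exact ((Ideal.quotientEquivAlgOfEq k hkerg.symm).trans
    (Ideal.quotientKerAlgEquivOfSurjective (f := g) hsurj)).toLinearEquiv.finrank_eq.symm

end IntersectionNumber

end LangerSurface
end

/-! ### Finiteness on a one-dimensional scheme, and prime avoidance in the plane. -/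

noncomputable section
namespace LangerSurface

open Scheme.IdealSheafData Module MvPolynomial
attribute [local instance] MvPolynomial.gradedAlgebra

section Dimension

variable {k : Type u} [Field k] {Y : Scheme.{u}} {π : Y ⟶ Spec (.of k)}

lemma finiteType_coordAlgebra [LocallyOfFiniteType π] {S : CommRingCat.{u}} (w : Spec S ⟶ Y)
    [IsOpenImmersion w] : letI := coordAlgebra π w; Algebra.FiniteType k S := by
  have h1 : LocallyOfFiniteType (Spec.map (scalars π w)) := by
    rw [scalars, Spec.map_preimage]; infer_instance
  exact (HasRingHomProperty.Spec_iff (P := @LocallyOfFiniteType)).mp h1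

/-- In a domain of dimension at most one nonzero primes are maximal, so the quotient by a nonzero
ideal is zero-dimensional; being of finite type over k, it is finite. -/
lemma finiteQuotients_of_topologicalKrullDim_le [IsIntegral Y] [LocallyOfFiniteType π]
    (hdim : topologicalKrullDim Y ≤ 1) : FiniteQuotients π := by
  intro S w hw I hI
  let _ : Algebra k S := coordAlgebra π w
  have hft : Algebra.FiniteType k S := finiteType_coordAlgebra w
  have hS : Nontrivial S := by
    by_contra h
    rw [not_nontrivial_iff_subsingleton] at h
    exact hI (Subsingleton.elim _ _)
  have hz : Nonempty (PrimeSpectrum S) := inferInstance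
  have hdom : IsDomain S := isDomain_of_isOpenImmersion w hz.some
  have h1 : Ring.KrullDimLE 1 S := by
    rw [Ring.krullDimLE_iff, ← PrimeSpectrum.topologicalKrullDim_eq_ringKrullDim]
    exact (w.isOpenEmbedding.isInducing.topologicalKrullDim_le).trans hdim
  have h2 : Ring.KrullDimLE 0 (S ⧸ I) := by
    refine Ring.krullDimLE_zero_iff.mpr fun J hJ ↦ ?_
    have hJ' : (J.comap (Ideal.Quotient.mk I)).IsPrime := inferInstance
    have hne : J.comap (Ideal.Quotient.mk I) ≠ ⊥ := by
      intro h
      refine hI (le_bot_iff.mp (le_trans ?_ h.le))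
      intro x hx
      rw [Ideal.mem_comap, Ideal.Quotient.eq_zero_iff_mem.mpr hx]
      exact J.zero_mem
    have hbot : (⊥ : Ideal S).IsPrime := Ideal.isPrime_bot
    have hmax := Ring.krullDimLE_one_iff_of_isPrime_bot.mp h1 _ hne hJ'
    rw [← Ideal.map_comap_of_surjective _ Ideal.Quotient.mk_surjective J]
    refine (Ideal.map_eq_top_or_isMaximal_of_surjective _ Ideal.Quotient.mk_surjective
      hmax).resolve_left fun h ↦ hJ.ne_top ?_
    rw [← h, Ideal.map_comap_of_surjective _ Ideal.Quotient.mk_surjective J]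
  exact (Module.finite_iff_krullDimLE_zero k (S ⧸ I)).mpr h2

/-- On an affine open the set is the zero locus of a nonzero ideal, whose quotient is Artinian and
has finitely many primes. Compactness globalises this. -/
lemma finite_of_isClosed [IsIntegral Y] [CompactSpace Y] (hfin : FiniteQuotients π) {Z : Set Y}
    (hZ : IsClosed Z) (hgen : genericPoint Y ∉ Z) : Z.Finite := by
  rw [← Set.univ_inter Z]
  refine isCompact_univ.induction_on (p := fun t ↦ (t ∩ Z).Finite) (by simp)
    (fun s t hst ht ↦ ht.subset (Set.inter_subset_inter_left Z hst))
    (fun s t hs ht ↦ by rw [Set.union_inter_distrib_right]; exact hs.union ht) fun y _ ↦ ?_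
  obtain ⟨U, hU, hyU, -⟩ := exists_isAffineOpen_mem_and_subset (x := y) (U := ⊤) trivial
  refine ⟨U, mem_nhdsWithin_of_mem_nhds (U.2.mem_nhds hyU), ?_⟩
  let w := hU.fromSpec
  let I := PrimeSpectrum.vanishingIdeal (w ⁻¹' Z)
  have hzero : PrimeSpectrum.zeroLocus (I : Set Γ(Y, U)) = w ⁻¹' Z := by
    rw [PrimeSpectrum.zeroLocus_vanishingIdeal_eq_closure]
    exact (hZ.preimage w.continuous).closure_eq
  have hI : I ≠ ⊥ := by
    intro h
    obtain ⟨z, hz⟩ : genericPoint Y ∈ Set.range w := by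
      rw [hU.range_fromSpec]
      exact (genericPoint_specializes y).mem_open U.2 hyU
    refine hgen (hz ▸ ?_)
    change z ∈ w ⁻¹' Z
    rw [← hzero, h]
    exact bot_le (a := z.asIdeal)
  let _ : Algebra k Γ(Y, U) := coordAlgebra π w
  have hf : Module.Finite k (Γ(Y, U) ⧸ I) := hfin _ w inferInstance I hI
  have hart : IsArtinianRing (Γ(Y, U) ⧸ I) := IsArtinianRing.of_finite k _
  have hfz : (w ⁻¹' Z).Finite := by
    have h1 := range_comap_of_surjective _ (Ideal.Quotient.mk I)
      Ideal.Quotient.mk_surjective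
    rw [Ideal.mk_ker, hzero] at h1
    rw [← h1]
    exact Set.finite_range _
  refine (hfz.image w).subset ?_
  rintro x ⟨hx, hxZ⟩
  obtain ⟨z, rfl⟩ : x ∈ Set.range w := by rw [hU.range_fromSpec]; exact hx
  exact ⟨z, hxZ, rfl⟩

end Dimension

section PrimeAvoidance

/-- A finite set of points of the projective plane is contained in the complement of a curve. -/
lemma exists_forall_mem_basicOpen {F : Type u} [Field F] (Z : Finset (P2 F)) :
    ∃ (d : ℕ) (Q : MvPolynomial (Fin 3) F), 0 < d ∧ Q ∈ grading F d ∧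
      ∀ z ∈ Z, z ∈ Proj.basicOpen (grading F) Q := by
  classical
  induction Z using Finset.strongInduction with
  | H Z ih =>
  rcases Z.eq_empty_or_nonempty with rfl | hne
  · exact ⟨1, X 0, one_pos, isHomogeneous_X F 0, by simp⟩
  -- A point p whose ideal is minimal is split off, so that no other point of Z has its ideal
  -- contained in that of p.
  obtain ⟨p, hp, hmin⟩ := Z.exists_minimalFor (fun z : P2 F ↦ z.asHomogeneousIdeal.toIdeal) hne
  obtain ⟨d, Q, hd, hQ, hQZ⟩ := ih (Z.erase p) (Finset.erase_ssubset hp)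
  by_cases hQp : p ∈ Proj.basicOpen (grading F) Q
  · refine ⟨d, Q, hd, hQ, fun z hz ↦ ?_⟩
    rcases eq_or_ne z p with rfl | h
    · exact hQp
    · exact hQZ z (Finset.mem_erase.mpr ⟨h, hz⟩)
  have hnotmem : ∀ (z : P2 F) f, z ∈ Proj.basicOpen (grading F) f ↔
      f ∉ z.asHomogeneousIdeal.toIdeal := fun z f ↦ Iff.rfl
  have hr : ∀ z ∈ Z.erase p, ∃ (e : ℕ) (r : MvPolynomial (Fin 3) F), r ∈ grading F e ∧
      r ∈ z.asHomogeneousIdeal.toIdeal ∧ r ∉ p.asHomogeneousIdeal.toIdeal := by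
    intro z hz
    rw [Finset.mem_erase] at hz
    have hnle : ¬ z.asHomogeneousIdeal.toIdeal ≤ p.asHomogeneousIdeal.toIdeal := fun hle ↦
      hz.1 (ProjectiveSpectrum.ext (HomogeneousIdeal.toIdeal_injective
        (le_antisymm hle (hmin hz.2 hle))))
    by_contra! hcon
    refine hnle fun f hf ↦ ?_
    rw [← DirectSum.sum_support_decompose (grading F) f]
    exact Ideal.sum_mem _ fun i _ ↦ hcon i _ (SetLike.coe_mem _)
      (z.asHomogeneousIdeal.isHomogeneous i hf)
  choose! e r hre hrz hrp using hr
  have hpp : p.asHomogeneousIdeal.toIdeal.IsPrime := p.isPrime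
  obtain ⟨i, hi⟩ : ∃ i, (X i : MvPolynomial (Fin 3) F) ∉ p.asHomogeneousIdeal.toIdeal := by
    have h1 : p ∈ ⨆ i, Proj.basicOpen (grading F) (X i) := by rw [iSup_basicOpen_X]; trivial
    obtain ⟨i, hi⟩ := Opens.mem_iSup.mp h1
    exact ⟨i, hi⟩
  -- R vanishes at every other point but not at p. The factor `X i` makes its degree c positive.
  set R := X i * ∏ z ∈ Z.erase p, r z with hR
  set c := 1 + ∑ z ∈ Z.erase p, e z with hc
  have hRc : R ∈ grading F c :=
    (isHomogeneous_X F i).mul (IsHomogeneous.prod _ _ _ hre)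
  have hRp : R ∉ p.asHomogeneousIdeal.toIdeal := by
    intro h
    rcases hpp.mem_or_mem h with h | h
    · exact hi h
    · obtain ⟨z, hz, h⟩ := hpp.prod_mem_iff.mp h
      exact hrp z hz h
  have hRz : ∀ z ∈ Z.erase p, R ∈ z.asHomogeneousIdeal.toIdeal := fun z hz ↦
    Ideal.mul_mem_left _ _ (Ideal.mem_of_dvd _ (Finset.dvd_prod_of_mem r hz) (hrz z hz))
  rw [hnotmem, not_not] at hQp
  -- The exponents equalise the degrees. At p only the second summand survives, at the other points
  -- only the first.
  refine ⟨d * c, Q ^ c + R ^ d, by positivity, ?_, fun z hz ↦ ?_⟩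
  · refine IsHomogeneous.add (IsHomogeneous.pow hQ c) ?_
    rw [mul_comm]
    exact IsHomogeneous.pow hRc d
  · rw [hnotmem]
    rcases eq_or_ne z p with rfl | h
    · rw [Ideal.add_mem_iff_right _ (Ideal.pow_mem_of_mem _ hQp c (by omega))]
      exact fun h ↦ hRp (hpp.mem_of_pow_mem _ h)
    · have hz' := Finset.mem_erase.mpr ⟨h, hz⟩
      have hzp : z.asHomogeneousIdeal.toIdeal.IsPrime := z.isPrime
      rw [Ideal.add_mem_iff_left _ (Ideal.pow_mem_of_mem _ (hRz z hz') d hd)]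
      exact fun h ↦ (hnotmem z Q).mp (hQZ z hz') (hzp.mem_of_pow_mem _ h)

end PrimeAvoidance

end LangerSurface
end

/-! ### Curves on the surface are finite over the plane. -/

noncomputable section
namespace LangerSurface

open Scheme.IdealSheafData Module MvPolynomial
attribute [local instance] MvPolynomial.gradedAlgebra

lemma pb_ne_bot {Y : Scheme.{u}} [IsIntegral Y] {A : Y.IdealSheafData}
    (h : genericPoint Y ∉ A.support) {S : CommRingCat.{u}} (w : Spec S ⟶ Y) [IsOpenImmersion w]
    (z : Spec S) : pb A w ≠ ⊥ := by
  intro hA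
  obtain ⟨z₀, hz₀⟩ : genericPoint Y ∈ Set.range w :=
    (genericPoint_specializes (w z)).mem_open w.opensRange.2 ⟨z, rfl⟩
  refine h ?_
  rw [← hz₀, mem_support_iff_pb_le, hA]
  exact bot_le

/-- On a curve that is affine over the plane, the degree of divisors supported in a given finite
set is invariant under multiplication by rational functions. -/
lemma exists_affine_deg_eq {F k : Type u} [Field F] [Field k] {Y : Scheme.{u}} [IsIntegral Y]
    {π : Y ⟶ Spec (.of k)} {K : Type u} [Field K] {ε : Spec (.of K) ⟶ Y}
    (hε : ε (closedPt (.of K)) = genericPoint Y) (hfin : FiniteQuotients π)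
    (hΓ : π.appTop.hom.Finite) (h : Y ⟶ P2 F) [IsAffineHom h] {Z : Set Y} (hZ : Z.Finite) :
    ∃ (S : CommRingCat.{u}) (w : Spec S ⟶ Y) (_ : Spec S), IsOpenImmersion w ∧ Z ⊆ Set.range w ∧
      ∀ A B : Y.IdealSheafData, (A.support : Set Y) ⊆ Z → (B.support : Set Y) ⊆ Z →
        pb A w ≠ ⊥ → pb B w ≠ ⊥ → ∀ ψ : K, ψ ≠ 0 →
        (∀ y x, x ∈ lat ε A y ↔ ψ * x ∈ lat ε B y) → deg π w A = deg π w B := by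
  classical
  -- Including the generic point guarantees that the affine open is nonempty even when Z is empty.
  obtain ⟨d, Q, hd, hQ, hQZ⟩ := exists_forall_mem_basicOpen
    ((hZ.insert (genericPoint Y)).image h).toFinset
  have hQZ' : ∀ y ∈ insert (genericPoint Y) Z, h y ∈ Proj.basicOpen (grading F) Q := fun y hy ↦
    hQZ _ ((Set.Finite.mem_toFinset _).mpr ⟨y, hy, rfl⟩)
  have hU : IsAffineOpen (h ⁻¹ᵁ Proj.basicOpen (grading F) Q) :=
    (Proj.isAffineOpen_basicOpen _ _ hQ hd).preimage h
  have hmemU : ∀ y, y ∈ Set.range hU.fromSpec ↔ h y ∈ Proj.basicOpen (grading F) Q := fun y ↦ by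
    rw [hU.range_fromSpec]; rfl
  obtain ⟨z₀, -⟩ := (hmemU _).mpr (hQZ' _ (Set.mem_insert _ _))
  refine ⟨_, hU.fromSpec, z₀, inferInstance,
    fun y hy ↦ (hmemU y).mpr (hQZ' y (Set.mem_insert_of_mem _ hy)), ?_⟩
  have hV : ∀ i : Fin 3, IsAffineOpen (h ⁻¹ᵁ Proj.basicOpen (grading F) (X i)) := fun i ↦
    (Proj.isAffineOpen_basicOpen _ _ (isHomogeneous_X F i) one_pos).preimage h
  have hmemV : ∀ i y, y ∈ Set.range (hV i).fromSpec ↔ h y ∈ Proj.basicOpen (grading F) (X i) :=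
    fun i y ↦ by rw [(hV i).range_fromSpec]; rfl
  -- Empty charts are discarded, since each chart has to receive the generic K-point.
  let ι := {i : Fin 3 // Nonempty (Spec Γ(Y, h ⁻¹ᵁ Proj.basicOpen (grading F) (X i)))}
  have hcov : ∀ y, ∃ i : ι, y ∈ Set.range (hV i.1).fromSpec := by
    intro y
    have h1 : h y ∈ ⨆ i, Proj.basicOpen (grading F) (X i) := by rw [iSup_basicOpen_X]; trivial
    obtain ⟨i, hi⟩ := Opens.mem_iSup.mp h1
    obtain ⟨z, hz⟩ := (hmemV i y).mpr hi
    exact ⟨⟨i, ⟨z⟩⟩, z, hz⟩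
  choose φ hu hφ hφ' using fun i : ι ↦ exists_eq_P2pt ((hV i.1).fromSpec ≫ h) (isHomogeneous_X F i.1)
    fun y ↦ by
      rw [Scheme.Hom.comp_apply]
      exact (hmemV i.1 _).mp ⟨y, rfl⟩
  intro A B hA hB hA0 hB0 ψ hψ hlat
  refine deg_eq_of_mul_equiv hε hfin hΓ _ (fun i : ι ↦ (hV i.1).fromSpec) hcov
    (fun i ↦ i.2.some) hU.fromSpec z₀ (fun i ↦ φ i Q) ?_ ?_ ?_ hA0 hB0 hψ hlat
  · intro i z
    rw [hmemU, ← Scheme.Hom.comp_apply, hφ' i]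
    exact P2pt_mem_basicOpen (φ i) (isHomogeneous_X F i.1) one_pos (hu i) hQ hd z
  · exact fun y hy ↦ (hmemU y).mpr (hQZ' y (Set.mem_insert_of_mem _ (hA hy)))
  · exact fun y hy ↦ (hmemU y).mpr (hQZ' y (Set.mem_insert_of_mem _ (hB hy)))

section Surface

variable {F : Type u} [Field F] {X₀ : Scheme.{u}} {f₀ : X₀ ⟶ P2 F}
  (k : Type u) [Field k] [Algebra F k]

variable (F) in
/-- The projective plane over `k`. -/
abbrev planeOver : Scheme.{u} :=
  pullback (P2.toSpec F) (Spec.map (CommRingCat.ofHom (algebraMap F k)))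

variable (f₀) in
/-- The morphism from the surface to the projective plane over `k`. -/
def toPlaneOver : surface k f₀ ⟶ planeOver F k :=
  pullback.lift (surface.proj k f₀ ≫ f₀) (surface.toSpec k f₀)
    (by rw [Category.assoc]; exact pullback.condition)

lemma toPlaneOver_fst :
    toPlaneOver f₀ k ≫ pullback.fst _ _ = surface.proj k f₀ ≫ f₀ := pullback.lift_fst _ _ _

lemma toPlaneOver_snd :
    toPlaneOver f₀ k ≫ pullback.snd _ _ = surface.toSpec k f₀ := pullback.lift_snd _ _ _

variable {k}

lemma isProper_surface [Fintype F] (hF : Nat.card F = 2) (hf₀ : IsBlowupAtRatPoints f₀) :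
    IsProper (surface.toSpec k f₀) := by
  have := isProper_blowup hF hf₀
  have : IsProper (f₀ ≫ P2.toSpec F) := inferInstance
  infer_instance

/-- A point of the fibre product gives two points of the blow-up over one field with the same image,
away from the centre. There the ideal of the centre becomes the unit ideal, which is Cartier, so the
universal property makes the two points equal. -/
lemma eq_of_toPlaneOver_eq (hf₀ : IsBlowupAtRatPoints f₀) {y y' : surface k f₀}
    (h : toPlaneOver f₀ k y = toPlaneOver f₀ k y')
    (hy : f₀ (surface.proj k f₀ y) ∉ ratPoints F) : y = y' := by
  obtain ⟨z, rfl, rfl⟩ := Scheme.Pullback.exists_preimage_pullback y y' h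
  let P := pullback (toPlaneOver f₀ k) (toPlaneOver f₀ k)
  let T := Spec (P.residueField z)
  let τ : T ⟶ P := P.fromSpecResidueField z
  let a : T ⟶ surface k f₀ := τ ≫ pullback.fst _ _
  let b : T ⟶ surface k f₀ := τ ≫ pullback.snd _ _
  have hab : a ≫ toPlaneOver f₀ k = b ≫ toPlaneOver f₀ k := by
    simp only [a, b, Category.assoc]
    rw [pullback.condition]
  have h1 : a ≫ surface.toSpec k f₀ = b ≫ surface.toSpec k f₀ := by
    rw [← toPlaneOver_snd, reassoc_of% hab]
  have h2 : (a ≫ surface.proj k f₀) ≫ f₀ = (b ≫ surface.proj k f₀) ≫ f₀ := by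
    have h3 := congrArg (· ≫ pullback.fst _ _) hab
    simpa only [Category.assoc, toPlaneOver_fst] using h3
  have hpt : ∀ t : T, τ t = z := fun t ↦ by
    have : τ t ∈ Set.range τ := ⟨t, rfl⟩
    rwa [Scheme.range_fromSpecResidueField] at this
  have hcart : IsEffectiveCartier
      ((vanishingIdeal (ratPoints F)).comap ((a ≫ surface.proj k f₀) ≫ f₀)) := by
    have h3 : (vanishingIdeal (ratPoints F)).comap ((a ≫ surface.proj k f₀) ≫ f₀) = ⊤ := by
      rw [← support_eq_bot_iff]
      ext t
      rw [support_comap]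
      refine iff_of_false (fun ht ↦ hy ?_) (Set.notMem_empty t)
      have h4 : f₀ (surface.proj k f₀ (pullback.fst (toPlaneOver f₀ k) (toPlaneOver f₀ k) (τ t))) ∈
          ((vanishingIdeal (ratPoints F)).support : Set (P2 F)) := ht
      rwa [hpt, coe_support_vanishingIdeal] at h4
    rw [h3]
    exact .of_pb fun x ↦ ⟨_, 𝟙 _, inferInstance, ⟨x, rfl⟩, 1, Submonoid.one_mem _, by
      rw [pb_top, Ideal.span_singleton_one]⟩
  have h4 : a ≫ surface.proj k f₀ = b ≫ surface.proj k f₀ :=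
    (hf₀.2 _ _ hcart).unique rfl h2.symm
  have hab' : a = b := pullback.hom_ext h4 h1
  let t : T := IsLocalRing.closedPoint _
  have h5 : a t = b t := by rw [hab']
  simpa only [a, b, Scheme.Hom.comp_apply, hpt] using h5

end Surface

section Curve

variable {F : Type u} [Field F] [Fintype F] {X₀ : Scheme.{u}} {f₀ : X₀ ⟶ P2 F}
  {k : Type u} [Field k] [Algebra F k]

/-- The morphism from a closed subscheme of the surface to the plane. -/
def curveToPlane (C : (surface k f₀).IdealSheafData) : C.subscheme ⟶ P2 F :=
  C.subschemeι ≫ surface.proj k f₀ ≫ f₀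

lemma isProper_curve (hF : Nat.card F = 2) (hf₀ : IsBlowupAtRatPoints f₀)
    (C : (surface k f₀).IdealSheafData) : IsProper (C.subschemeι ≫ surface.toSpec k f₀) := by
  have := isProper_surface (k := k) hF hf₀
  infer_instance

/-- The map from C to the plane over k is proper with finite fibres, hence finite. The projection
from the plane over k to the plane over F is affine, as a base change of Spec k → Spec F. -/
lemma isAffineHom_curveToPlane (hF : Nat.card F = 2) (hf₀ : IsBlowupAtRatPoints f₀)
    {C : (surface k f₀).IdealSheafData} [IsIntegral C.subscheme]
    (hfin : FiniteQuotients (C.subschemeι ≫ surface.toSpec k f₀))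
    (hC : f₀ (surface.proj k f₀ (gen C)) ∉ ratPoints F) : IsAffineHom (curveToPlane C) := by
  have hprop := isProper_curve hF hf₀ C
  let g : C.subscheme ⟶ planeOver F k := C.subschemeι ≫ toPlaneOver f₀ k
  have hg₂ : g ≫ pullback.snd _ _ = C.subschemeι ≫ surface.toSpec k f₀ := by
    rw [Category.assoc, toPlaneOver_snd]
  have hg₁ : g ≫ pullback.fst _ _ = curveToPlane C := by
    rw [Category.assoc, toPlaneOver_fst]; rfl
  have : IsProper (g ≫ pullback.snd (P2.toSpec F) _) := by rw [hg₂]; exact hprop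
  have hgp : IsProper g := IsProper.of_comp g (pullback.snd _ _)
  have hcomp : CompactSpace C.subscheme := by
    have : QuasiCompact (C.subschemeι ≫ surface.toSpec k f₀) := inferInstance
    exact QuasiCompact.compactSpace_of_compactSpace (C.subschemeι ≫ surface.toSpec k f₀)
  have hbad : ((curveToPlane C) ⁻¹' (ratPoints F : Set (P2 F))).Finite := by
    refine finite_of_isClosed hfin ((ratPoints F).isClosed.preimage (curveToPlane C).continuous) ?_
    intro h
    refine hC ?_
    change curveToPlane C (genericPoint C.subscheme) ∈ ratPoints F at h
    rwa [curveToPlane, Scheme.Hom.comp_apply, Scheme.Hom.comp_apply] at h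
  -- A fibre has at most one point off the preimage of the rational points, and that preimage is
  -- finite because it misses the generic point.
  have hquasi : LocallyQuasiFinite g := by
    refine .of_finite_preimage_singleton g fun x ↦ ?_
    have hsub : (g ⁻¹' {x} \ (curveToPlane C) ⁻¹' (ratPoints F : Set (P2 F))).Subsingleton := by
      rintro y ⟨hy, hy'⟩ y' ⟨hy₂, -⟩
      refine C.subschemeι.isClosedEmbedding.injective (eq_of_toPlaneOver_eq hf₀ ?_ ?_)
      · rw [← Scheme.Hom.comp_apply, ← Scheme.Hom.comp_apply]
        exact hy.trans hy₂.symm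
      · exact hy'
    refine (hsub.finite.union hbad).subset ?_
    rw [Set.sdiff_union_self]
    exact Set.subset_union_left
  have : IsFinite g := .of_isProper_of_locallyQuasiFinite g
  have : IsAffineHom (pullback.fst (P2.toSpec F) (Spec.map (CommRingCat.ofHom (algebraMap F k)))) :=
    MorphismProperty.of_isPullback (P := @IsAffineHom) (IsPullback.of_hasPullback _ _).flip
      inferInstance
  rw [← hg₁]
  infer_instance

end Curve

end LangerSurface
end

/-! ### Curves off the rational lines, in chart coordinates. -/

noncomputable section
namespace LangerSurface

open Scheme.IdealSheafData Module MvPolynomial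
attribute [local instance] MvPolynomial.gradedAlgebra

/-- If C had zero ideal on a nonempty chart, so would C + D₁ and hence D₂, but a local equation of
D₂ is a non-zero-divisor. -/
lemma LinearlyEquivalent.pb_ne_bot {X : Scheme.{u}} {C D₁ D₂ : X.IdealSheafData}
    (h₁ : IsEffectiveCartier D₁) (h₂ : IsEffectiveCartier D₂)
    (h : LinearlyEquivalent (C * D₁) D₂)
    {A : CommRingCat.{u}} (J : Spec A ⟶ X) [IsOpenImmersion J] (y : Spec A) : pb C J ≠ ⊥ := by
  intro hC
  have h3 : C.ideal (affineRange J) = ⊥ := by rw [ideal_affineRange, hC, Ideal.map_bot]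
  have h4 : (C * D₁).ideal (affineRange J) = ⊥ := by
    rw [ideal_mul, Pi.mul_apply, h3, Ideal.bot_mul]
  have h5 : D₂.ideal (affineRange J) = ⊥ := by
    obtain ⟨e, -⟩ := h
    have hs : Subsingleton ((C * D₁).ideal (affineRange J)) := by rw [h4]; infer_instance
    have := (e (affineRange J)).symm.toEquiv.subsingleton
    exact (Submodule.subsingleton_iff_eq_bot).mp this
  have h6 : pb D₂ J = ⊥ := by rw [pb_eq_map_rangeIso, h5, Ideal.map_bot]
  obtain ⟨R, ν, z, -, -, -, δ, hδ, hδ'⟩ := exists_pb_pair h₁ h₂ J ⟨y, rfl⟩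
  rw [pb_comp, h6, Ideal.map_bot, eq_comm, Ideal.span_singleton_eq_bot] at hδ'
  have hR : Nontrivial R := ⟨0, 1, fun h ↦ z.2.ne_top
    ((Ideal.eq_top_iff_one _).mpr (h ▸ Ideal.zero_mem z.asIdeal))⟩
  exact nonZeroDivisors.ne_zero hδ hδ'

section

variable {F : Type u} [Field F] [Fintype F] {X₀ : Scheme.{u}} {f₀ : X₀ ⟶ P2 F}
  {k : Type u} [Field k] [Algebra F k]

lemma lineEq_notMem (hF : Nat.card F = 2) (hf₀ : IsBlowupAtRatPoints f₀)
    {x : surface k f₀}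
    (hx : ∀ a : Fin 3 → F, a ≠ 0 → f₀ (surface.proj k f₀ x) ∉ (ratLine a : Set (P2 F)))
    {b : Frame F} {y : Spec (.of (ChartRing F k))} (hy : surfaceChart k hF hf₀ b y = x)
    {a : Fin 3 → F} (ha : a ≠ 0) : lineEq k b a ∉ y.asIdeal := by
  intro h
  by_cases h0 : ∑ i, a i * b.pt i = 0
  · refine hx a ha ?_
    rw [← hy, surfaceChart_mem_ratLine]
    exact ⟨h0, Ideal.mul_mem_left _ _ h⟩
  · rw [lineEq_of_ne_zero k h0] at h
    exact y.2.ne_top ((Ideal.eq_top_iff_one _).mpr h)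

omit [Fintype F] in
lemma Frame.N_ne_zero (b : Frame F) (j : Fin 3) : b.N j ≠ 0 := by
  intro h
  have := b.sum_N_mul_M j j
  simp [h] at this

lemma s_notMem (hF : Nat.card F = 2) (hf₀ : IsBlowupAtRatPoints f₀)
    {x : surface k f₀}
    (hx : ∀ a : Fin 3 → F, a ≠ 0 → f₀ (surface.proj k f₀ x) ∉ (ratLine a : Set (P2 F)))
    {b : Frame F} {y : Spec (.of (ChartRing F k))} (hy : surfaceChart k hF hf₀ b y = x) :
    ChartRing.s F k ∉ y.asIdeal := by
  intro h
  refine hx (b.N 1) (b.N_ne_zero 1) ?_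
  rw [← hy, surfaceChart_mem_ratLine]
  exact ⟨by simpa [Frame.pt] using b.sum_N_mul_M 1 0, Ideal.mul_mem_right _ _ h⟩

lemma lineEq_N_two (b : Frame F) : lineEq k b (b.N 2) = ChartRing.t F k := by
  have h0 : ∑ i, b.N 2 i * b.pt i = 0 := by simpa [Frame.pt] using b.sum_N_mul_M 2 0
  rw [lineEq_of_eq_zero k h0, b.sum_N_mul_M, b.sum_N_mul_M]
  simp

/-- Off the rational lines a point lies over the neighbourhood of every rational point. Moreover t
does not vanish at it, since t is the equation of a rational line, so both charts there contain it.
-/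
lemma exists_surfaceChart_eq (hF : Nat.card F = 2) (hf₀ : IsBlowupAtRatPoints f₀)
    {x : surface k f₀}
    (hx : ∀ a : Fin 3 → F, a ≠ 0 → f₀ (surface.proj k f₀ x) ∉ (ratLine a : Set (P2 F)))
    (b : Frame F) : x ∈ Set.range (surfaceChart k hF hf₀ b) := by
  have h1 : f₀ (surface.proj k f₀ x) ∈ Proj.basicOpen (grading F) b.denom := by
    rw [Frame.mem_basicOpen_denom]
    intro a ha
    refine hx a fun h ↦ ?_
    simp [h] at ha
  rcases mem_range_surfaceChart_or k hF hf₀ b h1 with h | ⟨y, hy⟩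
  · exact h
  · have ht : ChartRing.t F k ∉ y.asIdeal := by
      rw [← lineEq_N_two b.swap]
      exact lineEq_notMem hF hf₀ hx hy (b.swap.N_ne_zero 2)
    have h2 := surfaceChart_mem_range_swap k hF hf₀ b.swap ht
    rwa [hy, b.swap_swap] at h2

lemma ChartRing.dvd_of_algebraMap_dvd {p h : MvPolynomial (Fin 2) k} (hp : Prime p)
    (hu : ¬ IsUnit (algebraMap _ (ChartRing F k) p))
    (hd : algebraMap _ (ChartRing F k) p ∣ algebraMap _ (ChartRing F k) h) : p ∣ h := by
  obtain ⟨c, hc⟩ := hd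
  obtain ⟨⟨c', ⟨_, n, rfl⟩⟩, hc'⟩ :=
    IsLocalization.surj (Submonoid.powers (chartDenom F k)) c
  have h1 : chartDenom F k ^ n * h = p * c' := by
    refine ChartRing.algebraMap_injective (F := F) ?_
    rw [map_mul, map_mul, hc, ← hc']
    ring
  refine (hp.dvd_or_dvd (Dvd.intro _ h1.symm)).resolve_left fun h2 ↦ hu ?_
  refine isUnit_of_dvd_unit (map_dvd (algebraMap _ (ChartRing F k)) (hp.dvd_of_dvd_pow h2)) ?_
  exact IsLocalization.Away.algebraMap_isUnit _

/-- In every chart, the curve is defined by an irreducible polynomial. -/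
lemma exists_prime_generator (hF : Nat.card F = 2) (hf₀ : IsBlowupAtRatPoints f₀)
    {C D₁ D₂ : (surface k f₀).IdealSheafData} [IsIntegral C.subscheme]
    (h₁ : IsEffectiveCartier D₁) (h₂ : IsEffectiveCartier D₂) (h : LinearlyEquivalent (C * D₁) D₂)
    {b : Frame F} {y : Spec (.of (ChartRing F k))} (hy : surfaceChart k hF hf₀ b y = gen C) :
    ∃ p : MvPolynomial (Fin 2) k, Prime p ∧
      y.asIdeal = Ideal.span {algebraMap _ (ChartRing F k) p} := by
  have hyp : y.asIdeal.IsPrime := y.2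
  have hne : y.asIdeal ≠ ⊥ := by
    rw [← pb_eq_asIdeal C _ hy]
    exact h.pb_ne_bot h₁ h₂ _ y
  have hne' : y.asIdeal.comap (algebraMap (MvPolynomial (Fin 2) k) (ChartRing F k)) ≠ ⊥ := by
    intro h0
    refine hne ((IsLocalization.map_under (Submonoid.powers (chartDenom F k)) _
      y.asIdeal).symm.trans ?_)
    exact (congrArg (Ideal.map _) h0).trans Ideal.map_bot
  -- The polynomial ring is factorial, so the nonzero prime contains a prime element; local
  -- principality then makes it a generator.
  obtain ⟨p, hp, hpp⟩ := Ideal.IsPrime.exists_mem_prime_of_ne_bot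
    (Ideal.comap_isPrime (algebraMap (MvPolynomial (Fin 2) k) (ChartRing F k)) y.asIdeal) hne'
  have hu : ¬ IsUnit (algebraMap _ (ChartRing F k) p) := fun hu ↦
    hyp.ne_top (Ideal.eq_top_of_isUnit_mem _ hp hu)
  exact ⟨p, hpp, eq_span_singleton_of_prime_mem (ChartRing.prime_algebraMap hpp hu) hp
    (exists_generator_asIdeal h₁ h₂ h _ hy)⟩

/-- The evaluation of forms in the homogeneous coordinates of a chart. -/
def coordHom (k : Type u) [Field k] [Algebra F k] (b : Frame F) :
    MvPolynomial (Fin 3) k →+* ChartRing F k :=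
  (algebraMap _ _).comp (Poly.chart (b.M.map (algebraMap F k))).toRingHom

lemma coordHom_apply (b : Frame F) (H : MvPolynomial (Fin 3) k) :
    coordHom k b H = algebraMap _ _ (Poly.chart (b.M.map (algebraMap F k)) H) := rfl

lemma coordHom_C (b : Frame F) (c : k) : coordHom k b (C c) = algebraMap k (ChartRing F k) c := by
  rw [coordHom_apply, ← algebraMap_eq, AlgHom.commutes, ← IsScalarTower.algebraMap_apply]

lemma coordHom_X (b : Frame F) (i : Fin 3) : coordHom k b (X i) =
    b.ev (algebraMap F (ChartRing F k)) (ChartRing.s F k) (ChartRing.s F k * ChartRing.t F k)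
      (X i) := by
  have h (c : F) : algebraMap (MvPolynomial (Fin 2) k) (ChartRing F k) (C (algebraMap F k c)) =
      algebraMap F (ChartRing F k) c := by
    rw [← algebraMap_eq, ← IsScalarTower.algebraMap_apply, ← IsScalarTower.algebraMap_apply]
  rw [coordHom_apply, Poly.chart_X, Frame.ev_X]
  simp only [map_add, map_mul, Matrix.map_apply, h]
  rfl

lemma coordHom_form (b : Frame F) (a : Fin 3 → F) :
    coordHom k b (form fun i ↦ algebraMap F k (a i)) =
      b.ev (algebraMap F (ChartRing F k)) (ChartRing.s F k) (ChartRing.s F k * ChartRing.t F k)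
        (form a) := by
  rw [form, form, map_sum, map_sum]
  refine Finset.sum_congr rfl fun i _ ↦ ?_
  rw [map_mul, map_mul, coordHom_C, coordHom_X, Frame.ev_C, ← IsScalarTower.algebraMap_apply]

/-- The homogeneous coordinates in two charts differ by a scalar. -/
lemma exists_coordHom_eq (hF : Nat.card F = 2) (hf₀ : IsBlowupAtRatPoints f₀) {b b' : Frame F}
    {R : CommRingCat.{u}} {κ κ' : CommRingCat.of (ChartRing F k) ⟶ R}
    (h : Spec.map κ ≫ surfaceChart k hF hf₀ b = Spec.map κ' ≫ surfaceChart k hF hf₀ b') :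
    ∃ l : R, IsUnit l ∧ ∀ (d : ℕ) (H : MvPolynomial (Fin 3) k), H.IsHomogeneous d →
      κ'.hom (coordHom k b' H) = l ^ d * κ.hom (coordHom k b H) := by
  have h1 := congrArg (· ≫ surface.proj k f₀ ≫ f₀) h
  have h2 := congrArg (· ≫ surface.toSpec k f₀) h
  simp only [Category.assoc, surfaceChart_plane, surfaceChart_toSpec, Frame.SpecMap_map] at h1 h2
  rw [← Spec.map_comp, ← Spec.map_comp] at h2
  have h3 : ∀ c : k, κ.hom (algebraMap k _ c) = κ'.hom (algebraMap k _ c) := fun c ↦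
    congrArg (fun f ↦ f.hom c) (Spec.map_injective h2)
  obtain ⟨hu, hl⟩ := b.eval_of_map_eq b' h1
  refine ⟨_, hu, fun d H hH ↦ ?_⟩
  refine hH.eval₂_smul (φ := κ.hom.comp (coordHom k b)) (φ' := κ'.hom.comp (coordHom k b')) ?_ ?_
  · intro c
    rw [RingHom.comp_apply, RingHom.comp_apply, coordHom_C, coordHom_C, h3]
  · intro i
    rw [RingHom.comp_apply, RingHom.comp_apply, coordHom_X, coordHom_X]
    have h4 := hl (X i) (isHomogeneous_X F i)
    have h5 := DFunLike.congr_fun (b.comp_ev (algebraMap F (ChartRing F k)) (ChartRing.s F k)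
      (ChartRing.s F k * ChartRing.t F k) κ.hom) (X i)
    have h6 := DFunLike.congr_fun (b'.comp_ev (algebraMap F (ChartRing F k)) (ChartRing.s F k)
      (ChartRing.s F k * ChartRing.t F k) κ'.hom) (X i)
    rw [RingHom.comp_apply] at h5 h6
    rw [h5, h6]
    simpa only [pow_one] using h4

end

end LangerSurface
end

/-! ### The plane equation of a curve and its multiplicities. -/

noncomputable section
namespace LangerSurface

open Scheme.IdealSheafData Module MvPolynomial
attribute [local instance] MvPolynomial.gradedAlgebra

/-- If no standard vector completed u, w to a basis, all 2 × 2 minors would vanish. Then u and w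
would be proportional, and over the field with two elements equal. -/
lemma Frame.exists_pt_col_eq {F : Type u} [Field F] (hF : Nat.card F = 2) {u w : Fin 3 → F}
    (hu : u ≠ 0) (hw : w ≠ 0) (huw : u ≠ w) :
    ∃ b : Frame F, (∀ i, b.M i 0 = u i) ∧ ∀ i, b.M i 1 = w i := by
  have key : ∀ M : Matrix (Fin 3) (Fin 3) F, M.det ≠ 0 → (∀ i, M i 0 = u i) →
      (∀ i, M i 1 = w i) → ∃ b : Frame F, (∀ i, b.M i 0 = u i) ∧ ∀ i, b.M i 1 = w i :=
    fun M hM h h' ↦ ⟨⟨M, M⁻¹, Matrix.mul_nonsing_inv _ hM.isUnit⟩, h, h'⟩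
  by_contra hcon
  have h0 : u 1 * w 2 = u 2 * w 1 := by
    by_contra h
    refine hcon (key !![u 0, w 0, 1; u 1, w 1, 0; u 2, w 2, 0] ?_
      (by intro i; fin_cases i <;> rfl) (by intro i; fin_cases i <;> rfl))
    simpa [Matrix.det_fin_three, sub_eq_zero, mul_comm (w 1)] using h
  have h1 : u 0 * w 2 = u 2 * w 0 := by
    by_contra h
    refine hcon (key !![u 0, w 0, 0; u 1, w 1, 1; u 2, w 2, 0] ?_
      (by intro i; fin_cases i <;> rfl) (by intro i; fin_cases i <;> rfl))
    simpa [Matrix.det_fin_three, neg_add_eq_zero, mul_comm (w 0)] using h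
  have h2 : u 0 * w 1 = u 1 * w 0 := by
    by_contra h
    refine hcon (key !![u 0, w 0, 0; u 1, w 1, 0; u 2, w 2, 1] ?_
      (by intro i; fin_cases i <;> rfl) (by intro i; fin_cases i <;> rfl))
    simpa [Matrix.det_fin_three, sub_eq_zero, mul_comm (w 0)] using h
  have h3 : ∀ i j, u i * w j = u j * w i := by
    intro i j
    fin_cases i <;> fin_cases j <;> first | rfl | assumption | (symm; assumption)
  obtain ⟨i, hi⟩ := Function.ne_iff.mp hu
  have hi1 : u i = 1 := (eq_zero_or_one_of_card hF _).resolve_left hi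
  rcases eq_zero_or_one_of_card hF (w i) with h | h
  · exact hw (funext fun j ↦ by simpa [hi1, h] using h3 i j)
  · exact huw (funext fun j ↦ by simpa [hi1, h, eq_comm] using h3 i j)

section

variable {F : Type u} [Field F] [Fintype F] {X₀ : Scheme.{u}} {f₀ : X₀ ⟶ P2 F}
  {k : Type u} [Field k] [Algebra F k]

lemma toField_eq_zero_iff {K : Type u} [Field K] {A : CommRingCat.{u}} (κ : A ⟶ .of K) (a : A) :
    κ.hom a = 0 ↔ a ∈ (Spec.map κ (closedPt (.of K))).asIdeal := by
  change _ ↔ κ.hom a ∈ IsLocalRing.maximalIdeal K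
  rw [IsLocalRing.mem_maximalIdeal, mem_nonunits_iff, isUnit_iff_ne_zero, not_not]

/-- A point with values in a field factors through every chart that contains its image. -/
lemma exists_toField_chart {X : Scheme.{u}} {K : Type u} [Field K] (e : Spec (.of K) ⟶ X)
    {A : CommRingCat.{u}} (J : Spec A ⟶ X) [IsOpenImmersion J] {y : Spec A}
    (hy : J y = e (closedPt (.of K))) :
    ∃ κ : A ⟶ .of K, Spec.map κ ≫ J = e ∧ ∀ a, κ.hom a = 0 ↔ a ∈ y.asIdeal := by
  have : IsLocalRing (CommRingCat.of K) := inferInstanceAs (IsLocalRing K)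
  obtain ⟨κ, hκ⟩ := exists_eq_SpecMap_comp_of_isLocalRing e J ⟨y, hy⟩
  have h1 : Spec.map κ (closedPt (.of K)) = y := by
    refine J.isOpenEmbedding.injective ?_
    rw [hy, hκ, Scheme.Hom.comp_apply]
  refine ⟨κ, hκ.symm, fun a ↦ ?_⟩
  rw [← h1]
  exact toField_eq_zero_iff κ a

/-- In the residue field of x the values of a form in two charts differ by a nonzero factor. -/
lemma coordHom_mem_iff (hF : Nat.card F = 2) (hf₀ : IsBlowupAtRatPoints f₀) {b b' : Frame F}
    {y y' : Spec (.of (ChartRing F k))} {x : surface k f₀} (hy : surfaceChart k hF hf₀ b y = x)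
    (hy' : surfaceChart k hF hf₀ b' y' = x) {d : ℕ} {H : MvPolynomial (Fin 3) k}
    (hH : H.IsHomogeneous d) : coordHom k b H ∈ y.asIdeal ↔ coordHom k b' H ∈ y'.asIdeal := by
  let e : Spec (.of ((surface k f₀).residueField x)) ⟶ surface k f₀ :=
    (surface k f₀).fromSpecResidueField x
  have he : e (closedPt _) = x := Scheme.fromSpecResidueField_apply _ _
  obtain ⟨κ, h1, h2⟩ := exists_toField_chart e (surfaceChart k hF hf₀ b) (hy.trans he.symm)
  obtain ⟨κ', h1', h2'⟩ := exists_toField_chart e (surfaceChart k hF hf₀ b') (hy'.trans he.symm)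
  obtain ⟨l, hl, h3⟩ := exists_coordHom_eq hF hf₀ (h1.trans h1'.symm)
  rw [← h2, ← h2', h3 d H hH, (hl.pow d).mul_right_eq_zero]

lemma coordHom_form_notMem (hF : Nat.card F = 2) (hf₀ : IsBlowupAtRatPoints f₀)
    {x : surface k f₀}
    (hx : ∀ a : Fin 3 → F, a ≠ 0 → f₀ (surface.proj k f₀ x) ∉ (ratLine a : Set (P2 F)))
    {b : Frame F} {y : Spec (.of (ChartRing F k))} (hy : surfaceChart k hF hf₀ b y = x)
    {a : Fin 3 → F} (ha : a ≠ 0) :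
    coordHom k b (form fun i ↦ algebraMap F k (a i)) ∉ y.asIdeal := by
  rw [coordHom_form]
  by_cases h0 : ∑ i, a i * b.pt i = 0
  · rw [ev_form_of_eq_zero k h0]
    intro h
    rcases y.2.mem_or_mem h with h | h
    · exact s_notMem hF hf₀ hx hy h
    · exact lineEq_notMem hF hf₀ hx hy ha h
  · exact fun h ↦ y.2.ne_top (Ideal.eq_top_of_isUnit_mem _ h
      (isUnit_ev_form hF h0 (isUnit_chart_denom k b)))

omit [Fintype F] in
lemma Frame.map_mul_eq (b : Frame F) :
    b.M.map (algebraMap F k) * b.N.map (algebraMap F k) = 1 := by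
  rw [← Matrix.map_mul, b.mul_eq, Matrix.map_one _ (map_zero _) (map_one _)]

/-- A curve that is none of the exceptional ones is the proper transform of a plane curve, whose
multiplicities at the three points of a line add up to at most the degree. -/
lemma exists_form (hF : Nat.card F = 2) (hf₀ : IsBlowupAtRatPoints f₀)
    {C D₁ D₂ : (surface k f₀).IdealSheafData} [IsIntegral C.subscheme]
    (h₁ : IsEffectiveCartier D₁) (h₂ : IsEffectiveCartier D₂) (h : LinearlyEquivalent (C * D₁) D₂)
    (hx : ∀ a : Fin 3 → F, a ≠ 0 →
      f₀ (surface.proj k f₀ (gen C)) ∉ (ratLine a : Set (P2 F))) :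
    ∃ (d : ℕ) (G : MvPolynomial (Fin 3) k) (m : (Fin 3 → F) → ℕ) (π : Frame F → ChartRing F k),
      G.IsHomogeneous d ∧ (∀ b, coordHom k b G = ChartRing.s F k ^ m b.pt * π b) ∧
      (∀ b, pb C (surfaceChart k hF hf₀ b) = Ideal.span {π b}) ∧
      ∀ u w, u ≠ 0 → w ≠ 0 → u ≠ w → m u + m w + m (u + w) ≤ d := by
  choose y hy using exists_surfaceChart_eq hF hf₀ hx
  choose p hp hpy using fun b ↦ exists_prime_generator hF hf₀ h₁ h₂ h (hy b)
  have hs : ∀ b, ¬ X 0 ∣ p b := fun b hd ↦ by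
    refine s_notMem hF hf₀ hx (hy b) ?_
    rw [hpy, Ideal.mem_span_singleton]
    exact map_dvd _ (((X_prime (i := (0 : Fin 2))).irreducible.associated_of_dvd
      (hp b).irreducible hd).symm.dvd)
  have hdvd : ∀ b (H : MvPolynomial (Fin 3) k),
      p b ∣ Poly.chart (b.M.map (algebraMap F k)) H ↔ coordHom k b H ∈ (y b).asIdeal := by
    intro b H
    rw [hpy, Ideal.mem_span_singleton, coordHom_apply]
    refine ⟨map_dvd _, ChartRing.dvd_of_algebraMap_dvd (F := F) (hp b) fun hu ↦ (y b).2.ne_top ?_⟩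
    rw [hpy]
    exact Ideal.span_singleton_eq_top.mpr hu
  choose d n G hG hGn hGd using fun b : Frame F ↦
    Poly.exists_homogeneous_generator_chart b.map_mul_eq (hp b) (hs b)
  have hGp : ∀ b, p b ∣ Poly.chart (b.M.map (algebraMap F k)) (G b) := fun b ↦ by
    rw [hGn]; exact Dvd.intro_left _ rfl
  obtain ⟨b₀, -⟩ := Frame.exists_pt_eq (F := F) (v := 1) one_ne_zero
  -- Each of the forms vanishes at the generic point of C, and each divides every form that does. So
  -- they agree up to units.
  have hle : ∀ b b', G b ∣ G b' := fun b b' ↦ hGd b _ _ (hG b') <| by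
    rw [hdvd, coordHom_mem_iff hF hf₀ (hy b) (hy b') (hG b'), ← hdvd]
    exact hGp b'
  have hG0 : ∀ b, G b ≠ 0 := fun b h0 ↦ by
    have := hGn b
    rw [h0, map_zero, eq_comm, mul_eq_zero] at this
    exact this.elim (pow_ne_zero _ (X_ne_zero _)) (hp b).ne_zero
  choose c hc using fun b ↦ associated_of_dvd_dvd (hle b b₀) (hle b₀ b)
  -- The generator absorbs the comparison unit, so that the single form `G b₀` serves all charts.
  let p' : Frame F → MvPolynomial (Fin 2) k :=
    fun b ↦ p b * Poly.chart (b.M.map (algebraMap F k)) (c b)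
  have hcu : ∀ b, IsUnit (Poly.chart (b.M.map (algebraMap F k)) (c b)) :=
    fun b ↦ (c b).isUnit.map _
  have hp' : ∀ b, Prime (p' b) := fun b ↦
    (associated_mul_unit_left (p b) _ (hcu b)).symm.prime (hp b)
  have hs' : ∀ b, ¬ X 0 ∣ p' b := fun b ↦ by
    rw [(hcu b).dvd_mul_right]; exact hs b
  have hGb : ∀ b, Poly.chart (b.M.map (algebraMap F k)) (G b₀) = X 0 ^ n b * p' b := fun b ↦ by
    rw [← hc b, map_mul, hGn, mul_assoc]
  -- The exponent of s is the multiplicity of `G b₀` at the point of the frame, and so depends on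
  -- that point alone.
  have hpow : ∀ b j, G b₀ ∈ Poly.pointIdeal (fun i ↦ algebraMap F k (b.pt i)) ^ j ↔ j ≤ n b := by
    intro b j
    refine (Poly.pow_dvd_chart_iff (m := j) b.map_mul_eq (hG b₀)).symm.trans ?_
    rw [hGb]
    refine ⟨fun h ↦ ?_, fun h ↦ Dvd.dvd.mul_right (pow_dvd_pow _ h) _⟩
    have h1 := (X_prime (i := (0 : Fin 2)) (R := k)).pow_dvd_of_dvd_mul_right _ (hs' b) h
    exact (pow_dvd_pow_iff (X_ne_zero _) (X_prime (i := (0 : Fin 2)) (R := k)).not_isUnit).mp h1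
  have hn : ∀ b b', b.pt = b'.pt → n b = n b' := fun b b' hb ↦
    eq_of_forall_le_iff fun j ↦ by rw [← hpow, ← hpow, hb]
  -- The value at the zero vector is arbitrary, as only nonzero vectors are points.
  let m : (Fin 3 → F) → ℕ := fun v ↦ open Classical in
    if hv : v ≠ 0 then n (Frame.exists_pt_eq hv).choose else 0
  have hm : ∀ b, m b.pt = n b := fun b ↦ by
    have hb : b.pt ≠ 0 := b.pt_ne_zero
    simp only [m, dif_pos hb]
    exact hn _ _ (Frame.exists_pt_eq hb).choose_spec
  have hmv : ∀ v : Fin 3 → F, v ≠ 0 →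
      G b₀ ∈ Poly.pointIdeal (fun i ↦ algebraMap F k (v i)) ^ m v := by
    intro v hv
    obtain ⟨b, rfl⟩ := Frame.exists_pt_eq hv
    rw [hpow, hm]
  refine ⟨d b₀, G b₀, m, fun b ↦ algebraMap _ _ (p' b), hG b₀, fun b ↦ ?_, fun b ↦ ?_, ?_⟩
  · rw [coordHom_apply, hGb, map_mul, map_pow, hm]
    rfl
  · rw [pb_eq_asIdeal C _ (hy b), hpy, Ideal.span_singleton_eq_span_singleton]
    change Associated _ (algebraMap _ _ (p b * _))
    rw [map_mul]
    exact associated_mul_unit_right _ _ ((hcu b).map _)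
  · intro u w hu hw huw
    obtain ⟨b, hbu, hbw⟩ := Frame.exists_pt_col_eq hF hu hw huw
    have huw' : u + w ≠ 0 := by
      intro h0
      refine huw (funext fun i ↦ ?_)
      have h2 := congrFun h0 i
      rw [Pi.add_apply, Pi.zero_apply, add_eq_zero_iff_eq_neg] at h2
      rcases eq_zero_or_one_of_card hF (u i) with h3 | h3 <;>
        rcases eq_zero_or_one_of_card hF (w i) with h4 | h4 <;>
        rw [h3, h4] at h2 ⊢ <;> simp at h2
    refine Poly.add_le_of_mem_pointIdeal_pow b.map_mul_eq (hG b₀) ?_ ?_ ?_ ?_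
    -- The line through the two points has equation s t in the chart. If it divided G, then t would
    -- divide the equation of C, and C would lie over a rational line.
    · intro hd
      have hN : ∑ i, b.N 2 i * b.pt i = 0 := by simpa [Frame.pt] using b.sum_N_mul_M 2 0
      have h1 : Poly.chart (b.M.map (algebraMap F k)) (form fun i ↦ algebraMap F k (b.N 2 i)) =
          X 0 * X 1 := ChartRing.algebraMap_injective (F := F) <| by
        rw [← coordHom_apply, coordHom_form, ev_form_of_eq_zero k hN, lineEq_N_two, map_mul]
        rfl
      have h2 : X 0 * X 1 ∣ X 0 ^ n b * p' b := by
        rw [← hGb, ← h1]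
        exact map_dvd (Poly.chart (b.M.map (algebraMap F k))) hd
      have hX : Prime (X 1 : MvPolynomial (Fin 2) k) := X_prime
      rcases hX.dvd_or_dvd (dvd_of_mul_left_dvd h2) with h3 | h3
      · exact absurd (X_dvd_X.mp (hX.dvd_of_dvd_pow h3)) (by simp)
      · refine lineEq_notMem hF hf₀ hx (hy b) (b.N_ne_zero 2) ?_
        rw [lineEq_N_two, hpy, Ideal.mem_span_singleton]
        exact map_dvd (algebraMap _ (ChartRing F k)) ((dvd_mul_right _ _).trans
          (hX.irreducible.associated_of_dvd (hp' b).irreducible h3).symm.dvd)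
    · simpa only [Matrix.map_apply, hbu] using hmv u hu
    · simpa only [Matrix.map_apply, hbw] using hmv w hw
    · simpa only [Matrix.map_apply, hbu, hbw, Pi.add_apply, map_add] using hmv (u + w) huw'

end

end LangerSurface
end

/-! ### Divisors on the surface and their restriction to C. -/

noncomputable section
namespace LangerSurface

open Scheme.IdealSheafData Module MvPolynomial
attribute [local instance] MvPolynomial.gradedAlgebra

section

variable {X : Scheme.{u}}

lemma pb_pow (I : X.IdealSheafData) (n : ℕ) {R : CommRingCat.{u}} (f : Spec R ⟶ X) :
    pb (I ^ n) f = pb I f ^ n := by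
  induction n with
  | zero => rw [pow_zero, pow_zero, Ideal.one_eq_top]; exact pb_top f
  | succ n ih => rw [pow_succ, pow_succ, pb_mul, ih]

lemma pb_prod {ι : Type*} (s : Finset ι) (I : ι → X.IdealSheafData) {R : CommRingCat.{u}}
    (f : Spec R ⟶ X) : pb (∏ i ∈ s, I i) f = ∏ i ∈ s, pb (I i) f := by
  classical
  induction s using Finset.induction_on with
  | empty => rw [Finset.prod_empty, Finset.prod_empty, Ideal.one_eq_top]; exact pb_top f
  | insert i s hi ih => rw [Finset.prod_insert hi, Finset.prod_insert hi, pb_mul, ih]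

/-- A closed subscheme is covered by affine charts over the charts of the ambient scheme. -/
lemma exists_chart_subscheme (C : X.IdealSheafData) {R : CommRingCat.{u}} (J : Spec R ⟶ X)
    [IsOpenImmersion J] {y : C.subscheme} (hy : C.subschemeι y ∈ Set.range J) :
    ∃ (S : CommRingCat.{u}) (w : Spec S ⟶ C.subscheme) (z : Spec S) (ρ : R ⟶ S),
      IsOpenImmersion w ∧ w z = y ∧ w ≫ C.subschemeι = Spec.map ρ ≫ J := by
  have hU : IsAffineOpen (C.subschemeι ⁻¹ᵁ (affineRange J).1) := (affineRange J).2.preimage _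
  obtain ⟨z, hz⟩ : y ∈ Set.range hU.fromSpec := by
    rw [hU.range_fromSpec]
    exact (mem_affineRange _).mpr hy
  have hr : Set.range (hU.fromSpec ≫ C.subschemeι) ⊆ Set.range J := by
    rintro _ ⟨z', rfl⟩
    have h1 : hU.fromSpec z' ∈ Set.range hU.fromSpec := ⟨z', rfl⟩
    rw [hU.range_fromSpec] at h1
    rw [Scheme.Hom.comp_apply]
    exact (mem_affineRange _).mp h1
  obtain ⟨ρ, hρ⟩ := Spec.map_surjective (IsOpenImmersion.lift J _ hr)
  exact ⟨_, hU.fromSpec, z, ρ, inferInstance, hz, by rw [hρ, IsOpenImmersion.lift_fac]⟩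

lemma gen_notMem_support {C D : X.IdealSheafData} [IsIntegral C.subscheme] (h : ¬ D ≤ C) :
    gen C ∉ D.support := by
  intro hg
  refine h ?_
  rw [← vanishingIdeal_eq_of_isIntegral (I := C), ← le_support_iff_le_vanishingIdeal]
  intro x hx
  have hx' : x ∈ (C.support : Set X) := hx
  rw [support_eq_closure] at hx'
  exact closure_minimal (Set.singleton_subset_iff.mpr hg) D.support.isClosed hx'

lemma genericPoint_mem_support_comap {C D : X.IdealSheafData} [IsIntegral C.subscheme] :
    genericPoint C.subscheme ∈ (D.comap C.subschemeι).support ↔ gen C ∈ D.support := by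
  rw [support_comap]; rfl

/-- A local equation stays nonzero on C because the generic point of C is off the divisor; on an
integral scheme it is then a non-zero-divisor. -/
lemma IsEffectiveCartier.restrict {C D : X.IdealSheafData} [IsIntegral C.subscheme]
    (hD : IsEffectiveCartier D) (hg : gen C ∉ D.support) :
    IsEffectiveCartier (D.comap C.subschemeι) := by
  refine .of_pb fun y ↦ ?_
  obtain ⟨R, J, z, hJ, hz, s, -, hs⟩ := hD.exists_pb (C.subschemeι y)
  obtain ⟨S, w, z', ρ, hw, hz', hρ⟩ := exists_chart_subscheme C J ⟨z, hz⟩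
  have hdom := isDomain_of_isOpenImmersion w z'
  have h1 : pb (D.comap C.subschemeι) w = Ideal.span {ρ.hom s} := by
    rw [pb_comap, hρ, pb_comp, hs, Ideal.map_span, Set.image_singleton]
  have h2 := pb_ne_bot (mt genericPoint_mem_support_comap.mp hg) w z'
  refine ⟨S, w, hw, ⟨z', hz'⟩, ρ.hom s, ?_, h1⟩
  rw [mem_nonZeroDivisors_iff_ne_zero]
  rintro h0
  rw [h1, h0, Ideal.span_singleton_eq_bot.mpr rfl] at h2
  exact h2 rfl

lemma toField_ne_zero {K : Type u} [Field K] {e : Spec (.of K) ⟶ X}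
    {A : CommRingCat.{u}} {J : Spec A ⟶ X} {κ : A ⟶ .of K} (hκ : Spec.map κ ≫ J = e)
    {D : X.IdealSheafData} {δ : A} (hD : pb D J = Ideal.span {δ})
    (he : e (closedPt (.of K)) ∉ D.support) : κ.hom δ ≠ 0 := by
  intro h
  refine he ?_
  rw [← hκ, Scheme.Hom.comp_apply, mem_support_iff_pb_le, hD, Ideal.span_singleton_le_iff_mem]
  exact (toField_eq_zero_iff κ δ).mp h

end

section

variable {F : Type u} [Field F] [Fintype F] {X₀ : Scheme.{u}} {f₀ : X₀ ⟶ P2 F}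
  {k : Type u} [Field k] [Algebra F k]

lemma notMem_ratPoint_of_forall_ratLine (hF : Nat.card F = 2) (hf₀ : IsBlowupAtRatPoints f₀)
    {x : surface k f₀}
    (hx : ∀ a : Fin 3 → F, a ≠ 0 → f₀ (surface.proj k f₀ x) ∉ (ratLine a : Set (P2 F)))
    {v : Fin 3 → F} (hv : v ≠ 0) : f₀ (surface.proj k f₀ x) ∉ (ratPoint v : Set (P2 F)) := by
  obtain ⟨b, rfl⟩ := Frame.exists_pt_eq hv
  obtain ⟨y, rfl⟩ := exists_surfaceChart_eq hF hf₀ hx b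
  rw [surfaceChart_mem_ratPoint k hF hf₀ b y hv]
  exact fun h ↦ s_notMem hF hf₀ hx rfl h.2

/-- The total transform of a rational line. -/
def totalLine (k : Type u) [Field k] [Algebra F k] (f₀ : X₀ ⟶ P2 F) (a : Fin 3 → F) :
    (surface k f₀).IdealSheafData :=
  open Classical in
  lineCurve k f₀ a * ∏ v : Fin 3 → F with v ≠ 0 ∧ ∑ i, a i * v i = 0, exceptionalCurve k f₀ v

lemma pb_exceptionalCurve_pow (hF : Nat.card F = 2) (hf₀ : IsBlowupAtRatPoints f₀) (b : Frame F)
    {v : Fin 3 → F} (hv : v ≠ 0) (n : ℕ) :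
    pb (exceptionalCurve k f₀ v) (surfaceChart k hF hf₀ b) ^ n =
      open Classical in if v = b.pt then Ideal.span {ChartRing.s F k ^ n} else 1 := by
  split_ifs with h
  · rw [h, pb_exceptionalCurve, Ideal.span_singleton_pow]
  · rw [pb_exceptionalCurve_of_ne k hF hf₀ b hv h, ← Ideal.one_eq_top, one_pow]

/-- If the line passes through b₀, its form pulls back to s times the equation of the proper
transform, the factor s being the one exceptional curve in this chart. If not, all terms are units.
-/
lemma pb_totalLine (hF : Nat.card F = 2) (hf₀ : IsBlowupAtRatPoints f₀) (b : Frame F)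
    {a : Fin 3 → F} (ha : a ≠ 0) : pb (totalLine k f₀ a) (surfaceChart k hF hf₀ b) =
      Ideal.span {coordHom k b (form fun i ↦ algebraMap F k (a i))} := by
  classical
  rw [totalLine, pb_mul, pb_prod, pb_lineCurve k hF hf₀ b ha]
  have h1 : ∀ v ∈ ({v : Fin 3 → F | v ≠ 0 ∧ ∑ i, a i * v i = 0} : Finset (Fin 3 → F)),
      pb (exceptionalCurve k f₀ v) (surfaceChart k hF hf₀ b) =
        if v = b.pt then Ideal.span {ChartRing.s F k ^ 1} else 1 := fun v hv ↦ by
    rw [← pow_one (pb _ _)]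
    exact pb_exceptionalCurve_pow hF hf₀ b (Finset.mem_filter.mp hv).2.1 1
  rw [Finset.prod_congr rfl h1, Finset.prod_ite_eq']
  by_cases h : ∑ i, a i * b.pt i = 0
  · rw [if_pos (by simpa [b.pt_ne_zero] using h), coordHom_form, ev_form_of_eq_zero k h,
      Ideal.span_singleton_mul_span_singleton, pow_one, mul_comm]
  · rw [if_neg (by simpa [b.pt_ne_zero] using h), mul_one, lineEq_of_ne_zero k h,
      Ideal.span_singleton_one, coordHom_form]
    exact (Ideal.span_singleton_eq_top.mpr
      (isUnit_ev_form hF h (isUnit_chart_denom k b))).symm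

lemma pb_prod_exceptionalCurve (hF : Nat.card F = 2) (hf₀ : IsBlowupAtRatPoints f₀) (b : Frame F)
    (m : (Fin 3 → F) → ℕ) :
    pb (open Classical in ∏ v ∈ Finset.univ.erase 0, exceptionalCurve k f₀ v ^ m v)
      (surfaceChart k hF hf₀ b) = Ideal.span {ChartRing.s F k ^ m b.pt} := by
  classical
  have h1 : ∀ v ∈ (Finset.univ.erase (0 : Fin 3 → F)),
      pb (exceptionalCurve k f₀ v ^ m v) (surfaceChart k hF hf₀ b) =
        if v = b.pt then Ideal.span {ChartRing.s F k ^ m v} else 1 := fun v hv ↦ by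
    rw [pb_pow]
    exact pb_exceptionalCurve_pow hF hf₀ b (Finset.ne_of_mem_erase hv) _
  rw [pb_prod, Finset.prod_congr rfl h1, Finset.prod_ite_eq',
    if_pos (Finset.mem_erase.mpr ⟨b.pt_ne_zero, Finset.mem_univ _⟩)]

lemma isEffectiveCartier_of_forall_surfaceChart (hF : Nat.card F = 2)
    (hf₀ : IsBlowupAtRatPoints f₀) {D : (surface k f₀).IdealSheafData}
    (h : ∀ b, ∃ δ : ChartRing F k, δ ≠ 0 ∧ pb D (surfaceChart k hF hf₀ b) = Ideal.span {δ}) :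
    IsEffectiveCartier D := by
  refine .of_pb fun x ↦ ?_
  obtain ⟨b, hb⟩ := exists_mem_range_surfaceChart k hF hf₀ x
  obtain ⟨δ, hδ, hD⟩ := h b
  exact ⟨_, _, inferInstance, hb, δ, mem_nonZeroDivisors_of_ne_zero hδ, hD⟩

lemma isEffectiveCartier_exceptionalCurve (hF : Nat.card F = 2) (hf₀ : IsBlowupAtRatPoints f₀)
    {v : Fin 3 → F} (hv : v ≠ 0) : IsEffectiveCartier (exceptionalCurve k f₀ v) := by
  refine isEffectiveCartier_of_forall_surfaceChart hF hf₀ fun b ↦ ?_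
  by_cases h : v = b.pt
  · exact ⟨_, ChartRing.prime_s.ne_zero, h ▸ pb_exceptionalCurve k hF hf₀ b⟩
  · exact ⟨1, one_ne_zero, (pb_exceptionalCurve_of_ne k hF hf₀ b hv h).trans
      Ideal.span_singleton_one.symm⟩

lemma lineEq_ne_zero {b : Frame F} {a : Fin 3 → F} (ha : a ≠ 0) : lineEq k b a ≠ 0 := by
  by_cases h : ∑ i, a i * b.pt i = 0 ∧ ∑ i, a i * b.M i 2 ≠ 0
  · exact (prime_lineEq k h.1 h.2).ne_zero
  · exact (isUnit_lineEq k ha fun h0 ↦ by simpa [h0] using h).ne_zero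

lemma isEffectiveCartier_lineCurve (hF : Nat.card F = 2) (hf₀ : IsBlowupAtRatPoints f₀)
    {a : Fin 3 → F} (ha : a ≠ 0) : IsEffectiveCartier (lineCurve k f₀ a) :=
  isEffectiveCartier_of_forall_surfaceChart hF hf₀ fun b ↦
    ⟨_, lineEq_ne_zero ha, pb_lineCurve k hF hf₀ b ha⟩

lemma notMem_support_exceptionalCurve (hF : Nat.card F = 2) (hf₀ : IsBlowupAtRatPoints f₀)
    {x : surface k f₀}
    (hx : ∀ a : Fin 3 → F, a ≠ 0 → f₀ (surface.proj k f₀ x) ∉ (ratLine a : Set (P2 F)))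
    {v : Fin 3 → F} (hv : v ≠ 0) : x ∉ (exceptionalCurve k f₀ v).support := by
  obtain ⟨b, rfl⟩ := Frame.exists_pt_eq hv
  obtain ⟨y, rfl⟩ := exists_surfaceChart_eq hF hf₀ hx b
  rw [mem_support_iff_pb_le, pb_exceptionalCurve, Ideal.span_singleton_le_iff_mem]
  exact s_notMem hF hf₀ hx rfl

lemma notMem_support_lineCurve (hF : Nat.card F = 2) (hf₀ : IsBlowupAtRatPoints f₀)
    {x : surface k f₀}
    (hx : ∀ a : Fin 3 → F, a ≠ 0 → f₀ (surface.proj k f₀ x) ∉ (ratLine a : Set (P2 F)))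
    {a : Fin 3 → F} (ha : a ≠ 0) : x ∉ (lineCurve k f₀ a).support := by
  obtain ⟨b, hb⟩ := exists_mem_range_surfaceChart k hF hf₀ x
  obtain ⟨y, rfl⟩ := hb
  rw [mem_support_iff_pb_le, pb_lineCurve k hF hf₀ b ha, Ideal.span_singleton_le_iff_mem]
  exact lineEq_notMem hF hf₀ hx rfl ha

end

end LangerSurface
end

/-! ### Linear equivalences restricted to C. -/

noncomputable section
namespace LangerSurface

open Scheme.IdealSheafData Module MvPolynomial
attribute [local instance] MvPolynomial.gradedAlgebra

lemma hom_apply_of_comp_eq {X : Scheme.{u}} {K : Type u} [Field K] {e : Spec (.of K) ⟶ X}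
    {A B : CommRingCat.{u}} {J : Spec A ⟶ X} [IsOpenImmersion J] {φ : A ⟶ B} {κ : A ⟶ .of K}
    {κ' : B ⟶ .of K} (hκ : Spec.map κ ≫ J = e) (hκ' : Spec.map κ' ≫ Spec.map φ ≫ J = e) (a : A) :
    κ'.hom (φ.hom a) = κ.hom a := by
  have h : φ ≫ κ' = κ := Spec.map_injective <| by
    rw [← cancel_mono J, hκ, Spec.map_comp, Category.assoc, hκ']
  exact congrArg (fun f ↦ f.hom a) h

section

variable {F : Type u} [Field F] [Fintype F] {X₀ : Scheme.{u}} {f₀ : X₀ ⟶ P2 F}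
  {k : Type u} [Field k] [Algebra F k]

/-- Around every point of a chart there are equations of the divisors in a linear equivalence
that correspond to each other. -/
lemma exists_local_equations (hF : Nat.card F = 2) (hf₀ : IsBlowupAtRatPoints f₀)
    {C D₁ D₂ : (surface k f₀).IdealSheafData}
    (h₁ : IsEffectiveCartier D₁) (h₂ : IsEffectiveCartier D₂)
    {θ : ∀ (R : CommRingCat.{u}) (_ : Spec R ⟶ surface k f₀), R → R}
    (hθ : ∀ (R : CommRingCat.{u}) (w : Spec R ⟶ surface k f₀) (β : R), IsOpenImmersion w →
        pb D₂ w = Ideal.span {β} → pb (C * D₁) w = Ideal.span {θ R w β})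
    {b : Frame F} {x : surface k f₀} (hx : x ∈ Set.range (surfaceChart k hF hf₀ b))
    {p : ChartRing F k} (hp : pb C (surfaceChart k hF hf₀ b) = Ideal.span {p}) :
    ∃ (R : CommRingCat.{u}) (ν : .of (ChartRing F k) ⟶ R) (δ₁ δ₂ : R),
      IsOpenImmersion (Spec.map ν) ∧ x ∈ Set.range (Spec.map ν ≫ surfaceChart k hF hf₀ b) ∧
      pb D₁ (Spec.map ν ≫ surfaceChart k hF hf₀ b) = Ideal.span {δ₁} ∧
      pb D₂ (Spec.map ν ≫ surfaceChart k hF hf₀ b) = Ideal.span {δ₂} ∧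
      ν.hom p * δ₁ = θ R (Spec.map ν ≫ surfaceChart k hF hf₀ b) δ₂ := by
  obtain ⟨R, ν, z, hν, hz, ⟨δ₁, -, hδ₁⟩, ⟨δ₂, -, hδ₂⟩⟩ := exists_pb_pair h₁ h₂ _ hx
  have hdom : IsDomain R := isDomain_of_isOpenImmersion (Spec.map ν) z
  have h3 := hθ R _ δ₂ inferInstance hδ₂
  rw [pb_mul, hδ₁, pb_comp, hp, Ideal.map_span, Set.image_singleton,
    Ideal.span_singleton_mul_span_singleton, Ideal.span_singleton_eq_span_singleton] at h3
  obtain ⟨u, hu⟩ := h3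
  refine ⟨R, ν, δ₁ * u, δ₂, hν, ⟨z, hz⟩, ?_, hδ₂, ?_⟩
  · rw [hδ₁, Ideal.span_singleton_eq_span_singleton]
    exact associated_mul_unit_right _ _ u.isUnit
  · rw [← mul_assoc]
    exact hu

/-- The cross relation between local equations in two charts. -/
lemma local_equations_cross (hF : Nat.card F = 2) (hf₀ : IsBlowupAtRatPoints f₀)
    {D₂ : (surface k f₀).IdealSheafData}
    {θ : ∀ (R : CommRingCat.{u}) (_ : Spec R ⟶ surface k f₀), R → R}
    (hcross : ∀ (R R' T : CommRingCat.{u}) (w : Spec R ⟶ surface k f₀)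
        (w' : Spec R' ⟶ surface k f₀) (φ : R ⟶ T) (φ' : R' ⟶ T)
        (β : R) (β' : R'), IsOpenImmersion w → IsOpenImmersion w' →
        IsOpenImmersion (Spec.map φ ≫ w) → Spec.map φ ≫ w = Spec.map φ' ≫ w' →
        pb D₂ w = Ideal.span {β} → pb D₂ w' = Ideal.span {β'} →
        φ.hom (θ R w β) * φ'.hom β' = φ'.hom (θ R' w' β') * φ.hom β)
    {K : Type u} [Field K] {e : Spec (.of K) ⟶ surface k f₀}
    {d : ℕ} {G : MvPolynomial (Fin 3) k} (hG : G.IsHomogeneous d)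
    {b b' : Frame F} {σ σ' p p' : ChartRing F k} (hp0 : p ≠ 0) (hGb : coordHom k b G = σ * p)
    (hGb' : coordHom k b' G = σ' * p') {R R' : CommRingCat.{u}} {ν : .of (ChartRing F k) ⟶ R}
    {ν' : .of (ChartRing F k) ⟶ R'} [IsOpenImmersion (Spec.map ν)] [IsOpenImmersion (Spec.map ν')]
    {δ₁ δ₂ : R} {δ₁' δ₂' : R'}
    (hδ₂ : pb D₂ (Spec.map ν ≫ surfaceChart k hF hf₀ b) = Ideal.span {δ₂})
    (hδ₂' : pb D₂ (Spec.map ν' ≫ surfaceChart k hF hf₀ b') = Ideal.span {δ₂'})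
    (hδ : ν.hom p * δ₁ = θ R (Spec.map ν ≫ surfaceChart k hF hf₀ b) δ₂)
    (hδ' : ν'.hom p' * δ₁' = θ R' (Spec.map ν' ≫ surfaceChart k hF hf₀ b') δ₂')
    {κ : R ⟶ .of K} {κ' : R' ⟶ .of K}
    (hκ : Spec.map κ ≫ Spec.map ν ≫ surfaceChart k hF hf₀ b = e)
    (hκ' : Spec.map κ' ≫ Spec.map ν' ≫ surfaceChart k hF hf₀ b' = e)
    {H : MvPolynomial (Fin 3) k} (hH : H.IsHomogeneous 1) :
    ∃ l : K, l ≠ 0 ∧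
      κ'.hom (ν'.hom (coordHom k b' H)) = l * κ.hom (ν.hom (coordHom k b H)) ∧
      κ'.hom (ν'.hom σ') * κ.hom δ₁ * κ'.hom δ₂' =
        l ^ d * κ.hom (ν.hom σ) * κ'.hom δ₁' * κ.hom δ₂ := by
  obtain ⟨T, φ, φ', z, hφ, hφ', hw, hz⟩ := exists_affine_overlap
    (Spec.map ν ≫ surfaceChart k hF hf₀ b) (Spec.map ν' ≫ surfaceChart k hF hf₀ b')
    (x := e (closedPt (.of K))) ⟨_, by rw [← hκ]; exact (Scheme.Hom.comp_apply _ _ _).symm⟩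
    ⟨_, by rw [← hκ']; exact (Scheme.Hom.comp_apply _ _ _).symm⟩
  obtain ⟨τ, hτ, -⟩ := exists_toField_chart e _ hz
  have hτ' : Spec.map τ ≫ Spec.map φ' ≫ Spec.map ν' ≫ surfaceChart k hF hf₀ b' = e := by
    rw [← hw, hτ]
  have hw' : Spec.map (ν ≫ φ) ≫ surfaceChart k hF hf₀ b =
      Spec.map (ν' ≫ φ') ≫ surfaceChart k hF hf₀ b' := by
    simpa only [Spec.map_comp, Category.assoc] using hw
  obtain ⟨l, hl, hlH⟩ := exists_coordHom_eq hF hf₀ hw'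
  have e1 : ∀ a, τ.hom (φ.hom a) = κ.hom a := hom_apply_of_comp_eq hκ hτ
  have e2 : ∀ a, τ.hom (φ'.hom a) = κ'.hom a := hom_apply_of_comp_eq hκ' hτ'
  refine ⟨τ.hom l, (hl.map τ.hom).ne_zero, ?_, ?_⟩
  · have h1 := congrArg τ.hom (hlH 1 H hH)
    rw [pow_one, map_mul] at h1
    exact (e2 _).symm.trans (h1.trans (congrArg (τ.hom l * ·) (e1 _)))
  · have h1 : φ'.hom (ν'.hom (σ' * p')) = l ^ d * φ.hom (ν.hom (σ * p)) := by
      rw [← hGb, ← hGb']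
      exact hlH d G hG
    have h2 := hcross _ _ T _ _ φ φ' δ₂ δ₂' inferInstance inferInstance inferInstance hw hδ₂ hδ₂'
    rw [← hδ, ← hδ'] at h2
    simp only [map_mul] at h1 h2
    -- When p is the equation of C, it becomes zero in K. So it has to be cancelled on the surface,
    -- where it is a non-zero-divisor, before evaluation at the generic point.
    have hp : φ.hom (ν.hom p) ∈ nonZeroDivisors T :=
      map_mem_nonZeroDivisors_of_isOpenImmersion φ
        (map_mem_nonZeroDivisors_of_isOpenImmersion ν (mem_nonZeroDivisors_of_ne_zero hp0))
    have h3 : φ'.hom (ν'.hom σ') * φ.hom δ₁ * φ'.hom δ₂' =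
        l ^ d * φ.hom (ν.hom σ) * φ'.hom δ₁' * φ.hom δ₂ := by
      refine (mul_cancel_right_mem_nonZeroDivisors hp).mp ?_
      linear_combination φ'.hom (ν'.hom σ') * h2 + φ'.hom δ₁' * φ.hom δ₂ * h1
    have h4 := congrArg τ.hom h3
    simp only [map_mul, map_pow] at h4
    rw [e1, e2, e2, e1, e1, e2] at h4
    exact h4

variable {C : (surface k f₀).IdealSheafData} [IsIntegral C.subscheme] {K : Type u} [Field K]
  {ε : Spec (.of K) ⟶ C.subscheme}

omit [Fintype F] in
lemma genericPoint_comp_subschemeι (hε : ε (closedPt (.of K)) = genericPoint C.subscheme) :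
    (ε ≫ C.subschemeι) (closedPt (.of K)) = gen C := by
  rw [Scheme.Hom.comp_apply, hε, gen]

lemma coordHom_form_ne_zero (hF : Nat.card F = 2) (hf₀ : IsBlowupAtRatPoints f₀)
    {e : Spec (.of K) ⟶ surface k f₀}
    (hx : ∀ a : Fin 3 → F, a ≠ 0 →
      f₀ (surface.proj k f₀ (e (closedPt (.of K)))) ∉ (ratLine a : Set (P2 F)))
    {b : Frame F} {κ : CommRingCat.of (ChartRing F k) ⟶ .of K}
    (hκ : Spec.map κ ≫ surfaceChart k hF hf₀ b = e) {a : Fin 3 → F} (ha : a ≠ 0) :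
    κ.hom (coordHom k b (form fun i ↦ algebraMap F k (a i))) ≠ 0 := fun h ↦
  coordHom_form_notMem hF hf₀ hx (by rw [← Scheme.Hom.comp_apply, hκ]) ha
    ((toField_eq_zero_iff κ _).mp h)

lemma s_ne_zero (hF : Nat.card F = 2) (hf₀ : IsBlowupAtRatPoints f₀)
    {e : Spec (.of K) ⟶ surface k f₀}
    (hx : ∀ a : Fin 3 → F, a ≠ 0 →
      f₀ (surface.proj k f₀ (e (closedPt (.of K)))) ∉ (ratLine a : Set (P2 F)))
    {b : Frame F} {κ : CommRingCat.of (ChartRing F k) ⟶ .of K}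
    (hκ : Spec.map κ ≫ surfaceChart k hF hf₀ b = e) : κ.hom (ChartRing.s F k) ≠ 0 := fun h ↦
  s_notMem hF hf₀ hx (by rw [← Scheme.Hom.comp_apply, hκ]) ((toField_eq_zero_iff κ _).mp h)

/-- The total transforms of any two rational lines are linearly equivalent on the curve. -/
lemma exists_mem_lat_totalLine_iff (hF : Nat.card F = 2) (hf₀ : IsBlowupAtRatPoints f₀)
    (hε : ε (closedPt (.of K)) = genericPoint C.subscheme)
    (hx : ∀ a : Fin 3 → F, a ≠ 0 →
      f₀ (surface.proj k f₀ (gen C)) ∉ (ratLine a : Set (P2 F)))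
    {a a' : Fin 3 → F} (ha : a ≠ 0) (ha' : a' ≠ 0) :
    ∃ ψ : K, ψ ≠ 0 ∧ ∀ y x, x ∈ lat ε ((totalLine k f₀ a).comap C.subschemeι) y ↔
      ψ * x ∈ lat ε ((totalLine k f₀ a').comap C.subschemeι) y := by
  have he := genericPoint_comp_subschemeι hε
  rw [← he] at hx
  obtain ⟨b₀, y₀, hy₀⟩ := exists_mem_range_surfaceChart k hF hf₀ ((ε ≫ C.subschemeι) (closedPt _))
  obtain ⟨κ₀, hκ₀, -⟩ := exists_toField_chart (ε ≫ C.subschemeι) _ hy₀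
  have hα := fun {a} ↦ coordHom_form_ne_zero hF hf₀ hx hκ₀ (a := a)
  -- The function ψ is the quotient of the two linear forms; the factor l relating homogeneous
  -- coordinates in different charts cancels.
  have hψ := div_ne_zero (hα ha') (hα ha)
  refine ⟨_, hψ, fun y x ↦ ?_⟩
  obtain ⟨b, hb⟩ := exists_mem_range_surfaceChart k hF hf₀ (C.subschemeι y)
  obtain ⟨S, w, z, ρ, hw, rfl, hρ⟩ := exists_chart_subscheme C _ hb
  obtain ⟨κ, hκ⟩ := exists_toField hε w z
  have hκ' : Spec.map (ρ ≫ κ) ≫ surfaceChart k hF hf₀ b = ε ≫ C.subschemeι := by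
    rw [Spec.map_comp, Category.assoc, ← hρ, ← hκ, Category.assoc]
  obtain ⟨l, hl, hlH⟩ := exists_coordHom_eq hF hf₀ (hκ₀.trans hκ'.symm)
  have h1 : ∀ {a : Fin 3 → F}, a ≠ 0 → pb ((totalLine k f₀ a).comap C.subschemeι) w =
      Ideal.span {ρ.hom (coordHom k b (form fun i ↦ algebraMap F k (a i)))} := fun {a} ha ↦ by
    rw [pb_comap, hρ, pb_comp, pb_totalLine hF hf₀ b ha, Ideal.map_span, Set.image_singleton]
  have h2 : ∀ a : Fin 3 → F, κ.hom (ρ.hom (coordHom k b (form fun i ↦ algebraMap F k (a i)))) =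
      l * κ₀.hom (coordHom k b₀ (form fun i ↦ algebraMap F k (a i))) := fun a ↦ by
    have := hlH 1 (form fun i ↦ algebraMap F k (a i)) (form_mem_grading _)
    rwa [pow_one] at this
  refine mem_lat_iff_of_generators hε w hκ z (h1 ha) (h1 ha') hψ ?_ x
  rw [h2, h2, mul_left_comm, div_mul_cancel₀ _ (hα ha)]

/-- The linear equivalence on the curve that comes from its homogeneous equation. -/
lemma exists_mem_lat_mul_iff (hF : Nat.card F = 2) (hf₀ : IsBlowupAtRatPoints f₀)
    (hε : ε (closedPt (.of K)) = genericPoint C.subscheme)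
    {D₁ D₂ : (surface k f₀).IdealSheafData}
    (h₁ : IsEffectiveCartier D₁) (h₂ : IsEffectiveCartier D₂) (h : LinearlyEquivalent (C * D₁) D₂)
    (hg₁ : gen C ∉ D₁.support) (hg₂ : gen C ∉ D₂.support)
    (hx : ∀ a : Fin 3 → F, a ≠ 0 →
      f₀ (surface.proj k f₀ (gen C)) ∉ (ratLine a : Set (P2 F)))
    {d : ℕ} {G : MvPolynomial (Fin 3) k} {m : (Fin 3 → F) → ℕ} {p : Frame F → ChartRing F k}
    (hG : G.IsHomogeneous d) (hGp : ∀ b, coordHom k b G = ChartRing.s F k ^ m b.pt * p b)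
    (hp : ∀ b, pb C (surfaceChart k hF hf₀ b) = Ideal.span {p b})
    {a : Fin 3 → F} (ha : a ≠ 0) :
    ∃ ψ : K, ψ ≠ 0 ∧ ∀ y x, x ∈ lat ε ((D₁ * totalLine k f₀ a ^ d).comap C.subschemeι) y ↔
      ψ * x ∈ lat ε ((D₂ * open Classical in ∏ v ∈ Finset.univ.erase 0,
        exceptionalCurve k f₀ v ^ m v).comap C.subschemeι) y := by
  obtain ⟨θ, hθ, hcross⟩ := h.exists_transfer
  have he := genericPoint_comp_subschemeι hε
  rw [← he] at hx hg₁ hg₂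
  have hp0 : ∀ b, p b ≠ 0 := fun b hpb ↦ by
    obtain ⟨y, -⟩ := exists_surfaceChart_eq hF hf₀ hx b
    refine h.pb_ne_bot h₁ h₂ (surfaceChart k hF hf₀ b) y ?_
    rw [hp, hpb, Ideal.span_singleton_eq_bot.mpr rfl]
  let H : MvPolynomial (Fin 3) k := form fun i ↦ algebraMap F k (a i)
  have hH : H.IsHomogeneous 1 := form_mem_grading _
  obtain ⟨b₀, hb₀⟩ := exists_mem_range_surfaceChart k hF hf₀ ((ε ≫ C.subschemeι) (closedPt _))
  obtain ⟨R₀, ν₀, γ₁, γ₂, hν₀, ⟨z₀, hz₀⟩, hγ₁, hγ₂, hγ⟩ :=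
    exists_local_equations hF hf₀ h₁ h₂ hθ hb₀ (hp b₀)
  obtain ⟨κ₀, hκ₀, -⟩ := exists_toField_chart (ε ≫ C.subschemeι) _ hz₀
  have hκ₀' : Spec.map (ν₀ ≫ κ₀) ≫ surfaceChart k hF hf₀ b₀ = ε ≫ C.subschemeι := by
    rw [Spec.map_comp, Category.assoc, hκ₀]
  have hα : κ₀.hom (ν₀.hom (coordHom k b₀ H)) ≠ 0 := coordHom_form_ne_zero hF hf₀ hx hκ₀' ha
  have hσ : κ₀.hom (ν₀.hom (ChartRing.s F k ^ m b₀.pt)) ≠ 0 := by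
    rw [map_pow, map_pow]
    exact pow_ne_zero _ (s_ne_zero hF hf₀ hx hκ₀')
  have hd₁ := toField_ne_zero hκ₀ hγ₁ hg₁
  have hd₂ := toField_ne_zero hκ₀ hγ₂ hg₂
  -- Here ψ is sᵐδ₂ / (δ₁Hᵈ). On the surface it is the product of G/Hᵈ with the ratio of δ₂ to the
  -- corresponding equation of C + D₁. One factor vanishes along C and the other has a pole there;
  -- only after cancelling the equation of C does the product restrict to C.
  have hψ := div_ne_zero (mul_ne_zero hσ hd₂) (mul_ne_zero hd₁ (pow_ne_zero d hα))
  refine ⟨_, hψ, fun y x ↦ ?_⟩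
  obtain ⟨b, hb⟩ := exists_mem_range_surfaceChart k hF hf₀ (C.subschemeι y)
  obtain ⟨R, ν, δ₁, δ₂, hν, hz, hδ₁, hδ₂, hδ⟩ :=
    exists_local_equations hF hf₀ h₁ h₂ hθ hb (hp b)
  obtain ⟨S, w, z, ρ, hw, rfl, hρ⟩ := exists_chart_subscheme C _ hz
  obtain ⟨κ, hκ⟩ := exists_toField hε w z
  have hκ' : Spec.map (ρ ≫ κ) ≫ Spec.map ν ≫ surfaceChart k hF hf₀ b = ε ≫ C.subschemeι := by
    rw [Spec.map_comp, Category.assoc, ← hρ, ← hκ, Category.assoc]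
  obtain ⟨l, hl, hlH, hlσ⟩ := local_equations_cross hF hf₀ hcross hG (hp0 b₀) (hGp b₀) (hGp b)
    hγ₂ hδ₂ hγ hδ hκ₀ hκ' hH
  have hA : pb ((D₁ * totalLine k f₀ a ^ d).comap C.subschemeι) w =
      Ideal.span {ρ.hom (δ₁ * ν.hom (coordHom k b H) ^ d)} := by
    rw [pb_comap, hρ, pb_comp, pb_mul, pb_pow, hδ₁, pb_comp, pb_totalLine hF hf₀ b ha,
      Ideal.map_span, Set.image_singleton, Ideal.span_singleton_pow,
      Ideal.span_singleton_mul_span_singleton, Ideal.map_span, Set.image_singleton]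
  have hB : pb ((D₂ * open Classical in ∏ v ∈ Finset.univ.erase 0,
        exceptionalCurve k f₀ v ^ m v).comap C.subschemeι) w =
      Ideal.span {ρ.hom (δ₂ * ν.hom (ChartRing.s F k ^ m b.pt))} := by
    rw [pb_comap, hρ, pb_comp, pb_mul, hδ₂, pb_comp, pb_prod_exceptionalCurve hF hf₀ b,
      Ideal.map_span, Set.image_singleton,
      Ideal.span_singleton_mul_span_singleton, Ideal.map_span, Set.image_singleton]
  refine mem_lat_iff_of_generators hε w hκ z hA hB hψ ?_ x
  have e1 : κ.hom (ρ.hom (ν.hom (coordHom k b H) ^ d)) =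
      (l * κ₀.hom (ν₀.hom (coordHom k b₀ H))) ^ d := by
    rw [map_pow, map_pow]
    exact congrArg (· ^ d) hlH
  have e2 : κ.hom (ρ.hom (ν.hom (ChartRing.s F k ^ m b.pt))) * κ₀.hom γ₁ * κ.hom (ρ.hom δ₂) =
        l ^ d * κ₀.hom (ν₀.hom (ChartRing.s F k ^ m b₀.pt)) * κ.hom (ρ.hom δ₁) * κ₀.hom γ₂ := hlσ
  rw [map_mul, map_mul, map_mul, map_mul, e1, mul_pow, div_mul_eq_mul_div,
    div_eq_iff (mul_ne_zero hd₁ (pow_ne_zero d hα))]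
  linear_combination (-κ₀.hom (ν₀.hom (coordHom k b₀ H)) ^ d) * e2

end

end LangerSurface
end

/-! ### Nonnegativity of the self-intersection of the remaining curves. -/

noncomputable section
namespace LangerSurface

open Scheme.IdealSheafData Module MvPolynomial
attribute [local instance] MvPolynomial.gradedAlgebra

lemma IsEffectiveCartier.mul {X : Scheme.{u}} {D D' : X.IdealSheafData} (hD : IsEffectiveCartier D)
    (hD' : IsEffectiveCartier D') : IsEffectiveCartier (D * D') := by
  refine .of_pb fun x ↦ ?_
  obtain ⟨A, J, y, hJ, hy, -⟩ := hD.exists_pb x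
  obtain ⟨R, ν, z, hν, hz, ⟨δ, hδ, h⟩, ⟨δ', hδ', h'⟩⟩ := exists_pb_pair hD hD' J ⟨y, hy⟩
  exact ⟨R, Spec.map ν ≫ J, inferInstance, ⟨z, hz⟩, δ * δ', mul_mem hδ hδ', by
    rw [pb_mul, h, h', Ideal.span_singleton_mul_span_singleton]⟩

lemma isEffectiveCartier_one {X : Scheme.{u}} : IsEffectiveCartier (1 : X.IdealSheafData) := by
  intro x
  obtain ⟨U, hU, hx, -⟩ := exists_isAffineOpen_mem_and_subset (x := x) (U := ⊤) trivial
  exact ⟨⟨U, hU⟩, hx, 1, one_mem _, Ideal.span_singleton_one.symm⟩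

section

variable {X : Scheme.{u}} {C : X.IdealSheafData} [IsIntegral C.subscheme]

variable (C) in
/-- An effective Cartier divisor that does not contain the integral closed subscheme `C`. -/
structure IsTransverse (D : X.IdealSheafData) : Prop where
  isEffectiveCartier : IsEffectiveCartier D
  gen_notMem : gen C ∉ D.support

lemma isTransverse_one : IsTransverse C 1 := ⟨isEffectiveCartier_one, by
  rw [Scheme.IdealSheafData.one_eq_top, support_top]; exact id⟩

lemma IsTransverse.mul {D D' : X.IdealSheafData} (hD : IsTransverse C D)
    (hD' : IsTransverse C D') : IsTransverse C (D * D') :=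
  ⟨hD.1.mul hD'.1, fun h ↦ h.elim hD.2 hD'.2⟩

lemma IsTransverse.prod {ι : Type*} {s : Finset ι} {D : ι → X.IdealSheafData}
    (hD : ∀ i ∈ s, IsTransverse C (D i)) : IsTransverse C (∏ i ∈ s, D i) :=
  Finset.prod_induction _ _ (fun _ _ ↦ IsTransverse.mul) isTransverse_one hD

lemma IsTransverse.pow {D : X.IdealSheafData} (hD : IsTransverse C D) (n : ℕ) :
    IsTransverse C (D ^ n) := by
  rw [← Finset.card_range n, ← Finset.prod_const]
  exact .prod fun _ _ ↦ hD

variable {k : Type u} [Field k] {π : C.subscheme ⟶ Spec (.of k)} (hfin : FiniteQuotients π)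
  {S : CommRingCat.{u}} (w : Spec S ⟶ C.subscheme) [IsOpenImmersion w] (z : Spec S)

lemma IsTransverse.pb_comap_ne_bot {D : X.IdealSheafData} (hD : IsTransverse C D) (z : Spec S) :
    pb (D.comap C.subschemeι) w ≠ ⊥ :=
  pb_ne_bot (mt genericPoint_mem_support_comap.mp hD.gen_notMem) w z

omit [IsIntegral C.subscheme] [IsOpenImmersion w] in
lemma deg_comap_one : deg π w ((1 : X.IdealSheafData).comap C.subschemeι) = 0 := by
  let _ := coordAlgebra π w
  have h : pb ((1 : X.IdealSheafData).comap C.subschemeι) w = ⊤ := by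
    rw [pb_comap]; exact pb_top _
  rw [deg, h]
  have : Subsingleton (S ⧸ (⊤ : Ideal S)) := Ideal.Quotient.subsingleton_iff.mpr rfl
  exact finrank_zero_of_subsingleton

include hfin z in
lemma deg_comap_mul {D D' : X.IdealSheafData} (hD : IsTransverse C D) (hD' : IsTransverse C D') :
    deg π w ((D * D').comap C.subschemeι) =
      deg π w (D.comap C.subschemeι) + deg π w (D'.comap C.subschemeι) := by
  rw [comap_mul]
  exact deg_mul hfin w z (hD.1.restrict hD.2) (hD.pb_comap_ne_bot w z) (hD'.pb_comap_ne_bot w z)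

include hfin z in
lemma deg_comap_prod {ι : Type*} {s : Finset ι} {D : ι → X.IdealSheafData}
    (hD : ∀ i ∈ s, IsTransverse C (D i)) : deg π w ((∏ i ∈ s, D i).comap C.subschemeι) =
      ∑ i ∈ s, deg π w ((D i).comap C.subschemeι) := by
  classical
  induction s using Finset.induction_on with
  | empty => rw [Finset.prod_empty, Finset.sum_empty, deg_comap_one]
  | insert i s hi ih =>
    have hs := fun j hj ↦ hD j (Finset.mem_insert_of_mem hj)
    rw [Finset.prod_insert hi, Finset.sum_insert hi, ← ih hs]
    exact deg_comap_mul hfin w z (hD i (Finset.mem_insert_self _ _)) (.prod hs)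

include hfin z in
lemma deg_comap_pow {D : X.IdealSheafData} (hD : IsTransverse C D) (n : ℕ) :
    deg π w ((D ^ n).comap C.subschemeι) = n * deg π w (D.comap C.subschemeι) := by
  have := deg_comap_prod hfin w z (s := Finset.range n) (fun _ _ ↦ hD)
  rwa [Finset.prod_const, Finset.sum_const, Finset.card_range, smul_eq_mul] at this

end

section

variable {F : Type u} [Field F] [Fintype F] {X₀ : Scheme.{u}} {f₀ : X₀ ⟶ P2 F}
  {k : Type u} [Field k] [Algebra F k]

omit [Fintype F] in
lemma add_self_eq_zero_of_card (hF : Nat.card F = 2) (v : Fin 3 → F) : v + v = 0 := by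
  have h2 : (1 + 1 : F) = 0 := (eq_zero_or_one_of_card hF _).resolve_right (by simp)
  funext i
  rw [Pi.add_apply, Pi.zero_apply, ← mul_two, ← one_add_one_eq_two, h2, mul_zero]

omit [Field F] in
lemma card_vectors (hF : Nat.card F = 2) : Fintype.card (Fin 3 → F) = 8 := by
  rw [Fintype.card_fun, ← Nat.card_eq_fintype_card, hF, Fintype.card_fin]
  rfl

omit [Fintype F] in
/-- Every two distinct points lie on a line. -/
lemma exists_line_through (hF : Nat.card F = 2) {u w : Fin 3 → F} (hu : u ≠ 0) (hw : w ≠ 0)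
    (huw : u ≠ w) : ∃ a : Fin 3 → F, a ≠ 0 ∧ ∑ i, a i * u i = 0 ∧ ∑ i, a i * w i = 0 := by
  obtain ⟨b, hbu, hbw⟩ := Frame.exists_pt_col_eq hF hu hw huw
  refine ⟨b.N 2, b.N_ne_zero 2, ?_, ?_⟩
  · simpa [hbu] using b.sum_N_mul_M 2 0
  · simpa [hbw] using b.sum_N_mul_M 2 1

/-- A curve that is not one of the exceptional curves or lines has nonnegative
self-intersection. -/
lemma intersectionNumber_le (hF : Nat.card F = 2) (hf₀ : IsBlowupAtRatPoints f₀)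
    {C D₁ D₂ : (surface k f₀).IdealSheafData} (hC : IsCurve C)
    [IsIntegral C.subscheme]
    (h₁ : IsEffectiveCartier D₁) (h₂ : IsEffectiveCartier D₂) (h : LinearlyEquivalent (C * D₁) D₂)
    (hg₁ : ¬ D₁ ≤ C) (hg₂ : ¬ D₂ ≤ C)
    (hx : ∀ a : Fin 3 → F, a ≠ 0 →
      f₀ (surface.proj k f₀ (gen C)) ∉ (ratLine a : Set (P2 F))) :
    intersectionNumber k (surface.toSpec k f₀) C D₁ ≤
      intersectionNumber k (surface.toSpec k f₀) C D₂ := by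
  classical
  have hprop := isProper_curve (k := k) hF hf₀ C
  have hfin : FiniteQuotients (C.subschemeι ≫ surface.toSpec k f₀) :=
    finiteQuotients_of_topologicalKrullDim_le hC.2.le
  have hcomp : CompactSpace C.subscheme :=
    QuasiCompact.compactSpace_of_compactSpace (C.subschemeι ≫ surface.toSpec k f₀)
  have haff : IsAffineHom (curveToPlane C) := isAffineHom_curveToPlane hF hf₀ hfin fun hmem ↦ by
    have hmem' : f₀ (surface.proj k f₀ (gen C)) ∈ (ratPoints F : Set (P2 F)) := hmem
    rw [coe_ratPoints, Set.mem_iUnion] at hmem'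
    obtain ⟨v, hv⟩ := hmem'
    exact notMem_ratPoint_of_forall_ratLine hF hf₀ hx v.2 hv
  let ε : Spec (.of (C.subscheme.residueField (genericPoint C.subscheme))) ⟶ C.subscheme :=
    C.subscheme.fromSpecResidueField _
  have hε : ε (closedPt _) = genericPoint C.subscheme := Scheme.fromSpecResidueField_apply _ _
  obtain ⟨d, G, m, p, hG, hGp, hp, hm⟩ := exists_form hF hf₀ h₁ h₂ h hx
  have ht₁ : IsTransverse C D₁ := ⟨h₁, gen_notMem_support hg₁⟩
  have ht₂ : IsTransverse C D₂ := ⟨h₂, gen_notMem_support hg₂⟩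
  have htE : ∀ v ≠ 0, IsTransverse C (exceptionalCurve k f₀ v) := fun v hv ↦
    ⟨isEffectiveCartier_exceptionalCurve hF hf₀ hv, notMem_support_exceptionalCurve hF hf₀ hx hv⟩
  have htL : ∀ a ≠ 0, IsTransverse C (lineCurve k f₀ a) := fun a ha ↦
    ⟨isEffectiveCartier_lineCurve hF hf₀ ha, notMem_support_lineCurve hF hf₀ hx ha⟩
  have htP : ∀ a : Fin 3 → F, IsTransverse C (∏ v : Fin 3 → F with v ≠ 0 ∧ ∑ i, a i * v i = 0,
      exceptionalCurve k f₀ v) :=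
    fun a ↦ .prod fun v hv ↦ htE v (Finset.mem_filter.mp hv).2.1
  have htH : ∀ a ≠ 0, IsTransverse C (totalLine k f₀ a) := fun a ha ↦ (htL a ha).mul (htP a)
  have htm : ∀ v ∈ Finset.univ.erase (0 : Fin 3 → F), IsTransverse C (exceptionalCurve k f₀ v ^ m v) :=
    fun v hv ↦ (htE v (Finset.ne_of_mem_erase hv)).pow _
  let supp (D : (surface k f₀).IdealSheafData) : Set C.subscheme :=
    ((D.comap C.subschemeι).support : Set C.subscheme)
  have hsupp : ∀ D, IsTransverse C D → (supp D).Finite := fun D hD ↦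
    finite_of_isClosed hfin (D.comap C.subschemeι).support.isClosed
      (mt genericPoint_mem_support_comap.mp hD.gen_notMem)
  have hsupp_mul : ∀ D D', supp (D * D') = supp D ∪ supp D' := fun D D' ↦ by
    simp only [supp, comap_mul, support_mul]; rfl
  -- One finite set contains all supports that occur, so that every degree can be computed on the
  -- same affine open.
  obtain ⟨Z, hZ, hZ₁, hZ₂, hZE, hZH⟩ : ∃ Z : Set C.subscheme, Z.Finite ∧ supp D₁ ⊆ Z ∧
      supp D₂ ⊆ Z ∧ supp (∏ v ∈ Finset.univ.erase 0, exceptionalCurve k f₀ v ^ m v) ⊆ Z ∧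
      ∀ a ≠ 0, supp (totalLine k f₀ a) ⊆ Z ∧ supp (totalLine k f₀ a ^ d) ⊆ Z := by
    refine ⟨(supp D₁ ∪ supp D₂) ∪ (supp (∏ v ∈ Finset.univ.erase 0, exceptionalCurve k f₀ v ^ m v) ∪
      ⋃ a : {a : Fin 3 → F // a ≠ 0}, (supp (totalLine k f₀ a.1) ∪
        supp (totalLine k f₀ a.1 ^ d))), ?_, fun y hy ↦ .inl (.inl hy), fun y hy ↦ .inl (.inr hy),
      fun y hy ↦ .inr (.inl hy), fun a ha ↦ ⟨fun y hy ↦ .inr (.inr ?_), fun y hy ↦ .inr (.inr ?_)⟩⟩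
    · exact ((hsupp _ ht₁).union (hsupp _ ht₂)).union ((hsupp _ (.prod htm)).union
        (Set.finite_iUnion fun a ↦ (hsupp _ (htH a.1 a.2)).union (hsupp _ ((htH a.1 a.2).pow d))))
    · exact Set.mem_iUnion.mpr ⟨⟨a, ha⟩, .inl hy⟩
    · exact Set.mem_iUnion.mpr ⟨⟨a, ha⟩, .inr hy⟩
  obtain ⟨S, w, z, hw, hZw, hdeg⟩ := exists_affine_deg_eq hε hfin
    (finite_appTop_of_universallyClosed k _) (curveToPlane C) hZ
  let δ (D : (surface k f₀).IdealSheafData) : ℕ :=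
    deg (C.subschemeι ≫ surface.toSpec k f₀) w (D.comap C.subschemeι)
  have hδ : ∀ {D D'}, IsTransverse C D → IsTransverse C D' → δ (D * D') = δ D + δ D' :=
    deg_comap_mul hfin w z
  have hI : ∀ D, supp D ⊆ Set.range w →
      intersectionNumber k (surface.toSpec k f₀) C D = δ D := fun D hD ↦
    intersectionNumber_eq_deg _ _ _ w fun y hy ↦ hD hy
  rw [hI D₁ (hZ₁.trans hZw),
    hI D₂ (hZ₂.trans hZw)]
  obtain ⟨a₀, ha₀⟩ : ∃ a : Fin 3 → F, a ≠ 0 := ⟨1, one_ne_zero⟩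
  -- This is C·D₁ + d(C·H) = C·D₂ + ∑ m_v(C·E_v), the numerical form of C ∼ dH − ∑ m_v E_v.
  have key : δ D₁ + d * δ (totalLine k f₀ a₀) =
      δ D₂ + ∑ v ∈ Finset.univ.erase 0, m v * δ (exceptionalCurve k f₀ v) := by
    obtain ⟨ψ, hψ, hψ'⟩ := exists_mem_lat_mul_iff hF hf₀ hε h₁ h₂ h ht₁.2 ht₂.2 hx hG hGp hp ha₀
    have h3 : δ (D₁ * totalLine k f₀ a₀ ^ d) = δ (D₂ * ∏ v ∈ Finset.univ.erase 0,
        exceptionalCurve k f₀ v ^ m v) := by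
      refine hdeg _ _ ?_ ?_ ((ht₁.mul ((htH a₀ ha₀).pow d)).pb_comap_ne_bot w z)
        ((ht₂.mul (.prod htm)).pb_comap_ne_bot w z) ψ hψ ?_
      · exact (hsupp_mul _ _).subset.trans (Set.union_subset hZ₁ (hZH a₀ ha₀).2)
      · exact (hsupp_mul _ _).subset.trans (Set.union_subset hZ₂ hZE)
      · intro y x
        convert hψ' y x
    rw [hδ ht₁ ((htH a₀ ha₀).pow d), hδ ht₂ (.prod htm)] at h3
    have h4 : δ (totalLine k f₀ a₀ ^ d) = d * δ (totalLine k f₀ a₀) :=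
      deg_comap_pow hfin w z (htH a₀ ha₀) d
    have h5 : δ (∏ v ∈ Finset.univ.erase 0, exceptionalCurve k f₀ v ^ m v) =
        ∑ v ∈ Finset.univ.erase 0, m v * δ (exceptionalCurve k f₀ v) :=
      (deg_comap_prod hfin w z htm).trans (Finset.sum_congr rfl fun v hv ↦
        deg_comap_pow hfin w z (htE v (Finset.ne_of_mem_erase hv)) _)
    rwa [h4, h5] at h3
  -- The fixed line may be replaced by the line through the two points. Its total transform contains
  -- the exceptional curves of its three points, and the proper transform of the line contributes a
  -- nonnegative amount.
  have hline : ∀ u w : Fin 3 → F, u ≠ 0 → w ≠ 0 → u ≠ w →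
      δ (exceptionalCurve k f₀ u) + δ (exceptionalCurve k f₀ w) +
        δ (exceptionalCurve k f₀ (u + w)) ≤ δ (totalLine k f₀ a₀) := by
    intro u v hu hv huv
    obtain ⟨a, ha, hau, hav⟩ := exists_line_through hF hu hv huv
    obtain ⟨ψ, hψ, hψ'⟩ := exists_mem_lat_totalLine_iff hF hf₀ hε hx ha₀ ha
    have h3 : δ (totalLine k f₀ a₀) = δ (totalLine k f₀ a) :=
      hdeg _ _ (hZH a₀ ha₀).1 (hZH a ha).1
        ((htH a₀ ha₀).pb_comap_ne_bot w z) ((htH a ha).pb_comap_ne_bot w z) ψ hψ hψ'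
    have h4 : δ (totalLine k f₀ a) = δ (lineCurve k f₀ a) +
        ∑ v : Fin 3 → F with v ≠ 0 ∧ ∑ i, a i * v i = 0, δ (exceptionalCurve k f₀ v) := by
      refine Eq.trans ?_ ((hδ (htL a ha) (htP a)).trans (congrArg _ (deg_comap_prod hfin w z
        fun v hv ↦ htE v (Finset.mem_filter.mp hv).2.1)))
      simp only [totalLine]
    have hself := add_self_eq_zero_of_card hF v
    have hu' : u ≠ u + v := fun h0 ↦ hv (left_eq_add.mp h0)
    have hv' : v ≠ u + v := fun h0 ↦ hu (right_eq_add.mp h0)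
    have huv' : u + v ≠ 0 := fun h0 ↦ huv (add_right_cancel (h0.trans hself.symm))
    rw [h3, h4]
    calc _ = ∑ x ∈ {u, v, u + v}, δ (exceptionalCurve k f₀ x) := by
          rw [Finset.sum_insert (by simp [huv, hu']), Finset.sum_insert (by simp [hv']),
            Finset.sum_singleton, add_assoc]
      _ ≤ _ := Finset.sum_le_sum_of_subset fun x hx ↦ by
          have h5 : ∑ i, a i * (u + v) i = 0 := by
            simp only [Pi.add_apply, mul_add, Finset.sum_add_distrib, hau, hav, add_zero]
          simp only [Finset.mem_insert, Finset.mem_singleton] at hx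
          rw [Finset.mem_filter]
          rcases hx with rfl | rfl | rfl
          exacts [⟨Finset.mem_univ _, hu, hau⟩, ⟨Finset.mem_univ _, hv, hav⟩,
            ⟨Finset.mem_univ _, huv', h5⟩]
      _ ≤ _ := Nat.le_add_left _ _
  have hsum := sum_mul_le_of_line_sum_le (add_self_eq_zero_of_card hF) (card_vectors hF)
    (fun v ↦ (m v : ℤ)) (fun v ↦ (δ (exceptionalCurve k f₀ v) : ℤ)) d (δ (totalLine k f₀ a₀))
    (fun _ ↦ Nat.cast_nonneg _) (fun _ ↦ Nat.cast_nonneg _) (Nat.cast_nonneg _)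
    (Nat.cast_nonneg _) (fun u w hu hw huw ↦ mod_cast hm u w hu hw huw)
    (fun u w hu hw huw ↦ mod_cast hline u w hu hw huw)
  have hsum' : ∑ v ∈ Finset.univ.erase 0, m v * δ (exceptionalCurve k f₀ v) ≤
      d * δ (totalLine k f₀ a₀) := by exact_mod_cast hsum
  omega

end

end LangerSurface

end

theorem proposition5p3 {F k : Type u} [Field F] [Field k] [Algebra F k] (hF : Nat.card F = 2)
    {X₀ : AlgebraicGeometry.Scheme.{u}} (f₀ : X₀ ⟶ LangerSurface.P2 F)
    (hf₀ : LangerSurface.IsBlowupAtRatPoints f₀)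
    (C : (LangerSurface.surface k f₀).IdealSheafData) (hC : LangerSurface.IsCurve C)
    (n : ℤ)
    (hn : LangerSurface.IsSelfIntersection k (LangerSurface.surface.toSpec k f₀) C n)
    (hneg : n < 0) :
    (∃ v : Fin 3 → F, v ≠ 0 ∧ C = LangerSurface.exceptionalCurve k f₀ v) ∨
      ∃ a : Fin 3 → F, a ≠ 0 ∧ C = LangerSurface.lineCurve k f₀ a := by
  have : Finite F := Nat.finite_of_card_ne_zero (by rw [hF]; norm_num)
  cases nonempty_fintype F
  have := hC.1
  obtain ⟨D₁, D₂, h₁, h₂, hg₁, hg₂, h, rfl⟩ := hn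
  by_contra! hcon
  -- The exceptional curves are excluded first: recognising a proper transform of a line requires
  -- the generic point to lie over no rational point.
  have hv : ∀ v : Fin 3 → F, v ≠ 0 → f₀ (LangerSurface.surface.proj k f₀ (LangerSurface.gen C)) ∉
      (LangerSurface.ratPoint v : Set (LangerSurface.P2 F)) := fun v hv hm ↦
    hcon.1 v hv (LangerSurface.eq_exceptionalCurve hF hf₀ h₁ h₂ h hv hm)
  have hx : ∀ a : Fin 3 → F, a ≠ 0 → f₀ (LangerSurface.surface.proj k f₀ (LangerSurface.gen C)) ∉
      (LangerSurface.ratLine a : Set (LangerSurface.P2 F)) := fun a ha hm ↦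
    hcon.2 a ha (LangerSurface.eq_lineCurve hF hf₀ h₁ h₂ h hv ha hm)
  have := LangerSurface.intersectionNumber_le hF hf₀ hC h₁ h₂ h hg₁ hg₂ hx
  omega
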